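/- **Setting.** Let $H$ be a deformation Hopf algebra over $\mathbb C[[\hbar]]$ (a topologically free topological Hopf algebra; $\otimes$ denotes the $\hbar$-adically completed tensor product), with coproduct $\Delta$ and counit $\varepsilon$. Let $H_0=H/\hbar H$, and let $\mathfrak g$ be the Lie algebra of primitive elements of $H_0$. Assume that $\mathfrak g$ is finite-dimensional and that $H_0$, with the commutator action of $\mathfrak g$, is a sum of finite-dimensional $\mathfrak g$-submodules. Let $\mathfrak l=\{y\in H: y \bmod \hbar\in\mathfrak g\}$, and let $\tilde H^\times$ be the corresponding simply connected group, with exponential map $\exp:\mathfrak l\to\tilde H^\times$; it is an extension of the simply connected Lie group of $\mathfrak g$ by $1+\hbar H$. It is generated by the elements $\exp y$, $y\in\mathfrak l$, and a word $\exp y_1\cdots\exp y_k$ is trivial iff it is so as a consequence of the relations given by the words which can be contracted to the trivial word along differentiable paths of words with zero logarithmic derivative. Let $\mathfrak a$ be a finite-dimensional (over $\mathbb C$) commutative Lie algebra of primitive elements of $H$ which maps injectively to $H_0$, let $\bar{\mathfrak a}\subset\mathfrak a$ be a Lie subalgebra, and let $\lambda\mapsto\bar\lambda$ be the projection $\mathfrak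 a^*\to\bar{\mathfrak a}^*$. Let $y_i$ be a basis of $\mathfrak a$, and $\partial_i$ the partial derivatives along the dual basis of $\mathfrak a^*$. Expressions $F(\lambda-\hbar h^{(i)})$ mean the Taylor expansion $\sum_k \frac{(-\hbar)^k}{k!}\sum_{i_1,\dots,i_k}(\partial_{i_1}\cdots\partial_{i_k}F)(\lambda)\,(y_{i_1}\cdots y_{i_k})^{(i)}$, where the upper index is the tensor component. For $\bar{\mathfrak a}$ we write $\hbar\bar h^{(i)}$. A meromorphic function with values in $H\otimes H$ is defined and holomorphic on a dense open set, and each of its coefficients in $\hbar$ is a finite sum of scalar meromorphic functions times constant vectors. A *dynamical twist* on $\mathfrak a^*$ is a meromorphic function $J:\mathfrak a^*\to H\otimes H$ of zero weight (commuting with $a\otimes1+1\otimes a$ for $a\in\mathfrak a$), equal to $1\otimes 1$ modulo $\hbar$, with $$J^{12,3}(\lambda)J^{12}(\lambda-\hbar h^{(3)})=J^{1,23}(\lambda)J^{23}(\lambda),\qquad (\varepsilon\otimes\mathrm{id})J(\lambda)=(\mathrm{id}\otimes\varepsilon)J(\lambda)=1,$$ and similarly for $\bar{\mathfrak a}^*$.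 Let $x$ be a meromorphic function on $\mathfrak a^*$ with values in $\tilde H^\times$, with $\varepsilon(x(\lambda))\equiv1$. Meromorphic means: $x$ is defined on a dense open set $U$, where it is locally a product of exponentials of holomorphic $\mathfrak l$-valued functions, and its logarithmic derivatives $\theta_i=(\partial_i x)x^{-1}\in \mathfrak l$ and the functions $x v x^{-1}$, $x^{-1}vx$ ($v\in H$) and $\Delta(x)\,v\,(x^2)^{-1}(x^1)^{-1}$ ($v\in H\otimes H$), which take values in $H$ and $H\otimes H$, are meromorphic. Products below are taken in this sense. For example, $$\Delta(x(\lambda))\,K\,x^2(\lambda)^{-1}x^1(\lambda-\hbar h^{(2)})^{-1}=\Delta(x)\,K\,(x^2)^{-1}(x^1)^{-1}\cdot x^1(\lambda)\,x^1(\lambda-\hbar h^{(2)})^{-1},$$ and the second factor is the Taylor series with coefficients $x\,\partial_{i_1}\cdots\partial_{i_k}(x^{-1})\in H$. **Proposition.** The following hold on the common domain of definition of the functions involved. 1. (Vertex-IRF transformations.) Let $x(\lambda)$ be of zero weight with respect to $\bar{\mathfrak a}$, let $\bar J$ be a dynamical twist on $\bar{\mathfrak a}^*$, and put $$J^x(\lambda)=\Delta(x(\lambda))\,\bar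 J(\bar\lambda)\,x^2(\lambda)^{-1}\,x^1(\lambda-\hbar h^{(2)})^{-1}.$$ If $J^x(\lambda)$ is of zero weight with respect to $\mathfrak a$, then $J^x$ is a dynamical twist on $\mathfrak a^*$. 2. (IRF-vertex transformations.) Let $x(\lambda)$ be of zero weight with respect to $\bar{\mathfrak a}$, let $J$ be a dynamical twist on $\mathfrak a^*$, and put $$J^x(\lambda)=\Delta(x(\lambda))\,J(\lambda)\,x^1(\lambda-\hbar h^{(2)})^{-1}\,x^2(\lambda)^{-1}.$$ If for some function $\bar J^x$ on $\bar{\mathfrak a}^*$ with values in $H\otimes H$ we have $J^x(\lambda)=\bar J^x(\bar\lambda)$ for all $\lambda$ in the domain of $J^x$, then $\bar J^x$ is a dynamical twist on $\bar{\mathfrak a}^*$. 3. If $J(\lambda)=\Delta(x(\lambda))\,x^2(\lambda)^{-1}\,x^1(\lambda-\hbar h^{(2)})^{-1}$ is of zero weight with respect to $\mathfrak a$, then it is a dynamical twist on $\mathfrak a^*$. 4. Let $H$ be quasitriangular with universal $R$-matrix $\mathcal R\in H\otimes H$. Let $J,\bar J$ be dynamical twists on $\mathfrak a^*,\bar{\mathfrak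 a}^*$, and let $x$ be a vertex-IRF transformation from $\bar J$ to $J$; that is, $x(\lambda)$ is of zero weight with respect to $\bar{\mathfrak a}$, and $J=J^x$ as in 1. Then $\mathcal R(\lambda)=J^{21}(\lambda)^{-1}\mathcal R J(\lambda)$ and $\bar{\mathcal R}(\bar\lambda)=\bar J^{21}(\bar\lambda)^{-1}\mathcal R\bar J(\bar\lambda)$ are related by $$\mathcal R(\lambda)=x^2(\lambda-\hbar h^{(1)})\,x^1(\lambda)\,\bar{\mathcal R}(\bar\lambda)\,x^2(\lambda)^{-1}\,x^1(\lambda-\hbar h^{(2)})^{-1}.$$ -/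

import Mathlib

open Filter Topology TensorProduct

noncomputable section

namespace Deform

/-! ### Topologically free `ℂ[[ħ]]`-modules

For a complex vector space `W` the topologically free module `W[[ħ]]` is the type `ℕ → W` of
coefficient sequences (`a n` is the coefficient of `ħ ^ n`).  The `ħ`-adically completed tensor
product of `V[[ħ]]` and `W[[ħ]]` is `(V ⊗ W)[[ħ]]`, and the `ℂ[[ħ]]`-linear maps
`V[[ħ]] → W[[ħ]]` are the elements of `Hom(V, W)[[ħ]]`. -/

section Formal

variable {V W V' W' : Type*} [AddCommGroup V] [Module ℂ V] [AddCommGroup W] [Module ℂ W]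
  [AddCommGroup V'] [Module ℂ V'] [AddCommGroup W'] [Module ℂ W']

/-- `ℂ[[ħ]]`-linear maps `V[[ħ]] → W[[ħ]]`. -/
abbrev FHom (V W : Type*) [AddCommGroup V] [Module ℂ V] [AddCommGroup W] [Module ℂ W] : Type _ :=
  ℕ → (V →ₗ[ℂ] W)

/-- Application of a `ℂ[[ħ]]`-linear map. -/
def FHom.app (f : FHom V W) (a : ℕ → V) : ℕ → W :=
  fun n => ∑ p ∈ Finset.HasAntidiagonal.antidiagonal n, f p.1 (a p.2)

/-- The `ℂ[[ħ]]`-linear extension of a linear map. -/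
def fmap (f : V →ₗ[ℂ] W) (a : ℕ → V) : ℕ → W := fun n => f (a n)

/-- Completed tensor product of two `ℂ[[ħ]]`-linear maps. -/
def FHom.tens (f : FHom V W) (g : FHom V' W') : FHom (V ⊗[ℂ] V') (W ⊗[ℂ] W') :=
  fun n => ∑ p ∈ Finset.HasAntidiagonal.antidiagonal n, TensorProduct.map (f p.1) (g p.2)

/-- The identity map of `V[[ħ]]`. -/
def FHom.one (V : Type*) [AddCommGroup V] [Module ℂ V] : FHom V V :=
  fun n => if n = 0 then LinearMap.id else 0

/-- The element `a ⊗ b` of the completed tensor product. -/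
def ften (a : ℕ → V) (b : ℕ → W) : ℕ → V ⊗[ℂ] W :=
  fun n => ∑ p ∈ Finset.HasAntidiagonal.antidiagonal n, a p.1 ⊗ₜ[ℂ] b p.2

/-- The action of a scalar `c ∈ ℂ[[ħ]]` on `W[[ħ]]`; for `W = ℂ`, the product of `ℂ[[ħ]]`. -/
def fsmul (c : ℕ → ℂ) (a : ℕ → W) : ℕ → W :=
  fun n => ∑ p ∈ Finset.HasAntidiagonal.antidiagonal n, c p.1 • a p.2

/-- The unit of `ℂ[[ħ]]`. -/
def fone : ℕ → ℂ := fun n => if n = 0 then 1 else 0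

/-- Given multiplications on `V[[ħ]]` and `W[[ħ]]`, the multiplication
`(v ⊗ w) (v' ⊗ w') = v v' ⊗ w w'` on the completed tensor product. -/
def tensMul (m : FHom (V ⊗[ℂ] V) V) (m' : FHom (W ⊗[ℂ] W) W) :
    FHom ((V ⊗[ℂ] W) ⊗[ℂ] (V ⊗[ℂ] W)) (V ⊗[ℂ] W) :=
  fun n => (m.tens m') n ∘ₗ (TensorProduct.tensorTensorTensorComm ℂ V W V W).toLinearMap

/-- The bilinear product on `V[[ħ]]` given by a multiplication map. -/
def prd (m : FHom (V ⊗[ℂ] V) V) (a b : ℕ → V) : ℕ → V := m.app (ften a b)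

end Formal

/-! ### Calculus with values in vector spaces without topology

Series and derivatives are tested on all linear functionals.  A map from a compact space which is
continuous in this sense takes values in a finite-dimensional subspace, so this is the usual
calculus of (locally) finite-dimensional valued functions. -/

section Calculus

variable {W : Type*} [AddCommGroup W] [Module ℂ W]

/-- The sum of a series in `W`, tested on linear functionals (`0` if there is no sum). -/
def wsum (u : ℕ → W) : W :=
  open Classical in
  if h : ∃ w : W, ∀ ψ : W →ₗ[ℂ] ℂ, HasSum (fun k => ψ (u k)) (ψ w) then h.choose else 0

/-- `f` has derivative `D` at `t`, tested on linear functionals. -/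
def HasWDeriv (𝕜 : Type*) [NontriviallyNormedField 𝕜] [NormedSpace 𝕜 ℂ]
    (f : 𝕜 → W) (D : W) (t : 𝕜) : Prop :=
  ∀ ψ : W →ₗ[ℂ] ℂ, HasDerivAt (fun s => ψ (f s)) (ψ D) t

/-- The derivative of `f` at `t` (`0` if there is none). -/
def wderiv (𝕜 : Type*) [NontriviallyNormedField 𝕜] [NormedSpace 𝕜 ℂ] (f : 𝕜 → W) (t : 𝕜) : W :=
  open Classical in
  if h : ∃ D : W, HasWDeriv 𝕜 f D t then h.choose else 0

/-- The operator series `∑ k, c k • T ^ k` on `W[[ħ]]`, evaluated at `v`, summed in each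
coefficient. -/
def opSeries (c : ℕ → ℂ) (T : (ℕ → W) → (ℕ → W)) (v : ℕ → W) : ℕ → W :=
  fun n => wsum (fun k => c k • (T^[k] v) n)

/-- `exp T` applied to `v`. -/
def opExp (T : (ℕ → W) → (ℕ → W)) (v : ℕ → W) : ℕ → W :=
  opSeries (fun k => ((k.factorial : ℂ))⁻¹) T v

variable {E : Type*} [NormedAddCommGroup E] [NormedSpace ℂ E]

/-- The derivative of a `W[[ħ]]`-valued function at `l` in the direction `μ`. -/
def dirDeriv (F : E → ℕ → W) (μ : E) (l : E) : ℕ → W :=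
  fun n => wderiv ℂ (fun t : ℂ => F (l + t • μ) n) 0

/-- A `W[[ħ]]`-valued function is holomorphic on the open set `U`. -/
def IsHolo (U : Set E) (F : E → ℕ → W) : Prop :=
  ∀ (n : ℕ) (ψ : W →ₗ[ℂ] ℂ), AnalyticOnNhd ℂ (fun l => ψ (F l n)) U

/-- `f` is a scalar meromorphic function on `E` (locally a quotient of holomorphic functions, with
denominator not identically zero) which is defined and holomorphic on `U`.  It is used for dense
open `U`; the values of `f` outside `U` are irrelevant. -/
def IsMero (U : Set E) (f : E → ℂ) : Prop :=
  AnalyticOnNhd ℂ f U ∧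
  ∀ l₀ : E, ∃ g h : E → ℂ, AnalyticAt ℂ g l₀ ∧ AnalyticAt ℂ h l₀ ∧
    (¬ ∀ᶠ l in 𝓝 l₀, h l = 0) ∧ ∀ᶠ l in 𝓝 l₀, l ∈ U → h l * f l = g l

/-- `F` is a `W[[ħ]]`-valued meromorphic function on `E`, holomorphic on `U`: each coefficient is a
finite sum of scalar meromorphic functions times constant vectors. -/
def IsMeroF (U : Set E) (F : E → ℕ → W) : Prop :=
  ∀ n : ℕ, ∃ (k : ℕ) (c : Fin k → E → ℂ) (v : Fin k → W),
    (∀ i, IsMero U (c i)) ∧ ∀ l ∈ U, F l n = ∑ i, c i l • v i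

/-- `∑ k, (-ħ) ^ k / k! • D ^ k F`, for an operator `D` on `W[[ħ]]`-valued functions. -/
def hExp (D : (E → ℕ → W) → (E → ℕ → W)) (F : E → ℕ → W) : E → ℕ → W :=
  fun l n => ∑ k ∈ Finset.range (n + 1),
    ((-1 : ℂ) ^ k / (k.factorial : ℂ)) • (D^[k] F) l (n - k)

end Calculus

/-- A deformation Hopf algebra `H = V[[ħ]]` over `ℂ[[ħ]]`: a topological Hopf algebra over
`ℂ[[ħ]]` whose underlying module is topologically free.  Its reduction `H / ħ H` is `V` with the
structure maps of index `0`. -/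
structure DeformationHopfAlgebra (V : Type*) [AddCommGroup V] [Module ℂ V] where
  mul : FHom (V ⊗[ℂ] V) V
  one : ℕ → V
  comul : FHom V (V ⊗[ℂ] V)
  counit : FHom V ℂ
  antipode : FHom V V
  mul_assoc : ∀ a b c : ℕ → V, prd mul (prd mul a b) c = prd mul a (prd mul b c)
  one_mul : ∀ a : ℕ → V, prd mul one a = a
  mul_one : ∀ a : ℕ → V, prd mul a one = a
  coassoc : ∀ a : ℕ → V,
    fmap (TensorProduct.assoc ℂ V V V).toLinearMap
      ((comul.tens (FHom.one V)).app (comul.app a)) =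
    ((FHom.one V).tens comul).app (comul.app a)
  counit_comul : ∀ a : ℕ → V,
    fmap (TensorProduct.lid ℂ V).toLinearMap ((counit.tens (FHom.one V)).app (comul.app a)) = a
  comul_counit : ∀ a : ℕ → V,
    fmap (TensorProduct.rid ℂ V).toLinearMap (((FHom.one V).tens counit).app (comul.app a)) = a
  comul_mul : ∀ a b : ℕ → V,
    comul.app (prd mul a b) = prd (tensMul mul mul) (comul.app a) (comul.app b)
  comul_one : comul.app one = ften one one
  counit_mul : ∀ a b : ℕ → V,
    counit.app (prd mul a b) = fsmul (counit.app a) (counit.app b)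
  counit_one : counit.app one = fone
  antipode_left : ∀ a : ℕ → V,
    mul.app ((antipode.tens (FHom.one V)).app (comul.app a)) = fsmul (counit.app a) one
  antipode_right : ∀ a : ℕ → V,
    mul.app (((FHom.one V).tens antipode).app (comul.app a)) = fsmul (counit.app a) one

namespace DeformationHopfAlgebra

variable {V : Type*} [AddCommGroup V] [Module ℂ V] (H : DeformationHopfAlgebra V)

/-! ### The algebras `H`, `H ⊗ H`, `H ⊗ H ⊗ H` -/

/-- The product of `H`. -/
def mul₁ (a b : ℕ → V) : ℕ → V := prd H.mul a b

/-- The product of `H ⊗ H`. -/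
def mul₂ (a b : ℕ → V ⊗[ℂ] V) : ℕ → V ⊗[ℂ] V := prd (tensMul H.mul H.mul) a b

/-- The product of `H ⊗ H ⊗ H`. -/
def mul₃ (a b : ℕ → (V ⊗[ℂ] V) ⊗[ℂ] V) : ℕ → (V ⊗[ℂ] V) ⊗[ℂ] V :=
  prd (tensMul (tensMul H.mul H.mul) H.mul) a b

/-- The unit of `H ⊗ H`. -/
def one₂ : ℕ → V ⊗[ℂ] V := ften H.one H.one

/-- `y¹ = y ⊗ 1`. -/
def leg1 (y : ℕ → V) : ℕ → V ⊗[ℂ] V := ften y H.one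

/-- `y² = 1 ⊗ y`. -/
def leg2 (y : ℕ → V) : ℕ → V ⊗[ℂ] V := ften H.one y

/-- `y¹ + y²`. -/
def legs (y : ℕ → V) : ℕ → V ⊗[ℂ] V := H.leg1 y + H.leg2 y

/-- The coproduct `H → H ⊗ H`. -/
def Δ (y : ℕ → V) : ℕ → V ⊗[ℂ] V := H.comul.app y

/-- The counit `H → ℂ[[ħ]]`. -/
def ε (y : ℕ → V) : ℕ → ℂ := H.counit.app y

/-- `J¹² = J ⊗ 1`. -/
def leg12 (J : ℕ → V ⊗[ℂ] V) : ℕ → (V ⊗[ℂ] V) ⊗[ℂ] V := ften J H.one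

/-- `J²³ = 1 ⊗ J`. -/
def leg23 (J : ℕ → V ⊗[ℂ] V) : ℕ → (V ⊗[ℂ] V) ⊗[ℂ] V :=
  fmap (TensorProduct.assoc ℂ V V V).symm.toLinearMap (ften H.one J)

/-- `J¹³`. -/
def leg13 (J : ℕ → V ⊗[ℂ] V) : ℕ → (V ⊗[ℂ] V) ⊗[ℂ] V :=
  fmap (TensorProduct.rightComm ℂ V V V).toLinearMap (ften J H.one)

/-- `J²¹`, the flip of `J`. -/
def flip (J : ℕ → V ⊗[ℂ] V) : ℕ → V ⊗[ℂ] V := fmap (TensorProduct.comm ℂ V V).toLinearMap J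

/-- `J^{12,3} = (Δ ⊗ id) J`. -/
def comulLeft (J : ℕ → V ⊗[ℂ] V) : ℕ → (V ⊗[ℂ] V) ⊗[ℂ] V :=
  (H.comul.tens (FHom.one V)).app J

/-- `J^{1,23} = (id ⊗ Δ) J`. -/
def comulRight (J : ℕ → V ⊗[ℂ] V) : ℕ → (V ⊗[ℂ] V) ⊗[ℂ] V :=
  fmap (TensorProduct.assoc ℂ V V V).symm.toLinearMap (((FHom.one V).tens H.comul).app J)

/-- `(ε ⊗ id) J`. -/
def counitLeft (J : ℕ → V ⊗[ℂ] V) : ℕ → V :=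
  fmap (TensorProduct.lid ℂ V).toLinearMap ((H.counit.tens (FHom.one V)).app J)

/-- `(id ⊗ ε) J`. -/
def counitRight (J : ℕ → V ⊗[ℂ] V) : ℕ → V :=
  fmap (TensorProduct.rid ℂ V).toLinearMap (((FHom.one V).tens H.counit).app J)

/-- The inverse of an invertible element of `H ⊗ H` (`0` if it is not invertible). -/
def inv₂ (a : ℕ → V ⊗[ℂ] V) : ℕ → V ⊗[ℂ] V :=
  open Classical in
  if h : ∃ b, H.mul₂ a b = H.one₂ ∧ H.mul₂ b a = H.one₂ then h.choose else 0

/-- `R` is a universal `R`-matrix of `H`. -/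
structure IsUniversalR (R : ℕ → V ⊗[ℂ] V) : Prop where
  invertible : ∃ b, H.mul₂ R b = H.one₂ ∧ H.mul₂ b R = H.one₂
  intertwines : ∀ a : ℕ → V, H.mul₂ R (H.Δ a) = H.mul₂ (flip (H.Δ a)) R
  hexagon_left : H.comulLeft R = H.mul₃ (H.leg13 R) (H.leg23 R)
  hexagon_right : H.comulRight R = H.mul₃ (H.leg13 R) (H.leg12 R)

/-! ### Primitive elements of `H₀ = H / ħ H` -/

/-- The set `𝔤` of primitive elements of `H₀`. -/
def prim₀ : Set V := {X | H.comul 0 X = X ⊗ₜ[ℂ] H.one 0 + H.one 0 ⊗ₜ[ℂ] X}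

/-- The commutator of `H₀`. -/
def comm₀ (X Y : V) : V := H.mul 0 (X ⊗ₜ[ℂ] Y) - H.mul 0 (Y ⊗ₜ[ℂ] X)

/-- The standing assumptions: `𝔤` is finite-dimensional, and the `𝔤`-module `H₀` (with the
commutator action) is a sum of finite-dimensional submodules. -/
structure LocallyFinite : Prop where
  finiteDimensional : FiniteDimensional ℂ (Submodule.span ℂ H.prim₀)
  exists_submodule : ∀ v : V, ∃ M : Submodule ℂ V, FiniteDimensional ℂ M ∧ v ∈ M ∧
    ∀ X ∈ H.prim₀, ∀ w ∈ M, H.comm₀ X w ∈ M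

/-! ### The group `H~ˣ`

It is the simply connected group of the Lie algebra `𝔩`, an extension of the simply connected Lie
group of `𝔤` by `1 + ħ H`.  As for any simply connected group, it is generated by the symbols
`exp y`, `y ∈ 𝔩`, and a word `exp y₁ ⋯ exp yₖ` is trivial in it iff, modulo conjugation and
products, it can be contracted: there are differentiable paths `Yᵢ` in `𝔩` from `0` to `yᵢ` such
that `exp Y₁(s) ⋯ exp Yₖ(s)` does not depend on `s`, i.e. has zero logarithmic derivative. -/

/-- The Lie algebra `𝔩` of all `y ∈ H` with `y mod ħ ∈ 𝔤`. -/
def Lie : Type _ := {y : ℕ → V // y 0 ∈ H.prim₀}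

/-- `ad y` on `H`. -/
def ad (y v : ℕ → V) : ℕ → V := H.mul₁ y v - H.mul₁ v y

/-- The logarithmic derivative `(exp y)' (exp y)⁻¹ = ∑ k, (ad y) ^ k (y') / (k + 1)!`. -/
def dexp (y y' : ℕ → V) : ℕ → V :=
  opSeries (fun k => (((k + 1).factorial : ℂ))⁻¹) (H.ad y) y'

/-- The logarithmic derivative `w' w⁻¹` of a word `w = exp y₁ ⋯ exp yₖ`, where the list consists of
the pairs `(yᵢ, yᵢ')`. -/
def wordLogDeriv : List ((ℕ → V) × (ℕ → V)) → (ℕ → V)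
  | [] => 0
  | p :: L => H.dexp p.1 p.2 + opExp (H.ad p.1) (wordLogDeriv L)

/-- The word `exp y₁ ⋯ exp yₖ` can be contracted. -/
def Contractible (L : List H.Lie) : Prop :=
  ∃ P : List (ℝ → H.Lie),
    (∀ Y ∈ P, (Y 0).1 = 0) ∧ P.map (fun Y => Y 1) = L ∧
    (∀ Y ∈ P, ∀ (s : ℝ) (n : ℕ), ∃ D : V, HasWDeriv ℝ (fun t => (Y t).1 n) D s) ∧
    ∀ s : ℝ, H.wordLogDeriv
      (P.map fun Y => ((Y s).1, fun n => wderiv ℝ (fun t => (Y t).1 n) s)) = 0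

/-- The group `H~ˣ`. -/
abbrev Tilde : Type _ :=
  PresentedGroup {r : FreeGroup H.Lie | ∃ L, H.Contractible L ∧ r = (L.map FreeGroup.of).prod}

/-- The exponential map `𝔩 → H~ˣ`. -/
def exp (y : H.Lie) : H.Tilde := PresentedGroup.of y

section TwoSided

variable {W : Type*} [AddCommGroup W] [Module ℂ W]

/-- The expression `f(x) v g(x)⁻¹` for `x ∈ H~ˣ`, where `f`, `g` are Lie homomorphisms from `𝔩` to
an algebra `W[[ħ]]` with product `m` which are congruent modulo `ħ`.  For `x = exp y` it is
`exp (T y) v` with `T y v = f(y) v - v g(y)`.  The operators `exp (T y)` satisfy the relations of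
`H~ˣ`, so the word chosen to represent `x` does not matter. -/
def twoSided (m : (ℕ → W) → (ℕ → W) → (ℕ → W)) (f g : (ℕ → V) → (ℕ → W)) (x : H.Tilde)
    (v : ℕ → W) : ℕ → W :=
  open Classical in
  (Quotient.out x : FreeGroup H.Lie).toWord.foldr
    (fun p u =>
      if p.2 then opExp (fun w => m (f p.1.1) w - m w (g p.1.1)) u
      else opExp (fun w => m w (g p.1.1) - m (f p.1.1) w) u) v

end TwoSided

/-- `x v x⁻¹`, for `v ∈ H`. -/
def Ad (x : H.Tilde) (v : ℕ → V) : ℕ → V := H.twoSided H.mul₁ id id x v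

/-- `x² x¹ v (x²)⁻¹ (x¹)⁻¹`, for `v ∈ H ⊗ H`. -/
def Ad₂ (x : H.Tilde) (v : ℕ → V ⊗[ℂ] V) : ℕ → V ⊗[ℂ] V :=
  H.twoSided H.mul₂ H.legs H.legs x v

/-- `Δ(x) v (x²)⁻¹ (x¹)⁻¹ = Δ(x) v (x¹)⁻¹ (x²)⁻¹`, for `v ∈ H ⊗ H`. -/
def twist₂ (x : H.Tilde) (v : ℕ → V ⊗[ℂ] V) : ℕ → V ⊗[ℂ] V :=
  H.twoSided H.mul₂ H.Δ H.legs x v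

/-- The counit `H~ˣ → 1 + ħ ℂ[[ħ]]`. -/
def εTilde (x : H.Tilde) : ℕ → ℂ := H.twoSided fsmul H.ε (fun _ => 0) x fone

/-! ### Meromorphic functions with values in `H~ˣ` -/

section Functions

variable {E : Type*} [NormedAddCommGroup E] [NormedSpace ℂ E]

/-- `x` is a meromorphic function on `E` with values in `H~ˣ`, holomorphic on the dense open set
`U`, with logarithmic derivative `θ l μ = (∂_μ x)(l) x(l)⁻¹`.  Holomorphic means: locally a product
of exponentials of holomorphic functions with values in `𝔩`.  Elements of `H~ˣ` are not elements of
`H`; that `x` has no essential singularities outside `U` is expressed by the `H`- and `H ⊗ H`-valued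
functions `θ`, `x v x⁻¹`, `x⁻¹ v x` and `Δ(x) v (x²)⁻¹ (x¹)⁻¹`. -/
structure IsMeroTilde (U : Set E) (x : E → H.Tilde) (θ : E → E → ℕ → V) : Prop where
  isOpen : IsOpen U
  dense : Dense U
  holo : ∀ l₀ ∈ U, ∃ N : Set E, IsOpen N ∧ l₀ ∈ N ∧ ∃ F : List (E → H.Lie),
    (∀ f ∈ F, IsHolo N fun l => (f l).1) ∧
    ∀ l ∈ N, x l = (F.map fun f => H.exp (f l)).prod ∧
      ∀ μ, θ l μ = H.wordLogDeriv (F.map fun f => ((f l).1, dirDeriv (fun l' => (f l').1) μ l))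
  mero_logDeriv : ∀ μ, IsMeroF U fun l => θ l μ
  mero_Ad : ∀ v, IsMeroF U fun l => H.Ad (x l) v
  mero_Ad_inv : ∀ v, IsMeroF U fun l => H.Ad (x l)⁻¹ v
  mero_twist₂ : ∀ v, IsMeroF U fun l => H.twist₂ (x l) v

end Functions

/-! ### Dynamical twists

The abelian Lie algebra `𝔞` is a finite-dimensional complex vector space with an embedding
`j : 𝔞 → H`.  It carries an auxiliary norm, which only serves to give `𝔞*` its usual structure of a
finite-dimensional complex vector space with its standard topology. -/

/-- `j` identifies `𝔞` with a commutative Lie algebra of primitive elements of `H` which is mapped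
injectively to `H₀`. -/
structure IsAbelianPrimitive {𝔞 : Type*} [AddCommGroup 𝔞] [Module ℂ 𝔞]
    (j : 𝔞 →ₗ[ℂ] (ℕ → V)) : Prop where
  primitive : ∀ a, H.Δ (j a) = H.leg1 (j a) + H.leg2 (j a)
  commute : ∀ a b, H.mul₁ (j a) (j b) = H.mul₁ (j b) (j a)
  injective : Function.Injective fun a => j a 0

section Dynamical

variable {𝔞 : Type*} [NormedAddCommGroup 𝔞] [NormedSpace ℂ 𝔞] [FiniteDimensional ℂ 𝔞]
  (j : 𝔞 →ₗ[ℂ] (ℕ → V))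

/-- The elements `yᵢ` of a basis of `𝔞`, in `H`. -/
def basisVec (i : Fin (Module.finrank ℂ 𝔞)) : ℕ → V := j (Module.finBasis ℂ 𝔞 i)

/-- The dual basis `yⁱ` of `𝔞*`. -/
def dualVec (𝔞 : Type*) [NormedAddCommGroup 𝔞] [NormedSpace ℂ 𝔞] [FiniteDimensional ℂ 𝔞]
    (i : Fin (Module.finrank ℂ 𝔞)) : StrongDual ℂ 𝔞 :=
  LinearMap.toContinuousLinearMap ((Module.finBasis ℂ 𝔞).coord i)

/-- `J¹²(l - ħ h⁽³⁾)`, the Taylor expansion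
`∑ k, (-ħ) ^ k / k! ∑ i₁ … iₖ, (∂_{i₁} ⋯ ∂_{iₖ} J)(l)¹² (y_{i₁} ⋯ y_{iₖ})³`. -/
def shift12 (J : StrongDual ℂ 𝔞 → ℕ → V ⊗[ℂ] V) : StrongDual ℂ 𝔞 → ℕ → (V ⊗[ℂ] V) ⊗[ℂ] V :=
  hExp (fun F l => ∑ i, H.mul₃ (dirDeriv F (dualVec 𝔞 i) l) (ften H.one₂ (basisVec j i)))
    (fun l => H.leg12 (J l))

/-- `x¹(l) x¹(l - ħ h⁽²⁾)⁻¹`, i.e. the Taylor expansion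
`∑ k, (-ħ) ^ k / k! ∑ i₁ … iₖ, (x ∂_{i₁} ⋯ ∂_{iₖ} x⁻¹)(l)¹ (y_{i₁} ⋯ y_{iₖ})²`,
where `x ∂ᵢ p = ∂ᵢ (x p) - θᵢ (x p)` for `θᵢ = (∂ᵢ x) x⁻¹`. -/
def ratioLeft (θ : StrongDual ℂ 𝔞 → StrongDual ℂ 𝔞 → ℕ → V) :
    StrongDual ℂ 𝔞 → ℕ → V ⊗[ℂ] V :=
  hExp (fun F l => ∑ i, H.mul₂
      (dirDeriv F (dualVec 𝔞 i) l - H.mul₂ (H.leg1 (θ l (dualVec 𝔞 i))) (F l))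
      (H.leg2 (basisVec j i)))
    (fun _ => H.one₂)

/-- `x¹(l - ħ h⁽²⁾)⁻¹ x¹(l)`, i.e. the Taylor expansion
`∑ k, (-ħ) ^ k / k! ∑ i₁ … iₖ, ((∂_{i₁} ⋯ ∂_{iₖ} x⁻¹) x)(l)¹ (y_{i₁} ⋯ y_{iₖ})²`,
where `(∂ᵢ p) x = ∂ᵢ (p x) - (p x) (x⁻¹ ∂ᵢ x)` and `x⁻¹ ∂ᵢ x = x⁻¹ θᵢ x`. -/
def ratioRight (x : StrongDual ℂ 𝔞 → H.Tilde)
    (θ : StrongDual ℂ 𝔞 → StrongDual ℂ 𝔞 → ℕ → V) : StrongDual ℂ 𝔞 → ℕ → V ⊗[ℂ] V :=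
  hExp (fun F l => ∑ i, H.mul₂
      (dirDeriv F (dualVec 𝔞 i) l -
        H.mul₂ (F l) (H.leg1 (H.Ad (x l)⁻¹ (θ l (dualVec 𝔞 i)))))
      (H.leg2 (basisVec j i)))
    (fun _ => H.one₂)

/-- `x²(l - ħ h⁽¹⁾) x²(l)⁻¹`, i.e. the Taylor expansion
`∑ k, (-ħ) ^ k / k! ∑ i₁ … iₖ, ((∂_{i₁} ⋯ ∂_{iₖ} x) x⁻¹)(l)² (y_{i₁} ⋯ y_{iₖ})¹`,
where `(∂ᵢ p) x⁻¹ = ∂ᵢ (p x⁻¹) + (p x⁻¹) θᵢ`. -/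
def ratioTwo (θ : StrongDual ℂ 𝔞 → StrongDual ℂ 𝔞 → ℕ → V) :
    StrongDual ℂ 𝔞 → ℕ → V ⊗[ℂ] V :=
  hExp (fun F l => ∑ i, H.mul₂
      (dirDeriv F (dualVec 𝔞 i) l + H.mul₂ (F l) (H.leg2 (θ l (dualVec 𝔞 i))))
      (H.leg1 (basisVec j i)))
    (fun _ => H.one₂)

/-- `J ∈ H ⊗ H` is of zero weight with respect to `𝔞`. -/
def ZeroWeight₂ (J : ℕ → V ⊗[ℂ] V) : Prop :=
  ∀ a : 𝔞, H.mul₂ (H.legs (j a)) J = H.mul₂ J (H.legs (j a))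

/-- `x ∈ H~ˣ` is of zero weight with respect to `𝔞`. -/
def ZeroWeight (x : H.Tilde) : Prop := ∀ a : 𝔞, H.Ad x (j a) = j a

/-- `J` is a (formal) dynamical twist for `H`: a meromorphic function on `𝔞*`, defined on the dense
open set `U`. -/
structure IsDynamicalTwist (U : Set (StrongDual ℂ 𝔞)) (J : StrongDual ℂ 𝔞 → ℕ → V ⊗[ℂ] V) :
    Prop where
  isOpen : IsOpen U
  dense : Dense U
  mero : IsMeroF U J
  zeroWeight : ∀ l ∈ U, H.ZeroWeight₂ j (J l)
  mod_h : ∀ l ∈ U, J l 0 = H.one₂ 0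
  twist_eq : ∀ l ∈ U, H.mul₃ (H.comulLeft (J l)) (H.shift12 j J l) =
    H.mul₃ (H.comulRight (J l)) (H.leg23 (J l))
  counit_left : ∀ l ∈ U, H.counitLeft (J l) = H.one
  counit_right : ∀ l ∈ U, H.counitRight (J l) = H.one

/-- `Δ(x(l)) K(l) x²(l)⁻¹ x¹(l - ħ h⁽²⁾)⁻¹`; vertex-IRF transformations use it with
`K(l) = J̄(l̄)`. -/
def vertexIRF (x : StrongDual ℂ 𝔞 → H.Tilde) (θ : StrongDual ℂ 𝔞 → StrongDual ℂ 𝔞 → ℕ → V)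
    (K : StrongDual ℂ 𝔞 → ℕ → V ⊗[ℂ] V) : StrongDual ℂ 𝔞 → ℕ → V ⊗[ℂ] V :=
  fun l => H.mul₂ (H.twist₂ (x l) (K l)) (H.ratioLeft j θ l)

/-- `Δ(x(l)) J(l) x¹(l - ħ h⁽²⁾)⁻¹ x²(l)⁻¹`. -/
def irfVertex (x : StrongDual ℂ 𝔞 → H.Tilde) (θ : StrongDual ℂ 𝔞 → StrongDual ℂ 𝔞 → ℕ → V)
    (J : StrongDual ℂ 𝔞 → ℕ → V ⊗[ℂ] V) : StrongDual ℂ 𝔞 → ℕ → V ⊗[ℂ] V :=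
  fun l => H.twist₂ (x l) (H.mul₂ (J l) (H.ratioRight j x θ l))

/-- The dynamical `R`-matrix `J²¹(l)⁻¹ R J(l)`, from the value of `J` at `l`. -/
def dynR (R J : ℕ → V ⊗[ℂ] V) : ℕ → V ⊗[ℂ] V := H.mul₂ (H.mul₂ (H.inv₂ (flip J)) R) J

end Dynamical

end DeformationHopfAlgebra

/-- The canonical projection `𝔞* → 𝔟*` for a subspace `𝔟 ⊆ 𝔞`. -/
def res {𝔞 : Type*} [NormedAddCommGroup 𝔞] [NormedSpace ℂ 𝔞] (𝔟 : Submodule ℂ 𝔞)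
    (l : StrongDual ℂ 𝔞) : StrongDual ℂ 𝔟 := l.comp 𝔟.subtypeL

end Deform

end

/-!
# Gauge transformations of dynamical twists

Put `J(l) = Δ(x(l)) K(l) x²(l)⁻¹ x¹(l - ħ h⁽²⁾)⁻¹`. Formally, both sides of the twist equation for
`J` are those for `K`, multiplied by `Δ³(x(l))` from the left and by
`x³(l)⁻¹ x²(l - ħ h⁽³⁾)⁻¹ x¹(l - ħ h⁽²⁾ - ħ h⁽³⁾)⁻¹` from the right. On the left hand side,
`J¹²(l - ħ h⁽³⁾)` contains `Δ(x)¹²(l - ħ h⁽³⁾)`, which cancels against the shifted factor of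
`J^{12,3}(l)`, and `x³(l)⁻¹` has to be moved through `K¹²(l - ħ h⁽³⁾)`: this needs `x` to commute
with the `y` occurring in the shift, that is, to have weight zero with respect to `𝔟`. On the right
hand side, `x¹(l - ħ h⁽²⁾ - ħ h⁽³⁾)⁻¹` has to be moved through `J²³(l)`: this needs `J` to have weight
zero. The common factors are invertible, so the twist equations for `J` and `K` are equivalent
(`Flow.twist_iff`). For vertex-IRF transformations this is used from `K = J̄` to `J`. An IRF-vertex
transformation `J ↦ J̄` is inverse to a vertex-IRF transformation by `x⁻¹` (`X_inv_mul_ρ`), so that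
the same equivalence for `x⁻¹` gives the twist equation for `J̄`; meromorphy of `J̄` descends along
the projection `𝔞* → 𝔟*` (`IsMeroF.descend`). The formula for the `R`-matrices is a cancellation
based on `R Δ(x) = Δ^{op}(x) R` (`dynR_twist₂_mul_ratioLeft`).

The elements `x(l)` are not in `H`, so the formal computation has to be given a meaning.

* An action `T` of `𝔩` on `W[[ħ]]` which is locally finite modulo `ħ` has finite-dimensional models
  modulo each power of `ħ` (`exists_model`). In these, `exp (T y)` is a matrix exponential with the
  usual derivative (`hasDerivAt_exp`). Hence contractible words act trivially and `T` integrates to an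
  action of the group `H~ˣ` (`IsRep.hom`), whose derivative along a differentiable function `x` is
  given by the logarithmic derivative of `x` (`IsRep.hasHDeriv_hom`). Linear and bilinear intertwiners
  of Lie algebra actions are intertwiners for the group, which gives all the rules for products such
  as `f(x) v g(x)⁻¹ g(x) w h(x)⁻¹ = f(x) v w h(x)⁻¹` (`conj_mul`).
* Meromorphic functions with values in an algebra over `ℂ[[ħ]]` form an algebra of the same kind
  (`FAlg.mero`), with commuting derivations. A product of shifted factors is the exponential
  `exp (-ħ D) F` of an operator `D F = ∑ i, (∂ᵢ F - αᵢ F + F βᵢ) yᵢ`, where `α` and `β` are the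
  logarithmic derivatives of the factors on both sides of `F` (`FAlg.covE`). These exponentials are
  multiplicative (`FAlg.covE_mul`), and successive shifts combine because logarithmic derivatives are
  flat connections (`FAlg.covE_covE`, `wordLogDeriv_flat`). The cancellations above are instances of
  these two rules.
-/

open Filter Topology TensorProduct

noncomputable section

namespace Deform

open Finset.HasAntidiagonal (antidiagonal)

set_option linter.unusedSectionVars false

/-! ### Linear and bilinear maps over `ℂ[[ħ]]` -/

section HL

variable {V W V' W' Z : Type*} [AddCommGroup V] [Module ℂ V] [AddCommGroup W] [Module ℂ W]
  [AddCommGroup V'] [Module ℂ V'] [AddCommGroup W'] [Module ℂ W'] [AddCommGroup Z] [Module ℂ Z]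

/-- Multiplication by `ħ`. -/
def hs (a : ℕ → W) : ℕ → W
  | 0 => 0
  | n + 1 => a n

/-- The constant series. -/
def cst (w : W) : ℕ → W := fun n => if n = 0 then w else 0

@[simp] lemma hs_zero (a : ℕ → W) : hs a 0 = 0 := rfl
@[simp] lemma hs_succ (a : ℕ → W) (n : ℕ) : hs a (n + 1) = a n := rfl
@[simp] lemma cst_zero (w : W) : cst w 0 = w := rfl
@[simp] lemma cst_succ (w : W) (n : ℕ) : cst w (n + 1) = 0 := rfl

lemma cst_add (v w : W) : cst (v + w) = cst v + cst w := by
  funext n; cases n <;> simp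

lemma cst_smul (c : ℂ) (w : W) : cst (c • w) = c • cst w := by
  funext n; cases n <;> simp

lemma cst_zero' : cst (0 : W) = 0 := by
  funext n; cases n <;> simp

lemma hs_add (a b : ℕ → W) : hs (a + b) = hs a + hs b := by
  funext n; cases n <;> simp

lemma hs_smul (c : ℂ) (a : ℕ → W) : hs (c • a) = c • hs a := by
  funext n; cases n <;> simp

lemma eq_cst_add_hs (a : ℕ → W) : a = cst (a 0) + hs (fun n => a (n + 1)) := by
  funext n; cases n <;> simp

/-- `Φ` is linear over `ℂ[[ħ]]`.  Commuting with `ħ` and with scalars of `ℂ` suffices: such a map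
is automatically `ħ`-adically continuous. -/
structure IsHL (Φ : (ℕ → V) → (ℕ → W)) : Prop where
  add : ∀ a b, Φ (a + b) = Φ a + Φ b
  smul : ∀ (c : ℂ) a, Φ (c • a) = c • Φ a
  hs : ∀ a, Φ (hs a) = hs (Φ a)

/-- `B` is bilinear over `ℂ[[ħ]]`. -/
structure IsHL₂ (B : (ℕ → V) → (ℕ → V') → (ℕ → W)) : Prop where
  left : ∀ b, IsHL fun a => B a b
  right : ∀ a, IsHL (B a)

namespace IsHL

variable {Φ Ψ : (ℕ → V) → (ℕ → W)}

/-- A `ℂ[[ħ]]`-linear map as a linear map over `ℂ`. -/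
def lin (hΦ : IsHL Φ) : (ℕ → V) →ₗ[ℂ] (ℕ → W) where
  toFun := Φ
  map_add' := hΦ.add
  map_smul' := hΦ.smul

lemma zero (hΦ : IsHL Φ) : Φ 0 = 0 := hΦ.lin.map_zero
lemma neg (hΦ : IsHL Φ) (a) : Φ (-a) = -Φ a := hΦ.lin.map_neg a
lemma sub (hΦ : IsHL Φ) (a b) : Φ (a - b) = Φ a - Φ b := hΦ.lin.map_sub a b
lemma sum (hΦ : IsHL Φ) {ι : Type*} (s : Finset ι) (f : ι → ℕ → V) :
    Φ (∑ i ∈ s, f i) = ∑ i ∈ s, Φ (f i) := map_sum hΦ.lin f s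

lemma apply_eq (hΦ : IsHL Φ) (a : ℕ → V) (n : ℕ) :
    Φ a n = ∑ p ∈ antidiagonal n, Φ (cst (a p.1)) p.2 := by
  induction n generalizing a with
  | zero =>
    conv_lhs => rw [eq_cst_add_hs a, hΦ.add, hΦ.hs]
    simp
  | succ n ih =>
    conv_lhs => rw [eq_cst_add_hs a, hΦ.add, hΦ.hs]
    rw [Finset.Nat.sum_antidiagonal_succ]
    simp only [Pi.add_apply, hs_succ]
    rw [ih]

lemma ext_cst (hΦ : IsHL Φ) (hΨ : IsHL Ψ) (h : ∀ v, Φ (cst v) = Ψ (cst v)) (a) : Φ a = Ψ a := by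
  funext n
  rw [hΦ.apply_eq, hΨ.apply_eq]
  simp only [h]

/-- The value of a `ℂ[[ħ]]`-linear map modulo `ħ ^ (n + 1)` depends only on the argument modulo
`ħ ^ (n + 1)`. -/
lemma congr (hΦ : IsHL Φ) {a b : ℕ → V} {n : ℕ} (h : ∀ m ≤ n, a m = b m) : Φ a n = Φ b n := by
  rw [hΦ.apply_eq, hΦ.apply_eq]
  refine Finset.sum_congr rfl fun p hp => ?_
  rw [h p.1 (by have := Finset.HasAntidiagonal.mem_antidiagonal.1 hp; omega)]

lemma id : IsHL (fun a : ℕ → V => a) := ⟨fun _ _ => rfl, fun _ _ => rfl, fun _ => rfl⟩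

lemma const_zero : IsHL (fun _ : ℕ → V => (0 : ℕ → W)) :=
  ⟨by simp, by simp, fun _ => by funext n; cases n <;> simp⟩

lemma comp {Θ : (ℕ → W) → (ℕ → Z)} (hΘ : IsHL Θ) (hΦ : IsHL Φ) : IsHL fun a => Θ (Φ a) :=
  ⟨fun a b => by rw [hΦ.add, hΘ.add], fun c a => by rw [hΦ.smul, hΘ.smul],
    fun a => by rw [hΦ.hs, hΘ.hs]⟩

lemma fadd (hΦ : IsHL Φ) (hΨ : IsHL Ψ) : IsHL fun a => Φ a + Ψ a :=
  ⟨fun a b => by rw [hΦ.add, hΨ.add]; abel, fun c a => by rw [hΦ.smul, hΨ.smul, smul_add],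
    fun a => by rw [hΦ.hs, hΨ.hs, hs_add]⟩

lemma fneg (hΦ : IsHL Φ) : IsHL fun a => -Φ a :=
  ⟨fun a b => by rw [hΦ.add]; abel, fun c a => by rw [hΦ.smul, smul_neg],
    fun a => by rw [hΦ.hs]; funext n; cases n <;> simp⟩

lemma fsub (hΦ : IsHL Φ) (hΨ : IsHL Ψ) : IsHL fun a => Φ a - Ψ a := by
  simpa only [sub_eq_add_neg] using hΦ.fadd hΨ.fneg

lemma fsum {ι : Type*} (s : Finset ι) {Φ : ι → (ℕ → V) → (ℕ → W)} (h : ∀ i ∈ s, IsHL (Φ i)) :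
    IsHL fun a => ∑ i ∈ s, Φ i a := by
  classical
  induction s using Finset.induction_on with
  | empty => simpa using const_zero
  | insert i s hi ih =>
    simp only [Finset.sum_insert hi]
    exact (h i (by simp)).fadd (ih fun j hj => h j (by simp [hj]))

end IsHL

lemma FHom.app_hl (f : FHom V W) : IsHL f.app where
  add a b := by
    funext n
    simp [FHom.app, Finset.sum_add_distrib]
  smul c a := by
    funext n
    simp [FHom.app, Finset.smul_sum]
  hs a := by
    funext n
    cases n with
    | zero => simp [FHom.app]
    | succ n => simp [FHom.app, Finset.Nat.sum_antidiagonal_succ']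

@[simp] lemma FHom.app_cst (f : FHom V W) (v : V) (n : ℕ) : f.app (cst v) n = f n v := by
  rw [FHom.app, Finset.sum_eq_single (n, 0)]
  · simp
  · rintro ⟨a, b⟩ hp hne
    cases b with
    | zero =>
      have := Finset.HasAntidiagonal.mem_antidiagonal.1 hp
      simp_all
    | succ b => simp
  · simp

lemma fmap_hl (f : V →ₗ[ℂ] W) : IsHL (fmap f) where
  add a b := by funext n; simp [fmap]
  smul c a := by funext n; simp [fmap]
  hs a := by funext n; cases n <;> simp [fmap]

lemma fmap_cst (f : V →ₗ[ℂ] W) (v : V) : fmap f (cst v) = cst (f v) := by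
  funext n; cases n <;> simp [fmap]

lemma ften_hl₂ : IsHL₂ (ften : (ℕ → V) → (ℕ → W) → _) where
  left b :=
    { add := fun a a' => by
        funext n; simp [ften, add_tmul, Finset.sum_add_distrib]
      smul := fun c a => by
        funext n; simp [ften, smul_tmul', Finset.smul_sum]
      hs := fun a => by
        funext n
        cases n with
        | zero => simp [ften]
        | succ n => simp [ften, Finset.Nat.sum_antidiagonal_succ] }
  right a := FHom.app_hl (fun n => TensorProduct.mk ℂ V W (a n))

lemma fsmul_hl₂ : IsHL₂ (fsmul : (ℕ → ℂ) → (ℕ → W) → _) where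
  left b :=
    { add := fun a a' => by
        funext n; simp [fsmul, add_smul, Finset.sum_add_distrib]
      smul := fun c a => by
        funext n; simp [fsmul, mul_smul, Finset.smul_sum]
      hs := fun a => by
        funext n
        cases n with
        | zero => simp [fsmul]
        | succ n => simp [fsmul, Finset.Nat.sum_antidiagonal_succ] }
  right a := FHom.app_hl (fun n => a n • (LinearMap.id : W →ₗ[ℂ] W))

lemma ften_cst (v : V) (w : W) : ften (cst v) (cst w) = cst (v ⊗ₜ[ℂ] w) := by
  have : ften (cst v) (cst w) = (FHom.app (fun n => TensorProduct.mk ℂ V W (cst v n))) (cst w) :=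
    rfl
  rw [this]
  funext n
  rw [FHom.app_cst]
  cases n <;> simp

namespace IsHL₂

variable {B : (ℕ → V) → (ℕ → V') → (ℕ → W)}

lemma comp {Z : Type*} [AddCommGroup Z] [Module ℂ Z] {Φ : (ℕ → W) → (ℕ → Z)} (hΦ : IsHL Φ)
    (hB : IsHL₂ B) : IsHL₂ fun a b => Φ (B a b) :=
  ⟨fun b => hΦ.comp (hB.left b), fun a => hΦ.comp (hB.right a)⟩

lemma comp_left {Φ : (ℕ → Z) → (ℕ → V)} (hB : IsHL₂ B) (hΦ : IsHL Φ) :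
    IsHL₂ fun a b => B (Φ a) b :=
  ⟨fun b => (hB.left b).comp hΦ, fun a => hB.right (Φ a)⟩

lemma comp_right {Φ : (ℕ → Z) → (ℕ → V')} (hB : IsHL₂ B) (hΦ : IsHL Φ) :
    IsHL₂ fun a b => B a (Φ b) :=
  ⟨fun b => hB.left (Φ b), fun a => (hB.right a).comp hΦ⟩

lemma flip (hB : IsHL₂ B) : IsHL₂ fun b a => B a b := ⟨hB.right, hB.left⟩

lemma fsub {B' : (ℕ → V) → (ℕ → V') → (ℕ → W)} (hB : IsHL₂ B) (hB' : IsHL₂ B') :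
    IsHL₂ fun a b => B a b - B' a b :=
  ⟨fun b => (hB.left b).fsub (hB'.left b), fun a => (hB.right a).fsub (hB'.right a)⟩

lemma ext_cst {B' : (ℕ → V) → (ℕ → V') → (ℕ → W)} (hB : IsHL₂ B) (hB' : IsHL₂ B')
    (h : ∀ v w, B (cst v) (cst w) = B' (cst v) (cst w)) (a b) : B a b = B' a b :=
  (hB.left b).ext_cst (hB'.left b)
    (fun v => (hB.right _).ext_cst (hB'.right _) (fun w => h v w) b) a

end IsHL₂

/-- Two `ℂ[[ħ]]`-linear maps on a completed tensor product agree if they agree on the elements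
`a ⊗ b`. -/
lemma IsHL.ext_ften {Φ Ψ : (ℕ → V ⊗[ℂ] V') → (ℕ → W)} (hΦ : IsHL Φ) (hΨ : IsHL Ψ)
    (h : ∀ a b, Φ (ften a b) = Ψ (ften a b)) (u) : Φ u = Ψ u := by
  refine hΦ.ext_cst hΨ (fun v => ?_) u
  induction v using TensorProduct.induction_on with
  | zero => rw [cst_zero', hΦ.zero, hΨ.zero]
  | tmul v w => rw [← ften_cst, h]
  | add v w hv hw => rw [cst_add, hΦ.add, hΨ.add, hv, hw]

lemma fhom_one_app (a : ℕ → V) : (FHom.one V).app a = a := by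
  refine (FHom.app_hl _).ext_cst IsHL.id (fun v => ?_) a
  funext n
  rw [FHom.app_cst]
  cases n <;> simp [FHom.one]

lemma FHom.tens_app_ften (f : FHom V W) (g : FHom V' W') (a : ℕ → V) (b : ℕ → V') :
    (f.tens g).app (ften a b) = ften (f.app a) (g.app b) := by
  refine IsHL₂.ext_cst (ften_hl₂.comp (FHom.app_hl (f.tens g)))
    ((ften_hl₂.comp_left (FHom.app_hl f)).comp_right (FHom.app_hl g)) (fun v w => ?_) a b
  funext n
  simp [ften_cst, FHom.tens, ften]

lemma fmap_comm_ften (a : ℕ → V) (b : ℕ → W) :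
    fmap (TensorProduct.comm ℂ V W).toLinearMap (ften a b) = ften b a := by
  refine IsHL₂.ext_cst (ften_hl₂.comp (fmap_hl _)) ften_hl₂.flip (fun v w => ?_) a b
  simp [ften_cst, fmap_cst]

lemma fmap_assoc_ften (a : ℕ → V) (b : ℕ → W) (c : ℕ → Z) :
    fmap (TensorProduct.assoc ℂ V W Z).toLinearMap (ften (ften a b) c) = ften a (ften b c) := by
  refine IsHL.ext_cst (((fmap_hl _).comp (ften_hl₂.left c)).comp (ften_hl₂.left b))
    (ften_hl₂.left _) (fun v => ?_) a
  refine IsHL₂.ext_cst (((ften_hl₂.comp_left (ften_hl₂.right (cst v)))).comp (fmap_hl _))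
    (ften_hl₂.comp (ften_hl₂.right (cst v))) (fun w z => ?_) b c
  simp [ften_cst, fmap_cst]

lemma fmap_assoc_symm_ften (a : ℕ → V) (b : ℕ → W) (c : ℕ → Z) :
    fmap (TensorProduct.assoc ℂ V W Z).symm.toLinearMap (ften a (ften b c)) =
      ften (ften a b) c := by
  rw [← fmap_assoc_ften]
  funext n
  simp [fmap]

lemma fmap_lid_ften (a : ℕ → ℂ) (b : ℕ → V) :
    fmap (TensorProduct.lid ℂ V).toLinearMap (ften a b) = fsmul a b := by
  funext n
  simp [fmap, ften, fsmul]

lemma fmap_rid_ften (a : ℕ → V) (b : ℕ → ℂ) :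
    fmap (TensorProduct.rid ℂ V).toLinearMap (ften a b) = fsmul b a := by
  funext n
  simp only [fmap, ften, fsmul, LinearEquiv.coe_coe, map_sum, TensorProduct.rid_tmul]
  exact (Finset.Nat.sum_antidiagonal_swap (f := fun p => b p.1 • a p.2)).symm ▸ rfl

lemma fsmul_fone (a : ℕ → W) : fsmul fone a = a := by
  have : fone = cst (1 : ℂ) := rfl
  rw [this]
  refine (fsmul_hl₂.right _).ext_cst IsHL.id (fun v => ?_) a
  funext n
  cases n with
  | zero => simp [fsmul]
  | succ n => simp [fsmul, Finset.Nat.sum_antidiagonal_succ]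

lemma prd_hl₂ (m : FHom (V ⊗[ℂ] V) V) : IsHL₂ (prd m) := ften_hl₂.comp (FHom.app_hl m)

lemma prd_tensMul_ften (m : FHom (V ⊗[ℂ] V) V) (m' : FHom (W ⊗[ℂ] W) W) (a c : ℕ → V)
    (b d : ℕ → W) :
    prd (tensMul m m') (ften a b) (ften c d) = ften (prd m a c) (prd m' b d) := by
  have h1 : ∀ u, (tensMul m m').app u =
      (m.tens m').app (fmap (TensorProduct.tensorTensorTensorComm ℂ V W V W).toLinearMap u) := by
    intro u
    refine (FHom.app_hl _).ext_cst ((FHom.app_hl _).comp (fmap_hl _)) (fun v => ?_) u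
    funext n
    simp [fmap_cst, tensMul]
  have h2 : fmap (TensorProduct.tensorTensorTensorComm ℂ V W V W).toLinearMap
      (ften (ften a b) (ften c d)) = ften (ften a c) (ften b d) := by
    refine IsHL.ext_cst
      ((fmap_hl _).comp ((ften_hl₂.left (ften c d)).comp (ften_hl₂.left b)))
      ((ften_hl₂.left _).comp (ften_hl₂.left c)) (fun v => ?_) a
    refine IsHL.ext_cst
      ((fmap_hl _).comp ((ften_hl₂.left (ften c d)).comp (ften_hl₂.right (cst v))))
      ((ften_hl₂.right _).comp (ften_hl₂.left d)) (fun w => ?_) b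
    refine IsHL₂.ext_cst ((ften_hl₂.comp (ften_hl₂.right _)).comp (fmap_hl _))
      ((ften_hl₂.comp_left (ften_hl₂.right (cst v))).comp_right (ften_hl₂.right (cst w)))
      (fun v' w' => ?_) c d
    simp [ften_cst, fmap_cst]
  rw [prd, h1, h2, FHom.tens_app_ften]
  rfl

end HL

/-! ### Algebras over `ℂ[[ħ]]` -/

section FAlg

variable {W W' W'' : Type*} [AddCommGroup W] [Module ℂ W] [AddCommGroup W'] [Module ℂ W']
  [AddCommGroup W''] [Module ℂ W'']

/-- The structure of an associative unital `ℂ[[ħ]]`-algebra on `W[[ħ]]`. -/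
structure FAlg (W : Type*) [AddCommGroup W] [Module ℂ W] where
  mul : (ℕ → W) → (ℕ → W) → (ℕ → W)
  one : ℕ → W
  hl : IsHL₂ mul
  assoc : ∀ a b c, mul (mul a b) c = mul a (mul b c)
  one_mul : ∀ a, mul one a = a
  mul_one : ∀ a, mul a one = a

/-- The underlying ring of an algebra structure on `W[[ħ]]`. -/
def FAlg.Elt (_ : FAlg W) : Type _ := ℕ → W

instance (A : FAlg W) : AddCommGroup A.Elt := inferInstanceAs (AddCommGroup (ℕ → W))

instance (A : FAlg W) : Module ℂ A.Elt := inferInstanceAs (Module ℂ (ℕ → W))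

instance (A : FAlg W) : Ring A.Elt :=
  { (inferInstanceAs (AddCommGroup (ℕ → W)) : AddCommGroup A.Elt) with
    mul := A.mul
    one := A.one
    left_distrib := fun a b c => (A.hl.right a).add b c
    right_distrib := fun a b c => (A.hl.left c).add a b
    zero_mul := fun a => (A.hl.left a).zero
    mul_zero := fun a => (A.hl.right a).zero
    mul_assoc := A.assoc
    one_mul := A.one_mul
    mul_one := A.mul_one }

instance (A : FAlg W) : Algebra ℂ A.Elt :=
  Algebra.ofModule (fun c a b => (A.hl.left b).smul c a) (fun c a b => (A.hl.right a).smul c b)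

lemma FAlg.mul_hl₂ (A : FAlg W) : IsHL₂ (V := W) (V' := W) (W := W) (fun a b : A.Elt => a * b) :=
  A.hl

lemma FAlg.mulL (A : FAlg W) (a : A.Elt) : IsHL (V := W) (W := W) (fun b : A.Elt => a * b) :=
  A.hl.right a

lemma FAlg.mulR (A : FAlg W) (b : A.Elt) : IsHL (V := W) (W := W) (fun a : A.Elt => a * b) :=
  A.hl.left b

/-- The algebra structure given by a multiplication map. -/
def FAlg.ofPrd (m : FHom (W ⊗[ℂ] W) W) (e : ℕ → W)
    (assoc : ∀ a b c, prd m (prd m a b) c = prd m a (prd m b c))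
    (one_mul : ∀ a, prd m e a = a) (mul_one : ∀ a, prd m a e = a) : FAlg W where
  mul := prd m
  one := e
  hl := prd_hl₂ m
  assoc := assoc
  one_mul := one_mul
  mul_one := mul_one

lemma tensMul_assoc (m : FHom (W ⊗[ℂ] W) W) (m' : FHom (W' ⊗[ℂ] W') W')
    (h : ∀ a b c, prd m (prd m a b) c = prd m a (prd m b c))
    (h' : ∀ a b c, prd m' (prd m' a b) c = prd m' a (prd m' b c)) (a b c) :
    prd (tensMul m m') (prd (tensMul m m') a b) c =
      prd (tensMul m m') a (prd (tensMul m m') b c) := by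
  have hl := prd_hl₂ (tensMul m m')
  refine ((hl.left c).comp (hl.left b)).ext_ften (hl.left _) (fun a₁ a₂ => ?_) a
  refine ((hl.left c).comp (hl.right _)).ext_ften ((hl.right _).comp (hl.left c))
    (fun b₁ b₂ => ?_) b
  refine (hl.right _).ext_ften ((hl.right _).comp (hl.right _)) (fun c₁ c₂ => ?_) c
  simp only [prd_tensMul_ften, h, h']

lemma tensMul_one_mul (m : FHom (W ⊗[ℂ] W) W) (m' : FHom (W' ⊗[ℂ] W') W') {e : ℕ → W} {e' : ℕ → W'}
    (h : ∀ a, prd m e a = a) (h' : ∀ a, prd m' e' a = a) (a) :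
    prd (tensMul m m') (ften e e') a = a := by
  refine ((prd_hl₂ (tensMul m m')).right _).ext_ften IsHL.id (fun a₁ a₂ => ?_) a
  simp only [prd_tensMul_ften, h, h']

lemma tensMul_mul_one (m : FHom (W ⊗[ℂ] W) W) (m' : FHom (W' ⊗[ℂ] W') W') {e : ℕ → W} {e' : ℕ → W'}
    (h : ∀ a, prd m a e = a) (h' : ∀ a, prd m' a e' = a) (a) :
    prd (tensMul m m') a (ften e e') = a := by
  refine ((prd_hl₂ (tensMul m m')).left _).ext_ften IsHL.id (fun a₁ a₂ => ?_) a
  simp only [prd_tensMul_ften, h, h']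

end FAlg

/-! ### Formal exponential series -/

section HSum

variable {Z Z₁ Z₂ : Type*} [AddCommGroup Z] [Module ℂ Z] [AddCommGroup Z₁] [Module ℂ Z₁]
  [AddCommGroup Z₂] [Module ℂ Z₂]

/-- The `ħ`-adically convergent sum `∑ k, ħ ^ k F k`. -/
def hsum (F : ℕ → ℕ → Z) : ℕ → Z := fun n => ∑ p ∈ antidiagonal n, F p.1 p.2

lemma sum_antidiagonal_assoc {M : Type*} [AddCommMonoid M] (f : ℕ → ℕ → ℕ → M) (n : ℕ) :
    ∑ p ∈ antidiagonal n, ∑ q ∈ antidiagonal p.1, f q.1 q.2 p.2 =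
      ∑ p ∈ antidiagonal n, ∑ q ∈ antidiagonal p.2, f p.1 q.1 q.2 := by
  simp only [Finset.sum_sigma']
  refine Finset.sum_nbij' (fun x => ⟨(x.2.1, x.2.2 + x.1.2), (x.2.2, x.1.2)⟩)
    (fun x => ⟨(x.1.1 + x.2.1, x.2.2), (x.1.1, x.2.1)⟩) ?_ ?_ ?_ ?_ ?_
  · rintro ⟨⟨a, b⟩, ⟨c, d⟩⟩ h
    simp only [Finset.mem_sigma, Finset.HasAntidiagonal.mem_antidiagonal] at h ⊢
    exact ⟨by omega, trivial⟩
  · rintro ⟨⟨a, b⟩, ⟨c, d⟩⟩ h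
    simp only [Finset.mem_sigma, Finset.HasAntidiagonal.mem_antidiagonal] at h ⊢
    exact ⟨by omega, trivial⟩
  · rintro ⟨⟨a, b⟩, ⟨c, d⟩⟩ h
    simp only [Finset.mem_sigma, Finset.HasAntidiagonal.mem_antidiagonal] at h ⊢
    obtain ⟨h1, rfl⟩ := h
    rfl
  · rintro ⟨⟨a, b⟩, ⟨c, d⟩⟩ h
    simp only [Finset.mem_sigma, Finset.HasAntidiagonal.mem_antidiagonal] at h ⊢
    obtain ⟨h1, rfl⟩ := h
    rfl
  · rintro ⟨⟨a, b⟩, ⟨c, d⟩⟩ h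
    rfl

lemma IsHL.hsum {Φ : (ℕ → Z) → (ℕ → Z₁)} (hΦ : IsHL Φ) (F : ℕ → ℕ → Z) :
    Φ (hsum F) = hsum fun k => Φ (F k) := by
  funext n
  rw [hΦ.apply_eq]
  simp only [Deform.hsum]
  have h : ∀ m, Φ (cst (∑ q ∈ antidiagonal m, F q.1 q.2)) =
      ∑ q ∈ antidiagonal m, Φ (cst (F q.1 q.2)) := by
    intro m
    rw [← hΦ.sum]
    congr 1
    funext k
    cases k <;> simp
  simp only [h, Finset.sum_apply]
  rw [sum_antidiagonal_assoc (fun a b c => Φ (cst (F a b)) c)]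
  refine Finset.sum_congr rfl fun p _ => ?_
  rw [hΦ.apply_eq (F p.1)]

lemma hsum_hsum (a : ℕ → ℕ → ℕ → Z) :
    hsum (fun i => hsum fun j => a i j) = hsum fun k => ∑ p ∈ antidiagonal k, a p.1 p.2 := by
  funext n
  simp only [hsum, Finset.sum_apply]
  exact (sum_antidiagonal_assoc (fun i j k => a i j k) n).symm

lemma iterate_binomial {M : Type*} [AddCommGroup M] (D : M →+ M) (c : ℕ → ℕ → M)
    (h : ∀ i j, D (c i j) = c (i + 1) j + c i (j + 1)) (k : ℕ) :
    D^[k] (c 0 0) = ∑ p ∈ antidiagonal k, k.choose p.1 • c p.1 p.2 := by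
  induction k with
  | zero => simp
  | succ k ih =>
    rw [Function.iterate_succ_apply', ih, map_sum,
      Finset.sum_antidiagonal_choose_succ_nsmul (fun i j => c i j)]
    simp only [map_nsmul, h, nsmul_add, Finset.sum_add_distrib]
    rw [add_comm]
    congr 1
    refine Finset.sum_congr rfl fun p hp => ?_
    rw [Nat.choose_symm_of_eq_add (Finset.HasAntidiagonal.mem_antidiagonal.1 hp).symm]

/-- The coefficients of `exp (-ħ D)`. -/
def hcoef (k : ℕ) : ℂ := (-1 : ℂ) ^ k / (k.factorial : ℂ)

lemma hcoef_mul (i j : ℕ) : hcoef (i + j) * ((i + j).choose i : ℂ) = hcoef i * hcoef j := by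
  have h : ((i + j).choose i : ℂ) = (i + j).factorial / (i.factorial * j.factorial) := by
    rw [Nat.choose_symm_add, Nat.add_choose,
      Nat.cast_div (Nat.factorial_mul_factorial_dvd_factorial_add i j)
      (by exact_mod_cast mul_ne_zero i.factorial_ne_zero j.factorial_ne_zero)]
    push_cast; rfl
  have h1 : ((i + j).factorial : ℂ) ≠ 0 := by exact_mod_cast (i + j).factorial_ne_zero
  have h2 : (i.factorial : ℂ) ≠ 0 := by exact_mod_cast i.factorial_ne_zero
  have h3 : (j.factorial : ℂ) ≠ 0 := by exact_mod_cast j.factorial_ne_zero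
  rw [hcoef, hcoef, hcoef, h, pow_add]
  field_simp

/-- `exp (-ħ D) F` for an operator `D` on `Z[[ħ]]`. -/
def hexp (D : (ℕ → Z) → (ℕ → Z)) (F : ℕ → Z) : ℕ → Z := hsum fun k => hcoef k • D^[k] F

lemma hexp_conv (c : ℕ → ℕ → ℕ → Z) :
    hsum (fun i => hsum fun j => (hcoef i * hcoef j) • c i j) =
      hsum fun k => hcoef k • ∑ p ∈ antidiagonal k, k.choose p.1 • c p.1 p.2 := by
  rw [hsum_hsum]
  congr 1
  funext k
  rw [Finset.smul_sum]
  refine Finset.sum_congr rfl fun p hp => ?_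
  have := Finset.HasAntidiagonal.mem_antidiagonal.1 hp
  rw [← this, ← hcoef_mul, mul_smul, ← Nat.cast_smul_eq_nsmul ℂ]

/-- The exponential of a derivation is multiplicative. -/
lemma hexp_bilin {B : (ℕ → Z₁) → (ℕ → Z₂) → (ℕ → Z)} (hB : IsHL₂ B)
    {D₁ : (ℕ → Z₁) → (ℕ → Z₁)} {D₂ : (ℕ → Z₂) → (ℕ → Z₂)} {D : (ℕ → Z) → (ℕ → Z)}
    (hD : ∀ a b, D (a + b) = D a + D b) (F : ℕ → Z₁) (G : ℕ → Z₂)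
    (h : ∀ i j, D (B (D₁^[i] F) (D₂^[j] G)) =
      B (D₁^[i + 1] F) (D₂^[j] G) + B (D₁^[i] F) (D₂^[j + 1] G)) :
    hexp D (B F G) = B (hexp D₁ F) (hexp D₂ G) := by
  have h1 : ∀ k, D^[k] (B F G) =
      ∑ p ∈ antidiagonal k, k.choose p.1 • B (D₁^[p.1] F) (D₂^[p.2] G) := fun k =>
    iterate_binomial (AddMonoidHom.mk' D hD) (fun i j => B (D₁^[i] F) (D₂^[j] G)) h k
  rw [hexp, hexp, hexp, (hB.left _).hsum]
  simp only [(hB.right _).hsum, (hB.left _).smul, (hB.right _).smul, smul_smul, h1]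
  rw [hexp_conv]

lemma IsHL.iterate {D : (ℕ → Z) → (ℕ → Z)} (hD : IsHL D) (k : ℕ) : IsHL (D^[k]) := by
  induction k with
  | zero => exact IsHL.id
  | succ k ih => rw [Function.iterate_succ]; exact ih.comp hD

/-- `exp (-ħ D₁) exp (-ħ D₂) = exp (-ħ (D₁ + D₂))` for commuting operators. -/
lemma hexp_hexp {D₁ D₂ : (ℕ → Z) → (ℕ → Z)} (h₁ : IsHL D₁) (h₂ : IsHL D₂)
    (h : ∀ F, D₁ (D₂ F) = D₂ (D₁ F)) (F : ℕ → Z) :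
    hexp D₁ (hexp D₂ F) = hexp (fun F => D₁ F + D₂ F) F := by
  have hc : Function.Commute D₁ D₂ := h
  have h1 : ∀ k, (fun F => D₁ F + D₂ F)^[k] F =
      ∑ p ∈ antidiagonal k, k.choose p.1 • D₁^[p.1] (D₂^[p.2] F) := fun k =>
    iterate_binomial (AddMonoidHom.mk' (fun F => D₁ F + D₂ F) (h₁.fadd h₂).add)
      (fun i j => D₁^[i] (D₂^[j] F)) (fun i j => by
        simp only [AddMonoidHom.mk'_apply, Function.iterate_succ_apply']
        congr 1
        exact ((hc.iterate_left i).symm (D₂^[j] F))) k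
  have h2 : ∀ i, D₁^[i] (hexp D₂ F) = hsum fun j => hcoef j • D₁^[i] (D₂^[j] F) := fun i => by
    rw [hexp, (h₁.iterate i).hsum]
    simp only [(h₁.iterate i).smul]
  have h3 : ∀ (c : ℂ) (G : ℕ → ℕ → Z), c • hsum G = hsum fun j => c • G j := fun c G => by
    funext n; simp [hsum, Finset.smul_sum]
  conv_lhs => rw [hexp]
  conv_rhs => rw [hexp]
  simp only [h2, h1, h3, smul_smul]
  rw [hexp_conv]

/-- Intertwiners carry exponentials to exponentials. -/
lemma IsHL.hexp {Φ : (ℕ → Z) → (ℕ → Z₁)} (hΦ : IsHL Φ) {D : (ℕ → Z) → (ℕ → Z)}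
    {D' : (ℕ → Z₁) → (ℕ → Z₁)} (F : ℕ → Z) (h : ∀ k, Φ (D (D^[k] F)) = D' (Φ (D^[k] F))) :
    Φ (hexp D F) = hexp D' (Φ F) := by
  have h1 : ∀ k, Φ (D^[k] F) = D'^[k] (Φ F) := by
    intro k
    induction k with
    | zero => rfl
    | succ k ih => rw [Function.iterate_succ_apply', Function.iterate_succ_apply', h, ih]
  rw [Deform.hexp, hΦ.hsum, Deform.hexp]
  simp only [hΦ.smul, h1]

lemma hexp_of_apply_eq_zero {D : (ℕ → Z) → (ℕ → Z)} (h0 : D 0 = 0) {F : ℕ → Z} (h : D F = 0) :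
    hexp D F = F := by
  have h1 : ∀ k, D^[k + 1] F = 0 := by
    intro k
    induction k with
    | zero => exact h
    | succ k ih => rw [Function.iterate_succ_apply', ih, h0]
  funext n
  rw [hexp, hsum]
  cases n with
  | zero => simp [hcoef]
  | succ n =>
    rw [Finset.Nat.sum_antidiagonal_succ, Finset.sum_eq_zero]
    · simp [hcoef]
    · intro p _
      rw [h1]; simp

lemma hexp_apply_zero (D : (ℕ → Z) → (ℕ → Z)) (F : ℕ → Z) : hexp D F 0 = F 0 := by
  simp [hexp, hsum, hcoef]

end HSum

section Scalars

variable {V W : Type*} [AddCommGroup V] [Module ℂ V] [AddCommGroup W] [Module ℂ W]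

lemma fsmul_cst (z : ℂ) (a : ℕ → W) : fsmul (cst z) a = z • a := by
  refine (fsmul_hl₂.right _).ext_cst
    ⟨fun a b => smul_add _ _ _, fun c a => smul_comm _ _ _, fun a => (hs_smul _ _).symm⟩
    (fun v => ?_) a
  funext n
  cases n with
  | zero => simp [fsmul]
  | succ n => simp [fsmul, Finset.Nat.sum_antidiagonal_succ]

lemma IsHL.fsmul {Φ : (ℕ → V) → (ℕ → W)} (hΦ : IsHL Φ) (c : ℕ → ℂ) (a : ℕ → V) :
    Φ (fsmul c a) = Deform.fsmul c (Φ a) := by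
  refine (hΦ.comp (fsmul_hl₂.left a)).ext_cst (fsmul_hl₂.left (Φ a)) (fun z => ?_) c
  simp only [fsmul_cst, hΦ.smul]

lemma fsmul_fone_right (c : ℕ → ℂ) : fsmul c fone = c := by
  have h : fone = cst (1 : ℂ) := rfl
  refine (fsmul_hl₂.left fone).ext_cst IsHL.id (fun z => ?_) c
  rw [fsmul_cst, h, ← cst_smul]
  simp

/-- A multiplicative `ℂ[[ħ]]`-linear map as a ring homomorphism. -/
def FAlg.hom {A : FAlg V} {B : FAlg W} (Φ : A.Elt → B.Elt) (hΦ : IsHL (V := V) (W := W) Φ)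
    (one : Φ 1 = 1) (mul : ∀ a b : A.Elt, Φ (a * b) = Φ a * Φ b) : A.Elt →+* B.Elt where
  toFun := Φ
  map_one' := one
  map_mul' := mul
  map_zero' := hΦ.zero
  map_add' := hΦ.add

end Scalars

namespace DeformationHopfAlgebra

variable {V : Type*} [AddCommGroup V] [Module ℂ V] (H : DeformationHopfAlgebra V)

/-! ### The rings `H`, `H ⊗ H`, `H ⊗ H ⊗ H` and their homomorphisms -/

/-- The algebra `H`. -/
def alg₁ : FAlg V := FAlg.ofPrd H.mul H.one H.mul_assoc H.one_mul H.mul_one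

/-- The algebra `H ⊗ H`. -/
def alg₂ : FAlg (V ⊗[ℂ] V) :=
  FAlg.ofPrd (tensMul H.mul H.mul) H.one₂ (tensMul_assoc _ _ H.mul_assoc H.mul_assoc)
    (tensMul_one_mul _ _ H.one_mul H.one_mul) (tensMul_mul_one _ _ H.mul_one H.mul_one)

/-- The algebra `H ⊗ H ⊗ H`. -/
def alg₃ : FAlg ((V ⊗[ℂ] V) ⊗[ℂ] V) :=
  FAlg.ofPrd (tensMul (tensMul H.mul H.mul) H.mul) (ften H.one₂ H.one)
    (tensMul_assoc _ _ H.alg₂.assoc H.mul_assoc)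
    (tensMul_one_mul _ _ H.alg₂.one_mul H.one_mul) (tensMul_mul_one _ _ H.alg₂.mul_one H.mul_one)

/-- The ring `H`. -/
abbrev A₁ : Type _ := H.alg₁.Elt
/-- The ring `H ⊗ H`. -/
abbrev A₂ : Type _ := H.alg₂.Elt
/-- The ring `H ⊗ H ⊗ H`. -/
abbrev A₃ : Type _ := H.alg₃.Elt

/-- The element `a ⊗ b` of `H ⊗ H`. -/
def t₂ (a b : H.A₁) : H.A₂ := ften a b
/-- The element `u ⊗ b` of `H ⊗ H ⊗ H`, for `u ∈ H ⊗ H`. -/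
def t₃ (u : H.A₂) (b : H.A₁) : H.A₃ := ften u b

lemma t₂_mul (a b c d : H.A₁) : H.t₂ a b * H.t₂ c d = H.t₂ (a * c) (b * d) :=
  prd_tensMul_ften _ _ _ _ _ _

lemma t₃_mul (u v : H.A₂) (b d : H.A₁) : H.t₃ u b * H.t₃ v d = H.t₃ (u * v) (b * d) :=
  prd_tensMul_ften _ _ _ _ _ _

lemma t₂_hl₂ : IsHL₂ (V := V) (V' := V) (W := V ⊗[ℂ] V) H.t₂ := ften_hl₂
lemma t₃_hl₂ : IsHL₂ (V := V ⊗[ℂ] V) (V' := V) (W := (V ⊗[ℂ] V) ⊗[ℂ] V) H.t₃ := ften_hl₂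

section Ext

variable {W : Type*} [AddCommGroup W] [Module ℂ W]

lemma ext_t₂ {B : FAlg W} {Φ Ψ : H.A₂ → B.Elt} (hΦ : IsHL (V := V ⊗[ℂ] V) (W := W) Φ)
    (hΨ : IsHL (V := V ⊗[ℂ] V) (W := W) Ψ) (h : ∀ a b, Φ (H.t₂ a b) = Ψ (H.t₂ a b)) (u : H.A₂) :
    Φ u = Ψ u := hΦ.ext_ften hΨ h u

/-- A `ℂ[[ħ]]`-linear map on `H ⊗ H` is multiplicative if it is so on the elements `a ⊗ b`. -/
lemma map_mul_of_t₂ {B : FAlg W} {Φ : H.A₂ → B.Elt} (hΦ : IsHL (V := V ⊗[ℂ] V) (W := W) Φ)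
    (h : ∀ a b c d, Φ (H.t₂ (a * c) (b * d)) = Φ (H.t₂ a b) * Φ (H.t₂ c d)) (u v : H.A₂) :
    Φ (u * v) = Φ u * Φ v := by
  refine H.ext_t₂ (Φ := fun u => Φ (u * v)) (Ψ := fun u => Φ u * Φ v)
    (hΦ.comp (H.alg₂.mulR v)) ((B.mulR _).comp hΦ) (fun a b => ?_) u
  refine H.ext_t₂ (Φ := fun v => Φ (H.t₂ a b * v)) (Ψ := fun v => Φ (H.t₂ a b) * Φ v)
    (hΦ.comp (H.alg₂.mulL _)) ((B.mulL _).comp hΦ) (fun c d => ?_) v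
  rw [t₂_mul, h]

end Ext

lemma leg1_hl : IsHL H.leg1 := ften_hl₂.left _
lemma leg2_hl : IsHL H.leg2 := ften_hl₂.right _
lemma leg12_hl : IsHL H.leg12 := ften_hl₂.left _
lemma leg23_hl : IsHL H.leg23 := (fmap_hl _).comp (ften_hl₂.right _)
lemma comulLeft_hl : IsHL H.comulLeft := FHom.app_hl _
lemma comulRight_hl : IsHL H.comulRight := (fmap_hl _).comp (FHom.app_hl _)
lemma counitLeft_hl : IsHL H.counitLeft := (fmap_hl _).comp (FHom.app_hl _)
lemma counitRight_hl : IsHL H.counitRight := (fmap_hl _).comp (FHom.app_hl _)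
lemma flip_hl : IsHL (flip : (ℕ → V ⊗[ℂ] V) → _) := fmap_hl _
lemma ε_hl : IsHL H.ε := FHom.app_hl _

/-- `Δ` as a ring homomorphism. -/
def Δh : H.A₁ →+* H.A₂ := FAlg.hom H.Δ H.comul.app_hl H.comul_one H.comul_mul

/-- `a ↦ a ⊗ 1`. -/
def l1 : H.A₁ →+* H.A₂ := FAlg.hom H.leg1 H.leg1_hl rfl fun a b => by
  have := H.t₂_mul a 1 b 1
  rw [_root_.mul_one] at this
  exact this.symm

/-- `a ↦ 1 ⊗ a`. -/
def l2 : H.A₁ →+* H.A₂ := FAlg.hom H.leg2 H.leg2_hl rfl fun a b => by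
  have := H.t₂_mul 1 a 1 b
  rw [_root_.mul_one] at this
  exact this.symm

/-- `u ↦ u ⊗ 1`. -/
def l12 : H.A₂ →+* H.A₃ := FAlg.hom H.leg12 H.leg12_hl rfl fun a b => by
  have := H.t₃_mul a b 1 1
  rw [_root_.mul_one] at this
  exact this.symm

/-- `a ↦ 1 ⊗ 1 ⊗ a`. -/
def l3 : H.A₁ →+* H.A₃ := FAlg.hom (fun a => H.t₃ 1 a) (ften_hl₂.right _) rfl fun a b => by
  have := H.t₃_mul 1 1 a b
  rw [_root_.mul_one] at this
  exact this.symm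

/-- The element `a ⊗ w` of `H ⊗ H ⊗ H`, for `w ∈ H ⊗ H`. -/
def t₃' (a : H.A₁) (w : H.A₂) : H.A₃ :=
  fmap (TensorProduct.assoc ℂ V V V).symm.toLinearMap (ften a w)

lemma t₃'_t₂ (a b c : H.A₁) : H.t₃' a (H.t₂ b c) = H.t₃ (H.t₂ a b) c := fmap_assoc_symm_ften _ _ _

lemma t₃'_hl₂ : IsHL₂ (V := V) (V' := V ⊗[ℂ] V) (W := (V ⊗[ℂ] V) ⊗[ℂ] V) H.t₃' :=
  ften_hl₂.comp (fmap_hl _)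

lemma t₃'_mul (a c : H.A₁) (u v : H.A₂) : H.t₃' a u * H.t₃' c v = H.t₃' (a * c) (u * v) := by
  refine H.ext_t₂ (Φ := fun u => H.t₃' a u * H.t₃' c v) (Ψ := fun u => H.t₃' (a * c) (u * v))
    ((H.alg₃.mulR _).comp (H.t₃'_hl₂.right a)) ((H.t₃'_hl₂.right _).comp (H.alg₂.mulR v))
    (fun b b' => ?_) u
  refine H.ext_t₂ (Φ := fun v => H.t₃' a (H.t₂ b b') * H.t₃' c v)
    (Ψ := fun v => H.t₃' (a * c) (H.t₂ b b' * v))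
    ((H.alg₃.mulL _).comp (H.t₃'_hl₂.right c)) ((H.t₃'_hl₂.right _).comp (H.alg₂.mulL _))
    (fun d d' => ?_) v
  simp only [t₃'_t₂, t₃_mul, t₂_mul]

lemma t₃'_one_one : H.t₃' 1 1 = 1 := H.t₃'_t₂ 1 1 1

/-- `u ↦ 1 ⊗ u`. -/
def l23 : H.A₂ →+* H.A₃ := FAlg.hom (H.t₃' 1) H.leg23_hl H.t₃'_one_one fun u v => by
  rw [t₃'_mul, _root_.mul_one]

lemma comulLeft_ften (a b : ℕ → V) : H.comulLeft (ften a b) = ften (H.Δ a) b := by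
  rw [comulLeft, FHom.tens_app_ften, fhom_one_app]; rfl

lemma comulRight_ften (a b : ℕ → V) : H.comulRight (ften a b) =
    fmap (TensorProduct.assoc ℂ V V V).symm.toLinearMap (ften a (H.Δ b)) := by
  rw [comulRight, FHom.tens_app_ften, fhom_one_app]; rfl

lemma counitLeft_ften (a b : ℕ → V) : H.counitLeft (ften a b) = fsmul (H.ε a) b := by
  rw [counitLeft, FHom.tens_app_ften, fhom_one_app, fmap_lid_ften]; rfl

lemma counitRight_ften (a b : ℕ → V) : H.counitRight (ften a b) = fsmul (H.ε b) a := by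
  rw [counitRight, FHom.tens_app_ften, fhom_one_app, fmap_rid_ften]; rfl

/-- `Δ ⊗ id`. -/
def cL : H.A₂ →+* H.A₃ :=
  have h : ∀ a b : H.A₁, (H.comulLeft (H.t₂ a b) : H.A₃) = H.t₃ (H.Δh a) b := H.comulLeft_ften
  FAlg.hom H.comulLeft H.comulLeft_hl ((h 1 1).trans (by rw [map_one]; rfl))
    (H.map_mul_of_t₂ H.comulLeft_hl fun a b c d => by rw [h, h, h, t₃_mul, map_mul])

/-- `id ⊗ Δ`. -/
def cR : H.A₂ →+* H.A₃ :=
  have h : ∀ a b : H.A₁, (H.comulRight (H.t₂ a b) : H.A₃) = H.t₃' a (H.Δh b) := H.comulRight_ften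
  FAlg.hom H.comulRight H.comulRight_hl ((h 1 1).trans (by rw [map_one, t₃'_one_one]))
    (H.map_mul_of_t₂ H.comulRight_hl fun a b c d => by rw [h, h, h, t₃'_mul, map_mul])

/-- The flip of the factors of `H ⊗ H`. -/
def fl : H.A₂ →+* H.A₂ :=
  have h : ∀ a b : H.A₁, (flip (H.t₂ a b) : H.A₂) = H.t₂ b a := fmap_comm_ften
  FAlg.hom flip flip_hl (h 1 1)
    (H.map_mul_of_t₂ flip_hl fun a b c d => by rw [h, h, h, t₂_mul])

/-- The element `c • a` of `H`, for `c ∈ ℂ[[ħ]]`. -/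
def sc (c : ℕ → ℂ) (a : H.A₁) : H.A₁ := fsmul c a

lemma sc_mul (c : ℕ → ℂ) (a b : H.A₁) : H.sc c a * b = H.sc c (a * b) :=
  (H.alg₁.hl.left b).fsmul c a

lemma mul_sc (c : ℕ → ℂ) (a b : H.A₁) : a * H.sc c b = H.sc c (a * b) :=
  (H.alg₁.hl.right a).fsmul c b

/-- The counit of `H`, as a function on the ring `H`. -/
def εh (a : H.A₁) : ℕ → ℂ := H.ε a

lemma sc_ε_mul (a b c : H.A₁) : H.sc (H.εh (a * b)) c = H.sc (H.εh a) (H.sc (H.εh b) c) := by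
  have h : H.εh (a * b) = fsmul (H.εh a) (H.εh b) := H.counit_mul a b
  rw [h]
  exact (fsmul_hl₂.left c).fsmul _ _

lemma sc_ε_one (c : H.A₁) : H.sc (H.εh 1) c = c := by
  have h : H.εh 1 = fone := H.counit_one
  rw [h]
  exact fsmul_fone _

/-- `ε ⊗ id`. -/
def eL : H.A₂ →+* H.A₁ :=
  have h : ∀ a b : H.A₁, (H.counitLeft (H.t₂ a b) : H.A₁) = H.sc (H.εh a) b := H.counitLeft_ften
  FAlg.hom H.counitLeft H.counitLeft_hl ((h 1 1).trans (H.sc_ε_one 1))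
    (H.map_mul_of_t₂ H.counitLeft_hl fun a b c d => by
      rw [h, h, h, sc_ε_mul, sc_mul, mul_sc])

/-- `id ⊗ ε`. -/
def eR : H.A₂ →+* H.A₁ :=
  have h : ∀ a b : H.A₁, (H.counitRight (H.t₂ a b) : H.A₁) = H.sc (H.εh b) a := H.counitRight_ften
  FAlg.hom H.counitRight H.counitRight_hl ((h 1 1).trans (H.sc_ε_one 1))
    (H.map_mul_of_t₂ H.counitRight_hl fun a b c d => by
      rw [h, h, h, sc_ε_mul, sc_mul, mul_sc])

section Relations

variable (a b : H.A₁) (u v : H.A₂)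

lemma l1_mul_l2 : H.l1 a * H.l2 b = H.t₂ a b := by
  have := H.t₂_mul a 1 1 b
  rwa [_root_.mul_one, _root_.one_mul] at this

lemma l2_mul_l1 : H.l2 b * H.l1 a = H.t₂ a b := by
  have := H.t₂_mul 1 b a 1
  rwa [_root_.mul_one, _root_.one_mul] at this

lemma l12_mul_l3 : H.l12 u * H.l3 b = H.t₃ u b := by
  have := H.t₃_mul u 1 1 b
  rwa [_root_.mul_one, _root_.one_mul] at this

lemma l3_mul_l12 : H.l3 b * H.l12 u = H.t₃ u b := by
  have := H.t₃_mul 1 u b 1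
  rwa [_root_.mul_one, _root_.one_mul] at this

lemma commute_l1_l2 : Commute (H.l1 a) (H.l2 b) := (H.l1_mul_l2 a b).trans (H.l2_mul_l1 a b).symm

lemma commute_l12_l3 : Commute (H.l12 u) (H.l3 b) :=
  (H.l12_mul_l3 b u).trans (H.l3_mul_l12 b u).symm

lemma cL_t₂ : H.cL (H.t₂ a b) = H.t₃ (H.Δh a) b := H.comulLeft_ften a b

lemma cL_l1 : H.cL (H.l1 a) = H.l12 (H.Δh a) := H.cL_t₂ a 1

lemma cL_l2 : H.cL (H.l2 a) = H.l3 a := by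
  have := H.cL_t₂ 1 a
  rw [map_one] at this
  exact this

lemma l23_t₂ : H.l23 (H.t₂ a b) = H.t₃ (H.t₂ 1 a) b := H.t₃'_t₂ 1 a b

lemma l23_l1 : H.l23 (H.l1 a) = H.l12 (H.l2 a) := H.l23_t₂ a 1

lemma l23_l2 : H.l23 (H.l2 a) = H.l3 a := H.l23_t₂ 1 a

lemma l23_eq : H.l23 u = H.t₃' 1 u := rfl

lemma l12_l1_eq : H.l12 (H.l1 a) = H.t₃' a 1 := (H.t₃'_t₂ a 1 1).symm

lemma cR_t₂ : H.cR (H.t₂ a b) = H.t₃' a (H.Δh b) := H.comulRight_ften a b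

lemma cR_l1 : H.cR (H.l1 a) = H.l12 (H.l1 a) := by
  have := H.cR_t₂ a 1
  rw [map_one] at this
  rw [l12_l1_eq]
  exact this

lemma cR_l2 : H.cR (H.l2 a) = H.l23 (H.Δh a) := H.cR_t₂ 1 a

lemma commute_l1_l23 : Commute (H.l12 (H.l1 a)) (H.l23 u) := by
  rw [l12_l1_eq, l23_eq, Commute, SemiconjBy, t₃'_mul, t₃'_mul]
  simp

lemma cL_Δ : H.cL (H.Δh a) = H.cR (H.Δh a) := by
  refine Eq.trans ?_ (congrArg (fmap (TensorProduct.assoc ℂ V V V).symm.toLinearMap)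
    (H.coassoc a))
  funext n
  exact ((TensorProduct.assoc ℂ V V V).symm_apply_apply _).symm

lemma fl_l1 : H.fl (H.l1 a) = H.l2 a := fmap_comm_ften _ _
lemma fl_l2 : H.fl (H.l2 a) = H.l1 a := fmap_comm_ften _ _

lemma eL_Δ : H.eL (H.Δh a) = a := H.counit_comul a
lemma eR_Δ : H.eR (H.Δh a) = a := H.comul_counit a

lemma eL_t₂ : H.eL (H.t₂ a b) = H.sc (H.εh a) b := H.counitLeft_ften a b
lemma eR_t₂ : H.eR (H.t₂ a b) = H.sc (H.εh b) a := H.counitRight_ften a b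
lemma eL_l1 : H.eL (H.l1 a) = H.sc (H.εh a) 1 := H.eL_t₂ a 1
lemma eL_l2 : H.eL (H.l2 a) = a := (H.eL_t₂ 1 a).trans (H.sc_ε_one a)
lemma eR_l1 : H.eR (H.l1 a) = a := (H.eR_t₂ a 1).trans (H.sc_ε_one a)
lemma eR_l2 : H.eR (H.l2 a) = H.sc (H.εh a) 1 := H.eR_t₂ 1 a

lemma l1_hl : IsHL (V := V) (W := V ⊗[ℂ] V) H.l1 := ften_hl₂.left _
lemma l2_hl : IsHL (V := V) (W := V ⊗[ℂ] V) H.l2 := ften_hl₂.right _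
lemma Δ_hl : IsHL (V := V) (W := V ⊗[ℂ] V) H.Δh := FHom.app_hl _
lemma l12_hl : IsHL (V := V ⊗[ℂ] V) (W := (V ⊗[ℂ] V) ⊗[ℂ] V) H.l12 := ften_hl₂.left _
lemma l3_hl : IsHL (V := V) (W := (V ⊗[ℂ] V) ⊗[ℂ] V) H.l3 := ften_hl₂.right _
lemma l23_hl : IsHL (V := V ⊗[ℂ] V) (W := (V ⊗[ℂ] V) ⊗[ℂ] V) H.l23 := H.leg23_hl
lemma cL_hl : IsHL (V := V ⊗[ℂ] V) (W := (V ⊗[ℂ] V) ⊗[ℂ] V) H.cL := H.comulLeft_hl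
lemma cR_hl : IsHL (V := V ⊗[ℂ] V) (W := (V ⊗[ℂ] V) ⊗[ℂ] V) H.cR := H.comulRight_hl
lemma fl_hl : IsHL (V := V ⊗[ℂ] V) (W := V ⊗[ℂ] V) H.fl := flip_hl
lemma eL_hl : IsHL (V := V ⊗[ℂ] V) (W := V) H.eL := H.counitLeft_hl
lemma eR_hl : IsHL (V := V ⊗[ℂ] V) (W := V) H.eR := H.counitRight_hl

/-- A primitive element has counit zero. -/
lemma ε_eq_zero (h : H.Δh a = H.l1 a + H.l2 a) : H.εh a = 0 := by
  have h1 := congrArg H.eL h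
  rw [map_add, eL_Δ, eL_l1, eL_l2] at h1
  have h2 : H.sc (H.εh a) 1 = 0 := by simpa using h1.symm
  have h4 : H.εh (H.sc (H.εh a) 1) = fsmul (H.εh a) (H.εh 1) := H.ε_hl.fsmul _ _
  have h5 : H.εh 1 = fone := H.counit_one
  rw [h5, fsmul_fone_right] at h4
  rw [← h4, h2]
  exact H.ε_hl.zero

end Relations

end DeformationHopfAlgebra

/-! ### Series in vector spaces without topology -/

section WeakSum

variable {V W Z : Type*} [AddCommGroup V] [Module ℂ V] [AddCommGroup W] [Module ℂ W]
  [AddCommGroup Z] [Module ℂ Z]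

lemma eq_of_dual {v w : W} (h : ∀ ψ : W →ₗ[ℂ] ℂ, ψ v = ψ w) : v = w := by
  rw [← sub_eq_zero, ← Module.forall_dual_apply_eq_zero_iff ℂ]
  intro ψ
  rw [map_sub, h, sub_self]

/-- The terms of the series `∑ u k` lie in a finite-dimensional space, in which the series is
absolutely convergent with sum `w`. -/
def HasFSum (u : ℕ → W) (w : W) : Prop :=
  ∃ (I : Type) (_ : Fintype I) (v : I → W) (c : I → ℕ → ℂ), (∀ i, Summable fun k => ‖c i k‖) ∧
    (∀ k, u k = ∑ i, c i k • v i) ∧ w = ∑ i, (∑' k, c i k) • v i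

namespace HasFSum

lemma hasSum {u : ℕ → W} {w : W} (h : HasFSum u w) (ψ : W →ₗ[ℂ] ℂ) :
    HasSum (fun k => ψ (u k)) (ψ w) := by
  obtain ⟨I, _, v, c, hc, hu, rfl⟩ := h
  simp only [hu, map_sum, map_smul, smul_eq_mul]
  exact hasSum_sum fun i _ => (hc i).of_norm.hasSum.mul_right _

lemma unique {u : ℕ → W} {w w' : W} (h : HasFSum u w) (h' : HasFSum u w') : w = w' :=
  eq_of_dual fun ψ => (h.hasSum ψ).unique (h'.hasSum ψ)

lemma wsum_eq {u : ℕ → W} {w : W} (h : HasFSum u w) : wsum u = w := by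
  have h1 : ∃ w : W, ∀ ψ : W →ₗ[ℂ] ℂ, HasSum (fun k => ψ (u k)) (ψ w) := ⟨w, h.hasSum⟩
  rw [wsum, dif_pos h1]
  exact eq_of_dual fun ψ => (h1.choose_spec ψ).unique (h.hasSum ψ)

lemma map (φ : W →ₗ[ℂ] Z) {u : ℕ → W} {w : W} (h : HasFSum u w) :
    HasFSum (fun k => φ (u k)) (φ w) := by
  obtain ⟨I, _, v, c, hc, hu, rfl⟩ := h
  exact ⟨I, inferInstance, fun i => φ (v i), c, hc, fun k => by simp [hu], by simp⟩

lemma zero : HasFSum (fun _ => (0 : W)) 0 :=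
  ⟨Empty, inferInstance, fun _ => 0, fun _ _ => 0, by simp, by simp, by simp⟩

lemma add {u u' : ℕ → W} {w w' : W} (h : HasFSum u w) (h' : HasFSum u' w') :
    HasFSum (fun k => u k + u' k) (w + w') := by
  obtain ⟨I, _, v, c, hc, hu, rfl⟩ := h
  obtain ⟨I', _, v', c', hc', hu', rfl⟩ := h'
  refine ⟨I ⊕ I', inferInstance, Sum.elim v v', Sum.elim c c', ?_, fun k => ?_, ?_⟩
  · rintro (i | i)
    · exact hc i
    · exact hc' i
  · simp [hu, hu']
  · simp

lemma sum {ι : Type*} (s : Finset ι) {u : ι → ℕ → W} {w : ι → W}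
    (h : ∀ i ∈ s, HasFSum (u i) (w i)) : HasFSum (fun k => ∑ i ∈ s, u i k) (∑ i ∈ s, w i) := by
  classical
  induction s using Finset.induction_on with
  | empty => simpa using zero
  | insert i s hi ih =>
    simp only [Finset.sum_insert hi]
    exact (h i (by simp)).add (ih fun j hj => h j (by simp [hj]))

/-- The Cauchy product. -/
lemma bilin (b : V →ₗ[ℂ] W →ₗ[ℂ] Z) {u : ℕ → V} {u' : ℕ → W} {w : V} {w' : W}
    (h : HasFSum u w) (h' : HasFSum u' w') :
    HasFSum (fun k => ∑ p ∈ antidiagonal k, b (u p.1) (u' p.2)) (b w w') := by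
  obtain ⟨I, _, v, c, hc, hu, rfl⟩ := h
  obtain ⟨I', _, v', c', hc', hu', rfl⟩ := h'
  refine ⟨I × I', inferInstance, fun i => b (v i.1) (v' i.2),
    fun i k => ∑ p ∈ antidiagonal k, c i.1 p.1 * c' i.2 p.2, fun i => ?_, fun k => ?_, ?_⟩
  · exact summable_norm_sum_mul_antidiagonal_of_summable_norm (hc i.1) (hc' i.2)
  · have h1 : ∀ p : ℕ × ℕ, b (u p.1) (u' p.2) =
        ∑ i, ∑ j, (c i p.1 * c' j p.2) • b (v i) (v' j) := fun p => by
      simp only [hu, hu', map_sum, map_smul, LinearMap.sum_apply, LinearMap.smul_apply,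
        Finset.smul_sum, mul_smul]
      rw [Finset.sum_comm]
      exact Finset.sum_congr rfl fun i _ => Finset.sum_congr rfl fun j _ => smul_comm _ _ _
    simp only [h1, Fintype.sum_prod_type, Finset.sum_smul]
    rw [Finset.sum_comm]
    exact Finset.sum_congr rfl fun i _ => Finset.sum_comm
  · simp only [map_sum, map_smul, LinearMap.sum_apply, LinearMap.smul_apply, Finset.smul_sum,
      Fintype.sum_prod_type]
    rw [Finset.sum_comm]
    refine Finset.sum_congr rfl fun i _ => Finset.sum_congr rfl fun j _ => ?_
    rw [← tsum_mul_tsum_eq_tsum_sum_antidiagonal_of_summable_norm (hc i) (hc' j), smul_smul,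
      mul_comm]

end HasFSum

/-- Coefficientwise convergence of a series in `W[[ħ]]`. -/
def HasHSum (u : ℕ → ℕ → W) (w : ℕ → W) : Prop := ∀ n, HasFSum (fun k => u k n) (w n)

/-- A coefficient of a `ℂ[[ħ]]`-linear map, as a linear map. -/
def IsHL.coef {Φ : (ℕ → V) → (ℕ → W)} (hΦ : IsHL Φ) (n : ℕ) : V →ₗ[ℂ] W where
  toFun v := Φ (cst v) n
  map_add' v w := by rw [cst_add, hΦ.add]; rfl
  map_smul' c v := by rw [cst_smul, hΦ.smul]; rfl

lemma IsHL.apply_eq_coef {Φ : (ℕ → V) → (ℕ → W)} (hΦ : IsHL Φ) (a : ℕ → V) (n : ℕ) :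
    Φ a n = ∑ p ∈ antidiagonal n, hΦ.coef p.2 (a p.1) := hΦ.apply_eq a n

/-- A coefficient of a `ℂ[[ħ]]`-bilinear map, as a bilinear map. -/
def IsHL₂.coef {B : (ℕ → V) → (ℕ → W) → (ℕ → Z)} (hB : IsHL₂ B) (n : ℕ) : V →ₗ[ℂ] W →ₗ[ℂ] Z :=
  LinearMap.mk₂ ℂ (fun v w => B (cst v) (cst w) n)
    (fun v v' w => by rw [cst_add, (hB.left _).add]; rfl)
    (fun c v w => by rw [cst_smul, (hB.left _).smul]; rfl)
    (fun v w w' => by rw [cst_add, (hB.right _).add]; rfl)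
    (fun c v w => by rw [cst_smul, (hB.right _).smul]; rfl)

lemma IsHL₂.apply_eq {B : (ℕ → V) → (ℕ → W) → (ℕ → Z)} (hB : IsHL₂ B) (a : ℕ → V) (b : ℕ → W)
    (n : ℕ) : B a b n =
      ∑ p ∈ antidiagonal n, ∑ q ∈ antidiagonal p.2, hB.coef q.2 (a p.1) (b q.1) := by
  rw [(hB.left b).apply_eq a]
  refine Finset.sum_congr rfl fun p _ => ?_
  rw [(hB.right (cst (a p.1))).apply_eq b]
  rfl

namespace HasHSum

lemma unique {u : ℕ → ℕ → W} {w w' : ℕ → W} (h : HasHSum u w) (h' : HasHSum u w') : w = w' :=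
  funext fun n => (h n).unique (h' n)

lemma map {Φ : (ℕ → V) → (ℕ → W)} (hΦ : IsHL Φ) {u : ℕ → ℕ → V} {w : ℕ → V} (h : HasHSum u w) :
    HasHSum (fun k => Φ (u k)) (Φ w) := by
  intro n
  simp only [hΦ.apply_eq_coef]
  exact HasFSum.sum _ fun p _ => (h p.1).map _

lemma add {u u' : ℕ → ℕ → W} {w w' : ℕ → W} (h : HasHSum u w) (h' : HasHSum u' w') :
    HasHSum (fun k => u k + u' k) (w + w') := fun n => (h n).add (h' n)

lemma bilin {B : (ℕ → V) → (ℕ → W) → (ℕ → Z)} (hB : IsHL₂ B) {u : ℕ → ℕ → V} {w : ℕ → V}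
    {u' : ℕ → ℕ → W} {w' : ℕ → W} (h : HasHSum u w) (h' : HasHSum u' w') :
    HasHSum (fun k => ∑ p ∈ antidiagonal k, B (u p.1) (u' p.2)) (B w w') := by
  intro n
  have h1 : (fun k => (∑ p ∈ antidiagonal k, B (u p.1) (u' p.2)) n) = fun k =>
      ∑ p ∈ antidiagonal n, ∑ q ∈ antidiagonal p.2, ∑ r ∈ antidiagonal k,
        hB.coef q.2 (u r.1 p.1) (u' r.2 q.1) := by
    funext k
    simp only [Finset.sum_apply, hB.apply_eq]
    rw [Finset.sum_comm]
    exact Finset.sum_congr rfl fun p _ => by rw [Finset.sum_comm]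
  rw [h1, hB.apply_eq]
  exact HasFSum.sum _ fun p _ => HasFSum.sum _ fun q _ => (h p.1).bilin (hB.coef q.2) (h' q.1)

end HasHSum

end WeakSum

/-! ### Derivatives tested on linear functionals -/

section WeakDeriv

variable {W W₁ W₂ : Type*} [AddCommGroup W] [Module ℂ W] [AddCommGroup W₁] [Module ℂ W₁]
  [AddCommGroup W₂] [Module ℂ W₂]

lemma linearIndependent_of_seq {v : ℕ → W}
    (h : ∀ k, v k ∉ Submodule.span ℂ (v '' {j | j < k})) : LinearIndependent ℂ v := by
  rw [linearIndependent_iff']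
  intro s
  induction s using Finset.induction_on_max with
  | empty => simp
  | insert a s has ih =>
    intro g hg
    rw [Finset.sum_insert (fun ha => lt_irrefl _ (has a ha))] at hg
    have hga : g a = 0 := by
      by_contra hne
      apply h a
      have h1 : v a = -(g a)⁻¹ • ∑ i ∈ s, g i • v i := by
        rw [← eq_neg_iff_add_eq_zero] at hg
        rw [neg_smul, ← smul_neg, ← hg, smul_smul, inv_mul_cancel₀ hne, one_smul]
      rw [h1]
      exact Submodule.smul_mem _ _ (Submodule.sum_mem _ fun i hi =>
        Submodule.smul_mem _ _ (Submodule.subset_span ⟨i, has i hi, rfl⟩))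
    rw [hga, zero_smul, zero_add] at hg
    intro i hi
    rcases Finset.mem_insert.1 hi with rfl | hi
    · exact hga
    · exact ih g hg i hi

/-- A function which is continuous at a point when tested on linear functionals takes values in a
finite-dimensional space near this point: otherwise it has linearly independent values along a
sequence tending to the point, and a linear functional can take the value `k` on the `k`-th one. -/
lemma exists_finiteDimensional_of_continuousAt {X : Type*} [TopologicalSpace X]
    [FirstCountableTopology X] {f : X → W} {t : X}
    (h : ∀ ψ : W →ₗ[ℂ] ℂ, ContinuousAt (fun s => ψ (f s)) t) :
    ∃ M : Submodule ℂ W, FiniteDimensional ℂ M ∧ M ≤ Submodule.span ℂ (Set.range f) ∧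
      ∀ᶠ s in 𝓝 t, f s ∈ M := by
  classical
  by_contra! hno
  obtain ⟨N, hN⟩ := (𝓝 t).exists_antitone_basis
  have hstep : ∀ (S : Finset X) (k : ℕ), ∃ s ∈ N k, f s ∉ Submodule.span ℂ (f '' S) := by
    intro S k
    have h1 := hno (Submodule.span ℂ (f '' S))
      (FiniteDimensional.span_of_finite ℂ (S.finite_toSet.image f))
      (Submodule.span_mono (Set.image_subset_range _ _))
    obtain ⟨s, hs1, hs2⟩ := (h1.and_eventually (hN.mem k)).exists
    exact ⟨s, hs2, hs1⟩
  choose g hg1 hg2 using hstep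
  let S : ℕ → Finset X := fun k => Nat.rec ∅ (fun k S => insert (g S k) S) k
  have hS : ∀ k, S (k + 1) = insert (g (S k) k) (S k) := fun k => rfl
  let s : ℕ → X := fun k => g (S k) k
  have hmem : ∀ k j, j < k → s j ∈ S k := by
    intro k
    induction k with
    | zero => intro j hj; omega
    | succ k ih =>
      intro j hj
      rw [hS, Finset.mem_insert]
      rcases Nat.lt_succ_iff_lt_or_eq.1 hj with h1 | rfl
      · exact Or.inr (ih j h1)
      · exact Or.inl rfl
  have hli : LinearIndependent ℂ fun k => f (s k) := by
    refine linearIndependent_of_seq fun k hk => hg2 (S k) k ?_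
    refine Submodule.span_mono ?_ hk
    rintro _ ⟨j, hj, rfl⟩
    exact ⟨s j, hmem k j hj, rfl⟩
  obtain ⟨ψ, hψ⟩ := LinearMap.exists_extend
    ((Module.Basis.span hli).constr ℂ fun k : ℕ => (k : ℂ))
  have hval : ∀ k, ψ (f (s k)) = k := by
    intro k
    have h1 := LinearMap.congr_fun hψ (Module.Basis.span hli k)
    rw [Module.Basis.constr_basis, LinearMap.comp_apply, Submodule.subtype_apply,
      Module.Basis.span_apply] at h1
    exact h1
  have ht : Tendsto s atTop (𝓝 t) := hN.tendsto fun k => hg1 (S k) k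
  have h2 : Tendsto (fun k : ℕ => (k : ℂ)) atTop (𝓝 (ψ (f t))) := by
    have := (h ψ).tendsto.comp ht
    refine this.congr fun k => hval k
  have h3 := h2.norm
  simp only [Complex.norm_natCast] at h3
  exact not_tendsto_nhds_of_tendsto_atTop tendsto_natCast_atTop_atTop _ h3

/-- Values in a finite-dimensional space, written out in a basis whose coordinates are linear
functionals on the whole space. -/
lemma exists_coord (M : Submodule ℂ W) [FiniteDimensional ℂ M] :
    ∃ (I : Type) (_ : Fintype I) (v : I → W) (φ : I → W →ₗ[ℂ] ℂ), (∀ i, v i ∈ M) ∧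
      ∀ w ∈ M, w = ∑ i, φ i w • v i := by
  obtain ⟨p, hp⟩ := LinearMap.exists_extend (LinearMap.id : M →ₗ[ℂ] M)
  let b := Module.finBasis ℂ M
  refine ⟨_, inferInstance, fun i => (b i : W), fun i => (b.coord i) ∘ₗ p, fun i => (b i).2, ?_⟩
  intro w hw
  have h1 : p w = ⟨w, hw⟩ := LinearMap.congr_fun hp ⟨w, hw⟩
  have h2 := congrArg (fun x : M => (x : W)) (b.sum_repr ⟨w, hw⟩)
  simp only [LinearMap.comp_apply, h1, Module.Basis.coord_apply]
  simp only [Submodule.coe_sum, Submodule.coe_smul] at h2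
  exact h2.symm

variable {𝕜 : Type*} [NontriviallyNormedField 𝕜] [NormedAlgebra 𝕜 ℂ]

namespace HasWDeriv

variable {f : 𝕜 → W} {D : W} {t : 𝕜}

lemma unique {D' : W} (h : HasWDeriv 𝕜 f D t) (h' : HasWDeriv 𝕜 f D' t) : D = D' :=
  eq_of_dual fun ψ => (h ψ).unique (h' ψ)

lemma wderiv_eq (h : HasWDeriv 𝕜 f D t) : wderiv 𝕜 f t = D := by
  have h1 : ∃ D : W, HasWDeriv 𝕜 f D t := ⟨D, h⟩
  rw [wderiv, dif_pos h1]
  exact h1.choose_spec.unique h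

lemma congr {g : 𝕜 → W} (h : HasWDeriv 𝕜 f D t) (hfg : g =ᶠ[𝓝 t] f) : HasWDeriv 𝕜 g D t :=
  fun ψ => (h ψ).congr_of_eventuallyEq (hfg.mono fun s hs => by simp only [hs])

lemma const (w : W) (t : 𝕜) : HasWDeriv 𝕜 (fun _ => w) 0 t := fun ψ => by
  simpa using hasDerivAt_const t (ψ w)

lemma map (φ : W →ₗ[ℂ] W₁) (h : HasWDeriv 𝕜 f D t) : HasWDeriv 𝕜 (fun s => φ (f s)) (φ D) t :=
  fun ψ => h (ψ ∘ₗ φ)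

lemma add {g : 𝕜 → W} {D' : W} (h : HasWDeriv 𝕜 f D t) (h' : HasWDeriv 𝕜 g D' t) :
    HasWDeriv 𝕜 (fun s => f s + g s) (D + D') t := fun ψ => by
  simpa only [map_add] using (h ψ).fun_add (h' ψ)

lemma sum {ι : Type*} (s : Finset ι) {f : ι → 𝕜 → W} {D : ι → W}
    (h : ∀ i ∈ s, HasWDeriv 𝕜 (f i) (D i) t) :
    HasWDeriv 𝕜 (fun r => ∑ i ∈ s, f i r) (∑ i ∈ s, D i) t := fun ψ => by
  simpa only [map_sum] using HasDerivAt.fun_sum fun i hi => h i hi ψ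

lemma smul {c : 𝕜 → ℂ} {c' : ℂ} (hc : HasDerivAt c c' t) (h : HasWDeriv 𝕜 f D t) :
    HasWDeriv 𝕜 (fun s => c s • f s) (c' • f t + c t • D) t := fun ψ => by
  simpa only [map_add, map_smul, smul_eq_mul] using hc.fun_mul (h ψ)

lemma mem {M : Submodule ℂ W} (h : HasWDeriv 𝕜 f D t) (hM : ∀ᶠ s in 𝓝 t, f s ∈ M) : D ∈ M := by
  by_contra hD
  obtain ⟨ψ, hψ, hle⟩ := Submodule.exists_le_ker_of_notMem hD
  refine hψ ?_
  have h1 : HasDerivAt (fun s => ψ (f s)) 0 t :=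
    (hasDerivAt_const t (0 : ℂ)).congr_of_eventuallyEq
      (hM.mono fun s hs => LinearMap.mem_ker.1 (hle hs))
  exact (h ψ).unique h1

/-- A differentiable function is locally a finite sum of scalar functions times constant
vectors. -/
lemma exists_sum (h : HasWDeriv 𝕜 f D t) :
    ∃ (I : Type) (_ : Fintype I) (v : I → W) (c : I → 𝕜 → ℂ) (c' : I → ℂ),
      (∀ i, HasDerivAt (c i) (c' i) t) ∧ (∀ᶠ s in 𝓝 t, f s = ∑ i, c i s • v i) ∧
      D = ∑ i, c' i • v i := by
  obtain ⟨M, hM, -, hf⟩ := exists_finiteDimensional_of_continuousAt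
    (f := f) (t := t) fun ψ => (h ψ).continuousAt
  obtain ⟨I, _, v, φ, -, hφ⟩ := exists_coord M
  exact ⟨I, inferInstance, v, fun i s => φ i (f s), fun i => φ i D, fun i => h (φ i),
    hf.mono fun s hs => hφ _ hs, hφ _ (h.mem hf)⟩

/-- The product rule. -/
lemma bilin (b : W →ₗ[ℂ] W₁ →ₗ[ℂ] W₂) {g : 𝕜 → W₁} {D' : W₁} (h : HasWDeriv 𝕜 f D t)
    (h' : HasWDeriv 𝕜 g D' t) :
    HasWDeriv 𝕜 (fun s => b (f s) (g s)) (b D (g t) + b (f t) D') t := by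
  obtain ⟨I, _, v, c, c', hc, hf, rfl⟩ := h.exists_sum
  have h1 : HasWDeriv 𝕜 (fun s => ∑ i, c i s • b (v i) (g s))
      (∑ i, (c' i • b (v i) (g t) + c i t • b (v i) D')) t :=
    HasWDeriv.sum _ fun i _ => HasWDeriv.smul (hc i) (h'.map (b (v i)))
  have h2 : ∑ i, (c' i • b (v i) (g t) + c i t • b (v i) D') =
      b (∑ i, c' i • v i) (g t) + b (f t) D' := by
    rw [hf.self_of_nhds]
    simp [Finset.sum_add_distrib]
  rw [← h2]
  refine h1.congr (hf.mono fun s hs => ?_)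
  simp [hs]

lemma exists_of_differentiableAt
    (h : ∀ ψ : W →ₗ[ℂ] ℂ, DifferentiableAt 𝕜 (fun s => ψ (f s)) t) :
    ∃ D, HasWDeriv 𝕜 f D t := by
  obtain ⟨M, hM, -, hf⟩ := exists_finiteDimensional_of_continuousAt
    (f := f) (t := t) fun ψ => (h ψ).continuousAt
  obtain ⟨I, _, v, φ, -, hφ⟩ := exists_coord M
  refine ⟨∑ i, deriv (fun s => φ i (f s)) t • v i, ?_⟩
  have h1 : HasWDeriv 𝕜 (fun s => ∑ i, φ i (f s) • v i)
      (∑ i, (deriv (fun s => φ i (f s)) t • v i + φ i (f t) • (0 : W))) t :=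
    HasWDeriv.sum _ fun i _ => HasWDeriv.smul (h (φ i)).hasDerivAt (HasWDeriv.const (v i) t)
  simp only [smul_zero, add_zero] at h1
  exact h1.congr (hf.mono fun s hs => hφ _ hs)

end HasWDeriv

/-- A `W[[ħ]]`-valued function has the derivative `D` at `t`. -/
def HasHDeriv (𝕜 : Type*) [NontriviallyNormedField 𝕜] [NormedAlgebra 𝕜 ℂ] (f : 𝕜 → ℕ → W)
    (D : ℕ → W) (t : 𝕜) : Prop := ∀ n, HasWDeriv 𝕜 (fun s => f s n) (D n) t

namespace HasHDeriv

variable {f : 𝕜 → ℕ → W} {D : ℕ → W} {t : 𝕜}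

lemma unique {D' : ℕ → W} (h : HasHDeriv 𝕜 f D t) (h' : HasHDeriv 𝕜 f D' t) : D = D' :=
  funext fun n => (h n).unique (h' n)

lemma congr {g : 𝕜 → ℕ → W} (h : HasHDeriv 𝕜 f D t) (hfg : g =ᶠ[𝓝 t] f) : HasHDeriv 𝕜 g D t :=
  fun n => (h n).congr (hfg.mono fun s hs => by simp only [hs])

lemma const (w : ℕ → W) (t : 𝕜) : HasHDeriv 𝕜 (fun _ => w) 0 t := fun _ => HasWDeriv.const _ t

lemma add {g : 𝕜 → ℕ → W} {D' : ℕ → W} (h : HasHDeriv 𝕜 f D t) (h' : HasHDeriv 𝕜 g D' t) :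
    HasHDeriv 𝕜 (fun s => f s + g s) (D + D') t := fun n => (h n).add (h' n)

lemma map {Φ : (ℕ → W) → (ℕ → W₁)} (hΦ : IsHL Φ) (h : HasHDeriv 𝕜 f D t) :
    HasHDeriv 𝕜 (fun s => Φ (f s)) (Φ D) t := by
  intro n
  simp only [hΦ.apply_eq_coef]
  exact HasWDeriv.sum _ fun p _ => (h p.1).map _

lemma bilin {B : (ℕ → W) → (ℕ → W₁) → (ℕ → W₂)} (hB : IsHL₂ B) {g : 𝕜 → ℕ → W₁}
    {D' : ℕ → W₁} (h : HasHDeriv 𝕜 f D t) (h' : HasHDeriv 𝕜 g D' t) :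
    HasHDeriv 𝕜 (fun s => B (f s) (g s)) (B D (g t) + B (f t) D') t := by
  intro n
  have h1 : (B D (g t) + B (f t) D') n = ∑ p ∈ antidiagonal n, ∑ q ∈ antidiagonal p.2,
      (hB.coef q.2 (D p.1) (g t q.1) + hB.coef q.2 (f t p.1) (D' q.1)) := by
    simp only [Pi.add_apply, hB.apply_eq, Finset.sum_add_distrib]
  rw [h1]
  simp only [hB.apply_eq]
  exact HasWDeriv.sum _ fun p _ => HasWDeriv.sum _ fun q _ => (h p.1).bilin _ (h' q.1)

/-- The product rule for the application of a family of `ℂ[[ħ]]`-linear maps. -/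
lemma app {Φ : 𝕜 → (ℕ → W) → (ℕ → W₁)} (hΦ : ∀ s, IsHL (Φ s)) {Φ' : (ℕ → W) → (ℕ → W₁)}
    (hΦ' : IsHL Φ') (hd : ∀ v, HasHDeriv 𝕜 (fun s => Φ s v) (Φ' v) t) (h : HasHDeriv 𝕜 f D t) :
    HasHDeriv 𝕜 (fun s => Φ s (f s)) (Φ' (f t) + Φ t D) t := by
  intro n
  have h1 : (Φ' (f t) + Φ t D) n = ∑ p ∈ antidiagonal n,
      (hΦ'.coef p.2 (f t p.1) + (hΦ t).coef p.2 (D p.1)) := by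
    simp only [Pi.add_apply, hΦ'.apply_eq_coef, (hΦ t).apply_eq_coef, Finset.sum_add_distrib]
  have h2 : (fun s => Φ s (f s) n) = fun s => ∑ p ∈ antidiagonal n, (hΦ s).coef p.2 (f s p.1) :=
    funext fun s => (hΦ s).apply_eq_coef _ _
  rw [h1, h2]
  refine HasWDeriv.sum _ fun p _ => ?_
  obtain ⟨I, _, v, c, c', hc, hf, hD⟩ := (h p.1).exists_sum
  have h3 : HasWDeriv 𝕜 (fun s => ∑ i, c i s • (hΦ s).coef p.2 (v i))
      (∑ i, (c' i • (hΦ t).coef p.2 (v i) + c i t • hΦ'.coef p.2 (v i))) t :=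
    HasWDeriv.sum _ fun i _ => HasWDeriv.smul (hc i) (hd (cst (v i)) p.2)
  have h4 : ∑ i, (c' i • (hΦ t).coef p.2 (v i) + c i t • hΦ'.coef p.2 (v i)) =
      hΦ'.coef p.2 (f t p.1) + (hΦ t).coef p.2 (D p.1) := by
    rw [hf.self_of_nhds, hD]
    simp [Finset.sum_add_distrib, add_comm]
  rw [← h4]
  refine h3.congr (hf.mono fun s hs => ?_)
  simp only [hs, map_sum, map_smul]

end HasHDeriv

end WeakDeriv

/-! ### Exponential-type series in a Banach algebra -/

section Banach

variable {B : Type*} [NormedRing B] [NormedAlgebra ℂ B] [CompleteSpace B]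

/-- The sum of the power series `∑ k, c k • A ^ k`. -/
def pser (c : ℕ → ℂ) (A : B) : B := ∑' k, c k • A ^ k

/-- The coefficients of `exp`. -/
def expC (k : ℕ) : ℂ := (k.factorial : ℂ)⁻¹

/-- The coefficients of `(exp t - 1) / t`. -/
def dexpC (k : ℕ) : ℂ := ((k + 1).factorial : ℂ)⁻¹

/-- The coefficients are bounded by those of the exponential series. -/
def IsExpType (c : ℕ → ℂ) : Prop := ∀ k, ‖c k‖ ≤ (k.factorial : ℝ)⁻¹

lemma isExpType_expC : IsExpType expC := fun k => by simp [expC]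

lemma isExpType_dexpC : IsExpType dexpC := fun k => by
  rw [dexpC, norm_inv, Complex.norm_natCast]
  gcongr
  omega

lemma IsExpType.summable {c : ℕ → ℂ} (hc : IsExpType c) {u : ℕ → B} {r C : ℝ}
    (hu : ∀ k, ‖u k‖ ≤ C * r ^ k) : Summable fun k => ‖c k • u k‖ := by
  have h1 : Summable fun k : ℕ => C * (r ^ k / (k.factorial : ℝ)) :=
    (Real.summable_pow_div_factorial r).mul_left C
  refine h1.of_nonneg_of_le (fun k => norm_nonneg _) fun k => ?_
  rw [norm_smul]
  calc ‖c k‖ * ‖u k‖ ≤ (k.factorial : ℝ)⁻¹ * (C * r ^ k) :=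
        mul_le_mul (hc k) (hu k) (norm_nonneg _) (by positivity)
    _ = C * (r ^ k / (k.factorial : ℝ)) := by rw [div_eq_inv_mul]; ring

lemma norm_pow_mul_le (A b : B) (k : ℕ) : ‖A ^ k * b‖ ≤ ‖A‖ ^ k * ‖b‖ := by
  induction k with
  | zero => simp
  | succ k ih =>
    rw [pow_succ', mul_assoc, pow_succ', mul_assoc]
    exact (norm_mul_le _ _).trans (mul_le_mul_of_nonneg_left ih (norm_nonneg _))

lemma norm_mul_pow_le (A b : B) (k : ℕ) : ‖b * A ^ k‖ ≤ ‖b‖ * ‖A‖ ^ k := by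
  induction k with
  | zero => simp
  | succ k ih =>
    rw [pow_succ, ← mul_assoc, pow_succ, ← mul_assoc]
    exact (norm_mul_le _ _).trans (mul_le_mul_of_nonneg_right ih (norm_nonneg _))

lemma IsExpType.summable_pow {c : ℕ → ℂ} (hc : IsExpType c) (A : B) :
    Summable fun k => ‖c k • A ^ k‖ :=
  hc.summable (C := ‖(1 : B)‖) (r := ‖A‖) fun k => by
    simpa [mul_comm] using norm_pow_mul_le A 1 k

lemma hasSum_pser {c : ℕ → ℂ} (hc : IsExpType c) (A : B) :
    HasSum (fun k => c k • A ^ k) (pser c A) := (hc.summable_pow A).of_norm.hasSum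

/-- The derivative of `A ^ k` in the direction `A'`. -/
def powD (A A' : B) (k : ℕ) : B := ∑ i ∈ Finset.range k, A ^ (k.pred - i) * A' * A ^ i

lemma norm_powD_le (A A' : B) (k : ℕ) : ‖powD A A' k‖ ≤ k * ‖A‖ ^ (k - 1) * ‖A'‖ := by
  have h1 : ∀ i ∈ Finset.range k, ‖A ^ (k.pred - i) * A' * A ^ i‖ ≤ ‖A‖ ^ (k - 1) * ‖A'‖ := by
    intro i hi
    have hi' := Finset.mem_range.1 hi
    calc ‖A ^ (k.pred - i) * A' * A ^ i‖ ≤ ‖A ^ (k.pred - i) * A'‖ * ‖A‖ ^ i :=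
          norm_mul_pow_le _ _ _
      _ ≤ (‖A‖ ^ (k.pred - i) * ‖A'‖) * ‖A‖ ^ i := by
          gcongr
          exact norm_pow_mul_le _ _ _
      _ = ‖A‖ ^ (k - 1) * ‖A'‖ := by
          have : k - 1 = (k.pred - i) + i := by simp only [Nat.pred_eq_sub_one]; omega
          rw [this, pow_add]; ring
  calc ‖powD A A' k‖ ≤ ∑ i ∈ Finset.range k, ‖A‖ ^ (k - 1) * ‖A'‖ :=
        (norm_sum_le _ _).trans (Finset.sum_le_sum h1)
    _ = _ := by simp [mul_assoc]

/-- The derivative of the `k`-th power as a continuous linear map. -/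
def powDL (A : B) (k : ℕ) : B →L[ℂ] B :=
  ∑ i ∈ Finset.range k, MulOpposite.op (A ^ i) • A ^ (k.pred - i) • ContinuousLinearMap.id ℂ B

lemma powDL_apply (A A' : B) (k : ℕ) : powDL A k A' = powD A A' k := by
  simp only [powDL, powD, sum_apply]
  refine Finset.sum_congr rfl fun i _ => ?_
  simp [mul_assoc]

lemma summable_powD {r : ℝ} :
    Summable fun k : ℕ => (k.factorial : ℝ)⁻¹ * (k * r ^ (k - 1)) := by
  refine (summable_nat_add_iff 1).1 ?_
  refine (Real.summable_pow_div_factorial r).congr fun k => ?_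
  have h1 : ((k + 1).factorial : ℝ) = (k + 1) * k.factorial := by
    push_cast [Nat.factorial_succ]; ring
  rw [h1]
  have h2 : (k.factorial : ℝ) ≠ 0 := by exact_mod_cast k.factorial_ne_zero
  have h3 : (k : ℝ) + 1 ≠ 0 := by positivity
  push_cast
  field_simp

lemma hasFDerivAt_pser {c : ℕ → ℂ} (hc : IsExpType c) (A : B) :
    HasFDerivAt (pser c) (∑' k, c k • powDL A k) A ∧ Summable fun k => c k • powDL A k := by
  set R := ‖A‖ + 1
  have hR : ∀ X ∈ Metric.ball (0 : B) R, ∀ k, ‖c k • powDL X k‖ ≤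
      (k.factorial : ℝ)⁻¹ * (k * R ^ (k - 1)) := by
    intro X hX k
    rw [norm_smul]
    refine mul_le_mul (hc k) ?_ (norm_nonneg _) (by positivity)
    refine ContinuousLinearMap.opNorm_le_bound _ (by positivity) fun A' => ?_
    rw [powDL_apply]
    refine (norm_powD_le X A' k).trans ?_
    have : ‖X‖ ≤ R := (mem_ball_zero_iff.1 hX).le
    gcongr
  have hA : A ∈ Metric.ball (0 : B) R := by simp [R]
  have hf : ∀ (k : ℕ) (X : B), X ∈ Metric.ball (0 : B) R →
      HasFDerivAt (fun X => c k • X ^ k) (c k • powDL X k) X := fun k X _ =>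
    (hasFDerivAt_pow' k).const_smul (c k)
  exact ⟨hasFDerivAt_tsum_of_isPreconnected summable_powD Metric.isOpen_ball
    (convex_ball (0 : B) R).isPreconnected hf (fun k X hX => hR X hX k) hA
    (hc.summable_pow A).of_norm hA,
    Summable.of_norm_bounded summable_powD fun k => hR A hA k⟩

variable {𝕜 : Type*} [NontriviallyNormedField 𝕜] [NormedAlgebra 𝕜 ℂ] [NormedSpace 𝕜 B]
  [IsScalarTower 𝕜 ℂ B]

lemma exists_hasDerivAt_pser {c : ℕ → ℂ} (hc : IsExpType c) {A : 𝕜 → B} {A' : B} {t : 𝕜}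
    (h : HasDerivAt A A' t) :
    ∃ S, HasDerivAt (fun s => pser c (A s)) S t ∧ HasSum (fun k => c k • powD (A t) A' k) S := by
  obtain ⟨h1, h2⟩ := hasFDerivAt_pser hc (A t)
  refine ⟨(∑' k, c k • powDL (A t) k) A', ?_, ?_⟩
  · exact (h1.restrictScalars 𝕜).comp_hasDerivAt t h
  · have h3 := h2.hasSum.mapL (ContinuousLinearMap.apply ℂ B A')
    simpa [powDL_apply] using h3

/-- The commutator with `A` in an algebra. -/
def adB (A X : B) : B := A * X - X * A

lemma norm_adB_iterate_le (A X : B) (k : ℕ) : ‖(adB A)^[k] X‖ ≤ ‖X‖ * (2 * ‖A‖) ^ k := by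
  induction k with
  | zero => simp
  | succ k ih =>
    rw [Function.iterate_succ_apply', adB]
    set Y := (adB A)^[k] X
    calc ‖A * Y - Y * A‖ ≤ ‖A * Y‖ + ‖Y * A‖ := norm_sub_le _ _
      _ ≤ ‖A‖ * ‖Y‖ + ‖Y‖ * ‖A‖ := add_le_add (norm_mul_le _ _) (norm_mul_le _ _)
      _ = 2 * ‖A‖ * ‖Y‖ := by ring
      _ ≤ 2 * ‖A‖ * (‖X‖ * (2 * ‖A‖) ^ k) := by gcongr
      _ = _ := by ring

lemma summable_adB {c : ℕ → ℂ} (hc : IsExpType c) (A X : B) :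
    Summable fun k => ‖c k • (adB A)^[k] X‖ :=
  hc.summable fun k => norm_adB_iterate_le A X k

/-- The value at `A` of the power series `∑ k, c k • (ad A) ^ k` of operators, applied to `X`. -/
def adSer (c : ℕ → ℂ) (A X : B) : B := ∑' k, c k • (adB A)^[k] X

lemma hasSum_adSer {c : ℕ → ℂ} (hc : IsExpType c) (A X : B) :
    HasSum (fun k => c k • (adB A)^[k] X) (adSer c A X) := (summable_adB hc A X).of_norm.hasSum

lemma expC_mul_choose (i j : ℕ) : expC (i + j) * ((i + j).choose i : ℂ) = expC i * expC j := by
  have h := hcoef_mul i j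
  have h1 : ∀ k, hcoef k = (-1) ^ k * expC k := fun k => by rw [hcoef, expC, div_eq_mul_inv]
  rw [h1, h1, h1, pow_add] at h
  have h2 : ((-1 : ℂ) ^ i * (-1) ^ j) ≠ 0 := by simp
  exact mul_left_cancel₀ h2 (by linear_combination h)

/-- `exp (ad A) X = exp A * X * exp (-A)`. -/
lemma adSer_expC (A X : B) : adSer expC A X = pser expC A * X * pser expC (-A) := by
  have h1 : ∀ k, (adB A)^[k] X =
      ∑ p ∈ antidiagonal k, k.choose p.1 • (A ^ p.1 * X * (-A) ^ p.2) := by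
    intro k
    have := iterate_binomial (AddMonoidHom.mk' (adB A) fun a b => by simp only [adB]; noncomm_ring)
      (fun i j => A ^ i * X * (-A) ^ j) (fun i j => by
        simp only [AddMonoidHom.mk'_apply, adB, pow_succ' A, pow_succ (-A)]
        noncomm_ring) k
    simpa using this
  have h2 : Summable fun k => ‖expC k • A ^ k * X‖ := by
    refine ((isExpType_expC.summable_pow A).mul_right ‖X‖).of_nonneg_of_le
      (fun _ => norm_nonneg _) fun k => norm_mul_le _ _
  have h3 := tsum_mul_tsum_eq_tsum_sum_antidiagonal_of_summable_norm h2
    (isExpType_expC.summable_pow (-A))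
  rw [Summable.tsum_mul_right] at h3
  · rw [pser, pser, h3, adSer]
    congr 1
    funext k
    rw [h1, Finset.smul_sum]
    refine Finset.sum_congr rfl fun p hp => ?_
    have hp' := Finset.HasAntidiagonal.mem_antidiagonal.1 hp
    rw [← Nat.cast_smul_eq_nsmul ℂ, smul_smul, ← hp', expC_mul_choose]
    simp only [smul_mul_assoc, mul_smul_comm, smul_smul]
    rw [mul_comm]
  · exact (isExpType_expC.summable_pow A).of_norm

lemma pser_expC_mul_neg (A : B) : pser expC A * pser expC (-A) = 1 := by
  have h1 := adSer_expC A 1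
  rw [mul_one] at h1
  rw [← h1]
  refine (hasSum_adSer isExpType_expC A 1).unique ?_
  have h2 : ∀ k ≠ 0, expC k • (adB A)^[k] (1 : B) = 0 := by
    intro k hk
    obtain ⟨k, rfl⟩ := Nat.exists_eq_succ_of_ne_zero hk
    have h3 : ∀ k, (adB A)^[k + 1] (1 : B) = 0 := by
      intro k
      induction k with
      | zero => simp [adB]
      | succ k ih => rw [Function.iterate_succ_apply', ih]; simp [adB]
    rw [h3, smul_zero]
  simpa [expC] using hasSum_single 0 h2

lemma pser_expC_zero : pser expC (0 : B) = 1 := by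
  have := pser_expC_mul_neg (0 : B)
  refine (hasSum_pser isExpType_expC (0 : B)).unique ?_
  have h2 : ∀ k ≠ 0, expC k • (0 : B) ^ k = 0 := fun k hk => by simp [hk]
  simpa [expC] using hasSum_single 0 h2

/-- The derivative of `A ^ k`, expanded in `(ad A) ^ i (A') * A ^ j`. -/
lemma powD_eq (A A' : B) (g : ℕ → ℕ → B) (h0 : ∀ j, g 0 j = 0)
    (hg : ∀ i j, g (i + 1) j = (adB A)^[i] A' * A ^ j) (k : ℕ) :
    powD A A' k = ∑ p ∈ antidiagonal k, k.choose p.1 • g p.1 p.2 := by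
  induction k with
  | zero => simp [powD, h0]
  | succ k ih =>
    have h1 : powD A A' (k + 1) = A * powD A A' k + A' * A ^ k := by
      rw [powD, Finset.sum_range_succ, powD, Finset.mul_sum]
      congr 1
      · refine Finset.sum_congr rfl fun i hi => ?_
        have := Finset.mem_range.1 hi
        have h2 : (k + 1).pred - i = (k.pred - i) + 1 := by
          simp only [Nat.pred_eq_sub_one]; omega
        rw [h2, pow_succ']
        simp only [mul_assoc]
      · simp
    have h2 : ∀ p : ℕ × ℕ, A * g p.1 p.2 =
        g (p.1 + 1) p.2 + g p.1 (p.2 + 1) - if p.1 = 0 then A' * A ^ p.2 else 0 := by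
      rintro ⟨i, j⟩
      cases i with
      | zero => simp [h0, hg]
      | succ i =>
        simp only [hg, Function.iterate_succ_apply', adB, pow_succ', Nat.add_eq_zero_iff,
          one_ne_zero, and_false, if_false]
        noncomm_ring
    have h3 : ∑ p ∈ antidiagonal k, k.choose p.1 • (if p.1 = 0 then A' * A ^ p.2 else 0) =
        A' * A ^ k := by
      rw [Finset.sum_eq_single (0, k)]
      · simp
      · rintro ⟨i, j⟩ hp hne
        have hp' := Finset.HasAntidiagonal.mem_antidiagonal.1 hp
        have : i ≠ 0 := by rintro rfl; apply hne; simp_all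
        simp [this]
      · simp
    rw [h1, ih, Finset.mul_sum, Finset.sum_antidiagonal_choose_succ_nsmul]
    simp only [mul_smul_comm, h2, smul_sub, smul_add, Finset.sum_sub_distrib,
      Finset.sum_add_distrib, h3]
    rw [sub_add_cancel, add_comm]
    congr 1
    refine Finset.sum_congr rfl fun p hp => ?_
    rw [Nat.choose_symm_of_eq_add (Finset.HasAntidiagonal.mem_antidiagonal.1 hp).symm]

lemma powD_succ (A A' : B) (k : ℕ) : powD A A' (k + 1) =
    ∑ p ∈ antidiagonal k, (k + 1).choose (p.1 + 1) • ((adB A)^[p.1] A' * A ^ p.2) := by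
  rw [powD_eq A A' (fun i j => Nat.casesOn i 0 fun i => (adB A)^[i] A' * A ^ j) (fun _ => rfl)
    (fun _ _ => rfl), Finset.Nat.sum_antidiagonal_succ]
  simp

/-- The derivative of the exponential in a noncommutative algebra. -/
lemma hasDerivAt_exp {A : 𝕜 → B} {A' : B} {t : 𝕜} (h : HasDerivAt A A' t) :
    HasDerivAt (fun s => pser expC (A s)) (adSer dexpC (A t) A' * pser expC (A t)) t := by
  obtain ⟨S, h1, h2⟩ := exists_hasDerivAt_pser isExpType_expC h
  suffices S = adSer dexpC (A t) A' * pser expC (A t) from this ▸ h1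
  have h3 := tsum_mul_tsum_eq_tsum_sum_antidiagonal_of_summable_norm
    (summable_adB isExpType_dexpC (A t) A') (isExpType_expC.summable_pow (A t))
  rw [adSer, pser, h3, ← h2.tsum_eq, h2.summable.tsum_eq_zero_add]
  simp only [powD, Finset.range_zero, Finset.sum_empty, smul_zero, zero_add]
  congr 1
  funext k
  change expC (k + 1) • powD (A t) A' (k + 1) = _
  rw [powD_succ, Finset.smul_sum]
  refine Finset.sum_congr rfl fun p hp => ?_
  have hp' := Finset.HasAntidiagonal.mem_antidiagonal.1 hp
  have h4 : expC (k + 1) * ((k + 1).choose (p.1 + 1) : ℂ) = dexpC p.1 * expC p.2 := by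
    have := expC_mul_choose (p.1 + 1) p.2
    rw [show p.1 + 1 + p.2 = k + 1 by omega] at this
    exact this
  rw [← Nat.cast_smul_eq_nsmul ℂ, smul_smul, h4]
  simp only [smul_mul_assoc, mul_smul_comm, smul_smul]
  rw [mul_comm]

end Banach

/-! ### Locally finite actions and their finite-dimensional models -/

section Model

variable {V W : Type*} [AddCommGroup V] [Module ℂ V] [AddCommGroup W] [Module ℂ W]

/-- Truncation modulo `ħ ^ (N + 1)`. -/
def trunc (N : ℕ) : (ℕ → W) →ₗ[ℂ] (ℕ → W) where
  toFun a n := if n ≤ N then a n else 0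
  map_add' a b := by funext n; by_cases h : n ≤ N <;> simp [h]
  map_smul' c a := by funext n; by_cases h : n ≤ N <;> simp [h]

lemma trunc_apply {N n : ℕ} (h : n ≤ N) (a : ℕ → W) : trunc N a n = a n := if_pos h

lemma trunc_eq {N : ℕ} {a b : ℕ → W} (h : ∀ m ≤ N, a m = b m) : trunc N a = trunc N b := by
  funext n
  by_cases hn : n ≤ N
  · rw [trunc_apply hn, trunc_apply hn, h n hn]
  · exact (if_neg hn).trans (if_neg hn).symm

lemma trunc_eq_sum (N : ℕ) (a : ℕ → W) :
    trunc N a = ∑ m ∈ Finset.range (N + 1), LinearMap.single ℂ (fun _ : ℕ => W) m (a m) := by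
  funext n
  rw [Finset.sum_apply]
  by_cases hn : n ≤ N
  · rw [trunc_apply hn, Finset.sum_eq_single n]
    · simp
    · intro m _ hm; simp [Pi.single_eq_of_ne' hm]
    · intro h; simp at h; omega
  · rw [Finset.sum_eq_zero]
    · exact if_neg hn
    · intro m hm
      have : m ≠ n := by have := Finset.mem_range.1 hm; omega
      simp [Pi.single_eq_of_ne' this]

/-- The action `T` of the elements of `P` on `W` (modulo `ħ`) is locally finite. -/
def IsLocFin (P : Set V) (d : V → W → W) : Prop :=
  ∀ w, ∃ M : Submodule ℂ W, M.FG ∧ w ∈ M ∧ ∀ X ∈ P, ∀ u ∈ M, d X u ∈ M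

lemma IsLocFin.exists_ge {P : Set V} {d : V → W → W} (h : IsLocFin P d)
    (hd : ∀ X, ∀ u v, d X (u + v) = d X u + d X v) {S : Submodule ℂ W} (hS : S.FG) :
    ∃ M : Submodule ℂ W, M.FG ∧ S ≤ M ∧ ∀ X ∈ P, ∀ u ∈ M, d X u ∈ M := by
  obtain ⟨s, rfl⟩ := hS
  choose M h1 h2 h3 using h
  refine ⟨⨆ w ∈ s, M w, Submodule.fg_biSup _ _ fun w _ => h1 w, Submodule.span_le.2 fun w hw =>
    (le_iSup₂_of_le w hw le_rfl : M w ≤ _) (h2 w), fun X hX u hu => ?_⟩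
  let D : W →+ W := AddMonoidHom.mk' (d X) (hd X)
  induction hu using Submodule.iSup_induction' with
  | mem w u hu =>
    by_cases hw : w ∈ s
    · simp only [hw, iSup_pos] at hu
      exact (le_iSup₂_of_le w hw le_rfl : M w ≤ _) (h3 w X hX u hu)
    · simp only [hw, iSup_neg, not_false_eq_true, Submodule.mem_bot] at hu
      rw [hu, show d X 0 = 0 from D.map_zero]
      exact Submodule.zero_mem _
  | zero => rw [show d X 0 = 0 from D.map_zero]; exact Submodule.zero_mem _
  | add u v _ _ hu hv => rw [hd]; exact Submodule.add_mem _ hu hv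

/-- The linear map `a ↦ (a - a(0)) / ħ`. -/
def tailL : (ℕ → W) →ₗ[ℂ] (ℕ → W) where
  toFun a n := a (n + 1)
  map_add' _ _ := rfl
  map_smul' _ _ := rfl

/-- Multiplication by `ħ ^ i`. -/
def hsL (i : ℕ) : (ℕ → W) →ₗ[ℂ] (ℕ → W) :=
  ({ toFun := hs, map_add' := hs_add, map_smul' := hs_smul } : (ℕ → W) →ₗ[ℂ] (ℕ → W)) ^ i

lemma hsL_succ (i : ℕ) (a : ℕ → W) : hsL (i + 1) a = hsL i (hs a) := by
  rw [hsL, pow_succ]; rfl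

lemma hsL_succ' (i : ℕ) (a : ℕ → W) : hsL (i + 1) a = hs (hsL i a) := by
  rw [hsL, pow_succ']; rfl

lemma hsL_apply_of_lt {i m : ℕ} (h : m < i) (a : ℕ → W) : hsL i a m = 0 := by
  induction i generalizing m with
  | zero => omega
  | succ i ih =>
    rw [hsL_succ']
    cases m with
    | zero => rfl
    | succ m => exact ih (by omega)

/-- The constant series as a linear map. -/
def cstL : W →ₗ[ℂ] (ℕ → W) where
  toFun := cst
  map_add' := cst_add
  map_smul' := cst_smul

lemma eq_cstL_add (a : ℕ → W) : a = cstL (a 0) + hs (tailL a) := eq_cst_add_hs a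

lemma IsHL.hsL {V' : Type*} [AddCommGroup V'] [Module ℂ V'] {Φ : (ℕ → V') → (ℕ → W)}
    (hΦ : IsHL Φ) (i : ℕ) (a : ℕ → V') : Φ (Deform.hsL i a) = Deform.hsL i (Φ a) := by
  induction i with
  | zero => rfl
  | succ i ih => rw [hsL_succ', hsL_succ', hΦ.hs, ih]

/-- A bilinear map over `ℂ[[ħ]]` as a bilinear map over `ℂ`. -/
def IsHL₂.lin {Z : Type*} [AddCommGroup Z] [Module ℂ Z] {B : (ℕ → V) → (ℕ → W) → (ℕ → Z)}
    (hB : IsHL₂ B) : (ℕ → V) →ₗ[ℂ] (ℕ → W) →ₗ[ℂ] (ℕ → Z) :=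
  LinearMap.mk₂ ℂ B (fun _ _ b => (hB.left b).add _ _) (fun _ _ b => (hB.left b).smul _ _)
    (fun a _ _ => (hB.right a).add _ _) (fun _ a _ => (hB.right a).smul _ _)

/-- If `T` acts locally finitely modulo `ħ`, it does so modulo `ħ ^ (N + 1)`: the submodule `M` is
built from the coefficients of `ħ ^ i, …, ħ ^ N`.  The coefficients of order `i` are enlarged to a
finite-dimensional submodule invariant modulo `ħ`; what `L` produces from it in higher orders is
still finite-dimensional and is added to the generators of order `i + 1`. -/
lemma exists_invariant {T : (ℕ → V) → (ℕ → W) → (ℕ → W)} (hT : IsHL₂ T) {P : Set V}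
    (hlf : IsLocFin P fun X u => T (cst X) (cst u) 0) {L : Submodule ℂ (ℕ → V)} (hL : L.FG)
    (hLP : ∀ y ∈ L, y 0 ∈ P) (N r : ℕ) : ∀ i, N + 1 ≤ i + r → ∀ S : Submodule ℂ (ℕ → W), S.FG →
    ∃ M : Submodule ℂ (ℕ → W), M.FG ∧ (∀ s ∈ S, hsL i s ∈ M) ∧
      ∀ y ∈ L, ∀ u ∈ M, ∃ u' ∈ M, ∀ m ≤ N, T y u m = u' m := by
  induction r with
  | zero =>
    intro i hi S hS
    refine ⟨S.map (hsL i), hS.map _, fun s hs => Submodule.mem_map_of_mem hs, ?_⟩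
    rintro y - _ ⟨s, -, rfl⟩
    refine ⟨0, Submodule.zero_mem _, fun m hm => ?_⟩
    rw [(hT.right y).hsL, hsL_apply_of_lt (by omega)]
    rfl
  | succ r ih =>
    intro i hi S hS
    obtain ⟨M₀, h1, h2, h3⟩ := hlf.exists_ge
      (fun X u v => by rw [cst_add, (hT.right _).add]; rfl) (hS.map (LinearMap.proj 0))
    obtain ⟨M', h1', h2', h3'⟩ := ih (i + 1) (by omega)
      (S.map tailL ⊔ (Submodule.map₂ hT.lin L (M₀.map cstL)).map tailL)
      ((hS.map _).sup ((hL.map₂ _ (h1.map _)).map _))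
    refine ⟨M₀.map (hsL i ∘ₗ cstL) ⊔ M', (h1.map _).sup h1', fun s hs => ?_, fun y hy u hu => ?_⟩
    · rw [eq_cstL_add s, map_add, ← hsL_succ]
      exact Submodule.add_mem_sup ⟨s 0, h2 ⟨s, hs, rfl⟩, rfl⟩
        (h2' _ (Submodule.mem_sup_left ⟨s, hs, rfl⟩))
    · obtain ⟨_, ⟨u₀, hu₀, rfl⟩, u', hu', rfl⟩ := Submodule.mem_sup.1 hu
      obtain ⟨u'', hu'', h4⟩ := h3' y hy u' hu'
      refine ⟨T y (hsL i (cstL u₀)) + u'', Submodule.add_mem _ ?_ (Submodule.mem_sup_right hu''),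
        fun m hm => ?_⟩
      · rw [(hT.right y).hsL, eq_cstL_add (T y (cstL u₀)), map_add, ← hsL_succ]
        refine Submodule.add_mem_sup ⟨T y (cstL u₀) 0, ?_, rfl⟩
          (h2' _ (Submodule.mem_sup_right ⟨_, Submodule.apply_mem_map₂ _ hy ⟨u₀, hu₀, rfl⟩, rfl⟩))
        have h5 : T y (cstL u₀) 0 = T (cst (y 0)) (cst u₀) 0 :=
          (hT.left (cst u₀)).congr fun m hm => by
            obtain rfl : m = 0 := by omega
            rfl
        rw [h5]
        exact h3 _ (hLP y hy) _ hu₀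
      · rw [(hT.right y).add]
        exact congrArg (fun z => T y (hsL i (cstL u₀)) m + z) (h4 m hm)

/-- Modulo `ħ ^ (N + 1)`, a vector `v` lies in a finite-dimensional subspace on which the
finite-dimensional space `L` acts through matrices depending linearly on `y ∈ L`. -/
lemma exists_model {T : (ℕ → V) → (ℕ → W) → (ℕ → W)} (hT : IsHL₂ T) {P : Set V}
    (hlf : IsLocFin P fun X u => T (cst X) (cst u) 0) {L : Submodule ℂ (ℕ → V)} (hL : L.FG)
    (hLP : ∀ y ∈ L, y 0 ∈ P) (N : ℕ) (v : ℕ → W) :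
    ∃ (d : ℕ) (ι : (Fin d → ℂ) →ₗ[ℂ] (ℕ → W))
      (A : (ℕ → V) →ₗ[ℂ] ((Fin d → ℂ) →L[ℂ] (Fin d → ℂ))),
      (∀ y ∈ L, ∀ e, ∀ m ≤ N, T y (ι e) m = ι (A y e) m) ∧ ∃ e, ∀ m ≤ N, v m = ι e m := by
  obtain ⟨M₁, h1, h2, h3⟩ := exists_invariant hT hlf hL hLP N (N + 1) 0 (by omega)
    (Submodule.span ℂ {v}) (Submodule.fg_span_singleton v)
  have hfg : (M₁.map (trunc N)).FG := h1.map _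
  set M := M₁.map (trunc N) with hM
  have : FiniteDimensional ℂ M := Module.Finite.iff_fg.2 hfg
  have hinv : ∀ y ∈ L, ∀ u ∈ M, trunc N (T y u) ∈ M := by
    rintro y hy _ ⟨u, hu, rfl⟩
    obtain ⟨u', hu', h⟩ := h3 y hy u hu
    refine ⟨u', hu', trunc_eq fun m hm => ?_⟩
    rw [← h m hm]
    exact (hT.right y).congr fun k hk => (trunc_apply (hk.trans hm) u).symm
  obtain ⟨p, hp⟩ := LinearMap.exists_extend (LinearMap.id : M →ₗ[ℂ] M)
  have hp' : ∀ u (hu : u ∈ M), p u = ⟨u, hu⟩ := fun u hu => LinearMap.congr_fun hp ⟨u, hu⟩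
  let b := (Module.finBasis ℂ M).equivFun
  let A : (ℕ → V) →ₗ[ℂ] ((Fin (Module.finrank ℂ M) → ℂ) →L[ℂ] (Fin (Module.finrank ℂ M) → ℂ)) :=
    (LinearMap.toContinuousLinearMap.toLinearMap) ∘ₗ
      (LinearMap.lcomp ℂ _ (M.subtype ∘ₗ b.symm.toLinearMap)) ∘ₗ
      (LinearMap.compRight ℂ (b.toLinearMap ∘ₗ p ∘ₗ trunc N)) ∘ₗ hT.lin
  have hA : ∀ y e, A y e = b (p (trunc N (T y (b.symm e)))) := fun y e => rfl
  refine ⟨_, M.subtype ∘ₗ b.symm.toLinearMap, A, fun y hy e m hm => ?_, b ⟨trunc N v,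
    Submodule.mem_map_of_mem (h2 v (Submodule.mem_span_singleton_self v))⟩, fun m hm => ?_⟩
  · rw [hA, hp' _ (hinv y hy _ (b.symm e).2)]
    simp [trunc_apply hm]
  · simp [trunc_apply hm]

end Model

section Convergence

variable {V W : Type*} [AddCommGroup V] [Module ℂ V] [AddCommGroup W] [Module ℂ W]

lemma hasFSum_of_summable {d : ℕ} (φ : (Fin d → ℂ) →ₗ[ℂ] W) {u : ℕ → Fin d → ℂ}
    (hu : Summable fun k => ‖u k‖) : HasFSum (fun k => φ (u k)) (φ (∑' k, u k)) := by
  have h : ∀ e, φ e = ∑ i, e i • φ (Pi.single i 1) := fun e => by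
    conv_lhs => rw [pi_eq_sum_univ' e]
    rw [map_sum]
    exact Finset.sum_congr rfl fun i _ => map_smul _ _ _
  refine ⟨Fin d, inferInstance, fun i => φ (Pi.single i 1), fun i k => u k i, fun i => ?_,
    fun k => h _, ?_⟩
  · exact hu.of_nonneg_of_le (fun _ => norm_nonneg _) fun k => norm_le_pi_norm (u k) i
  · rw [h]
    refine Finset.sum_congr rfl fun i _ => ?_
    rw [tsum_apply hu.of_norm]

/-- The value of an operator series in a finite-dimensional model. -/
lemma hasFSum_model {d N : ℕ} {T : (ℕ → W) → (ℕ → W)} (hT : IsHL T)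
    {ι : (Fin d → ℂ) →ₗ[ℂ] (ℕ → W)} {A : (Fin d → ℂ) →L[ℂ] (Fin d → ℂ)}
    (hA : ∀ e, ∀ m ≤ N, T (ι e) m = ι (A e) m) {v : ℕ → W} {e : Fin d → ℂ}
    (hv : ∀ m ≤ N, v m = ι e m) {c : ℕ → ℂ} (hc : IsExpType c) {m : ℕ} (hm : m ≤ N) :
    HasFSum (fun k => (c k • T^[k] v) m) (ι (pser c A e) m) := by
  have h1 : ∀ k, ∀ m ≤ N, T^[k] v m = ι ((A ^ k) e) m := by
    intro k
    induction k with
    | zero => simpa using hv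
    | succ k ih =>
      intro m hm
      rw [Function.iterate_succ_apply', pow_succ']
      exact (hT.congr fun i hi => ih i (hi.trans hm)).trans (hA _ m hm)
  have h2 := hasFSum_of_summable (LinearMap.proj m ∘ₗ ι) (u := fun k => (c k • A ^ k) e)
    (((hc.summable_pow A).mul_right ‖e‖).of_nonneg_of_le (fun _ => norm_nonneg _)
      fun k => ContinuousLinearMap.le_opNorm _ _)
  have h3 : ∑' k, (c k • A ^ k) e = pser c A e := by
    have := (hasSum_pser hc A).mapL (ContinuousLinearMap.apply ℂ (Fin d → ℂ) e)
    exact this.tsum_eq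
  rw [h3] at h2
  refine (iff_of_eq (congrArg₂ _ (funext fun k => ?_) rfl)).1 h2
  simp [h1 k m hm]

end Convergence

/-- A linear map to a finite-dimensional normed space turns derivatives tested on functionals into
derivatives. -/
lemma HasWDeriv.hasDerivAt {W B 𝕜 : Type*} [AddCommGroup W] [Module ℂ W] [NormedAddCommGroup B]
    [NormedSpace ℂ B] [FiniteDimensional ℂ B] [NontriviallyNormedField 𝕜] [NormedAlgebra 𝕜 ℂ]
    [NormedSpace 𝕜 B] [IsScalarTower 𝕜 ℂ B] {f : 𝕜 → W} {D : W} {t : 𝕜}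
    (h : HasWDeriv 𝕜 f D t) (A : W →ₗ[ℂ] B) : HasDerivAt (fun s => A (f s)) (A D) t := by
  let b := Module.finBasis ℂ B
  have h1 : ∀ w, A w = ∑ i, (b.coord i ∘ₗ A) w • b i := fun w => by
    conv_lhs => rw [← b.sum_repr (A w)]
    rfl
  rw [h1 D, show (fun s => A (f s)) = _ from funext fun s => h1 (f s)]
  exact HasDerivAt.fun_sum fun i _ => (h (b.coord i ∘ₗ A)).smul_const (b i)

namespace DeformationHopfAlgebra

variable {V : Type*} [AddCommGroup V] [Module ℂ V] (H : DeformationHopfAlgebra V)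
variable {W W₁ W₂ : Type*} [AddCommGroup W] [Module ℂ W] [AddCommGroup W₁] [Module ℂ W₁]
  [AddCommGroup W₂] [Module ℂ W₂]

/-! ### Representations of the group `H~ˣ` -/

lemma ad_hl₂ : IsHL₂ H.ad := (prd_hl₂ H.mul).fsub (prd_hl₂ H.mul).flip

/-- An action of the Lie algebra `H` on `W[[ħ]]` which, modulo `ħ`, is locally finite on `𝔤`. -/
structure IsRep (T : (ℕ → V) → (ℕ → W) → (ℕ → W)) : Prop where
  hl : IsHL₂ T
  lie : ∀ y z v, T (H.ad y z) v = T y (T z v) - T z (T y v)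
  lf : IsLocFin H.prim₀ fun X u => T (cst X) (cst u) 0

/-- The primitive elements of `H₀` form a subspace. -/
def primS : Submodule ℂ V where
  carrier := H.prim₀
  add_mem' {a b} ha hb := by
    simp only [prim₀, Set.mem_ofPred_eq] at *
    rw [map_add, ha, hb, TensorProduct.add_tmul, TensorProduct.tmul_add]
    abel
  zero_mem' := by simp [prim₀]
  smul_mem' c a ha := by
    simp only [prim₀, Set.mem_ofPred_eq] at *
    rw [map_smul, ha, smul_add, TensorProduct.smul_tmul', TensorProduct.tmul_smul]

/-- The additive inverse in `𝔩`. -/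
def negL (y : H.Lie) : H.Lie := ⟨-y.1, H.primS.neg_mem y.2⟩

namespace IsRep

variable {H} {T : (ℕ → V) → (ℕ → W) → (ℕ → W)} (hT : H.IsRep T)
include hT

lemma exists_model {L : Submodule ℂ (ℕ → V)} (hL : L.FG) (hLP : ∀ y ∈ L, y 0 ∈ H.prim₀) (N : ℕ)
    (v : ℕ → W) :
    ∃ (d : ℕ) (ι : (Fin d → ℂ) →ₗ[ℂ] (ℕ → W))
      (A : (ℕ → V) →ₗ[ℂ] ((Fin d → ℂ) →L[ℂ] (Fin d → ℂ))),
      (∀ y ∈ L, ∀ e, ∀ m ≤ N, T y (ι e) m = ι (A y e) m) ∧ ∃ e, ∀ m ≤ N, v m = ι e m :=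
  Deform.exists_model hT.hl hT.lf hL hLP N v

lemma exists_model_one (y : H.Lie) (N : ℕ) (v : ℕ → W) :
    ∃ (d : ℕ) (ι : (Fin d → ℂ) →ₗ[ℂ] (ℕ → W)) (A : (Fin d → ℂ) →L[ℂ] (Fin d → ℂ)),
      (∀ e, ∀ m ≤ N, T y.1 (ι e) m = ι (A e) m) ∧ ∃ e, ∀ m ≤ N, v m = ι e m := by
  obtain ⟨d, ι, A, h1, h2⟩ := hT.exists_model (Submodule.fg_span_singleton y.1) (fun z hz => by
    obtain ⟨c, rfl⟩ := Submodule.mem_span_singleton.1 hz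
    exact H.primS.smul_mem c y.2) N v
  exact ⟨d, ι, A y.1, h1 _ (Submodule.mem_span_singleton_self _), h2⟩

lemma hasHSum (y : H.Lie) {c : ℕ → ℂ} (hc : IsExpType c) (v : ℕ → W) :
    HasHSum (fun k => c k • (T y.1)^[k] v) (opSeries c (T y.1) v) := by
  intro n
  obtain ⟨d, ι, A, h1, e, h2⟩ := hT.exists_model_one y n v
  have h3 := hasFSum_model (hT.hl.right y.1) h1 h2 hc le_rfl
  rw [← h3.wsum_eq] at h3
  exact h3

lemma hasHSum_exp (y : H.Lie) (v : ℕ → W) :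
    HasHSum (fun k => expC k • (T y.1)^[k] v) (opExp (T y.1) v) :=
  hT.hasHSum y isExpType_expC v

lemma opSeries_hl (y : H.Lie) {c : ℕ → ℂ} (hc : IsExpType c) : IsHL (opSeries c (T y.1)) where
  add a b := (hT.hasHSum y hc _).unique (by
    have := (hT.hasHSum y hc a).add (hT.hasHSum y hc b)
    refine (iff_of_eq (congrArg₂ _ (funext fun k => ?_) rfl)).1 this
    rw [((hT.hl.right y.1).iterate k).add, smul_add])
  smul c' a := (hT.hasHSum y hc _).unique (by
    have := (hT.hasHSum y hc a).map (Φ := fun v => c' • v)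
      ⟨fun a b => smul_add _ _ _, fun c a => smul_comm _ _ _, fun a => (hs_smul _ _).symm⟩
    refine (iff_of_eq (congrArg₂ _ (funext fun k => ?_) rfl)).1 this
    rw [((hT.hl.right y.1).iterate k).smul, smul_comm])
  hs a := (hT.hasHSum y hc _).unique (by
    have := (hT.hasHSum y hc a).map (Φ := Deform.hs) ⟨hs_add, hs_smul, fun _ => rfl⟩
    refine (iff_of_eq (congrArg₂ _ (funext fun k => ?_) rfl)).1 this
    rw [((hT.hl.right y.1).iterate k).hs, hs_smul])

lemma opExp_hl (y : H.Lie) : IsHL (opExp (T y.1)) := hT.opSeries_hl y isExpType_expC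

/-- The value of `exp (T y)` in a model. -/
lemma opExp_model (y : H.Lie) {d N : ℕ} {ι : (Fin d → ℂ) →ₗ[ℂ] (ℕ → W)}
    {A : (Fin d → ℂ) →L[ℂ] (Fin d → ℂ)} (h1 : ∀ e, ∀ m ≤ N, T y.1 (ι e) m = ι (A e) m)
    {v : ℕ → W} {e : Fin d → ℂ} (h2 : ∀ m ≤ N, v m = ι e m) (m : ℕ) (hm : m ≤ N) :
    opExp (T y.1) v m = ι (pser expC A e) m :=
  (hT.hasHSum_exp y v m).unique (hasFSum_model (hT.hl.right y.1) h1 h2 isExpType_expC hm)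

lemma opExp_neg (y : H.Lie) (v : ℕ → W) :
    opExp (T y.1) (opExp (T (H.negL y).1) v) = v := by
  funext n
  obtain ⟨d, ι, A, h1, e, h2⟩ := hT.exists_model_one y n v
  have h1' : ∀ e, ∀ m ≤ n, T (H.negL y).1 (ι e) m = ι ((-A) e) m := fun e m hm => by
    have h3 : T (H.negL y).1 (ι e) = -T y.1 (ι e) := (hT.hl.left _).neg _
    rw [h3, Pi.neg_apply, h1 e m hm]
    simp
  rw [hT.opExp_model y h1 (hT.opExp_model (H.negL y) h1' h2) n le_rfl, h2 n le_rfl]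
  have h4 := DFunLike.congr_fun (pser_expC_mul_neg A) e
  exact congrArg (fun z => ι z n) h4

lemma opExp_neg' (y : H.Lie) (v : ℕ → W) :
    opExp (T (H.negL y).1) (opExp (T y.1) v) = v := by
  have h : H.negL (H.negL y) = y := Subtype.ext (neg_neg _)
  have := hT.opExp_neg (H.negL y) v
  rwa [h] at this

lemma opExp_zero (y : H.Lie) (hy : y.1 = 0) (v : ℕ → W) : opExp (T y.1) v = v := by
  funext n
  obtain ⟨d, ι, A, h1, e, h2⟩ := hT.exists_model_one y n v
  have h3 : ∀ e, ∀ m ≤ n, T y.1 (ι e) m = ι ((0 : (Fin d → ℂ) →L[ℂ] (Fin d → ℂ)) e) m :=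
    fun e m _ => by rw [hy, (hT.hl.left _).zero]; simp
  rw [hT.opExp_model y h3 h2 n le_rfl, h2 n le_rfl, pser_expC_zero]
  simp

/-- Linear intertwiners of Lie algebra actions intertwine the exponentials. -/
lemma opExp_map {T' : (ℕ → V) → (ℕ → W₁) → (ℕ → W₁)} (hT' : H.IsRep T')
    {Φ : (ℕ → W) → (ℕ → W₁)} (hΦ : IsHL Φ) (y : H.Lie)
    (h : ∀ v, Φ (T y.1 v) = T' y.1 (Φ v)) (v : ℕ → W) :
    Φ (opExp (T y.1) v) = opExp (T' y.1) (Φ v) := by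
  refine ((hT.hasHSum_exp y v).map hΦ).unique ?_
  refine (iff_of_eq (congrArg₂ _ (funext fun k => ?_) rfl)).1 (hT'.hasHSum_exp y (Φ v))
  rw [hΦ.smul]
  congr 1
  exact ((show Function.Semiconj Φ (T y.1) (T' y.1) from h).iterate_right k v).symm

/-- Bilinear intertwiners of Lie algebra actions intertwine the exponentials. -/
lemma opExp_bilin {T₁ : (ℕ → V) → (ℕ → W₁) → (ℕ → W₁)} (hT₁ : H.IsRep T₁)
    {T₂ : (ℕ → V) → (ℕ → W₂) → (ℕ → W₂)} (hT₂ : H.IsRep T₂)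
    {B : (ℕ → W₁) → (ℕ → W₂) → (ℕ → W)} (hB : IsHL₂ B) (y : H.Lie)
    (h : ∀ a b, T y.1 (B a b) = B (T₁ y.1 a) b + B a (T₂ y.1 b)) (a : ℕ → W₁) (b : ℕ → W₂) :
    opExp (T y.1) (B a b) = B (opExp (T₁ y.1) a) (opExp (T₂ y.1) b) := by
  refine (hT.hasHSum_exp y _).unique ?_
  have h1 := (hT₁.hasHSum_exp y a).bilin hB (hT₂.hasHSum_exp y b)
  refine (iff_of_eq (congrArg₂ _ (funext fun k => ?_) rfl)).1 h1
  have h2 := iterate_binomial (AddMonoidHom.mk' (T y.1) (hT.hl.right y.1).add)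
    (fun i j => B ((T₁ y.1)^[i] a) ((T₂ y.1)^[j] b)) (fun i j => by
      rw [Function.iterate_succ_apply', Function.iterate_succ_apply']
      exact h _ _) k
  have h3 : (T y.1)^[k] (B a b) = _ := h2
  rw [h3, Finset.smul_sum]
  refine Finset.sum_congr rfl fun p hp => ?_
  have hp' := Finset.HasAntidiagonal.mem_antidiagonal.1 hp
  rw [← Nat.cast_smul_eq_nsmul ℂ, smul_smul, ← hp', expC_mul_choose, (hB.left _).smul,
    (hB.right _).smul, smul_smul]

end IsRep

/-! ### The action of words and of the group -/

/-- The action of the word `exp y₁ ⋯ exp yₖ`. -/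
def act (T : (ℕ → V) → (ℕ → W) → (ℕ → W)) (L : List H.Lie) (v : ℕ → W) : ℕ → W :=
  L.foldr (fun y u => opExp (T y.1) u) v

@[simp] lemma act_nil (T : (ℕ → V) → (ℕ → W) → (ℕ → W)) (v : ℕ → W) : H.act T [] v = v := rfl

@[simp] lemma act_cons (T : (ℕ → V) → (ℕ → W) → (ℕ → W)) (y : H.Lie) (L : List H.Lie) (v : ℕ → W) :
    H.act T (y :: L) v = opExp (T y.1) (H.act T L v) := rfl

/-- The commutator action of `H` on itself. -/
lemma isRep_ad (hH : H.LocallyFinite) : H.IsRep H.ad where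
  hl := H.ad_hl₂
  lie y z v := by
    have h : ∀ a b c : H.A₁, (a * b - b * a) * c - c * (a * b - b * a) =
        (a * (b * c - c * b) - (b * c - c * b) * a) -
          (b * (a * c - c * a) - (a * c - c * a) * b) := fun a b c => by noncomm_ring
    exact h y z v
  lf w := by
    obtain ⟨M, h1, h2, h3⟩ := hH.exists_submodule w
    refine ⟨M, Module.Finite.iff_fg.1 h1, h2, fun X hX u hu => ?_⟩
    have := h3 X hX u hu
    simp only [ad, mul₁, Pi.sub_apply, prd, ften_cst, FHom.app_cst]
    exact this

variable {𝕜 : Type*} [NontriviallyNormedField 𝕜] [NormedAlgebra 𝕜 ℂ]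

lemma _root_.Deform.HasHDeriv.trunc {f : 𝕜 → ℕ → W} {D : ℕ → W} {t : 𝕜}
    (h : HasHDeriv 𝕜 f D t) (N : ℕ) :
    HasWDeriv 𝕜 (fun s => Deform.trunc N (f s)) (Deform.trunc N D) t := by
  simp only [trunc_eq_sum]
  exact HasWDeriv.sum _ fun m _ => (h m).map (LinearMap.single ℂ (fun _ : ℕ => W) m)

/-- A finite-dimensional model of the action of a differentiable path in `𝔩`, modulo
`ħ ^ (N + 1)`. -/
lemma IsRep.exists_path_model {H : DeformationHopfAlgebra V} {T : (ℕ → V) → (ℕ → W) → (ℕ → W)}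
    (hT : H.IsRep T) {Y : 𝕜 → H.Lie} {Y' : ℕ → V} {t : 𝕜}
    (hY : HasHDeriv 𝕜 (fun s => (Y s).1) Y' t) (N : ℕ) (v : ℕ → W) :
    ∃ (d : ℕ) (ι : (Fin d → ℂ) →ₗ[ℂ] (ℕ → W)) (B : 𝕜 → (Fin d → ℂ) →L[ℂ] (Fin d → ℂ))
      (B' : (Fin d → ℂ) →L[ℂ] (Fin d → ℂ)), HasDerivAt B B' t ∧
      (∀ᶠ s in 𝓝 t, ∀ e, ∀ m ≤ N, T (Y s).1 (ι e) m = ι (B s e) m) ∧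
      (∀ e, ∀ m ≤ N, T Y' (ι e) m = ι (B' e) m) ∧ ∃ e, ∀ m ≤ N, v m = ι e m := by
  have hYN := hY.trunc N
  obtain ⟨L, hL1, hL2, hL3⟩ := exists_finiteDimensional_of_continuousAt
    (f := fun s => Deform.trunc N (Y s).1) (t := t) fun ψ => (hYN ψ).continuousAt
  have hLP : ∀ y ∈ L, y 0 ∈ H.prim₀ := fun y hy => by
    have h1 : Submodule.span ℂ (Set.range fun s => Deform.trunc N (Y s).1) ≤
        H.primS.comap (LinearMap.proj 0) := by
      rw [Submodule.span_le]
      rintro _ ⟨s, rfl⟩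
      change Deform.trunc N (Y s).1 0 ∈ H.prim₀
      rw [trunc_apply (Nat.zero_le _)]
      exact (Y s).2
    exact h1 (hL2 hy)
  obtain ⟨d, ι, A, h1, h2⟩ := hT.exists_model (Module.Finite.iff_fg.1 hL1) hLP N v
  exact ⟨d, ι, fun s => A (Deform.trunc N (Y s).1), A (Deform.trunc N Y'), hYN.hasDerivAt A,
    hL3.mono fun s hs e m hm => ((hT.hl.left (ι e)).congr fun i hi =>
      (trunc_apply (hi.trans hm) (Y s).1).symm).trans (h1 _ hs e m hm),
    fun e m hm => ((hT.hl.left (ι e)).congr fun i hi =>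
      (trunc_apply (hi.trans hm) Y').symm).trans (h1 _ (hYN.mem hL3) e m hm), h2⟩

/-- The derivative of `exp (T y)`.  In a finite-dimensional model this is the formula for the
derivative of the matrix exponential. -/
lemma IsRep.hasHDeriv_opExp {H : DeformationHopfAlgebra V} (hH : H.LocallyFinite)
    {T : (ℕ → V) → (ℕ → W) → (ℕ → W)} (hT : H.IsRep T) {Y : 𝕜 → H.Lie} {Y' : ℕ → V} {t : 𝕜}
    (hY : HasHDeriv 𝕜 (fun s => (Y s).1) Y' t) (v : ℕ → W) :
    HasHDeriv 𝕜 (fun s => opExp (T (Y s).1) v) (T (H.dexp (Y t).1 Y') (opExp (T (Y t).1) v)) t := by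
  intro N
  obtain ⟨d, ι, B, B', hB, hmod, hmod', e, h2⟩ := hT.exists_path_model hY N v
  have hexp := hasDerivAt_exp hB
  -- in the model, `dexp` is the series in `ad (B t)` which occurs in the derivative of `exp`
  have hdexp : ∀ e, ∀ m ≤ N, T (H.dexp (Y t).1 Y') (ι e) m = ι (adSer dexpC (B t) B' e) m := by
    intro e m hm
    have h3 : ∀ k e, ∀ m ≤ N, T ((H.ad (Y t).1)^[k] Y') (ι e) m = ι ((adB (B t))^[k] B' e) m := by
      intro k
      induction k with
      | zero => exact hmod'
      | succ k ih =>
        intro e m hm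
        have h4 := hmod.self_of_nhds
        rw [Function.iterate_succ_apply', Function.iterate_succ_apply', hT.lie, Pi.sub_apply,
          (hT.hl.right _).congr fun i hi => ih e i (hi.trans hm), h4 _ m hm,
          (hT.hl.right _).congr fun i hi => h4 e i (hi.trans hm), ih _ m hm, adB]
        simp
    have h5 := (((isRep_ad H hH).hasHSum (Y t) isExpType_dexpC Y').map (hT.hl.left (ι e))) m
    refine h5.unique ?_
    have h6 := hasFSum_of_summable (LinearMap.proj m ∘ₗ ι)
      (u := fun k => (dexpC k • (adB (B t))^[k] B') e)
      (((summable_adB isExpType_dexpC (B t) B').mul_right ‖e‖).of_nonneg_of_le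
        (fun _ => norm_nonneg _) fun k => ContinuousLinearMap.le_opNorm _ _)
    have h7 : ∑' k, (dexpC k • (adB (B t))^[k] B') e = adSer dexpC (B t) B' e := by
      have := (hasSum_adSer isExpType_dexpC (B t) B').mapL
        (ContinuousLinearMap.apply ℂ (Fin d → ℂ) e)
      exact this.tsum_eq
    rw [h7] at h6
    refine (iff_of_eq (congrArg₂ _ (funext fun k => ?_) rfl)).1 h6
    refine Eq.trans ?_ (congrFun ((hT.hl.left (ι e)).smul (dexpC k) _) m).symm
    refine Eq.trans ?_ (congrArg (fun z => dexpC k • z) (h3 k e m hm)).symm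
    simp
  intro ψ
  let ev : ((Fin d → ℂ) →L[ℂ] (Fin d → ℂ)) →ₗ[ℂ] ℂ :=
    ψ ∘ₗ LinearMap.proj N ∘ₗ ι ∘ₗ (ContinuousLinearMap.apply ℂ (Fin d → ℂ) e).toLinearMap
  have h8 : HasDerivAt (fun s => ev (pser expC (B s))) (ev (adSer dexpC (B t) B' *
      pser expC (B t))) t :=
    ((LinearMap.toContinuousLinearMap ev).restrictScalars 𝕜).hasFDerivAt.comp_hasDerivAt t hexp
  have h9 : ψ (T (H.dexp (Y t).1 Y') (opExp (T (Y t).1) v) N) =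
      ev (adSer dexpC (B t) B' * pser expC (B t)) := by
    rw [(hT.hl.right _).congr fun i hi =>
      hT.opExp_model (Y t) hmod.self_of_nhds h2 i hi, hdexp _ N le_rfl]
    rfl
  rw [h9]
  refine h8.congr_of_eventuallyEq (hmod.mono fun s hs => ?_)
  change ψ (opExp (T (Y s).1) v N) = _
  rw [hT.opExp_model (Y s) hs h2 N le_rfl]
  rfl

/-- The `k`-th term of the derivative of a power series in `T y`. -/
def powT (T : (ℕ → V) → (ℕ → W) → (ℕ → W)) (y y' : ℕ → V) (k : ℕ) (v : ℕ → W) : ℕ → W :=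
  ∑ i ∈ Finset.range k, (T y)^[k.pred - i] (T y' ((T y)^[i] v))

/-- Operator series can be differentiated termwise. -/
lemma IsRep.exists_hasHDeriv_opSeries {H : DeformationHopfAlgebra V}
    {T : (ℕ → V) → (ℕ → W) → (ℕ → W)} (hT : H.IsRep T) {Y : 𝕜 → H.Lie} {Y' : ℕ → V} {t : 𝕜}
    (hY : HasHDeriv 𝕜 (fun s => (Y s).1) Y' t) {c : ℕ → ℂ} (hc : IsExpType c) (v : ℕ → W) :
    ∃ D, HasHDeriv 𝕜 (fun s => opSeries c (T (Y s).1) v) D t ∧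
      HasHSum (fun k => c k • powT T (Y t).1 Y' k v) D := by
  suffices ∀ N, ∃ D, HasWDeriv 𝕜 (fun s => opSeries c (T (Y s).1) v N) D t ∧
      HasFSum (fun k => (c k • powT T (Y t).1 Y' k v) N) D by
    choose D h1 h2 using this
    exact ⟨D, h1, h2⟩
  intro N
  obtain ⟨d, ι, B, B', hB, hmod, hmod', e, h2⟩ := hT.exists_path_model hY N v
  obtain ⟨S, hS1, hS2⟩ := exists_hasDerivAt_pser hc hB
  refine ⟨ι (S e) N, fun ψ => ?_, ?_⟩
  · let ev : ((Fin d → ℂ) →L[ℂ] (Fin d → ℂ)) →ₗ[ℂ] ℂ :=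
      ψ ∘ₗ LinearMap.proj N ∘ₗ ι ∘ₗ (ContinuousLinearMap.apply ℂ (Fin d → ℂ) e).toLinearMap
    have h8 : HasDerivAt (fun s => ev (pser c (B s))) (ev S) t :=
      ((LinearMap.toContinuousLinearMap ev).restrictScalars 𝕜).hasFDerivAt.comp_hasDerivAt t hS1
    refine h8.congr_of_eventuallyEq (hmod.mono fun s hs => ?_)
    exact congrArg ψ (hasFSum_model (hT.hl.right _) hs h2 hc le_rfl).wsum_eq
  · have hS3 := hS2.mapL (ContinuousLinearMap.apply ℂ (Fin d → ℂ) e)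
    have h6 := hasFSum_of_summable (LinearMap.proj N ∘ₗ ι) hS3.summable.norm
    rw [hS3.tsum_eq] at h6
    refine (iff_of_eq (congrArg₂ _ (funext fun k => ?_) rfl)).1 h6
    have hp : ∀ (k : ℕ) (u : ℕ → W) (e : Fin d → ℂ), (∀ m ≤ N, u m = ι e m) →
        ∀ m ≤ N, (T (Y t).1)^[k] u m = ι ((B t ^ k) e) m := by
      intro k u e hu
      induction k with
      | zero => simpa using hu
      | succ k ih =>
        intro m hm
        rw [Function.iterate_succ_apply', pow_succ']
        exact ((hT.hl.right _).congr fun i hi => ih i (hi.trans hm)).trans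
          (hmod.self_of_nhds _ m hm)
    have h7 : powT T (Y t).1 Y' k v N = ι (powD (B t) B' k e) N := by
      simp only [powT, powD, Finset.sum_apply, sum_apply, map_sum]
      refine Finset.sum_congr rfl fun i _ => ?_
      exact hp _ _ _ (fun m hm => ((hT.hl.right _).congr fun j hj =>
        hp i v e h2 j (hj.trans hm)).trans (hmod' _ m hm)) N le_rfl
    rw [Pi.smul_apply, h7]
    simp

end DeformationHopfAlgebra

namespace DeformationHopfAlgebra

variable {V : Type*} [AddCommGroup V] [Module ℂ V] {H : DeformationHopfAlgebra V}
variable {W : Type*} [AddCommGroup W] [Module ℂ W]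
variable {𝕜 : Type*} [NontriviallyNormedField 𝕜] [NormedAlgebra 𝕜 ℂ]

/-- All letters of the word of paths `P` are differentiable at `t`. -/
def DiffWord (𝕜 : Type*) [NontriviallyNormedField 𝕜] [NormedAlgebra 𝕜 ℂ] (P : List (𝕜 → H.Lie))
    (t : 𝕜) : Prop :=
  ∀ Y ∈ P, ∃ D, HasHDeriv 𝕜 (fun s => (Y s).1) D t

/-- The logarithmic derivative of the word of paths `P`. -/
def logDeriv (P : List (𝕜 → H.Lie)) (t : 𝕜) : ℕ → V :=
  H.wordLogDeriv (P.map fun Y => ((Y t).1, fun n => wderiv 𝕜 (fun s => (Y s).1 n) t))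

namespace IsRep

variable {T : (ℕ → V) → (ℕ → W) → (ℕ → W)} (hT : H.IsRep T)
include hT

/-- The action of a product `exp y w`: `T (exp (ad y) z) (exp (T y) v) = exp (T y) (T z v)`. -/
lemma opExp_apply (hH : H.LocallyFinite) (y : H.Lie) (z : ℕ → V) (v : ℕ → W) :
    opExp (T y.1) (T z v) = T (opExp (H.ad y.1) z) (opExp (T y.1) v) :=
  hT.opExp_bilin (H.isRep_ad hH) hT hT.hl y (fun a b => by rw [hT.lie]; abel) z v

/-- The derivative of the action of a word of paths. -/
lemma hasHDeriv_act (hH : H.LocallyFinite) {P : List (𝕜 → H.Lie)} {t : 𝕜}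
    (hP : DiffWord 𝕜 P t) (v : ℕ → W) :
    HasHDeriv 𝕜 (fun s => H.act T (P.map fun Y => Y s) v)
      (T (logDeriv P t) (H.act T (P.map fun Y => Y t) v)) t := by
  induction P with
  | nil =>
    have h : T (logDeriv ([] : List (𝕜 → H.Lie)) t) v = 0 := (hT.hl.left _).zero
    simp only [List.map_nil, act_nil, h]
    exact HasHDeriv.const _ _
  | cons Y P ih =>
    obtain ⟨D, hD⟩ := hP Y (by simp)
    have hD' : (fun n => wderiv 𝕜 (fun s => (Y s).1 n) t) = D := funext fun n => (hD n).wderiv_eq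
    have h1 := HasHDeriv.app (Φ := fun s => opExp (T (Y s).1))
      (Φ' := fun w => T (H.dexp (Y t).1 D) (opExp (T (Y t).1) w))
      (fun s => hT.opExp_hl (Y s)) ((hT.hl.right _).comp (hT.opExp_hl (Y t)))
      (fun w => hT.hasHDeriv_opExp hH hD w) (ih fun Z hZ => hP Z (by simp [hZ]))
    have h2 : T (logDeriv (Y :: P) t) (H.act T ((Y :: P).map fun Y => Y t) v) =
        T (H.dexp (Y t).1 D) (opExp (T (Y t).1) (H.act T (P.map fun Y => Y t) v)) +
          opExp (T (Y t).1) (T (logDeriv P t) (H.act T (P.map fun Y => Y t) v)) := by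
      rw [hT.opExp_apply hH]
      refine Eq.trans ?_ ((hT.hl.left _).add _ _)
      rw [← hD']
      rfl
    rw [h2]
    exact h1

/-- Contractible words act trivially: along a contraction the derivative of the action is given by
the logarithmic derivative of the word, so it vanishes. -/
lemma act_of_contractible (hH : H.LocallyFinite) {L : List H.Lie} (hL : H.Contractible L)
    (v : ℕ → W) : H.act T L v = v := by
  obtain ⟨P, h0, rfl, hd, hz⟩ := hL
  have hder : ∀ s, HasHDeriv ℝ (fun s => H.act T (P.map fun Y => Y s) v) 0 s := by
    intro s
    have h1 : DiffWord ℝ P s := fun Y hY => by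
      choose D hD using hd Y hY s
      exact ⟨D, hD⟩
    have h2 := hT.hasHDeriv_act hH h1 v
    rw [show logDeriv P s = 0 from hz s, (hT.hl.left _).zero] at h2
    exact h2
  have h0' : H.act T (P.map fun Y => Y 0) v = v := by
    clear hd hz hder
    induction P with
    | nil => rfl
    | cons Y P ih =>
      rw [List.map_cons, act_cons, ih fun Z hZ => h0 Z (by simp [hZ])]
      exact hT.opExp_zero _ (h0 Y (by simp)) _
  refine Eq.trans ?_ h0'
  funext n
  refine eq_of_dual fun ψ => ?_
  have h3 : ∀ s, HasDerivAt (fun s => ψ (H.act T (P.map fun Y => Y s) v n)) 0 s := fun s => by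
    simpa using hder s n ψ
  exact is_const_of_deriv_eq_zero (fun s => (h3 s).differentiableAt) (fun s => (h3 s).deriv) 1 0

/-- The bijection `exp (T y)`. -/
def expEquiv (y : H.Lie) : Equiv.Perm (ℕ → W) where
  toFun := opExp (T y.1)
  invFun := opExp (T (H.negL y).1)
  left_inv := hT.opExp_neg' y
  right_inv := hT.opExp_neg y

lemma lift_expEquiv (L : List H.Lie) (v : ℕ → W) :
    FreeGroup.lift hT.expEquiv (L.map FreeGroup.of).prod v = H.act T L v := by
  induction L with
  | nil => simp
  | cons y L ih =>
    rw [List.map_cons, List.prod_cons, map_mul, Equiv.Perm.mul_apply, ih, FreeGroup.lift_apply_of]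
    rfl

/-- The action of the group `H~ˣ` obtained by integrating a representation. -/
def hom (hH : H.LocallyFinite) : H.Tilde →* Equiv.Perm (ℕ → W) :=
  PresentedGroup.toGroup (f := hT.expEquiv) (by
    rintro r ⟨L, hL, rfl⟩
    refine Equiv.ext fun v => ?_
    rw [hT.lift_expEquiv, hT.act_of_contractible hH hL]
    rfl)

lemma hom_prod (hH : H.LocallyFinite) (L : List H.Lie) (v : ℕ → W) :
    hT.hom hH (L.map H.exp).prod v = H.act T L v := by
  induction L with
  | nil => simp
  | cons y L ih =>
    rw [List.map_cons, List.prod_cons, map_mul, Equiv.Perm.mul_apply, ih, act_cons]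
    exact DFunLike.congr_fun (PresentedGroup.toGroup.of _) _

lemma hom_mul (hH : H.LocallyFinite) (x x' : H.Tilde) (v : ℕ → W) :
    hT.hom hH (x * x') v = hT.hom hH x (hT.hom hH x' v) := by rw [map_mul]; rfl

lemma hom_inv_hom (hH : H.LocallyFinite) (x : H.Tilde) (v : ℕ → W) :
    hT.hom hH x⁻¹ (hT.hom hH x v) = v := by rw [← hT.hom_mul, inv_mul_cancel, map_one]; rfl

lemma hom_hom_inv (hH : H.LocallyFinite) (x : H.Tilde) (v : ℕ → W) :
    hT.hom hH x (hT.hom hH x⁻¹ v) = v := by rw [← hT.hom_mul, mul_inv_cancel, map_one]; rfl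

end IsRep

lemma _root_.Deform.eq_hs_tailL {a : ℕ → W} (h : a 0 = 0) : a = hs (tailL a) := by
  funext n
  cases n with
  | zero => exact h
  | succ n => rfl

lemma _root_.Deform.HasFSum.of_succ_eq_zero {u : ℕ → W} (h : ∀ k, u (k + 1) = 0) :
    HasFSum u (u 0) := by
  refine ⟨Unit, inferInstance, fun _ => u 0, fun _ k => if k = 0 then 1 else 0, fun _ => ?_,
    fun k => ?_, by simp⟩
  · exact summable_of_hasFiniteSupport ((Set.finite_singleton 0).subset fun k hk => by
      by_contra hne
      simp_all)
  · cases k with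
    | zero => simp
    | succ k => simp [h k]

/-- An induction principle for the group `H~ˣ`. -/
lemma tilde_induction {C : H.Tilde → Prop} (exp : ∀ y, C (H.exp y)) (one : C 1)
    (mul : ∀ x x', C x → C x' → C (x * x')) (inv : ∀ x, C x → C x⁻¹) (x : H.Tilde) : C x :=
  PresentedGroup.generated_by _
    ({ carrier := {x | C x}, mul_mem' := fun {a b} => mul a b, one_mem' := one,
       inv_mem' := fun {a} => inv a } : Subgroup H.Tilde) exp x

namespace IsRep

variable {T : (ℕ → V) → (ℕ → W) → (ℕ → W)} (hT : H.IsRep T)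
include hT

lemma hom_exp (hH : H.LocallyFinite) (y : H.Lie) (v : ℕ → W) :
    hT.hom hH (H.exp y) v = opExp (T y.1) v :=
  DFunLike.congr_fun (PresentedGroup.toGroup.of _) _

lemma hom_hl (hH : H.LocallyFinite) (x : H.Tilde) : IsHL (hT.hom hH x) := by
  refine tilde_induction (C := fun x => IsHL (hT.hom hH x)) (fun y => ?_) ?_ ?_ ?_ x
  · rw [show ⇑(hT.hom hH (H.exp y)) = opExp (T y.1) from funext (hT.hom_exp hH y)]
    exact hT.opExp_hl y
  · rw [map_one]; exact IsHL.id
  · intro x x' h h'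
    rw [map_mul]; exact h.comp h'
  · intro x h
    have inj := (hT.hom hH x).injective
    refine ⟨fun a b => inj ?_, fun c a => inj ?_, fun a => inj ?_⟩
    · rw [h.add, hT.hom_hom_inv, hT.hom_hom_inv, hT.hom_hom_inv]
    · rw [h.smul, hT.hom_hom_inv, hT.hom_hom_inv]
    · rw [h.hs, hT.hom_hom_inv, hT.hom_hom_inv]

variable {W₁ W₂ : Type*} [AddCommGroup W₁] [Module ℂ W₁] [AddCommGroup W₂] [Module ℂ W₂]

lemma hom_bilin (hH : H.LocallyFinite) {T₁ : (ℕ → V) → (ℕ → W₁) → (ℕ → W₁)} (hT₁ : H.IsRep T₁)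
    {T₂ : (ℕ → V) → (ℕ → W₂) → (ℕ → W₂)} (hT₂ : H.IsRep T₂)
    {B : (ℕ → W₁) → (ℕ → W₂) → (ℕ → W)} (hB : IsHL₂ B)
    (h : ∀ y a b, T y (B a b) = B (T₁ y a) b + B a (T₂ y b)) (x : H.Tilde) :
    ∀ a b, hT.hom hH x (B a b) = B (hT₁.hom hH x a) (hT₂.hom hH x b) := by
  refine tilde_induction (C := fun x => ∀ a b, hT.hom hH x (B a b) =
    B (hT₁.hom hH x a) (hT₂.hom hH x b)) (fun y a b => ?_) (fun a b => ?_)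
    (fun x x' h1 h2 a b => ?_) (fun x h1 a b => ?_) x
  · rw [hom_exp, hom_exp, hom_exp, hT.opExp_bilin hT₁ hT₂ hB y (h y.1)]
  · simp only [map_one]; rfl
  · rw [hom_mul, hom_mul, hom_mul, h2, h1]
  · apply (hT.hom hH x).injective
    rw [h1, hom_hom_inv, hom_hom_inv, hom_hom_inv]

lemma hom_map (hH : H.LocallyFinite) {T' : (ℕ → V) → (ℕ → W₁) → (ℕ → W₁)} (hT' : H.IsRep T')
    {Φ : (ℕ → W) → (ℕ → W₁)} (hΦ : IsHL Φ) (h : ∀ y v, Φ (T y v) = T' y (Φ v)) (x : H.Tilde) :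
    ∀ v, Φ (hT.hom hH x v) = hT'.hom hH x (Φ v) := by
  refine tilde_induction (C := fun x => ∀ v, Φ (hT.hom hH x v) = hT'.hom hH x (Φ v))
    (fun y a => ?_) (fun a => ?_) (fun x x' h1 h2 a => ?_) (fun x h1 a => ?_) x
  · rw [hom_exp, hom_exp, hT.opExp_map hT' hΦ y (h y.1)]
  · simp only [map_one]; rfl
  · rw [hom_mul, hom_mul, h1, h2]
  · apply (hT'.hom hH x).injective
    rw [← h1, hom_hom_inv, hom_hom_inv]

/-- `x (y v) = (x y x⁻¹) (x v)`. -/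
lemma hom_apply (hH : H.LocallyFinite) (x : H.Tilde) (z : ℕ → V) (v : ℕ → W) :
    hT.hom hH x (T z v) = T ((H.isRep_ad hH).hom hH x z) (hT.hom hH x v) :=
  hT.hom_bilin hH (H.isRep_ad hH) hT hT.hl (fun y a b => by rw [hT.lie]; abel) x z v

/-- Vectors annihilated by the Lie algebra are fixed by the group. -/
lemma hom_fixed (hH : H.LocallyFinite) {v : ℕ → W} (h : ∀ y, T y v = 0) (x : H.Tilde) :
    hT.hom hH x v = v := by
  refine tilde_induction (C := fun x => hT.hom hH x v = v) (fun y => ?_) (by rw [map_one]; rfl)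
    (fun x x' h1 h2 => by rw [hom_mul, h2, h1])
    (fun x h1 => by conv_lhs => rw [← h1, hom_inv_hom]) x
  rw [hom_exp]
  refine (hT.hasHSum_exp y v).unique fun n => ?_
  have h2 : ∀ k, expC (k + 1) • (T y.1)^[k + 1] v = 0 := fun k => by
    rw [Function.iterate_succ_apply, h, ((hT.hl.right y.1).iterate k).zero, smul_zero]
  have h3 := HasFSum.of_succ_eq_zero (u := fun k => (expC k • (T y.1)^[k] v) n)
    fun k => congrFun (h2 k) n
  simpa [expC] using h3

/-- The group preserves the congruence class modulo `ħ` of a vector whose class is annihilated by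
the Lie algebra. -/
lemma hom_apply_zero (hH : H.LocallyFinite) {v : W} (h : ∀ y : H.Lie, T y.1 (cst v) 0 = 0)
    (x : H.Tilde) : ∀ w : ℕ → W, w 0 = v → hT.hom hH x w 0 = v := by
  refine tilde_induction (C := fun x => ∀ w : ℕ → W, w 0 = v → hT.hom hH x w 0 = v)
    (fun y w hw => ?_) (fun w hw => by rw [map_one]; exact hw)
    (fun x x' h1 h2 w hw => by rw [hom_mul]; exact h1 _ (h2 _ hw)) (fun x h1 w hw => ?_) x
  · have h2 : ∀ k, (T y.1)^[k + 1] w 0 = 0 := fun k => by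
      induction k with
      | zero =>
        rw [← h y]
        exact (hT.hl.right y.1).congr fun m hm => by
          obtain rfl : m = 0 := by omega
          exact hw
      | succ k ih =>
        rw [Function.iterate_succ_apply']
        have h3 : T y.1 ((T y.1)^[k + 1] w) 0 = T y.1 0 0 := (hT.hl.right y.1).congr fun m hm => by
          obtain rfl : m = 0 := by omega
          exact ih
        rw [h3, (hT.hl.right y.1).zero]
        rfl
    rw [hom_exp]
    refine (hT.hasHSum_exp y w 0).unique ?_
    have h3 := HasFSum.of_succ_eq_zero (u := fun k => (expC k • (T y.1)^[k] w) 0)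
      fun k => (congrArg (fun z => expC (k + 1) • z) (h2 k)).trans (smul_zero _)
    simpa [expC, hw] using h3
  · have h2 : (w - hT.hom hH x (cst v)) 0 = 0 := by
      rw [Pi.sub_apply, hw, h1 (cst v) rfl, sub_self]
    have h3 : hT.hom hH x⁻¹ w - cst v = hs (hT.hom hH x⁻¹ (tailL (w - hT.hom hH x (cst v)))) := by
      rw [← (hT.hom_hl hH x⁻¹).hs, ← eq_hs_tailL h2, (hT.hom_hl hH x⁻¹).sub, hom_inv_hom]
    exact sub_eq_zero.1 (congrFun h3 0)

/-- The group action is given by the operators which define `twoSided`. -/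
lemma hom_eq_foldr (hH : H.LocallyFinite) (x : H.Tilde) (v : ℕ → W) :
    open Classical in
    hT.hom hH x v = (Quotient.out x : FreeGroup H.Lie).toWord.foldr
      (fun p u => if p.2 then opExp (T p.1.1) u else opExp (fun w => -T p.1.1 w) u) v := by
  classical
  have h1 : hT.hom hH x = FreeGroup.lift hT.expEquiv (Quotient.out x : FreeGroup H.Lie) := by
    conv_lhs => rw [← Quotient.out_eq x]
    rfl
  rw [h1]
  have h2 : ∀ w : List (H.Lie × Bool), FreeGroup.lift hT.expEquiv (FreeGroup.mk w) v = w.foldr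
      (fun p u => if p.2 then opExp (T p.1.1) u else opExp (fun w => -T p.1.1 w) u) v := by
    intro w
    rw [FreeGroup.lift_mk]
    induction w with
    | nil => rfl
    | cons p w ih =>
      rw [List.map_cons, List.prod_cons, Equiv.Perm.mul_apply, ih, List.foldr_cons]
      obtain ⟨y, b⟩ := p
      cases b
      · have h3 : T (H.negL y).1 = fun w => -T y.1 w := funext fun w => (hT.hl.left w).neg y.1
        rw [← h3]
        rfl
      · rfl
  rw [← h2, FreeGroup.mk_toWord]

lemma hom_prod_inv (hH : H.LocallyFinite) (L : List H.Lie) (v : ℕ → W) :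
    hT.hom hH (L.map H.exp).prod⁻¹ v = H.act T (L.reverse.map H.negL) v := by
  induction L generalizing v with
  | nil => simp
  | cons y L ih =>
    have h : H.act T (L.reverse.map H.negL ++ [H.negL y]) v =
        H.act T (L.reverse.map H.negL) (opExp (T (H.negL y).1) v) := by
      simp [act]
    have h' : hT.hom hH (H.exp y)⁻¹ v = opExp (T (H.negL y).1) v := by
      apply (hT.hom hH (H.exp y)).injective
      rw [hom_hom_inv, hom_exp, hT.opExp_neg]
    rw [List.map_cons, List.prod_cons, mul_inv_rev, hom_mul, ih, List.reverse_cons,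
      List.map_append, List.map_singleton, h, h']

end IsRep

/-- The path `x` in `H~ˣ` is, near `t`, a product of exponentials of paths in `𝔩` which are
differentiable at `t`, and its logarithmic derivative at `t` is `y`. -/
def HasLogDeriv (𝕜 : Type*) [NontriviallyNormedField 𝕜] [NormedAlgebra 𝕜 ℂ] (x : 𝕜 → H.Tilde)
    (y : ℕ → V) (t : 𝕜) : Prop :=
  ∃ P : List (𝕜 → H.Lie), DiffWord 𝕜 P t ∧
    (∀ᶠ s in 𝓝 t, x s = (P.map fun Y => H.exp (Y s)).prod) ∧ y = logDeriv P t

namespace IsRep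

variable {T : (ℕ → V) → (ℕ → W) → (ℕ → W)} (hT : H.IsRep T)
include hT

lemma hasHDeriv_hom (hH : H.LocallyFinite) {x : 𝕜 → H.Tilde} {y : ℕ → V} {t : 𝕜}
    (hx : HasLogDeriv 𝕜 x y t) (v : ℕ → W) :
    HasHDeriv 𝕜 (fun s => hT.hom hH (x s) v) (T y (hT.hom hH (x t) v)) t := by
  obtain ⟨P, hP, hx, rfl⟩ := hx
  have h1 : ∀ s, x s = (P.map fun Y => H.exp (Y s)).prod →
      hT.hom hH (x s) v = H.act T (P.map fun Y => Y s) v := fun s hs => by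
    rw [hs, ← hT.hom_prod hH, List.map_map]; rfl
  rw [h1 t hx.self_of_nhds]
  exact (hT.hasHDeriv_act hH hP v).congr (hx.mono h1)

lemma hasHDeriv_hom_inv (hH : H.LocallyFinite) {x : 𝕜 → H.Tilde} {y : ℕ → V} {t : 𝕜}
    (hx : HasLogDeriv 𝕜 x y t) (v : ℕ → W) :
    HasHDeriv 𝕜 (fun s => hT.hom hH (x s)⁻¹ v)
      (-T ((H.isRep_ad hH).hom hH (x t)⁻¹ y) (hT.hom hH (x t)⁻¹ v)) t := by
  have hx' := hx
  obtain ⟨P, hP, hx, rfl⟩ := hx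
  have h1 : ∀ s, x s = (P.map fun Y => H.exp (Y s)).prod →
      hT.hom hH (x s)⁻¹ v = H.act T ((P.reverse.map fun Y s => H.negL (Y s)).map fun Y => Y s) v :=
    fun s hs => by
      have := hT.hom_prod_inv hH (P.map fun Y => Y s) v
      rw [List.map_map] at this
      rw [hs]
      refine Eq.trans this ?_
      rw [← List.map_reverse, List.map_map, List.map_map]
      rfl
  have h2 : DiffWord 𝕜 (P.reverse.map fun Y s => H.negL (Y s)) t := by
    intro Y hY
    obtain ⟨Z, hZ, rfl⟩ := List.mem_map.1 hY
    obtain ⟨D, hD⟩ := hP Z (List.mem_reverse.1 hZ)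
    exact ⟨-D, hD.map IsHL.id.fneg⟩
  have h3 := (hT.hasHDeriv_act hH h2 v).congr (hx.mono h1)
  have h4 : ∀ w, HasHDeriv 𝕜 (fun s => hT.hom hH (x s) w)
      (T (logDeriv P t) (hT.hom hH (x t) w)) t := hT.hasHDeriv_hom hH hx'
  have h5 := HasHDeriv.app (Φ := fun s => hT.hom hH (x s))
    (Φ' := fun w => T (logDeriv P t) (hT.hom hH (x t) w)) (fun s => hT.hom_hl hH _)
    ((hT.hl.right _).comp (hT.hom_hl hH _)) h4 h3
  simp only [hT.hom_hom_inv] at h5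
  have h6 := h5.unique (HasHDeriv.const v t)
  rw [← h1 t hx.self_of_nhds] at h3 h6
  have h7 := congrArg (hT.hom hH (x t)⁻¹) (eq_neg_of_add_eq_zero_right h6)
  rw [hom_inv_hom, (hT.hom_hl hH _).neg, hom_apply] at h7
  rwa [h7] at h3

end IsRep
end DeformationHopfAlgebra

/-! ### Differential calculus of holomorphic functions with values in `𝔩` -/

section Brackets

variable {R : Type*} [Ring R]

/-- The commutator in a ring. -/
def brk (a b : R) : R := a * b - b * a

lemma brk_brk (y a b : R) : brk y (brk a b) = brk (brk y a) b + brk a (brk y b) := by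
  simp only [brk]; noncomm_ring

/-- The `k`-th term of the derivative in the direction `b` of the series in `ad y` applied
to `a`. -/
def brkD (y b a : R) (k : ℕ) : R :=
  ∑ i ∈ Finset.range k, (brk y)^[k.pred - i] (brk b ((brk y)^[i] a))

lemma brkD_succ (y b a : R) (k : ℕ) :
    brkD y b a (k + 1) = brk y (brkD y b a k) + brk b ((brk y)^[k] a) := by
  let D : R →+ R := AddMonoidHom.mk' (brk y) fun a b => by simp only [brk]; noncomm_ring
  rw [brkD, Finset.sum_range_succ, brkD]
  congr 1
  · refine Eq.trans ?_ (map_sum D _ _).symm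
    refine Finset.sum_congr rfl fun i hi => ?_
    have := Finset.mem_range.1 hi
    have h2 : (k + 1).pred - i = (k.pred - i) + 1 := by
      simp only [Nat.pred_eq_sub_one]; omega
    rw [h2, Function.iterate_succ_apply']
    rfl
  · simp

/-- The antisymmetric part of the derivative, as a binomial sum. -/
lemma brkD_sub (y b a : R) (g : ℕ → ℕ → R) (h0 : ∀ j, g 0 j = 0) (h0' : ∀ i, g i 0 = 0)
    (hg : ∀ i j, g (i + 1) (j + 1) = brk ((brk y)^[i] b) ((brk y)^[j] a)) (k : ℕ) :
    brkD y b a k - brkD y a b k =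
      ∑ p ∈ antidiagonal (k + 1), (k + 1).choose p.1 • g p.1 p.2 := by
  let D : R →+ R := AddMonoidHom.mk' (brk y) fun a b => by simp only [brk]; noncomm_ring
  have hD : ∀ a, D a = brk y a := fun _ => rfl
  induction k with
  | zero => simp [brkD, h0, h0', Finset.Nat.sum_antidiagonal_succ]
  | succ k ih =>
    have h1 : brkD y b a (k + 1) - brkD y a b (k + 1) =
        D (brkD y b a k - brkD y a b k) + (g 1 (k + 1) + g (k + 1) 1) := by
      rw [brkD_succ, brkD_succ, map_sub, hg 0 k, hg k 0, hD, hD]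
      simp only [Function.iterate_zero, id_eq]
      simp only [brk]
      abel
    have h2 : ∀ p : ℕ × ℕ, D (g p.1 p.2) = g (p.1 + 1) p.2 + g p.1 (p.2 + 1) -
        ((if p.1 = 0 then g 1 p.2 else 0) + if p.2 = 0 then g p.1 1 else 0) := by
      rintro ⟨i, j⟩
      cases i with
      | zero => cases j <;> simp [h0, h0']
      | succ i =>
        cases j with
        | zero => simp [h0']
        | succ j =>
          rw [hD, hg, brk_brk, hg, hg, Function.iterate_succ_apply', Function.iterate_succ_apply']
          simp
    have h3 : ∑ p ∈ antidiagonal (k + 1), (k + 1).choose p.1 • (if p.1 = 0 then g 1 p.2 else 0) =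
        g 1 (k + 1) := by
      rw [Finset.sum_eq_single (0, k + 1)]
      · simp
      · rintro ⟨i, j⟩ hp hne
        have hp' := Finset.HasAntidiagonal.mem_antidiagonal.1 hp
        have : i ≠ 0 := by rintro rfl; apply hne; simp_all
        simp [this]
      · simp
    have h4 : ∑ p ∈ antidiagonal (k + 1), (k + 1).choose p.1 • (if p.2 = 0 then g p.1 1 else 0) =
        g (k + 1) 1 := by
      rw [Finset.sum_eq_single (k + 1, 0)]
      · simp
      · rintro ⟨i, j⟩ hp hne
        have hp' := Finset.HasAntidiagonal.mem_antidiagonal.1 hp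
        have : j ≠ 0 := by rintro rfl; apply hne; simp_all
        simp [this]
      · simp
    rw [h1, ih, map_sum, Finset.sum_antidiagonal_choose_succ_nsmul]
    simp only [map_nsmul, h2, smul_sub, smul_add, Finset.sum_sub_distrib,
      Finset.sum_add_distrib, h3, h4]
    rw [sub_add_cancel, add_comm]
    congr 1
    refine Finset.sum_congr rfl fun p hp => ?_
    rw [Nat.choose_symm_of_eq_add (Finset.HasAntidiagonal.mem_antidiagonal.1 hp).symm]

lemma brkD_succ_sub (y b a : R) (k : ℕ) : brkD y b a (k + 1) - brkD y a b (k + 1) =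
    ∑ p ∈ antidiagonal k, (k + 2).choose (p.1 + 1) • brk ((brk y)^[p.1] b) ((brk y)^[p.2] a) := by
  rw [brkD_sub y b a (fun i j => Nat.casesOn i 0 fun i => Nat.casesOn j 0 fun j =>
    brk ((brk y)^[i] b) ((brk y)^[j] a)) (fun _ => rfl) (fun i => by cases i <;> rfl)
    (fun _ _ => rfl), Finset.Nat.sum_antidiagonal_succ, Finset.Nat.sum_antidiagonal_succ']
  simp

end Brackets

section Calculus

variable {W W₁ : Type*} [AddCommGroup W] [Module ℂ W] [AddCommGroup W₁] [Module ℂ W₁]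
variable {𝕜 : Type*} [NontriviallyNormedField 𝕜] [NormedAlgebra 𝕜 ℂ]

lemma HasFSum.shift {u : ℕ → W} {w : W} (h0 : u 0 = 0) (h : HasFSum u w) :
    HasFSum (fun k => u (k + 1)) w := by
  obtain ⟨I, _, v, c, hc, hu, rfl⟩ := h
  refine ⟨I, inferInstance, v, fun i k => c i (k + 1),
    fun i => (summable_nat_add_iff (f := fun k => ‖c i k‖) 1).2 (hc i), fun k => hu _, ?_⟩
  have h1 : ∀ i, ∑' k, c i k = c i 0 + ∑' k, c i (k + 1) := fun i =>
    (hc i).of_norm.tsum_eq_zero_add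
  simp only [h1, add_smul, Finset.sum_add_distrib, ← hu, h0, zero_add]

/-- The derivative of a family of `ℂ[[ħ]]`-linear maps is `ℂ[[ħ]]`-linear. -/
lemma HasHDeriv.isHL {Φ : 𝕜 → (ℕ → W) → (ℕ → W₁)} (hΦ : ∀ s, IsHL (Φ s))
    {Φ' : (ℕ → W) → (ℕ → W₁)} {t : 𝕜} (hd : ∀ v, HasHDeriv 𝕜 (fun s => Φ s v) (Φ' v) t) :
    IsHL Φ' where
  add a b := (hd (a + b)).unique (by simpa only [(hΦ _).add] using (hd a).add (hd b))
  smul c a := (hd (c • a)).unique (by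
    simpa only [(hΦ _).smul] using (hd a).map (Φ := fun v => c • v)
      ⟨fun a b => smul_add _ _ _, fun c a => smul_comm _ _ _, fun a => (hs_smul _ _).symm⟩)
  hs a := (hd (Deform.hs a)).unique (by
    simpa only [(hΦ _).hs] using (hd a).map (Φ := Deform.hs) ⟨hs_add, hs_smul, fun _ => rfl⟩)

variable {E : Type*} [NormedAddCommGroup E] [NormedSpace ℂ E]

/-- `F` has the derivative `D` at `l` in the direction `μ`. -/
def HasDirDeriv (F : E → ℕ → W) (μ l : E) (D : ℕ → W) : Prop :=
  HasHDeriv ℂ (fun t : ℂ => F (l + t • μ)) D 0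

lemma HasDirDeriv.eq {F : E → ℕ → W} {μ l : E} {D : ℕ → W} (h : HasDirDeriv F μ l D) :
    dirDeriv F μ l = D := funext fun n => (h n).wderiv_eq

lemma tendsto_line (l μ : E) : Tendsto (fun t : ℂ => l + t • μ) (𝓝 0) (𝓝 l) := by
  have : Continuous fun t : ℂ => l + t • μ := by fun_prop
  simpa using this.tendsto 0

lemma HasDirDeriv.congr {F G : E → ℕ → W} {μ l : E} {D : ℕ → W} (h : HasDirDeriv F μ l D)
    (hFG : G =ᶠ[𝓝 l] F) : HasDirDeriv G μ l D :=
  HasHDeriv.congr h ((tendsto_line l μ).eventually hFG)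

lemma hasWDeriv_line {N : Set E} {f : E → W} {l : E}
    (hl : l ∈ N) (h : ∀ ψ : W →ₗ[ℂ] ℂ, AnalyticOnNhd ℂ (fun l => ψ (f l)) N) (μ : E) :
    ∃ D, HasWDeriv ℂ (fun t : ℂ => f (l + t • μ)) D 0 ∧
      ∀ ψ : W →ₗ[ℂ] ℂ, ψ D = fderiv ℂ (fun l => ψ (f l)) l μ := by
  have h1 : ∀ ψ : W →ₗ[ℂ] ℂ, HasDerivAt (fun t : ℂ => ψ (f (l + t • μ)))
      (fderiv ℂ (fun l => ψ (f l)) l μ) 0 := by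
    intro ψ
    have h2 : HasFDerivAt (fun l => ψ (f l)) (fderiv ℂ (fun l => ψ (f l)) l) (l + (0 : ℂ) • μ) := by
      rw [zero_smul, add_zero]
      exact (h ψ l hl).differentiableAt.hasFDerivAt
    have h3 : HasDerivAt (fun t : ℂ => l + t • μ) μ 0 := by
      simpa using ((hasDerivAt_id (0 : ℂ)).smul_const μ).const_add l
    exact h2.comp_hasDerivAt (0 : ℂ) h3
  obtain ⟨D, hD⟩ := HasWDeriv.exists_of_differentiableAt fun ψ => (h1 ψ).differentiableAt
  exact ⟨D, hD, fun ψ => (hD ψ).unique (h1 ψ)⟩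

namespace IsHolo

variable {N : Set E} {F : E → ℕ → W}

lemma hasDirDeriv (hF : IsHolo N F) {l : E} (hl : l ∈ N) (μ : E) :
    HasDirDeriv F μ l (dirDeriv F μ l) := by
  intro n
  obtain ⟨D, hD, -⟩ := hasWDeriv_line hl (hF n) μ
  have : dirDeriv F μ l n = D := hD.wderiv_eq
  rw [this]
  exact hD

lemma apply_dirDeriv (hF : IsHolo N F) {l : E} (hl : l ∈ N) (μ : E) (n : ℕ)
    (ψ : W →ₗ[ℂ] ℂ) : ψ (dirDeriv F μ l n) = fderiv ℂ (fun l => ψ (F l n)) l μ := by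
  obtain ⟨D, hD, h⟩ := hasWDeriv_line hl (hF n) μ
  have : dirDeriv F μ l n = D := hD.wderiv_eq
  rw [this, h]

lemma dirDeriv (hF : IsHolo N F) (hN : IsOpen N) (μ : E) : IsHolo N (dirDeriv F μ) := by
  intro n ψ
  have h : AnalyticOnNhd ℂ (fun l => fderiv ℂ (fun l => ψ (F l n)) l μ) N :=
    fun l hl => ((ContinuousLinearMap.apply ℂ ℂ μ).analyticAt _).comp ((hF n ψ).fderiv l hl)
  exact h.congr hN fun l hl => (hF.apply_dirDeriv hl μ n ψ).symm

/-- Mixed partial derivatives commute. -/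
lemma dirDeriv_comm (hF : IsHolo N F) (hN : IsOpen N) {l : E} (hl : l ∈ N) (μ ν : E) :
    Deform.dirDeriv (Deform.dirDeriv F μ) ν l = Deform.dirDeriv (Deform.dirDeriv F ν) μ l := by
  funext n
  refine eq_of_dual fun ψ => ?_
  have h1 : ∀ μ ν, ψ (Deform.dirDeriv (Deform.dirDeriv F μ) ν l n) =
      fderiv ℂ (fderiv ℂ fun l => ψ (F l n)) l ν μ := by
    intro μ ν
    rw [(hF.dirDeriv hN μ).apply_dirDeriv hl]
    have h2 : (fun l => ψ (Deform.dirDeriv F μ l n)) =ᶠ[𝓝 l]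
        fun l => fderiv ℂ (fun l => ψ (F l n)) l μ :=
      Filter.eventuallyEq_of_mem (hN.mem_nhds hl) fun l' hl' => hF.apply_dirDeriv hl' μ n ψ
    rw [h2.fderiv_eq]
    have h3 := ((hF n ψ).fderiv l hl).differentiableAt.hasFDerivAt.clm_apply
      (hasFDerivAt_const μ l)
    rw [h3.fderiv]
    simp
  rw [h1, h1]
  have h4 : IsSymmSndFDerivAt ℂ (fun l => ψ (F l n)) l :=
    ContDiffAt.isSymmSndFDerivAt_of_omega ((hF n ψ l hl).contDiffAt)
  exact h4 ν μ

end IsHolo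

end Calculus

namespace DeformationHopfAlgebra

variable {V : Type*} [AddCommGroup V] [Module ℂ V] {H : DeformationHopfAlgebra V}
variable {E : Type*} [NormedAddCommGroup E] [NormedSpace ℂ E]

lemma ad_comm (a b : ℕ → V) : H.ad a b = -H.ad b a := by simp [ad]

/-! ### Flatness of logarithmic derivatives -/

/-- The logarithmic derivative of the exponential is a flat connection.  The terms with second
derivatives cancel; both sides are expanded in the brackets of `(ad y) ^ p (∂_ν y)` and
`(ad y) ^ q (∂_μ y)`, and the coefficients agree because of
`(p + q + 2).choose (p + 1) / (p + q + 2)! = 1 / ((p + 1)! (q + 1)!)`. -/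
lemma dexp_flat (hH : H.LocallyFinite) {N : Set E} (hN : IsOpen N) {f : E → H.Lie}
    (hf : IsHolo N fun l => (f l).1) {l : E} (hl : l ∈ N) :
    ∃ D : E → E → ℕ → V,
      (∀ μ ν, HasDirDeriv (fun l => H.dexp (f l).1 (dirDeriv (fun l => (f l).1) μ l)) ν l
        (D ν μ)) ∧
      ∀ μ ν, D ν μ - D μ ν = H.ad (H.dexp (f l).1 (dirDeriv (fun l => (f l).1) ν l))
        (H.dexp (f l).1 (dirDeriv (fun l => (f l).1) μ l)) := by
  set pd := fun μ => dirDeriv (fun l => (f l).1) μ with hpd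
  have hT := H.isRep_ad hH
  have h1 : ∀ ν v, ∃ D, HasHDeriv ℂ (fun t : ℂ => H.dexp (f (l + t • ν)).1 v) D 0 ∧
      HasHSum (fun k => dexpC k • powT H.ad (f l).1 (pd ν l) k v) D := fun ν v => by
    have := hT.exists_hasHDeriv_opSeries (Y := fun t : ℂ => f (l + t • ν)) (t := 0)
      (hf.hasDirDeriv hl ν) isExpType_dexpC v
    simp only [zero_smul, add_zero] at this
    exact this
  choose Φ' hΦ1 hΦ2 using h1
  have hHL : ∀ y : H.Lie, IsHL (H.dexp y.1) := fun y => hT.opSeries_hl y isExpType_dexpC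
  have h2 : ∀ μ ν, HasDirDeriv (fun l => H.dexp (f l).1 (pd μ l)) ν l
      (Φ' ν (pd μ l) + H.dexp (f l).1 (dirDeriv (pd μ) ν l)) := fun μ ν => by
    have := HasHDeriv.app (Φ := fun t : ℂ => H.dexp (f (l + t • ν)).1) (Φ' := Φ' ν)
      (fun t => hHL _) (HasHDeriv.isHL (fun t => hHL _) (hΦ1 ν)) (hΦ1 ν)
      ((hf.dirDeriv hN μ).hasDirDeriv hl ν)
    simp only [zero_smul, add_zero] at this
    exact this
  refine ⟨_, h2, fun μ ν => ?_⟩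
  rw [show dirDeriv (pd μ) ν l = dirDeriv (pd ν) μ l from hf.dirDeriv_comm hN hl μ ν,
    add_sub_add_right_eq_sub]
  have h3 : HasHSum (fun k => dexpC (k + 1) •
      (powT H.ad (f l).1 (pd ν l) (k + 1) (pd μ l) - powT H.ad (f l).1 (pd μ l) (k + 1) (pd ν l)))
      (Φ' ν (pd μ l) - Φ' μ (pd ν l)) := by
    have := (hΦ2 ν (pd μ l)).add ((hΦ2 μ (pd ν l)).map IsHL.id.fneg)
    intro n
    have h4 := (this n).shift (by simp [powT])
    rw [sub_eq_add_neg]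
    refine (iff_of_eq (congrArg₂ _ (funext fun k => ?_) rfl)).1 h4
    simp [sub_eq_add_neg]
  refine h3.unique ?_
  have h5 := (hT.hasHSum (f l) isExpType_dexpC (pd ν l)).bilin H.ad_hl₂
    (hT.hasHSum (f l) isExpType_dexpC (pd μ l))
  refine (iff_of_eq (congrArg₂ _ (funext fun k => ?_) rfl)).1 h5
  have h6 : powT H.ad (f l).1 (pd ν l) (k + 1) (pd μ l) -
        powT H.ad (f l).1 (pd μ l) (k + 1) (pd ν l) =
      ∑ p ∈ antidiagonal k, (k + 2).choose (p.1 + 1) •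
        H.ad ((H.ad (f l).1)^[p.1] (pd ν l)) ((H.ad (f l).1)^[p.2] (pd μ l)) :=
    brkD_succ_sub (R := H.A₁) (f l).1 (pd ν l) (pd μ l) k
  rw [h6, Finset.smul_sum]
  refine Finset.sum_congr rfl fun p hp => ?_
  have hp' := Finset.HasAntidiagonal.mem_antidiagonal.1 hp
  have h4 : dexpC (k + 1) * ((k + 2).choose (p.1 + 1) : ℂ) = dexpC p.1 * dexpC p.2 := by
    have := expC_mul_choose (p.1 + 1) (p.2 + 1)
    rw [show p.1 + 1 + (p.2 + 1) = k + 2 by omega] at this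
    exact this
  rw [← Nat.cast_smul_eq_nsmul ℂ, smul_smul, h4, (H.ad_hl₂.left _).smul, (H.ad_hl₂.right _).smul,
    smul_smul]

/-- The logarithmic derivative of a product of exponentials is a flat connection. -/
lemma wordLogDeriv_flat (hH : H.LocallyFinite) {N : Set E} (hN : IsOpen N)
    (F : List (E → H.Lie)) (hF : ∀ f ∈ F, IsHolo N fun l => (f l).1) {l : E} (hl : l ∈ N) :
    ∃ D : E → E → ℕ → V,
      (∀ μ ν, HasDirDeriv (fun l => H.wordLogDeriv
        (F.map fun f => ((f l).1, dirDeriv (fun l => (f l).1) μ l))) ν l (D ν μ)) ∧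
      ∀ μ ν, D ν μ - D μ ν =
        H.ad (H.wordLogDeriv (F.map fun f => ((f l).1, dirDeriv (fun l => (f l).1) ν l)))
        (H.wordLogDeriv (F.map fun f => ((f l).1, dirDeriv (fun l => (f l).1) μ l))) := by
  induction F with
  | nil => exact ⟨0, fun μ ν => HasHDeriv.const _ _, fun μ ν => by simp [wordLogDeriv, ad]⟩
  | cons f F ih =>
    obtain ⟨D, hD1, hD2⟩ := ih fun g hg => hF g (by simp [hg])
    have hf := hF f (by simp)
    obtain ⟨D', hD1', hD2'⟩ := dexp_flat hH hN hf hl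
    have hT := H.isRep_ad hH
    set α := fun μ l => H.dexp (f l).1 (dirDeriv (fun l => (f l).1) μ l) with hα
    set β := fun μ l => H.wordLogDeriv
      (F.map fun f => ((f l).1, dirDeriv (fun l => (f l).1) μ l)) with hβ
    have h1 : ∀ μ ν, HasDirDeriv (fun l => opExp (H.ad (f l).1) (β μ l)) ν l
        (H.ad (α ν l) (opExp (H.ad (f l).1) (β μ l)) + opExp (H.ad (f l).1) (D ν μ)) :=
      fun μ ν => by
      have := HasHDeriv.app (𝕜 := ℂ) (t := 0) (Φ := fun t : ℂ => opExp (H.ad (f (l + t • ν)).1))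
        (Φ' := fun w => H.ad (α ν l) (opExp (H.ad (f l).1) w))
        (fun t => hT.opExp_hl _) ((hT.hl.right _).comp (hT.opExp_hl _)) (fun v => by
          have := hT.hasHDeriv_opExp hH (Y := fun t : ℂ => f (l + t • ν)) (t := 0)
            (hf.hasDirDeriv hl ν) v
          simp only [zero_smul, add_zero] at this
          exact this) (hD1 μ ν)
      simp only [zero_smul, add_zero] at this
      exact this
    refine ⟨fun ν μ => D' ν μ + (H.ad (α ν l) (opExp (H.ad (f l).1) (β μ l)) +
      opExp (H.ad (f l).1) (D ν μ)), fun μ ν => HasHDeriv.add (hD1' μ ν) (h1 μ ν), fun μ ν => ?_⟩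
    have h2 : ∀ μ, H.wordLogDeriv ((f :: F).map fun f => ((f l).1, dirDeriv (fun l => (f l).1) μ l))
        = α μ l + opExp (H.ad (f l).1) (β μ l) := fun μ => rfl
    rw [h2, h2]
    have h3 : opExp (H.ad (f l).1) (D ν μ) - opExp (H.ad (f l).1) (D μ ν) =
        H.ad (opExp (H.ad (f l).1) (β ν l)) (opExp (H.ad (f l).1) (β μ l)) := by
      rw [← (hT.opExp_hl (f l)).sub, hD2, hT.opExp_apply hH]
    have h4 : ∀ a b c d : ℕ → V, H.ad (a + b) (c + d) =
        H.ad a c + H.ad a d + (H.ad b c + H.ad b d) := fun a b c d => by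
      rw [(H.ad_hl₂.left _).add, (H.ad_hl₂.right _).add, (H.ad_hl₂.right _).add]
    rw [h4, ← h3, ← hD2' μ ν, ad_comm (opExp (H.ad (f l).1) (β ν l)) (α μ l)]
    have h5 : ∀ a b c a' b' c' : ℕ → V,
        a + (b + c) - (a' + (b' + c')) = a - a' + b + (-b' + (c - c')) := by intros; abel
    exact h5 _ _ _ _ _ _

namespace IsMeroTilde

variable {U : Set E} {x : E → H.Tilde} {θ : E → E → ℕ → V}

lemma hasLogDeriv (hx : H.IsMeroTilde U x θ) {l : E} (hl : l ∈ U) (μ : E) :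
    HasLogDeriv ℂ (fun t : ℂ => x (l + t • μ)) (θ l μ) 0 := by
  obtain ⟨N, hN, hlN, F, hF, h⟩ := hx.holo l hl
  refine ⟨F.map fun f (t : ℂ) => f (l + t • μ), ?_, ?_, ?_⟩
  · intro Y hY
    obtain ⟨f, hf, rfl⟩ := List.mem_map.1 hY
    exact ⟨_, (hF f hf).hasDirDeriv hlN μ⟩
  · refine ((tendsto_line l μ).eventually (hN.mem_nhds hlN)).mono fun t ht => ?_
    refine (h _ ht).1.trans ?_
    rw [List.map_map]
    rfl
  · rw [(h l hlN).2 μ, logDeriv, List.map_map]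
    congr 1
    refine List.map_congr_left fun f _ => ?_
    simp only [Function.comp_apply, zero_smul, add_zero]
    rfl

lemma flat (hH : H.LocallyFinite) (hx : H.IsMeroTilde U x θ) {l : E} (hl : l ∈ U) :
    ∃ D : E → E → ℕ → V, (∀ μ ν, HasDirDeriv (fun l => θ l μ) ν l (D ν μ)) ∧
      ∀ μ ν, D ν μ - D μ ν = H.ad (θ l ν) (θ l μ) := by
  obtain ⟨N, hN, hlN, F, hF, h⟩ := hx.holo l hl
  obtain ⟨D, h1, h2⟩ := wordLogDeriv_flat hH hN F hF hlN
  refine ⟨D, fun μ ν => (h1 μ ν).congr ?_, fun μ ν => ?_⟩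
  · exact Filter.eventuallyEq_of_mem (hN.mem_nhds hlN) fun l' hl' => (h l' hl').2 μ
  · rw [h2, (h l hlN).2, (h l hlN).2]

end IsMeroTilde
end DeformationHopfAlgebra

/-! ### Meromorphic functions -/

section Mero

variable {E E' : Type*} [NormedAddCommGroup E] [NormedSpace ℂ E] [NormedAddCommGroup E']
  [NormedSpace ℂ E']

lemma not_eventually_eq_zero_of_ne {h : E → ℂ} {l₀ p : E} {r : ℝ}
    (hh : AnalyticOnNhd ℂ h (Metric.ball l₀ r)) (hp : p ∈ Metric.ball l₀ r) (hne : h p ≠ 0) :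
    ∀ q ∈ Metric.ball l₀ r, ¬ ∀ᶠ l in 𝓝 q, h l = 0 := by
  intro q hq h0
  exact hne (hh.eqOn_zero_of_preconnected_of_eventuallyEq_zero
    (convex_ball l₀ r).isPreconnected hq h0 hp)

lemma exists_analyticOnNhd_ball {g : E → ℂ} {l₀ : E} (hg : AnalyticAt ℂ g l₀) :
    ∃ r > 0, AnalyticOnNhd ℂ g (Metric.ball l₀ r) := by
  obtain ⟨r, hr, h⟩ := Metric.eventually_nhds_iff_ball.1 hg.eventually_analyticAt
  exact ⟨r, hr, h⟩

/-- Germs of analytic functions in several variables form a domain. -/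
lemma not_eventually_eq_zero_mul {g h : E → ℂ} {l₀ : E} (hg : AnalyticAt ℂ g l₀)
    (hh : AnalyticAt ℂ h l₀) (hg0 : ¬ ∀ᶠ l in 𝓝 l₀, g l = 0) (hh0 : ¬ ∀ᶠ l in 𝓝 l₀, h l = 0) :
    ¬ ∀ᶠ l in 𝓝 l₀, g l * h l = 0 := by
  intro h0
  obtain ⟨r, hr, h1⟩ := exists_analyticOnNhd_ball hh
  obtain ⟨p, hp1, hp2, hp3, hp4⟩ := ((Filter.not_eventually.1 hg0).and_eventually
    (h0.eventually_nhds.and ((show ∀ᶠ l in 𝓝 l₀, l ∈ Metric.ball l₀ r from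
      Metric.ball_mem_nhds l₀ hr).and hg.eventually_analyticAt))).exists
  have h2 : ∀ᶠ l in 𝓝 p, h l = 0 := by
    filter_upwards [hp2, hp4.continuousAt.eventually_ne hp1] with l hl1 hl2
    exact (mul_eq_zero.1 hl1).resolve_left hl2
  refine hh0 ?_
  have h3 := h1.eqOn_zero_of_preconnected_of_eventuallyEq_zero
    (convex_ball l₀ r).isPreconnected hp3 h2
  exact Filter.eventually_of_mem (Metric.ball_mem_nhds l₀ hr) fun l hl => h3 hl

namespace IsMero

variable {U : Set E} {f g : E → ℂ}

lemma mono {U' : Set E} (hf : IsMero U f) (h : U' ⊆ U) : IsMero U' f :=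
  ⟨hf.1.mono h, fun l₀ => by
    obtain ⟨g, k, hg, hk, h0, h1⟩ := hf.2 l₀
    exact ⟨g, k, hg, hk, h0, h1.mono fun l hl hlU => hl (h hlU)⟩⟩

lemma const (c : ℂ) : IsMero U fun _ => c :=
  ⟨analyticOnNhd_const, fun l₀ => ⟨fun _ => c, fun _ => 1, analyticAt_const, analyticAt_const,
    by simp [(inferInstance : (𝓝 l₀).NeBot).ne], by simp⟩⟩

lemma add (hf : IsMero U f) (hg : IsMero U g) : IsMero U fun l => f l + g l :=
  ⟨hf.1.add hg.1, fun l₀ => by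
    obtain ⟨a, b, ha, hb, h0, h1⟩ := hf.2 l₀
    obtain ⟨a', b', ha', hb', h0', h1'⟩ := hg.2 l₀
    refine ⟨fun l => b' l * a l + b l * a' l, fun l => b l * b' l, (hb'.mul ha).add (hb.mul ha'),
      hb.mul hb', not_eventually_eq_zero_mul hb hb' h0 h0', ?_⟩
    filter_upwards [h1, h1'] with l hl hl' hlU
    rw [← hl hlU, ← hl' hlU]
    ring⟩

lemma mul (hf : IsMero U f) (hg : IsMero U g) : IsMero U fun l => f l * g l :=
  ⟨hf.1.mul hg.1, fun l₀ => by
    obtain ⟨a, b, ha, hb, h0, h1⟩ := hf.2 l₀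
    obtain ⟨a', b', ha', hb', h0', h1'⟩ := hg.2 l₀
    refine ⟨fun l => a l * a' l, fun l => b l * b' l, ha.mul ha',
      hb.mul hb', not_eventually_eq_zero_mul hb hb' h0 h0', ?_⟩
    filter_upwards [h1, h1'] with l hl hl' hlU
    rw [← hl hlU, ← hl' hlU]
    ring⟩

lemma fderiv (hf : IsMero U f) (hU : IsOpen U) (μ : E) : IsMero U fun l => fderiv ℂ f l μ := by
  have han : ∀ {k : E → ℂ} {l : E}, AnalyticAt ℂ k l →
      AnalyticAt ℂ (fun l => _root_.fderiv ℂ k l μ) l :=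
    fun hk => ((ContinuousLinearMap.apply ℂ ℂ μ).analyticAt _).comp hk.fderiv
  refine ⟨fun l hl => han (hf.1 l hl), fun l₀ => ?_⟩
  obtain ⟨a, b, ha, hb, h0, h1⟩ := hf.2 l₀
  refine ⟨fun l => b l * _root_.fderiv ℂ a l μ - _root_.fderiv ℂ b l μ * a l, fun l => b l * b l,
    (hb.mul (han ha)).sub ((han hb).mul ha), hb.mul hb, not_eventually_eq_zero_mul hb hb h0 h0, ?_⟩
  filter_upwards [h1.eventually_nhds, ha.eventually_analyticAt, hb.eventually_analyticAt]
    with l hl hal hbl hlU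
  have h2 : (fun l => b l * f l) =ᶠ[𝓝 l] a := by
    filter_upwards [hl, hU.mem_nhds hlU] with l' hl' hlU' using hl' hlU'
  have h3 := (hbl.differentiableAt.hasFDerivAt.mul
    (hf.1 l hlU).differentiableAt.hasFDerivAt).congr_of_eventuallyEq h2.symm
  have h4 := congrArg (fun k => k μ) h3.fderiv
  have h5 := hl.self_of_nhds hlU
  simp only [_root_.add_apply, _root_.smul_apply, smul_eq_mul] at h4
  rw [h4, ← h5]
  ring

/-- Pullback along a surjective linear map. -/
lemma comp {U' : Set E'} {f : E' → ℂ} (hf : IsMero U' f) (p : E →L[ℂ] E') (s : E' →L[ℂ] E)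
    (hps : ∀ l, p (s l) = l) : IsMero (p ⁻¹' U') fun l => f (p l) := by
  refine ⟨fun l hl => (hf.1 _ hl).comp (p.analyticAt l), fun l₀ => ?_⟩
  obtain ⟨a, b, ha, hb, h0, h1⟩ := hf.2 (p l₀)
  refine ⟨fun l => a (p l), fun l => b (p l), ha.comp (p.analyticAt l₀), hb.comp (p.analyticAt l₀),
    fun h => h0 ?_, p.continuous.continuousAt.eventually h1⟩
  have h2 : Tendsto (fun l => l₀ + s (l - p l₀)) (𝓝 (p l₀)) (𝓝 l₀) := by
    have : Continuous fun l => l₀ + s (l - p l₀) := by fun_prop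
    simpa using this.tendsto (p l₀)
  refine (h2.eventually h).mono fun l hl => ?_
  simpa [hps] using hl

/-- A function is meromorphic if its pullback along a surjective linear map is so. -/
lemma descend {O : Set E} (hd : Dense O) (p : E →L[ℂ] E') (s : E' →L[ℂ] E)
    (hps : ∀ l, p (s l) = l) {f : E' → ℂ} (hf : IsMero O fun l => f (p l)) : IsMero (p '' O) f := by
  have han : AnalyticOnNhd ℂ f (p '' O) := by
    rintro _ ⟨l, hl, rfl⟩
    have h1 : AnalyticAt ℂ (fun l' => l + s (l' - p l)) (p l) :=
      analyticAt_const.add ((s.analyticAt _).comp (analyticAt_id.sub analyticAt_const))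
    have h2 : AnalyticAt ℂ (fun l => f (p l)) (l + s (p l - p l)) := by simpa using hf.1 l hl
    have h3 := AnalyticAt.comp (f := fun l' => l + s (l' - p l)) h2 h1
    refine h3.congr (Filter.Eventually.of_forall fun l' => ?_)
    simp [hps]
  refine ⟨han, fun l₀ => ?_⟩
  obtain ⟨a, b, ha, hb, h0, h1⟩ := hf.2 (s l₀)
  obtain ⟨r₁, hr₁, h2⟩ := Metric.eventually_nhds_iff_ball.1
    (h1.and (ha.eventually_analyticAt.and hb.eventually_analyticAt))
  -- the relation `b * f = a` extends from the dense set `O` by continuity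
  have h3 : ∀ l ∈ Metric.ball (s l₀) r₁, p l ∈ p '' O → b l * f (p l) = a l := by
    intro l hl hlp
    have hc : ContinuousAt (fun l => b l * f (p l) - a l) l :=
      ((h2 l hl).2.2.continuousAt.mul ((han _ hlp).continuousAt.comp p.continuous.continuousAt)).sub
        (h2 l hl).2.1.continuousAt
    by_contra hne
    have h4 := hc.eventually_ne (sub_ne_zero.2 hne)
    have h5 : ∀ᶠ l' in 𝓝 l, l' ∈ Metric.ball (s l₀) r₁ := Metric.isOpen_ball.mem_nhds hl
    obtain ⟨l', hl'1, hl'2⟩ := (hd.inter_nhds_nonempty (h4.and h5))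
    exact hl'2.1 (sub_eq_zero.2 ((h2 l' hl'2.2).1 hl'1))
  -- a section near `l₀` along which `b` does not vanish identically
  have hcont : Continuous fun q : E × E' => q.1 + s (q.2 - p q.1) := by fun_prop
  have h4 : ∀ᶠ q : E × E' in 𝓝 (s l₀, l₀), q.1 + s (q.2 - p q.1) ∈ Metric.ball (s l₀) r₁ := by
    refine hcont.continuousAt.eventually ?_
    have : (fun q : E × E' => q.1 + s (q.2 - p q.1)) (s l₀, l₀) = s l₀ := by simp [hps]
    rw [this]
    exact Metric.ball_mem_nhds _ hr₁
  rw [nhds_prod_eq] at h4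
  obtain ⟨P₁, hP₁, P₂, hP₂, h5⟩ := Filter.eventually_prod_iff.1 h4
  obtain ⟨r₂, hr₂, h6⟩ := Metric.eventually_nhds_iff_ball.1 hP₂
  have h7 : ∀ᶠ l in 𝓝 (s l₀), p l ∈ Metric.ball l₀ r₂ := by
    refine p.continuous.continuousAt.eventually ?_
    rw [hps]
    exact Metric.ball_mem_nhds _ hr₂
  obtain ⟨l₁, hl1, hl2, hl3⟩ := ((Filter.not_eventually.1 h0).and_eventually (hP₁.and h7)).exists
  set σ : E' → E := fun l => l₁ + s (l - p l₁) with hσ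
  have hσb : ∀ l ∈ Metric.ball l₀ r₂, σ l ∈ Metric.ball (s l₀) r₁ := fun l hl => h5 hl2 (h6 l hl)
  have hσa : ∀ l, AnalyticAt ℂ σ l := fun l =>
    analyticAt_const.add ((s.analyticAt _).comp (analyticAt_id.sub analyticAt_const))
  have hpσ : ∀ l, p (σ l) = l := fun l => by simp [hσ, hps]
  have hbσ : AnalyticOnNhd ℂ (fun l => b (σ l)) (Metric.ball l₀ r₂) := fun l hl =>
    (h2 _ (hσb l hl)).2.2.comp (hσa l)
  refine ⟨fun l => a (σ l), fun l => b (σ l),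
    (h2 _ (hσb l₀ (Metric.mem_ball_self hr₂))).2.1.comp (hσa l₀),
    hbσ l₀ (Metric.mem_ball_self hr₂), ?_, ?_⟩
  · refine not_eventually_eq_zero_of_ne hbσ hl3 ?_ l₀ (Metric.mem_ball_self hr₂)
    have : σ (p l₁) = l₁ := by simp [hσ]
    simpa [this] using hl1
  · refine Filter.eventually_of_mem (Metric.ball_mem_nhds l₀ hr₂) fun l hl hlO => ?_
    have := h3 (σ l) (hσb l hl) (by rwa [hpσ])
    rwa [hpσ] at this

end IsMero

end Mero

/-! ### Algebras of meromorphic functions -/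

section Bundled

variable {E E' : Type*} [NormedAddCommGroup E] [NormedSpace ℂ E] [NormedAddCommGroup E']
  [NormedSpace ℂ E']
variable {W W₁ W₂ Z : Type*} [AddCommGroup W] [Module ℂ W] [AddCommGroup W₁] [Module ℂ W₁]
  [AddCommGroup W₂] [Module ℂ W₂] [AddCommGroup Z] [Module ℂ Z]

/-- The space of restrictions to `U` of the finite sums of scalar meromorphic functions, holomorphic
on `U`, times constant vectors. -/
def meroSub (U : Set E) (W : Type*) [AddCommGroup W] [Module ℂ W] : Submodule ℂ (U → W) where
  carrier := {F | ∃ (I : Type) (_ : Fintype I) (c : I → E → ℂ) (v : I → W),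
    (∀ i, IsMero U (c i)) ∧ ∀ l : U, F l = ∑ i, c i l • v i}
  add_mem' := by
    rintro F G ⟨I, _, c, v, h1, h2⟩ ⟨J, _, d, w, h3, h4⟩
    refine ⟨I ⊕ J, inferInstance, Sum.elim c d, Sum.elim v w, ?_, fun l => ?_⟩
    · rintro (i | i)
      · exact h1 i
      · exact h3 i
    · simp [h2, h4]
  zero_mem' := ⟨Empty, inferInstance, fun _ => 0, fun _ => 0, by simp, by simp⟩
  smul_mem' := by
    rintro a F ⟨I, _, c, v, h1, h2⟩
    refine ⟨I, inferInstance, c, fun i => a • v i, h1, fun l => ?_⟩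
    simp only [Pi.smul_apply, h2, Finset.smul_sum]
    exact Finset.sum_congr rfl fun i _ => smul_comm _ _ _

variable {U : Set E}

lemma const_mem_meroSub (w : W) : (fun _ : U => w) ∈ meroSub U W :=
  ⟨Unit, inferInstance, fun _ _ => 1, fun _ => w, fun _ => IsMero.const 1, by simp⟩

lemma smul_mem_meroSub {c : E → ℂ} (hc : IsMero U c) {F : U → W} (hF : F ∈ meroSub U W) :
    (fun l : U => c l • F l) ∈ meroSub U W := by
  obtain ⟨I, _, d, v, h1, h2⟩ := hF
  refine ⟨I, inferInstance, fun i l => c l * d i l, v, fun i => hc.mul (h1 i), fun l => ?_⟩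
  simp [h2, Finset.smul_sum, mul_smul]

lemma map_mem_meroSub (φ : W →ₗ[ℂ] Z) {F : U → W} (hF : F ∈ meroSub U W) :
    (fun l : U => φ (F l)) ∈ meroSub U Z := by
  obtain ⟨I, _, d, v, h1, h2⟩ := hF
  exact ⟨I, inferInstance, d, fun i => φ (v i), h1, fun l => by simp [h2]⟩

lemma sum_mem_meroSub {ι : Type*} (s : Finset ι) {F : ι → U → W}
    (hF : ∀ i ∈ s, F i ∈ meroSub U W) : (fun l : U => ∑ i ∈ s, F i l) ∈ meroSub U W := by
  have := Submodule.sum_mem (meroSub U W) hF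
  refine (iff_of_eq (congrArg (· ∈ meroSub U W) (funext fun l => ?_))).1 this
  simp

lemma bilin_mem_meroSub (b : W₁ →ₗ[ℂ] W₂ →ₗ[ℂ] Z) {F : U → W₁} {G : U → W₂}
    (hF : F ∈ meroSub U W₁) (hG : G ∈ meroSub U W₂) :
    (fun l : U => b (F l) (G l)) ∈ meroSub U Z := by
  obtain ⟨I, _, c, v, h1, h2⟩ := hF
  have h3 : (fun l : U => b (F l) (G l)) = fun l : U => ∑ i, c i l • b (v i) (G l) := by
    funext l
    simp [h2]
  rw [h3]
  exact sum_mem_meroSub _ fun i _ => smul_mem_meroSub (h1 i) (map_mem_meroSub (b (v i)) hG)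

/-- The value at `l` of a meromorphic function with values in `W[[ħ]]`. -/
def ev (l : U) (F : ℕ → meroSub U W) : ℕ → W := fun n => (F n).1 l

lemma ev_hl (l : U) : IsHL (ev l : (ℕ → meroSub U W) → (ℕ → W)) where
  add _ _ := rfl
  smul _ _ := rfl
  hs a := by funext n; cases n <;> rfl

lemma ext_ev {F G : ℕ → meroSub U W} (h : ∀ l, ev l F = ev l G) : F = G :=
  funext fun n => Subtype.ext (funext fun l => congrFun (h l) n)

/-- A meromorphic function with values in `W[[ħ]]`, from its values. -/
def mkMero (f : U → ℕ → W) (h : ∀ n, (fun l => f l n) ∈ meroSub U W) : ℕ → meroSub U W :=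
  fun n => ⟨fun l => f l n, h n⟩

/-- The function `f` on `E` represents `F`. -/
def Rep (f : E → ℕ → W) (F : ℕ → meroSub U W) : Prop := ∀ l (hl : l ∈ U), f l = ev ⟨l, hl⟩ F

lemma _root_.Deform.IsMeroF.mem {f : E → ℕ → W} (h : IsMeroF U f) (n : ℕ) :
    (fun l : U => f l n) ∈ meroSub U W := by
  obtain ⟨k, c, v, h1, h2⟩ := h n
  exact ⟨Fin k, inferInstance, c, v, h1, fun l => h2 l l.2⟩

lemma IsMeroF.exists_rep {f : E → ℕ → W} (h : IsMeroF U f) :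
    ∃ F : ℕ → meroSub U W, Rep f F := ⟨mkMero (fun l => f l) h.mem, fun _ _ => rfl⟩

lemma Rep.isMeroF {f : E → ℕ → W} {F : ℕ → meroSub U W} (h : Rep f F) : IsMeroF U f := by
  intro n
  obtain ⟨I, _, c, v, h1, h2⟩ := (F n).2
  let e := Fintype.equivFin I
  refine ⟨Fintype.card I, fun i => c (e.symm i), fun i => v (e.symm i), fun i => h1 _,
    fun l hl => ?_⟩
  rw [h l hl]
  refine (h2 ⟨l, hl⟩).trans ?_
  exact (e.symm.sum_comp fun i => c i l • v i).symm

/-- The pointwise application of a family of `ℂ[[ħ]]`-linear maps, which is meromorphic on constant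
vectors. -/
def liftFam (Ξ : E → (ℕ → W) → (ℕ → W₁)) (hΞ : ∀ l, IsHL (Ξ l))
    (hm : ∀ v n, (fun l : U => Ξ l (cst v) n) ∈ meroSub U W₁) (F : ℕ → meroSub U W) :
    ℕ → meroSub U W₁ :=
  mkMero (fun l => Ξ l (ev l F)) fun n => by
    have h1 : (fun l : U => Ξ l (ev l F) n) =
        fun l : U => ∑ p ∈ antidiagonal n, (hΞ l).coef p.2 ((F p.1).1 l) :=
      funext fun l => (hΞ l).apply_eq_coef _ _
    rw [h1]
    refine sum_mem_meroSub _ fun p _ => ?_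
    obtain ⟨I, _, c, v, h2, h3⟩ := (F p.1).2
    have h4 : (fun l : U => (hΞ l).coef p.2 ((F p.1).1 l)) =
        fun l : U => ∑ i, c i l • Ξ l (cst (v i)) p.2 := by
      funext l
      rw [h3, map_sum]
      exact Finset.sum_congr rfl fun i _ => map_smul _ _ _
    rw [h4]
    exact sum_mem_meroSub _ fun i _ => smul_mem_meroSub (h2 i) (hm _ _)

lemma ev_liftFam (Ξ : E → (ℕ → W) → (ℕ → W₁)) (hΞ : ∀ l, IsHL (Ξ l))
    (hm : ∀ v n, (fun l : U => Ξ l (cst v) n) ∈ meroSub U W₁) (F : ℕ → meroSub U W) (l : U) :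
    ev l (liftFam Ξ hΞ hm F) = Ξ l (ev l F) := rfl

lemma liftFam_hl (Ξ : E → (ℕ → W) → (ℕ → W₁)) (hΞ : ∀ l, IsHL (Ξ l))
    (hm : ∀ v n, (fun l : U => Ξ l (cst v) n) ∈ meroSub U W₁) : IsHL (liftFam Ξ hΞ hm) where
  add a b := ext_ev fun l => by
    rw [(ev_hl l).add, ev_liftFam, ev_liftFam, ev_liftFam, (ev_hl l).add, (hΞ l).add]
  smul c a := ext_ev fun l => by
    rw [(ev_hl l).smul, ev_liftFam, ev_liftFam, (ev_hl l).smul, (hΞ l).smul]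
  hs a := ext_ev fun l => by
    rw [(ev_hl l).hs, ev_liftFam, ev_liftFam, (ev_hl l).hs, (hΞ l).hs]

/-- The pointwise application of a `ℂ[[ħ]]`-linear map. -/
def liftHL {Φ : (ℕ → W) → (ℕ → W₁)} (hΦ : IsHL Φ) : (ℕ → meroSub U W) → (ℕ → meroSub U W₁) :=
  liftFam (fun _ => Φ) (fun _ => hΦ) fun _ _ => const_mem_meroSub _

lemma liftHL_hl {Φ : (ℕ → W) → (ℕ → W₁)} (hΦ : IsHL Φ) :
    IsHL (liftHL hΦ : (ℕ → meroSub U W) → (ℕ → meroSub U W₁)) := liftFam_hl _ _ _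

/-- Constant functions. -/
def cstF (w : ℕ → W) : ℕ → meroSub U W := mkMero (fun _ => w) fun _ => const_mem_meroSub _

/-- The pointwise application of a `ℂ[[ħ]]`-bilinear map. -/
def liftBil {B : (ℕ → W₁) → (ℕ → W₂) → (ℕ → Z)} (hB : IsHL₂ B) (F : ℕ → meroSub U W₁)
    (G : ℕ → meroSub U W₂) : ℕ → meroSub U Z :=
  mkMero (fun l => B (ev l F) (ev l G)) fun n => by
    have h1 : (fun l : U => B (ev l F) (ev l G) n) =
        fun l : U => ∑ p ∈ antidiagonal n, ∑ q ∈ antidiagonal p.2,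
          hB.coef q.2 ((F p.1).1 l) ((G q.1).1 l) := funext fun l => hB.apply_eq _ _ _
    rw [h1]
    exact sum_mem_meroSub _ fun p _ => sum_mem_meroSub _ fun q _ =>
      bilin_mem_meroSub _ (F p.1).2 (G q.1).2

lemma ev_liftBil {B : (ℕ → W₁) → (ℕ → W₂) → (ℕ → Z)} (hB : IsHL₂ B) (F : ℕ → meroSub U W₁)
    (G : ℕ → meroSub U W₂) (l : U) : ev l (liftBil hB F G) = B (ev l F) (ev l G) := rfl

lemma liftBil_hl₂ {B : (ℕ → W₁) → (ℕ → W₂) → (ℕ → Z)} (hB : IsHL₂ B) :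
    IsHL₂ (liftBil (U := U) hB) where
  left b := {
    add := fun a a' => ext_ev fun l => by
      simp only [(ev_hl l).add, ev_liftBil, (hB.left _).add]
    smul := fun c a => ext_ev fun l => by
      simp only [(ev_hl l).smul, ev_liftBil, (hB.left _).smul]
    hs := fun a => ext_ev fun l => by
      simp only [(ev_hl l).hs, ev_liftBil, (hB.left _).hs] }
  right a := {
    add := fun b b' => ext_ev fun l => by
      simp only [(ev_hl l).add, ev_liftBil, (hB.right _).add]
    smul := fun c b => ext_ev fun l => by
      simp only [(ev_hl l).smul, ev_liftBil, (hB.right _).smul]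
    hs := fun b => ext_ev fun l => by
      simp only [(ev_hl l).hs, ev_liftBil, (hB.right _).hs] }

/-- The algebra of meromorphic functions with values in an algebra. -/
def FAlg.mero (A : FAlg W) (U : Set E) : FAlg (meroSub U W) where
  mul := liftBil A.hl
  one := cstF A.one
  hl := liftBil_hl₂ A.hl
  assoc _ _ _ := ext_ev fun _ => A.assoc _ _ _
  one_mul _ := ext_ev fun _ => A.one_mul _
  mul_one _ := ext_ev fun _ => A.mul_one _

/-- Evaluation as a ring homomorphism. -/
def FAlg.evR (A : FAlg W) (l : U) : (A.mero U).Elt →+* A.Elt :=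
  FAlg.hom (ev l) (ev_hl l) rfl fun _ _ => rfl

lemma FAlg.ext_evR {A : FAlg W} {F G : (A.mero U).Elt} (h : ∀ l, A.evR l F = A.evR l G) : F = G :=
  ext_ev h

/-- The pointwise application of a ring homomorphism. -/
def FAlg.liftHom {A : FAlg W} {B : FAlg W₁} (Φ : A.Elt →+* B.Elt)
    (hΦ : IsHL (V := W) (W := W₁) Φ) (U : Set E) : (A.mero U).Elt →+* (B.mero U).Elt :=
  FAlg.hom (liftHL hΦ) (liftHL_hl hΦ) (ext_ev fun _ => map_one Φ)
    fun _ _ => ext_ev fun _ => map_mul Φ _ _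

lemma FAlg.evR_liftHom {A : FAlg W} {B : FAlg W₁} (Φ : A.Elt →+* B.Elt)
    (hΦ : IsHL (V := W) (W := W₁) Φ) (F : (A.mero U).Elt) (l : U) :
    B.evR l (FAlg.liftHom Φ hΦ U F) = Φ (A.evR l F) := rfl

/-- Constants in the algebra of functions. -/
def FAlg.const (A : FAlg W) (U : Set E) : A.Elt →+* (A.mero U).Elt where
  toFun a := cstF (W := W) a
  map_one' := rfl
  map_mul' _ _ := rfl
  map_zero' := rfl
  map_add' _ _ := rfl

lemma FAlg.evR_const (A : FAlg W) (a : A.Elt) (l : U) : A.evR l (A.const U a) = a := rfl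

/-! ### Derivations of the algebras of meromorphic functions -/

open Classical in
/-- The extension by zero. -/
def extF (F : ℕ → meroSub U W) (l : E) : ℕ → W := if h : l ∈ U then ev ⟨l, h⟩ F else 0

lemma rep_extF (F : ℕ → meroSub U W) : Rep (extF F) F := fun l hl => by simp [extF, hl]

lemma extF_apply (F : ℕ → meroSub U W) (l : U) : extF F l = ev l F := rep_extF F l l.2

lemma Rep.eventuallyEq {f g : E → ℕ → W} {F : ℕ → meroSub U W} (hU : IsOpen U) (hf : Rep f F)
    (hg : Rep g F) {l : E} (hl : l ∈ U) : f =ᶠ[𝓝 l] g :=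
  Filter.eventuallyEq_of_mem (hU.mem_nhds hl) fun l' hl' => (hf l' hl').trans (hg l' hl').symm

lemma hasWDeriv_sum {I : Type*} [Fintype I] {c : I → E → ℂ} (v : I → W) {l : E}
    (hc : ∀ i, AnalyticAt ℂ (c i) l) (μ : E) :
    HasWDeriv ℂ (fun t : ℂ => ∑ i, c i (l + t • μ) • v i) (∑ i, fderiv ℂ (c i) l μ • v i) 0 := by
  refine HasWDeriv.sum _ fun i _ => ?_
  have h2 : HasFDerivAt (c i) (fderiv ℂ (c i) l) (l + (0 : ℂ) • μ) := by
    rw [zero_smul, add_zero]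
    exact (hc i).differentiableAt.hasFDerivAt
  have h3 : HasDerivAt (fun t : ℂ => l + t • μ) μ 0 := by
    simpa using ((hasDerivAt_id (0 : ℂ)).smul_const μ).const_add l
  have h4 := HasWDeriv.smul (h2.comp_hasDerivAt (0 : ℂ) h3) (HasWDeriv.const (v i) (0 : ℂ))
  simpa using h4

lemma hasWDeriv_extF (hU : IsOpen U) (F : ℕ → meroSub U W) (n : ℕ) {I : Type*} [Fintype I]
    {c : I → E → ℂ} {v : I → W} (hc : ∀ i, IsMero U (c i))
    (h : ∀ l : U, (F n).1 l = ∑ i, c i l • v i) (μ : E) (l : U) :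
    HasWDeriv ℂ (fun t : ℂ => extF F (l + t • μ) n) (∑ i, fderiv ℂ (c i) l μ • v i) 0 := by
  refine (hasWDeriv_sum v (fun i => (hc i).1 l l.2) μ).congr ?_
  refine ((tendsto_line (l : E) μ).eventually (hU.mem_nhds l.2)).mono fun t ht => ?_
  exact (congrFun (rep_extF F _ ht) n).trans (h ⟨_, ht⟩)

lemma dirDeriv_mem (hU : IsOpen U) (F : ℕ → meroSub U W) (μ : E) (n : ℕ) :
    (fun l : U => dirDeriv (extF F) μ l n) ∈ meroSub U W := by
  obtain ⟨I, _, c, v, h1, h2⟩ := (F n).2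
  exact ⟨I, inferInstance, fun i l => fderiv ℂ (c i) l μ, v, fun i => (h1 i).fderiv hU μ,
    fun l => (hasWDeriv_extF hU F n h1 h2 μ l).wderiv_eq⟩

/-- The derivative in the direction `μ` of meromorphic functions on the open set `U`. -/
def dd (hU : IsOpen U) (μ : E) (F : ℕ → meroSub U W) : ℕ → meroSub U W :=
  mkMero (fun l => dirDeriv (extF F) μ l) (dirDeriv_mem hU F μ)

variable (hU : IsOpen U)

lemma hasDirDeriv_extF (F : ℕ → meroSub U W) (μ : E) (l : U) :
    HasDirDeriv (extF F) μ l (ev l (dd hU μ F)) := by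
  intro n
  obtain ⟨I, _, c, v, h1, h2⟩ := (F n).2
  have h3 := hasWDeriv_extF hU F n h1 h2 μ l
  have h4 : ev l (dd hU μ F) n = _ := h3.wderiv_eq
  rw [h4]
  exact h3

lemma Rep.hasDirDeriv {f : E → ℕ → W} {F : ℕ → meroSub U W} (h : Rep f F) (μ : E) (l : U) :
    HasDirDeriv f μ l (ev l (dd hU μ F)) :=
  (hasDirDeriv_extF hU F μ l).congr (h.eventuallyEq hU (rep_extF F) l.2)

lemma Rep.dirDeriv {f : E → ℕ → W} {F : ℕ → meroSub U W} (h : Rep f F) (μ : E) :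
    Rep (dirDeriv f μ) (dd hU μ F) := fun l hl => (h.hasDirDeriv hU μ ⟨l, hl⟩).eq

lemma Rep.ev_dd {f : E → ℕ → W} {F : ℕ → meroSub U W} (h : Rep f F) {μ : E} {l : U}
    {D : ℕ → W} (hD : HasDirDeriv f μ l D) : ev l (dd hU μ F) = D :=
  HasHDeriv.unique (h.hasDirDeriv hU μ l) hD

lemma dd_hl (μ : E) : IsHL (dd hU μ : (ℕ → meroSub U W) → _) where
  add F G := ext_ev fun l => by
    have h : Rep (fun l => extF F l + extF G l) (F + G) := fun l hl => by
      change extF F l + extF G l = _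
      rw [rep_extF F l hl, rep_extF G l hl]; rfl
    exact h.ev_dd hU ((hasDirDeriv_extF hU F μ l).add (hasDirDeriv_extF hU G μ l))
  smul c F := ext_ev fun l => by
    have h : Rep (fun l => c • extF F l) (c • F) := fun l hl => by
      change c • extF F l = _
      rw [rep_extF F l hl]; rfl
    exact h.ev_dd hU ((hasDirDeriv_extF hU F μ l).map (Φ := fun v => c • v)
      ⟨fun a b => smul_add _ _ _, fun c a => smul_comm _ _ _, fun a => (hs_smul _ _).symm⟩)
  hs F := ext_ev fun l => by
    have h : Rep (fun l => hs (extF F l)) (hs F) := fun l hl => by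
      change hs (extF F l) = _
      rw [rep_extF F l hl, (ev_hl _).hs]
    rw [(ev_hl l).hs]
    exact h.ev_dd hU
      ((hasDirDeriv_extF hU F μ l).map (Φ := Deform.hs) ⟨hs_add, hs_smul, fun _ => rfl⟩)

lemma dd_liftHL {Φ : (ℕ → W) → (ℕ → W₁)} (hΦ : IsHL Φ) (μ : E) (F : ℕ → meroSub U W) :
    dd hU μ (liftHL hΦ F) = liftHL hΦ (dd hU μ F) := ext_ev fun l => by
  have h : Rep (fun l => Φ (extF F l)) (liftHL hΦ F) := fun l hl => by
    change Φ (extF F l) = _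
    rw [rep_extF F l hl]; rfl
  exact h.ev_dd hU ((hasDirDeriv_extF hU F μ l).map hΦ)

lemma dd_cstF (w : ℕ → W) (μ : E) : dd hU μ (cstF w : ℕ → meroSub U W) = 0 := ext_ev fun l => by
  have h : Rep (fun _ : E => w) (cstF w : ℕ → meroSub U W) := fun l hl => rfl
  exact h.ev_dd hU (HasHDeriv.const w _)

/-- The Leibniz rule. -/
lemma dd_liftBil {B : (ℕ → W₁) → (ℕ → W₂) → (ℕ → Z)} (hB : IsHL₂ B) (μ : E)
    (F : ℕ → meroSub U W₁) (G : ℕ → meroSub U W₂) :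
    dd hU μ (liftBil hB F G) = liftBil hB (dd hU μ F) G + liftBil hB F (dd hU μ G) :=
  ext_ev fun l => by
    have h : Rep (fun l => B (extF F l) (extF G l)) (liftBil hB F G) := fun l hl => by
      change B (extF F l) (extF G l) = _
      rw [rep_extF F l hl, rep_extF G l hl]; rfl
    have := HasHDeriv.bilin hB (hasDirDeriv_extF hU F μ l) (hasDirDeriv_extF hU G μ l)
    simp only [zero_smul, add_zero, extF_apply] at this
    exact h.ev_dd hU this

/-- The derivative in the direction `μ`, on the algebra of meromorphic functions. -/
def FAlg.der (A : FAlg W) (hU : IsOpen U) (μ : E) (F : (A.mero U).Elt) : (A.mero U).Elt :=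
  dd (W := W) hU μ F

lemma FAlg.der_mul (A : FAlg W) (hU : IsOpen U) (μ : E) (F G : (A.mero U).Elt) :
    A.der hU μ (F * G) = A.der hU μ F * G + F * A.der hU μ G := dd_liftBil hU A.hl μ F G

/-- The derivative of the pointwise application of a family of linear maps. -/
lemma dd_liftFam {Ξ : E → (ℕ → W) → (ℕ → W₁)} (hΞ : ∀ l, IsHL (Ξ l))
    (hm : ∀ v n, (fun l : U => Ξ l (cst v) n) ∈ meroSub U W₁) {μ : E} {l : U}
    {Φ' : (ℕ → W) → (ℕ → W₁)} (hΦ' : ∀ v, HasDirDeriv (fun l => Ξ l v) μ l (Φ' v))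
    (F : ℕ → meroSub U W) :
    ev l (dd hU μ (liftFam Ξ hΞ hm F)) = Φ' (ev l F) + Ξ l (ev l (dd hU μ F)) := by
  have h : Rep (fun l => Ξ l (extF F l)) (liftFam Ξ hΞ hm F) := fun l hl => by
    change Ξ l (extF F l) = _
    rw [rep_extF F l hl]; rfl
  have := HasHDeriv.app (fun t => hΞ _) (HasHDeriv.isHL (fun t => hΞ _) hΦ') hΦ'
    (hasDirDeriv_extF hU F μ l)
  simp only [zero_smul, add_zero, extF_apply] at this
  exact h.ev_dd hU this

lemma ev_dd_apply (F : ℕ → meroSub U W) (n : ℕ) {I : Type*} [Fintype I]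
    {c : I → E → ℂ} {v : I → W} (hc : ∀ i, IsMero U (c i))
    (h : ∀ l : U, (F n).1 l = ∑ i, c i l • v i) (μ : E) (l : U) :
    ev l (dd hU μ F) n = ∑ i, fderiv ℂ (c i) l μ • v i :=
  (hasWDeriv_extF hU F n hc h μ l).wderiv_eq

lemma dd_comm (μ ν : E) (F : ℕ → meroSub U W) : dd hU μ (dd hU ν F) = dd hU ν (dd hU μ F) := by
  refine ext_ev fun l => funext fun n => ?_
  obtain ⟨I, _, c, v, h1, h2⟩ := (F n).2
  rw [ev_dd_apply hU (dd hU ν F) n (fun i => (h1 i).fderiv hU ν)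
    (fun l => ev_dd_apply hU F n h1 h2 ν l), ev_dd_apply hU (dd hU μ F) n
    (fun i => (h1 i).fderiv hU μ) (fun l => ev_dd_apply hU F n h1 h2 μ l)]
  refine Finset.sum_congr rfl fun i _ => ?_
  have h3 : ∀ μ ν, fderiv ℂ (fun l => fderiv ℂ (c i) l ν) l μ =
      fderiv ℂ (fderiv ℂ (c i)) l μ ν := by
    intro μ ν
    have h4 := ((h1 i).1.fderiv l l.2).differentiableAt.hasFDerivAt.clm_apply
      (hasFDerivAt_const ν (l : E))
    rw [h4.fderiv]
    simp
  have h5 : IsSymmSndFDerivAt ℂ (c i) l :=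
    ContDiffAt.isSymmSndFDerivAt_of_omega (((h1 i).1 l l.2).contDiffAt)
  rw [h3, h3, h5]

lemma dd_sum {ι : Type*} (s : Finset ι) (a : ι → ℂ) (μ : ι → E) (F : ℕ → meroSub U W) :
    dd hU (∑ i ∈ s, a i • μ i) F = ∑ i ∈ s, a i • dd hU (μ i) F := by
  refine ext_ev fun l => funext fun n => ?_
  obtain ⟨I, _, c, v, h1, h2⟩ := (F n).2
  have h3 : ev l (∑ i ∈ s, a i • dd hU (μ i) F) n = ∑ i ∈ s, a i • ev l (dd hU (μ i) F) n := by
    rw [(ev_hl l).sum, Finset.sum_apply]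
    rfl
  rw [h3]
  simp only [ev_dd_apply hU F n h1 h2, map_sum, map_smul, Finset.sum_smul, Finset.smul_sum,
    smul_assoc]
  exact Finset.sum_comm

/-- The pullback of meromorphic functions along a surjective linear map. -/
def pull {U' : Set E'} (p : E →L[ℂ] E') (s : E' →L[ℂ] E) (hps : ∀ l, p (s l) = l)
    (hp : ∀ l ∈ U, p l ∈ U') (F : ℕ → meroSub U' W) : ℕ → meroSub U W :=
  mkMero (fun l => ev ⟨p l, hp l l.2⟩ F) fun n => by
    obtain ⟨I, _, c, v, h1, h2⟩ := (F n).2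
    exact ⟨I, inferInstance, fun i l => c i (p l), v,
      fun i => ((h1 i).comp p s hps).mono hp, fun l => h2 _⟩

lemma pull_hl {U' : Set E'} (p : E →L[ℂ] E') (s : E' →L[ℂ] E) (hps : ∀ l, p (s l) = l)
    (hp : ∀ l ∈ U, p l ∈ U') : IsHL (pull (W := W) p s hps hp) where
  add _ _ := rfl
  smul _ _ := rfl
  hs F := by funext n; cases n <;> rfl

lemma dd_pull {U' : Set E'} (hU' : IsOpen U') (p : E →L[ℂ] E') (s : E' →L[ℂ] E)
    (hps : ∀ l, p (s l) = l) (hp : ∀ l ∈ U, p l ∈ U') (μ : E) (F : ℕ → meroSub U' W) :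
    dd hU μ (pull p s hps hp F) = pull p s hps hp (dd hU' (p μ) F) := ext_ev fun l => by
  have h : Rep (fun l => extF F (p l)) (pull p s hps hp F) := fun l hl => rep_extF F _ _
  refine h.ev_dd hU ?_
  have := hasDirDeriv_extF hU' F (p μ) ⟨p l, hp l l.2⟩
  simp only [HasDirDeriv, map_add, map_smul]
  exact this

/-! ### Taylor expansions -/

/-- `hExp` computes the exponential of an operator on the algebra of meromorphic functions. -/
lemma rep_hExp {Dr : (E → ℕ → W) → (E → ℕ → W)} {D : (ℕ → meroSub U W) → (ℕ → meroSub U W)}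
    (hD : ∀ f F, Rep f F → Rep (Dr f) (D F)) {f : E → ℕ → W} {F : ℕ → meroSub U W} (h : Rep f F) :
    Rep (hExp Dr f) (hexp D F) := by
  have h1 : ∀ k, Rep (Dr^[k] f) (D^[k] F) := by
    intro k
    induction k with
    | zero => exact h
    | succ k ih =>
      rw [Function.iterate_succ_apply', Function.iterate_succ_apply']
      exact hD _ _ ih
  intro l hl
  have h2 : ev ⟨l, hl⟩ (hexp D F) = hsum fun k => hcoef k • ev ⟨l, hl⟩ (D^[k] F) := by
    rw [hexp, (ev_hl _).hsum]
    rfl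
  rw [h2]
  funext n
  simp only [hExp, hsum, Finset.Nat.sum_antidiagonal_eq_sum_range_succ_mk]
  refine Finset.sum_congr rfl fun k _ => ?_
  rw [h1 k l hl]
  rfl

end Bundled

namespace DeformationHopfAlgebra

variable {V : Type*} [AddCommGroup V] [Module ℂ V] {H : DeformationHopfAlgebra V}
variable {W W₁ W₂ : Type*} [AddCommGroup W] [Module ℂ W] [AddCommGroup W₁] [Module ℂ W₁]
  [AddCommGroup W₂] [Module ℂ W₂]

/-! ### Two-sided actions of the group `H~ˣ` -/

/-- Tensor products of locally finite actions are locally finite. -/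
lemma isLocFin_tensor {P : Set V} {T₁ : (ℕ → V) → (ℕ → W₁) → (ℕ → W₁)}
    {T₂ : (ℕ → V) → (ℕ → W₂) → (ℕ → W₂)}
    {T : (ℕ → V) → (ℕ → W₁ ⊗[ℂ] W₂) → (ℕ → W₁ ⊗[ℂ] W₂)} (hT : ∀ y, IsHL (T y))
    (h₁ : IsLocFin P fun X u => T₁ (cst X) (cst u) 0)
    (h₂ : IsLocFin P fun X u => T₂ (cst X) (cst u) 0)
    (h : ∀ y a b, T y (ften a b) = ften (T₁ y a) b + ften a (T₂ y b)) :
    IsLocFin P fun X u => T (cst X) (cst u) 0 := by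
  have hadd : ∀ X u v, T (cst X) (cst (u + v)) 0 = T (cst X) (cst u) 0 + T (cst X) (cst v) 0 :=
    fun X u v => by rw [cst_add, (hT _).add]; rfl
  have hsum : ∀ {M : Submodule ℂ (W₁ ⊗[ℂ] W₂)} {S : Set (W₁ ⊗[ℂ] W₂)} {X : V},
      (∀ u ∈ S, T (cst X) (cst u) 0 ∈ M) → ∀ u ∈ Submodule.span ℂ S, T (cst X) (cst u) 0 ∈ M := by
    intro M S X hS u hu
    induction hu using Submodule.span_induction with
    | mem u hu => exact hS u hu
    | zero => rw [cst_zero', (hT _).zero]; exact M.zero_mem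
    | add u v _ _ hu hv => rw [hadd]; exact M.add_mem hu hv
    | smul c u _ hu => rw [cst_smul, (hT _).smul]; exact M.smul_mem c hu
  intro w
  induction w using TensorProduct.induction_on with
  | zero => exact ⟨⊥, Submodule.fg_bot, Submodule.zero_mem _, fun X _ u hu => by
      rw [(Submodule.mem_bot ℂ).1 hu]
      change T (cst X) (cst 0) 0 ∈ _
      rw [cst_zero', (hT _).zero]; exact Submodule.zero_mem _⟩
  | tmul w w' =>
    obtain ⟨M, hM1, hM2, hM3⟩ := h₁ w
    obtain ⟨M', hM1', hM2', hM3'⟩ := h₂ w'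
    refine ⟨Submodule.map₂ (TensorProduct.mk ℂ W₁ W₂) M M', hM1.map₂ _ hM1',
      Submodule.apply_mem_map₂ _ hM2 hM2', fun X hX => ?_⟩
    rw [Submodule.map₂_eq_span_image2]
    refine hsum ?_
    rintro _ ⟨a, ha, b, hb, rfl⟩
    have h3 : T (cst X) (cst (a ⊗ₜ[ℂ] b)) 0 =
        T₁ (cst X) (cst a) 0 ⊗ₜ[ℂ] b + a ⊗ₜ[ℂ] T₂ (cst X) (cst b) 0 := by
      rw [← ften_cst, h]
      simp [ften]
    change T (cst X) (cst (a ⊗ₜ[ℂ] b)) 0 ∈ _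
    rw [h3]
    exact Submodule.add_mem _ (Submodule.subset_span ⟨_, hM3 X hX a ha, _, hb, rfl⟩)
      (Submodule.subset_span ⟨_, ha, _, hM3' X hX b hb, rfl⟩)
  | add u v hu hv =>
    obtain ⟨M, hM1, hM2, hM3⟩ := hu
    obtain ⟨M', hM1', hM2', hM3'⟩ := hv
    refine ⟨M ⊔ M', hM1.sup hM1', Submodule.add_mem_sup hM2 hM2', fun X hX u hu => ?_⟩
    obtain ⟨a, ha, b, hb, rfl⟩ := Submodule.mem_sup.1 hu
    change T (cst X) (cst (a + b)) 0 ∈ _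
    rw [hadd]
    exact Submodule.add_mem_sup (hM3 X hX a ha) (hM3' X hX b hb)

/-- The trivial action. -/
lemma isRep_zero : H.IsRep (fun _ (_ : ℕ → W) => 0) where
  hl := ⟨fun _ => IsHL.const_zero, fun _ => IsHL.const_zero⟩
  lie _ _ _ := (sub_self _).symm
  lf w := ⟨Submodule.span ℂ {w}, Submodule.fg_span_singleton w,
    Submodule.mem_span_singleton_self w, fun _ _ _ _ => Submodule.zero_mem _⟩

variable (H) in
/-- A `ℂ[[ħ]]`-linear map from `H` to an algebra which, modulo `ħ`, gives a locally finite
commutator action of `𝔤`. -/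
structure Ref (A : FAlg W) where
  toFun : H.A₁ → A.Elt
  lf : IsLocFin H.prim₀ fun X u => (A.mul (toFun (cst X)) (cst u) - A.mul (cst u) (toFun (cst X))) 0

/-- A Lie homomorphism from `H` to an algebra, which on `𝔩` is congruent to `r` modulo `ħ`. -/
structure LieMap {A : FAlg W} (r : H.Ref A) where
  toFun : H.A₁ → A.Elt
  hl : IsHL (V := V) (W := W) toFun
  lie : ∀ y z, toFun (y * z - z * y) = toFun y * toFun z - toFun z * toFun y
  mod : ∀ y : ℕ → V, y 0 ∈ H.prim₀ → toFun y 0 = r.toFun y 0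

instance {A : FAlg W} (r : H.Ref A) : CoeFun (LieMap r) fun _ => H.A₁ → A.Elt := ⟨LieMap.toFun⟩

section Conj

variable {A : FAlg W} {r : H.Ref A}

/-- The operator `v ↦ f(y) v - v g(y)`. -/
def two (f g : LieMap r) (y : ℕ → V) (v : ℕ → W) : ℕ → W := A.mul (f y) v - A.mul v (g y)

lemma isRep_two (f g : LieMap r) : H.IsRep (two f g) where
  hl := (A.hl.comp_left f.hl).fsub (A.hl.flip.comp_left g.hl)
  lie y z v := by
    have h : ∀ a b a' b' c : A.Elt, (a * b - b * a) * c - c * (a' * b' - b' * a') =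
        (a * (b * c - c * b') - (b * c - c * b') * a') -
          (b * (a * c - c * a') - (a * c - c * a') * b') := fun a b a' b' c => by noncomm_ring
    have h1 : ∀ (y z : H.A₁) (v : A.Elt), f (y * z - z * y) * v - v * g (y * z - z * y) =
        (f y * (f z * v - v * g z) - (f z * v - v * g z) * g y) -
          (f z * (f y * v - v * g y) - (f y * v - v * g y) * g z) := fun y z v => by
      rw [f.lie, g.lie, h]
    exact h1 y z v
  lf w := by
    obtain ⟨M, h1, h2, h3⟩ := r.lf w
    refine ⟨M, h1, h2, fun X hX u hu => ?_⟩
    have h4 : two f g (cst X) (cst u) 0 =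
        (A.mul (r.toFun (cst X)) (cst u) - A.mul (cst u) (r.toFun (cst X))) 0 := by
      have hf : ∀ m ≤ 0, f.toFun (cst X) m = r.toFun (cst X) m := fun m hm => by
        obtain rfl : m = 0 := by omega
        exact f.mod (cst X) hX
      have hg : ∀ m ≤ 0, g.toFun (cst X) m = r.toFun (cst X) m := fun m hm => by
        obtain rfl : m = 0 := by omega
        exact g.mod (cst X) hX
      exact congrArg₂ (· - ·) ((A.hl.left (cst u)).congr hf) ((A.hl.right (cst u)).congr hg)
    change two f g (cst X) (cst u) 0 ∈ M
    rw [h4]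
    exact h3 X hX u hu

variable (hH : H.LocallyFinite)

/-- The element `f(x) v g(x)⁻¹`. -/
def conj (f g : LieMap r) (x : H.Tilde) (v : A.Elt) : A.Elt := (isRep_two f g).hom hH x v

lemma twoSided_eq (f g : LieMap r) (x : H.Tilde) (v : ℕ → W) :
    H.twoSided A.mul f g x v = conj hH f g x v := by
  classical
  have h : ∀ y : ℕ → V, (fun w => -two f g y w) = fun w => A.mul w (g y) - A.mul (f y) w :=
    fun y => funext fun w => neg_sub _ _
  refine Eq.trans ?_ ((isRep_two f g).hom_eq_foldr hH x v).symm
  simp only [h]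
  rfl

lemma conj_hl (f g : LieMap r) (x : H.Tilde) : IsHL (V := W) (W := W) (conj hH f g x) :=
  (isRep_two f g).hom_hl hH x

lemma conj_injective (f g : LieMap r) (x : H.Tilde) : Function.Injective (conj hH f g x) :=
  ((isRep_two f g).hom hH x).injective

lemma conj_inv_conj (f g : LieMap r) (x : H.Tilde) (v : A.Elt) :
    conj hH f g x⁻¹ (conj hH f g x v) = v := (isRep_two f g).hom_inv_hom hH x v

lemma conj_conj_inv (f g : LieMap r) (x : H.Tilde) (v : A.Elt) :
    conj hH f g x (conj hH f g x⁻¹ v) = v := (isRep_two f g).hom_hom_inv hH x v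

/-- `f(x) v g(x)⁻¹ g(x) w h(x)⁻¹ = f(x) v w h(x)⁻¹`. -/
lemma conj_mul (f g h : LieMap r) (x : H.Tilde) (v w : A.Elt) :
    conj hH f g x v * conj hH g h x w = conj hH f h x (v * w) := by
  refine ((isRep_two f h).hom_bilin hH (isRep_two f g) (isRep_two g h) A.hl (fun y a b => ?_)
    x v w).symm
  have h : ∀ a b p q s : A.Elt,
      p * (a * b) - a * b * s = (p * a - a * q) * b + a * (q * b - b * s) :=
    fun a b p q s => by noncomm_ring
  exact h _ _ _ _ _

lemma conj_one (f : LieMap r) (x : H.Tilde) : conj hH f f x 1 = 1 :=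
  (isRep_two f f).hom_fixed hH (fun y => by
    have h : ∀ a : A.Elt, a * 1 - 1 * a = 0 := fun a => by simp
    exact h (f y)) x

lemma conj_map {B : FAlg W₁} {r' : H.Ref B} {f g : LieMap r} {f' g' : LieMap r'}
    {Φ : A.Elt → B.Elt} (hΦ : IsHL (V := W) (W := W₁) Φ)
    (h : ∀ y v, Φ (f y * v - v * g y) = f' y * Φ v - Φ v * g' y) (x : H.Tilde) (v : A.Elt) :
    Φ (conj hH f g x v) = conj hH f' g' x (Φ v) :=
  (isRep_two f g).hom_map hH (isRep_two f' g') hΦ (fun y v => h y v) x v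

lemma conj_fixed (f g : LieMap r) {v : A.Elt} (h : ∀ y, f y * v = v * g y) (x : H.Tilde) :
    conj hH f g x v = v :=
  (isRep_two f g).hom_fixed hH (fun y => sub_eq_zero.2 (h y)) x

/-- `f(x) v g(x)⁻¹` is congruent to `1` modulo `ħ` if `v` is. -/
lemma conj_apply_zero (f g : LieMap r) (x : H.Tilde) {v : A.Elt} (hv : v 0 = A.one 0) :
    conj hH f g x v 0 = A.one 0 := by
  refine (isRep_two f g).hom_apply_zero hH (v := A.one 0) (fun y => ?_) x v hv
  have h1 : ∀ m ≤ 0, f.toFun y.1 m = g.toFun y.1 m := fun m hm => by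
    obtain rfl : m = 0 := by omega
    exact (f.mod y.1 y.2).trans (g.mod y.1 y.2).symm
  have h2 : ∀ m ≤ 0, (cst (A.one 0) : ℕ → W) m = A.one m := fun m hm => by
    obtain rfl : m = 0 := by omega
    rfl
  have h3 : two f g y.1 (cst (A.one 0)) 0 = (A.mul (g y.1) A.one - A.mul A.one (g y.1)) 0 :=
    congrArg₂ (· - ·) (((A.hl.left _).congr h1).trans ((A.hl.right _).congr h2))
      ((A.hl.left _).congr h2)
  refine h3.trans ?_
  have h4 : ∀ a : ℕ → W, (A.mul a A.one - A.mul A.one a) 0 = 0 := fun a => by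
    rw [A.mul_one, A.one_mul, sub_self]; rfl
  exact h4 _

end Conj

variable (H)

/-! ### The Lie homomorphisms from `H` to `H`, `H ⊗ H`, `H ⊗ H ⊗ H` -/

/-- The identity of `H` as a reference map. -/
def ref₁ (hH : H.LocallyFinite) : H.Ref H.alg₁ := ⟨id, (H.isRep_ad hH).lf⟩

/-- `y ↦ y¹ + y²`. -/
def lg (y : H.A₁) : H.A₂ := H.l1 y + H.l2 y

/-- `y ↦ y¹ + y² + y³`. -/
def lg₃ (y : H.A₁) : H.A₃ := H.l12 (H.lg y) + H.l3 y

lemma lg_hl : IsHL (V := V) (W := V ⊗[ℂ] V) H.lg := H.l1_hl.fadd H.l2_hl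

lemma lg₃_hl : IsHL (V := V) (W := (V ⊗[ℂ] V) ⊗[ℂ] V) H.lg₃ :=
  (H.l12_hl.comp H.lg_hl).fadd H.l3_hl

section Pure

variable (y a b : H.A₁) (u v : H.A₂)

lemma l1_mul_t₂ : H.l1 y * H.t₂ a b = H.t₂ (y * a) b := by
  rw [← l1_mul_l2, ← _root_.mul_assoc, ← map_mul, l1_mul_l2]

lemma l2_mul_t₂ : H.l2 y * H.t₂ a b = H.t₂ a (y * b) := by
  rw [← l2_mul_l1, ← _root_.mul_assoc, ← map_mul, l2_mul_l1]

lemma t₂_mul_l1 : H.t₂ a b * H.l1 y = H.t₂ (a * y) b := by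
  rw [← l2_mul_l1, _root_.mul_assoc, ← map_mul, l2_mul_l1]

lemma t₂_mul_l2 : H.t₂ a b * H.l2 y = H.t₂ a (b * y) := by
  rw [← l1_mul_l2, _root_.mul_assoc, ← map_mul, l1_mul_l2]

lemma l12_mul_t₃ : H.l12 v * H.t₃ u b = H.t₃ (v * u) b := by
  rw [← l12_mul_l3, ← _root_.mul_assoc, ← map_mul, l12_mul_l3]

lemma l3_mul_t₃ : H.l3 y * H.t₃ u b = H.t₃ u (y * b) := by
  rw [← l3_mul_l12, ← _root_.mul_assoc, ← map_mul, l3_mul_l12]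

lemma t₃_mul_l12 : H.t₃ u b * H.l12 v = H.t₃ (u * v) b := by
  rw [← l3_mul_l12, _root_.mul_assoc, ← map_mul, l3_mul_l12]

lemma t₃_mul_l3 : H.t₃ u b * H.l3 y = H.t₃ u (b * y) := by
  rw [← l12_mul_l3, _root_.mul_assoc, ← map_mul, l12_mul_l3]

lemma t₂_sub_left (c : H.A₁) : H.t₂ (a - c) b = H.t₂ a b - H.t₂ c b := (H.t₂_hl₂.left b).sub a c

lemma t₂_sub_right (c : H.A₁) : H.t₂ a (b - c) = H.t₂ a b - H.t₂ a c := (H.t₂_hl₂.right a).sub b c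

lemma t₃_sub_left : H.t₃ (u - v) b = H.t₃ u b - H.t₃ v b := (H.t₃_hl₂.left b).sub u v

lemma t₃_sub_right (c : H.A₁) : H.t₃ u (b - c) = H.t₃ u b - H.t₃ u c := (H.t₃_hl₂.right u).sub b c

lemma comm_lg_t₂ : H.lg y * H.t₂ a b - H.t₂ a b * H.lg y =
    H.t₂ (y * a - a * y) b + H.t₂ a (y * b - b * y) := by
  rw [t₂_sub_left, t₂_sub_right, lg, add_mul, mul_add, l1_mul_t₂, l2_mul_t₂, t₂_mul_l1, t₂_mul_l2]
  abel

lemma comm_l12_add_l3_t₃ (p q : H.A₂) : (H.l12 p + H.l3 y) * H.t₃ u b -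
    H.t₃ u b * (H.l12 q + H.l3 y) = H.t₃ (p * u - u * q) b + H.t₃ u (y * b - b * y) := by
  rw [t₃_sub_left, t₃_sub_right, add_mul, mul_add, l12_mul_t₃, l3_mul_t₃, t₃_mul_l12,
    t₃_mul_l3]
  abel

end Pure

variable (hH : H.LocallyFinite)

/-- `H ⊗ H` with the commutator action of `y¹ + y²`. -/
def ref₂ : H.Ref H.alg₂ := ⟨H.lg, isLocFin_tensor
  (T := fun y u => H.alg₂.mul (H.lg y) u - H.alg₂.mul u (H.lg y)) (T₁ := H.ad) (T₂ := H.ad)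
  (fun _ => (H.alg₂.hl.right _).fsub (H.alg₂.hl.left _)) (H.isRep_ad hH).lf (H.isRep_ad hH).lf
  fun y a b => H.comm_lg_t₂ y a b⟩

/-- `H ⊗ H ⊗ H` with the commutator action of `y¹ + y² + y³`. -/
def ref₃ : H.Ref H.alg₃ := ⟨H.lg₃, isLocFin_tensor
  (T := fun y u => H.alg₃.mul (H.lg₃ y) u - H.alg₃.mul u (H.lg₃ y))
  (T₁ := fun y u => H.alg₂.mul (H.lg y) u - H.alg₂.mul u (H.lg y)) (T₂ := H.ad)
  (fun _ => (H.alg₃.hl.right _).fsub (H.alg₃.hl.left _)) (H.ref₂ hH).lf (H.isRep_ad hH).lf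
  fun y a b => H.comm_l12_add_l3_t₃ y b a (H.lg y) (H.lg y)⟩

/-- `H ⊗ H ⊗ H` with the commutator action of `y¹ + y²`. -/
def ref₁₂ : H.Ref H.alg₃ := ⟨fun y => H.l12 (H.lg y), isLocFin_tensor
  (T := fun y u => H.alg₃.mul (H.l12 (H.lg y)) u - H.alg₃.mul u (H.l12 (H.lg y)))
  (T₁ := fun y u => H.alg₂.mul (H.lg y) u - H.alg₂.mul u (H.lg y)) (T₂ := fun _ _ => 0)
  (fun _ => (H.alg₃.hl.right _).fsub (H.alg₃.hl.left _)) (H.ref₂ hH).lf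
  (isRep_zero (H := H)).lf fun y a b => by
    have h : ∀ (y : H.A₁) (a : H.A₂) (b : H.A₁), H.l12 (H.lg y) * H.t₃ a b -
        H.t₃ a b * H.l12 (H.lg y) = H.t₃ (H.lg y * a - a * H.lg y) b + H.t₃ a 0 :=
      fun y a b => by
        rw [show H.t₃ a 0 = 0 from (H.t₃_hl₂.right a).zero, l12_mul_t₃, t₃_mul_l12, t₃_sub_left,
          add_zero]
    exact h y a b⟩

lemma Δh_mod {y : ℕ → V} (hy : y 0 ∈ H.prim₀) : H.Δh y 0 = H.lg y 0 := by
  have h1 : H.Δ y 0 = H.comul 0 (y 0) := by simp [Δ, FHom.app]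
  have h2 : (H.leg1 y + H.leg2 y) 0 = y 0 ⊗ₜ[ℂ] H.one 0 + H.one 0 ⊗ₜ[ℂ] y 0 := by
    simp [leg1, leg2, ften]
  exact h1.trans (hy.trans h2.symm)

lemma _root_.Deform.mod_congr {W₁ W₂ : Type*} [AddCommGroup W₁] [Module ℂ W₁]
    [AddCommGroup W₂] [Module ℂ W₂] {Φ : (ℕ → W₁) → (ℕ → W₂)} (hΦ : IsHL Φ) {a b : ℕ → W₁} (h : a 0 = b 0) :
    Φ a 0 = Φ b 0 :=
  hΦ.congr fun m hm => by
    obtain rfl : m = 0 := by omega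
    exact h

/-- The sum of two commuting Lie homomorphisms. -/
lemma lie_add {A : FAlg W} {F G : H.A₁ → A.Elt}
    (hF : ∀ y z, F (y * z - z * y) = F y * F z - F z * F y)
    (hG : ∀ y z, G (y * z - z * y) = G y * G z - G z * G y) (h : ∀ y z, Commute (F y) (G z)) (y z) :
    F (y * z - z * y) + G (y * z - z * y) =
      (F y + G y) * (F z + G z) - (F z + G z) * (F y + G y) := by
  rw [hF, hG]
  have h1 := (h y z).eq
  have h2 := (h z y).eq
  simp only [add_mul, mul_add, h1, h2]
  abel

lemma lie_hom {A : FAlg W} (Φ : H.A₁ →+* A.Elt) (y z : H.A₁) :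
    Φ (y * z - z * y) = Φ y * Φ z - Φ z * Φ y := by simp

lemma lie_lg (y z : H.A₁) : H.lg (y * z - z * y) = H.lg y * H.lg z - H.lg z * H.lg y :=
  H.lie_add (F := H.l1) (G := H.l2) (H.lie_hom H.l1) (H.lie_hom H.l2) H.commute_l1_l2 y z

/-- The identity of `H`. -/
def mId : LieMap (H.ref₁ hH) := ⟨fun y => y, IsHL.id, fun _ _ => rfl, fun _ _ => rfl⟩

/-- The coproduct. -/
def mΔ : LieMap (H.ref₂ hH) := ⟨H.Δh, H.Δ_hl, H.lie_hom H.Δh, fun _ hy => H.Δh_mod hy⟩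

/-- `y ↦ y¹ + y²`. -/
def mLg : LieMap (H.ref₂ hH) := ⟨H.lg, H.lg_hl, H.lie_lg, fun _ _ => rfl⟩

/-- The opposite coproduct. -/
def mΔop : LieMap (H.ref₂ hH) := ⟨fun y => H.fl (H.Δh y), H.fl_hl.comp H.Δ_hl,
  H.lie_hom (H.fl.comp H.Δh), fun y hy => by
    have h : ∀ y : H.A₁, H.fl (H.lg y) = H.lg y := fun y => by
      rw [lg, map_add, fl_l1, fl_l2, add_comm]
    exact (mod_congr H.fl_hl (H.Δh_mod hy)).trans (congrFun (h y) 0)⟩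

/-- `y ↦ Δ(y) ⊗ 1`. -/
def mΔ₁₂ : LieMap (H.ref₁₂ hH) := ⟨fun y => H.l12 (H.Δh y), H.l12_hl.comp H.Δ_hl,
  H.lie_hom (H.l12.comp H.Δh), fun _ hy => mod_congr H.l12_hl (H.Δh_mod hy)⟩

/-- `y ↦ y¹ + y²` in `H ⊗ H ⊗ H`. -/
def mLg₁₂ : LieMap (H.ref₁₂ hH) := ⟨fun y => H.l12 (H.lg y), H.l12_hl.comp H.lg_hl,
  fun y z => by rw [lie_lg, map_sub, map_mul, map_mul], fun _ _ => rfl⟩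

/-- `y ↦ y¹ + y² + y³`. -/
def mLg₃ : LieMap (H.ref₃ hH) := ⟨H.lg₃, H.lg₃_hl,
  H.lie_add (F := fun y => H.l12 (H.lg y)) (G := H.l3) (mLg₁₂ H hH).lie (H.lie_hom H.l3)
    fun _ _ => H.commute_l12_l3 _ _, fun _ _ => rfl⟩

/-- `y ↦ Δ(y) ⊗ 1 + 1 ⊗ 1 ⊗ y`. -/
def mΔ₃ : LieMap (H.ref₃ hH) := ⟨fun y => H.l12 (H.Δh y) + H.l3 y,
  (H.l12_hl.comp H.Δ_hl).fadd H.l3_hl,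
  H.lie_add (F := fun y => H.l12 (H.Δh y)) (G := H.l3) (mΔ₁₂ H hH).lie (H.lie_hom H.l3)
    fun _ _ => H.commute_l12_l3 _ _,
  fun y hy => congrArg (· + H.l3 y 0) ((mΔ₁₂ H hH).mod y hy)⟩

/-- `y ↦ y ⊗ 1 ⊗ 1 + 1 ⊗ Δ(y)`. -/
def m₃Δ : LieMap (H.ref₃ hH) := ⟨fun y => H.l12 (H.l1 y) + H.l23 (H.Δh y),
  (H.l12_hl.comp H.l1_hl).fadd (H.l23_hl.comp H.Δ_hl),
  H.lie_add (F := fun y => H.l12 (H.l1 y)) (G := fun y => H.l23 (H.Δh y))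
    (H.lie_hom (H.l12.comp H.l1)) (H.lie_hom (H.l23.comp H.Δh))
    fun _ _ => H.commute_l1_l23 _ _,
  fun y hy => by
    have h : ∀ y : H.A₁, H.l12 (H.l1 y) + H.l23 (H.lg y) = H.lg₃ y := fun y => by
      rw [lg₃, lg, map_add, map_add, l23_l1, l23_l2, add_assoc]
    exact (congrArg (H.l12 (H.l1 y) 0 + ·) (mod_congr H.l23_hl (H.Δh_mod hy))).trans
      (congrFun (h y) 0)⟩

/-- The iterated coproduct. -/
def mΔΔ : LieMap (H.ref₃ hH) := ⟨fun y => H.cL (H.Δh y), H.cL_hl.comp H.Δ_hl,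
  H.lie_hom (H.cL.comp H.Δh), fun y hy => by
    have h : ∀ y : H.A₁, H.cL (H.lg y) = H.l12 (H.Δh y) + H.l3 y := fun y => by
      rw [lg, map_add, cL_l1, cL_l2]
    exact ((mod_congr H.cL_hl (H.Δh_mod hy)).trans (congrFun (h y) 0)).trans
      ((mΔ₃ H hH).mod y hy)⟩

/-! ### The counit of `H~ˣ` -/

/-- The algebra `ℂ[[ħ]]`. -/
def algC : FAlg ℂ where
  mul := fsmul
  one := fone
  hl := fsmul_hl₂
  assoc a b c := (fsmul_hl₂.left c).fsmul a b
  one_mul := fsmul_fone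
  mul_one := fsmul_fone_right

lemma fsmul_comm (a b : ℕ → ℂ) : fsmul a b = fsmul b a := by
  refine fsmul_hl₂.ext_cst fsmul_hl₂.flip (fun v w => ?_) a b
  rw [fsmul_cst, fsmul_cst, ← cst_smul, ← cst_smul, smul_eq_mul, smul_eq_mul, mul_comm]

/-- `ℂ[[ħ]]` with the trivial action. -/
def refC : H.Ref algC := ⟨fun _ => 0, by
  have h : IsLocFin H.prim₀ fun (_ : V) (_ : ℂ) => (0 : ℂ) := (isRep_zero (H := H) (W := ℂ)).lf
  refine (iff_of_eq (congrArg _ (funext fun X => funext fun u => ?_))).1 h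
  have h1 : ∀ u : ℕ → ℂ, (fsmul (0 : ℕ → ℂ) u - fsmul u (0 : ℕ → ℂ)) 0 = 0 := fun u => by
    simp [fsmul]
  exact (h1 _).symm⟩

lemma ε_prim₀ {y : ℕ → V} (hy : y 0 ∈ H.prim₀) : H.ε y 0 = 0 := by
  have h : ∀ y : H.A₁, H.eL (H.lg y) = H.sc (H.εh y) 1 + y := fun y => by
    rw [lg, map_add, eL_l1, eL_l2]
  have h1 : y 0 = H.sc (H.εh y) 1 0 + y 0 :=
    ((congrFun (H.eL_Δ y) 0).symm.trans (mod_congr H.eL_hl (H.Δh_mod hy))).trans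
      (congrFun (h y) 0)
  have h2 : H.sc (H.εh y) 1 0 = (0 : ℕ → V) 0 := left_eq_add.1 (h1.trans (add_comm _ _))
  have h3 : H.ε (H.sc (H.εh y) 1) = H.ε y := by
    have h4 : H.ε (H.sc (H.εh y) 1) = fsmul (H.ε y) (H.ε H.one) := H.ε_hl.fsmul _ _
    rw [h4, show H.ε H.one = fone from H.counit_one, fsmul_fone_right]
  rw [← h3, mod_congr H.ε_hl h2, H.ε_hl.zero]
  rfl

/-- The counit. -/
def mε : LieMap H.refC := ⟨H.εh, H.ε_hl, fun y z => by
  have h : ∀ a b : H.A₁, H.εh (a * b) = fsmul (H.εh a) (H.εh b) := H.counit_mul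
  have h1 : H.εh (y * z - z * y) = H.εh (y * z) - H.εh (z * y) := H.ε_hl.sub _ _
  rw [h1, h, h]
  rfl, fun _ hy => H.ε_prim₀ hy⟩

/-- The zero map. -/
def mZero : LieMap H.refC := ⟨fun _ => 0, IsHL.const_zero, fun _ _ => by simp, fun _ _ => rfl⟩

end DeformationHopfAlgebra

/-! ### Taylor shifts with connections -/

section Shift

variable {E : Type*} [NormedAddCommGroup E] [NormedSpace ℂ E] {U : Set E} (hU : IsOpen U)
variable {W W₁ : Type*} [AddCommGroup W] [Module ℂ W] [AddCommGroup W₁] [Module ℂ W₁]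
variable {A : FAlg W} {B : FAlg W₁} {ι : Type*} [Fintype ι] (e : ι → E)

namespace FAlg

lemma der_hl (μ : E) : IsHL (V := meroSub U W) (W := meroSub U W) (A.der hU μ) := dd_hl hU μ

lemma der_const (μ : E) (a : A.Elt) : A.der hU μ (A.const U a) = 0 := dd_cstF hU a μ

lemma der_comm (μ ν : E) (F : (A.mero U).Elt) :
    A.der hU μ (A.der hU ν F) = A.der hU ν (A.der hU μ F) := dd_comm hU μ ν F

lemma der_one (μ : E) : A.der hU μ 1 = 0 := A.der_const hU μ 1

lemma commute_of_evR {F G : (A.mero U).Elt} (h : ∀ l, Commute (A.evR l F) (A.evR l G)) :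
    Commute F G := ext_evR fun l => by rw [map_mul, map_mul, (h l).eq]

/-- The operator `F ↦ ∑ i, (∂ᵢ F - αᵢ F + F βᵢ) yᵢ`. -/
def covD (α β : ι → (A.mero U).Elt) (y : ι → A.Elt) (F : (A.mero U).Elt) : (A.mero U).Elt :=
  ∑ i, (A.der hU (e i) F - α i * F + F * β i) * A.const U (y i)

/-- The exponential `exp (-ħ D) F` of `D = covD α β y`.  If `αᵢ = (∂ᵢ a) a⁻¹` and
`βᵢ = (∂ᵢ b) b⁻¹`, this is `a (a⁻¹ F b)(l - ħ y) b⁻¹`. -/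
def covE (α β : ι → (A.mero U).Elt) (y : ι → A.Elt) (F : (A.mero U).Elt) : (A.mero U).Elt :=
  hexp (Z := meroSub U W) (A.covD hU e α β y) F

variable {hU e} {α β γ : ι → (A.mero U).Elt} {y : ι → A.Elt} {F G : (A.mero U).Elt}

lemma covD_hl (α β : ι → (A.mero U).Elt) (y : ι → A.Elt) :
    IsHL (V := meroSub U W) (W := meroSub U W) (A.covD hU e α β y) :=
  IsHL.fsum (V := meroSub U W) (W := meroSub U W) _ fun i _ => ((A.mero U).mulR _).comp
    (((A.der_hl hU (e i)).fsub ((A.mero U).mulL _)).fadd ((A.mero U).mulR _))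

lemma covE_apply_zero (α β : ι → (A.mero U).Elt) (y : ι → A.Elt) (F : (A.mero U).Elt) (l : U) :
    A.evR l (A.covE hU e α β y F) 0 = A.evR l F 0 :=
  congrArg (fun w : meroSub U W => w.1 l) (hexp_apply_zero (Z := meroSub U W) _ F)

lemma covE_eq_self (h : A.covD hU e α β y F = 0) : A.covE hU e α β y F = F :=
  hexp_of_apply_eq_zero (Z := meroSub U W) (covD_hl α β y).zero h

lemma covE_one (h : ∀ i, α i = β i) : A.covE hU e α β y 1 = 1 :=
  covE_eq_self (by simp [covD, der_one, h])

/-- Linear maps which intertwine the operators intertwine their exponentials. -/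
lemma covE_map {α' β' : ι → (B.mero U).Elt} {y' : ι → B.Elt} {Φ : (A.mero U).Elt → (B.mero U).Elt}
    (hΦ : IsHL (V := meroSub U W) (W := meroSub U W₁) Φ)
    (h : ∀ F, Φ (A.covD hU e α β y F) = B.covD hU e α' β' y' (Φ F)) (F : (A.mero U).Elt) :
    Φ (A.covE hU e α β y F) = B.covE hU e α' β' y' (Φ F) :=
  hΦ.hexp F fun _ => h _

lemma covE_liftHom {Φ : A.Elt →+* B.Elt} (hΦ : IsHL (V := W) (W := W₁) Φ)
    (α β : ι → (A.mero U).Elt) (y : ι → A.Elt) (F : (A.mero U).Elt) :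
    liftHom Φ hΦ U (A.covE hU e α β y F) =
      B.covE hU e (fun i => liftHom Φ hΦ U (α i)) (fun i => liftHom Φ hΦ U (β i))
        (fun i => Φ (y i)) (liftHom Φ hΦ U F) := by
  refine covE_map (liftHL_hl hΦ) (fun F => ?_) F
  have h : ∀ μ F, liftHom Φ hΦ U (A.der hU μ F) = B.der hU μ (liftHom Φ hΦ U F) :=
    fun μ F => (dd_liftHL hU hΦ μ F).symm
  change liftHom Φ hΦ U (A.covD hU e α β y F) = _
  simp only [covD, map_sum, map_mul, map_add, map_sub, h]
  rfl

/-- Elements which commute with the `yⱼ` are preserved. -/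
lemma commute_iterate_covD (hy : ∀ i j, Commute (y i) (y j))
    (hβ : ∀ i j, Commute (A.const U (y j)) (β i)) (hγ : ∀ i j, Commute (A.const U (y j)) (γ i))
    (hG : ∀ j, Commute (A.const U (y j)) G) (k : ℕ) :
    ∀ j, Commute (A.const U (y j)) ((A.covD hU e β γ y)^[k] G) := by
  induction k with
  | zero => exact hG
  | succ k ih =>
    rw [Function.iterate_succ_apply']
    refine fun j => Commute.sum_right _ _ _ fun i _ => ?_
    have h1 : Commute (A.const U (y j)) (A.der hU (e i) ((A.covD hU e β γ y)^[k] G)) := by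
      have h2 := congrArg (A.der hU (e i)) (ih j).eq
      rw [der_mul, der_mul, der_const, zero_mul, zero_add, mul_zero, add_zero] at h2
      exact h2
    exact ((h1.sub_right ((hβ i j).mul_right (ih j))).add_right
      ((ih j).mul_right (hγ i j))).mul_right ((hy j i).map (A.const U))

/-- Multiplicativity of Taylor shifts.  The connection `β` in the middle is arbitrary: it cancels
in the Leibniz rule `D (F G) = (D F) G + F (D G)`. -/
lemma covE_mul (hy : ∀ i j, Commute (y i) (y j))
    (hβ : ∀ i j, Commute (A.const U (y j)) (β i)) (hγ : ∀ i j, Commute (A.const U (y j)) (γ i))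
    (hG : ∀ j, Commute (A.const U (y j)) G) (α : ι → (A.mero U).Elt) (F : (A.mero U).Elt) :
    A.covE hU e α γ y (F * G) = A.covE hU e α β y F * A.covE hU e β γ y G := by
  refine hexp_bilin (Z := meroSub U W) (A.mero U).hl (covD_hl α γ y).add F G fun i j => ?_
  have hc := commute_iterate_covD (hU := hU) (e := e) hy hβ hγ hG j
  have key : ∀ P Q : (A.mero U).Elt, (∀ j, Commute (A.const U (y j)) Q) →
      A.covD hU e α γ y (P * Q) = A.covD hU e α β y P * Q + P * A.covD hU e β γ y Q := by
    intro P Q hQ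
    simp only [covD, Finset.sum_mul, Finset.mul_sum, ← Finset.sum_add_distrib]
    refine Finset.sum_congr rfl fun i _ => ?_
    have h1 := (hQ i).eq
    rw [der_mul, mul_assoc _ (A.const U (y i)) Q, h1]
    noncomm_ring
  have h2 : ∀ β γ : ι → (A.mero U).Elt, ∀ F k, (A.covD hU e β γ y)^[k + 1] F =
      A.covD hU e β γ y ((A.covD hU e β γ y)^[k] F) :=
    fun β γ F k => Function.iterate_succ_apply' _ _ _
  refine (key _ _ hc).trans (congrArg₂ (· + ·) ?_ ?_)
  · exact congrArg (fun P : (A.mero U).Elt => P * (A.covD hU e β γ y)^[j] G) (h2 α β F i).symm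
  · exact congrArg (fun Q : (A.mero U).Elt => (A.covD hU e α β y)^[i] F * Q) (h2 β γ G j).symm

/-- Elements which commute with everything involved can be moved through. -/
lemma commute_covE {c : A.Elt} (hα : ∀ i, Commute (A.const U c) (α i)) (hy : ∀ i, Commute c (y i)) :
    Commute (A.const U c) (A.covE hU e α 0 y 1) := by
  have h1 : ∀ F, A.const U c * A.covD hU e α 0 y F = A.covD hU e α 0 y (A.const U c * F) := by
    intro F
    simp only [covD, Finset.mul_sum, der_mul, der_const]
    refine Finset.sum_congr rfl fun i _ => ?_
    rw [← mul_assoc (α i), ← (hα i).eq]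
    simp only [Pi.zero_apply]
    noncomm_ring
  have h2 : ∀ F, A.covD hU e α 0 y F * A.const U c = A.covD hU e α 0 y (F * A.const U c) := by
    intro F
    simp only [covD, Finset.sum_mul, der_mul, der_const]
    refine Finset.sum_congr rfl fun i _ => ?_
    have h3 := ((hy i).map (A.const U)).eq
    rw [mul_assoc _ _ (A.const U c), ← h3]
    simp only [Pi.zero_apply]
    noncomm_ring
  have h3 := covE_map (hU := hU) (e := e) ((A.mero U).mulL (A.const U c)) h1 1
  have h4 := covE_map (hU := hU) (e := e) ((A.mero U).mulR (A.const U c)) h2 1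
  exact h3.trans ((congrArg _ ((_root_.mul_one _).trans (_root_.one_mul _).symm)).trans h4.symm)

/-- Taylor shifts with a flat connection commute. -/
lemma covE_covE {y' : ι → A.Elt} (hy : ∀ i j, Commute (A.const U (y j)) (α i))
    (hy' : ∀ i j, Commute (A.const U (y' j)) (α i)) (hyy : ∀ i j, Commute (y i) (y' j))
    (hα : ∀ i j, A.der hU (e i) (α j) - A.der hU (e j) (α i) = α i * α j - α j * α i)
    (F : (A.mero U).Elt) :
    A.covE hU e α 0 y (A.covE hU e α 0 y' F) = A.covE hU e α 0 (fun i => y i + y' i) F := by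
  have h1 : ∀ F, A.covD hU e α 0 y (A.covD hU e α 0 y' F) =
      A.covD hU e α 0 y' (A.covD hU e α 0 y F) := by
    intro F
    have h2 : ∀ (y y' : ι → A.Elt), (∀ i j, Commute (A.const U (y' j)) (α i)) →
        A.covD hU e α 0 y (A.covD hU e α 0 y' F) = ∑ i, ∑ j,
          (A.der hU (e i) (A.der hU (e j) F - α j * F) - α i * (A.der hU (e j) F - α j * F)) *
            (A.const U (y' j) * A.const U (y i)) := by
      intro y y' hy'
      simp only [covD, Pi.zero_apply, mul_zero, add_zero]
      refine Finset.sum_congr rfl fun i _ => ?_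
      rw [show A.der hU (e i) (∑ j, (A.der hU (e j) F - α j * F) * A.const U (y' j)) =
        ∑ j, A.der hU (e i) ((A.der hU (e j) F - α j * F) * A.const U (y' j)) from
          (A.der_hl hU (e i)).sum _ _, Finset.mul_sum, ← Finset.sum_sub_distrib, Finset.sum_mul]
      refine Finset.sum_congr rfl fun j _ => ?_
      rw [der_mul, der_const]
      noncomm_ring
    rw [h2 y y' hy', h2 y' y hy, Finset.sum_comm]
    refine Finset.sum_congr rfl fun i _ => Finset.sum_congr rfl fun j _ => ?_
    have h3 : ∀ a b, A.der hU (e a) (A.der hU (e b) F - α b * F) =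
        A.der hU (e a) (A.der hU (e b) F) -
          (A.der hU (e a) (α b) * F + α b * A.der hU (e a) F) := by
      intro a b
      rw [← der_mul]
      exact (A.der_hl hU (e a)).sub _ _
    have h4 := ((hyy j i).map (A.const U)).eq
    rw [h4]
    congr 1
    rw [h3, h3, der_comm hU (e i) (e j)]
    have h5 := hα i j
    have h6 : A.der hU (e i) (α j) = A.der hU (e j) (α i) + (α i * α j - α j * α i) := by
      rw [← h5]; abel
    rw [h6]
    noncomm_ring
  refine Eq.trans (hexp_hexp (Z := meroSub U W) (covD_hl α 0 y) (covD_hl α 0 y') h1 F) ?_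
  refine congrArg (fun D => hexp (Z := meroSub U W) D F) (funext fun F => ?_)
  have h7 : ∀ F, A.covD hU e α 0 y F + A.covD hU e α 0 y' F =
      A.covD hU e α 0 (fun i => y i + y' i) F := by
    intro F
    simp only [covD, map_add, mul_add, Finset.sum_add_distrib]
  exact h7 F

lemma evR_covD (α β : ι → (A.mero U).Elt) (y : ι → A.Elt) (F : (A.mero U).Elt) (l : U) :
    A.evR l (A.covD hU e α β y F) = ∑ i, (A.evR l (A.der hU (e i) F) - A.evR l (α i) * A.evR l F +
      A.evR l F * A.evR l (β i)) * y i := by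
  simp only [covD, map_sum, map_mul, map_add, map_sub, evR_const]

/-- Elements congruent to `1` modulo `ħ` are invertible. -/
lemma isUnit_of_apply_zero {a : A.Elt} (h : a 0 = A.one 0) : IsUnit a := by
  set u : A.Elt := 1 - a with hu
  have h0 : u 0 = 0 := by
    change A.one 0 - a 0 = 0
    rw [h, sub_self]
  set u' : A.Elt := tailL (W := W) u
  have hu' : u = hs (W := W) u' := eq_hs_tailL h0
  set S : A.Elt := hsum (Z := W) fun k => u' ^ k with hS
  set S' : A.Elt := hsum (Z := W) fun k => u' ^ (k + 1) with hS'
  set T : A.Elt := hs (W := W) S' with hT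
  have h1 : S = 1 + T := by
    funext n
    have h2 : S n = ∑ p ∈ antidiagonal n, (u' ^ p.1 : A.Elt) p.2 := rfl
    rw [h2]
    cases n with
    | zero =>
      change _ = (1 : A.Elt) 0 + 0
      simp
    | succ n =>
      rw [Finset.Nat.sum_antidiagonal_succ, pow_zero]
      rfl
  have h2 : u' * S = S' := by
    refine ((A.mulL u').hsum _).trans (congrArg _ (funext fun k => ?_))
    exact (pow_succ' u' k).symm
  have h3 : S * u' = S' := by
    refine ((A.mulR u').hsum _).trans (congrArg _ (funext fun k => ?_))
    exact (pow_succ u' k).symm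
  have h4 : u * S = T := by
    rw [hu']
    exact ((A.mulR S).hs u').trans (congrArg (hs (W := W)) h2)
  have h5 : S * u = T := by
    rw [hu']
    exact ((A.mulL S).hs u').trans (congrArg (hs (W := W)) h3)
  have h6 : S = 1 + u * S := by rw [h4]; exact h1
  have h7 : S = 1 + S * u := by rw [h5]; exact h1
  have ha : a = 1 - u := by rw [hu]; abel
  refine ⟨⟨a, S, ?_, ?_⟩, rfl⟩
  · rw [ha, sub_mul, _root_.one_mul, sub_eq_iff_eq_add]; exact h6
  · rw [ha, mul_sub, _root_.mul_one, sub_eq_iff_eq_add]; exact h7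

end FAlg

end Shift

namespace DeformationHopfAlgebra

variable {V : Type*} [AddCommGroup V] [Module ℂ V] {H : DeformationHopfAlgebra V}
variable {E : Type*} [NormedAddCommGroup E] [NormedSpace ℂ E] {U : Set E}
variable (hH : H.LocallyFinite)

/-! ### Gauge transformations -/

lemma conj₁₂_t₃ (x : H.Tilde) (u : H.A₂) (b : H.A₁) :
    conj hH (H.mΔ₁₂ hH) (H.mLg₁₂ hH) x (H.t₃ u b) = H.t₃ (conj hH (H.mΔ hH) (H.mLg hH) x u) b := by
  refine (conj_map hH (H.t₃_hl₂.left b) (fun y v => ?_) x u).symm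
  exact (H.t₃_sub_left b _ _).trans
    (congrArg₂ (· - ·) (H.l12_mul_t₃ b v _).symm (H.t₃_mul_l12 b v _).symm)

lemma conj₁₂_mul_l3 (x : H.Tilde) (b : H.A₁) (v : H.A₃) :
    conj hH (H.mΔ₁₂ hH) (H.mLg₁₂ hH) x (v * H.l3 b) =
      conj hH (H.mΔ₁₂ hH) (H.mLg₁₂ hH) x v * H.l3 b := by
  refine (conj_map hH (r := H.ref₁₂ hH) (f := H.mΔ₁₂ hH) (g := H.mLg₁₂ hH) (f' := H.mΔ₁₂ hH)
    (g' := H.mLg₁₂ hH) (H.alg₃.mulR (H.l3 b)) (fun y v => ?_) x _).symm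
  have h : ∀ u v : H.A₂, ∀ w b : H.A₃, Commute (H.l12 v) b →
      (H.l12 u * w - w * H.l12 v) * b = H.l12 u * (w * b) - w * b * H.l12 v := by
    intro u v w b hb
    rw [sub_mul, _root_.mul_assoc, _root_.mul_assoc, _root_.mul_assoc, hb.eq]
  exact h _ _ _ _ (H.commute_l12_l3 _ _)

/-- `Δ(x)¹² x³ (u ⊗ b) (x³)⁻¹ (x²)⁻¹ (x¹)⁻¹ = Δ(x) u (x²)⁻¹ (x¹)⁻¹ ⊗ x b x⁻¹`. -/
lemma conj₃_t₃ (x : H.Tilde) (u : H.A₂) (b : H.A₁) :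
    conj hH (H.mΔ₃ hH) (H.mLg₃ hH) x (H.t₃ u b) =
      H.t₃ (conj hH (H.mΔ hH) (H.mLg hH) x u) (conj hH (H.mId hH) (H.mId hH) x b) :=
  (isRep_two (H.mΔ₃ hH) (H.mLg₃ hH)).hom_bilin hH (isRep_two (H.mΔ hH) (H.mLg hH))
    (isRep_two (H.mId hH) (H.mId hH)) H.t₃_hl₂
    (fun y u b => H.comm_l12_add_l3_t₃ y b u (H.Δh y) (H.lg y)) x u b

lemma conj₂_t₂ (x : H.Tilde) (a b : H.A₁) :
    conj hH (H.mLg hH) (H.mLg hH) x (H.t₂ a b) =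
      H.t₂ (conj hH (H.mId hH) (H.mId hH) x a) (conj hH (H.mId hH) (H.mId hH) x b) :=
  (isRep_two (H.mLg hH) (H.mLg hH)).hom_bilin hH (isRep_two (H.mId hH) (H.mId hH))
    (isRep_two (H.mId hH) (H.mId hH)) H.t₂_hl₂ (fun y a b => H.comm_lg_t₂ y a b) x a b

/-- A function `x` with values in `H~ˣ` and logarithmic derivatives `θ`, which can be used as a
gauge transformation of twists.  These are the properties of `IsMeroTilde` functions with counit `1`
which are used for the twist equation; unlike `IsMeroTilde`, they are easily passed from `x` to
`x⁻¹`. -/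
structure Flow (U : Set E) (x : E → H.Tilde) (θ : E → E → ℕ → V) : Prop where
  isOpen : IsOpen U
  mero_logDeriv : ∀ μ, IsMeroF U fun l => θ l μ
  mero_conj : ∀ v : ℕ → V ⊗[ℂ] V, IsMeroF U fun l => conj hH (H.mΔ hH) (H.mLg hH) (x l) v
  hasDirDeriv : ∀ l ∈ U, ∀ (μ : E) (v : ℕ → (V ⊗[ℂ] V) ⊗[ℂ] V),
    HasDirDeriv (fun l => conj hH (H.mΔ₁₂ hH) (H.mLg₁₂ hH) (x l) v) μ l
      (two (H.mΔ₁₂ hH) (H.mLg₁₂ hH) (θ l μ) (conj hH (H.mΔ₁₂ hH) (H.mLg₁₂ hH) (x l) v))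
  flat : ∀ l ∈ U, ∃ D : E → E → ℕ → V, (∀ μ ν, HasDirDeriv (fun l => θ l μ) ν l (D ν μ)) ∧
    ∀ μ ν, D ν μ - D μ ν = H.ad (θ l ν) (θ l μ)
  counit : ∀ l ∈ U, ∀ μ, H.ε (θ l μ) = 0

namespace Flow

variable {hH} {x : E → H.Tilde} {θ : E → E → ℕ → V} (hx : Flow hH U x θ)

/-- The logarithmic derivative in the direction `μ`. -/
def Θ (μ : E) : (H.alg₁.mero U).Elt := mkMero (fun l => θ l μ) (hx.mero_logDeriv μ).mem

section Lt

variable {W : Type*} [AddCommGroup W] [Module ℂ W] {A : FAlg W}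

/-- The image of the logarithmic derivative in the direction `μ` under a linear map. -/
def lt {f : H.A₁ → A.Elt} (hf : IsHL (V := V) (W := W) f) (μ : E) : (A.mero U).Elt :=
  liftHL hf (hx.Θ μ)

end Lt

/-- The operator `v ↦ Δ(x) v (x²)⁻¹ (x¹)⁻¹` on meromorphic functions. -/
def X : (H.alg₂.mero U).Elt → (H.alg₂.mero U).Elt :=
  liftFam (fun l => conj hH (H.mΔ hH) (H.mLg hH) (x l)) (fun _ => conj_hl hH _ _ _)
    fun v n => (hx.mero_conj (cst v)).mem n

lemma evR_X (F : (H.alg₂.mero U).Elt) (l : U) :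
    H.alg₂.evR l (hx.X F) = conj hH (H.mΔ hH) (H.mLg hH) (x l) (H.alg₂.evR l F) := rfl

include hx in
lemma mem_conj₁₂ (w : (V ⊗[ℂ] V) ⊗[ℂ] V) (n : ℕ) :
    (fun l : U => conj hH (H.mΔ₁₂ hH) (H.mLg₁₂ hH) (x l) (cst w) n) ∈
      meroSub U ((V ⊗[ℂ] V) ⊗[ℂ] V) := by
  have hl : ∀ l : U, IsHL (V := (V ⊗[ℂ] V) ⊗[ℂ] V) (W := (V ⊗[ℂ] V) ⊗[ℂ] V)
    (conj hH (H.mΔ₁₂ hH) (H.mLg₁₂ hH) (x l)) := fun l => conj_hl hH _ _ _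
  induction w using TensorProduct.induction_on with
  | zero =>
    refine (iff_of_eq (congrArg (· ∈ meroSub U _) (funext fun l => ?_))).1
      (Submodule.zero_mem (meroSub U ((V ⊗[ℂ] V) ⊗[ℂ] V)))
    rw [cst_zero']
    exact (congrFun (hl l).zero n).symm
  | tmul v b =>
    let F : (H.alg₂.mero U).Elt := hx.X (cstF (cst v))
    have h1 := (liftHL (H.t₃_hl₂.left (cst b)) F n).2
    refine (iff_of_eq (congrArg (· ∈ meroSub U _) (funext fun l => ?_))).1 h1
    rw [← ften_cst]
    exact congrFun (conj₁₂_t₃ hH (x l) (cst v) (cst b)).symm n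
  | add v w hv hw =>
    refine (iff_of_eq (congrArg (· ∈ meroSub U _) (funext fun l => ?_))).1
      (Submodule.add_mem _ hv hw)
    rw [cst_add]
    exact (congrFun ((hl l).add _ _) n).symm

/-- The operator `v ↦ Δ(x)¹² v (x²)⁻¹ (x¹)⁻¹` on meromorphic functions. -/
def X₁₂ : (H.alg₃.mero U).Elt → (H.alg₃.mero U).Elt :=
  liftFam (fun l => conj hH (H.mΔ₁₂ hH) (H.mLg₁₂ hH) (x l)) (fun _ => conj_hl hH _ _ _)
    hx.mem_conj₁₂

lemma evR_X₁₂ (F : (H.alg₃.mero U).Elt) (l : U) :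
    H.alg₃.evR l (hx.X₁₂ F) = conj hH (H.mΔ₁₂ hH) (H.mLg₁₂ hH) (x l) (H.alg₃.evR l F) := rfl

lemma X₁₂_hl : IsHL (V := meroSub U ((V ⊗[ℂ] V) ⊗[ℂ] V)) (W := meroSub U ((V ⊗[ℂ] V) ⊗[ℂ] V))
    hx.X₁₂ := liftFam_hl _ _ _

lemma X₁₂_l12 (F : (H.alg₂.mero U).Elt) : hx.X₁₂ (FAlg.liftHom H.l12 H.l12_hl U F) =
    FAlg.liftHom H.l12 H.l12_hl U (hx.X F) := FAlg.ext_evR fun l => conj₁₂_t₃ hH (x l) _ 1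

lemma X₁₂_mul_l3 (F : (H.alg₃.mero U).Elt) (b : H.A₁) : hx.X₁₂ (F * H.alg₃.const U (H.l3 b)) =
    hx.X₁₂ F * H.alg₃.const U (H.l3 b)  :=
  FAlg.ext_evR fun l => conj₁₂_mul_l3 hH (x l) b _

lemma der_X₁₂ (μ : E) (F : (H.alg₃.mero U).Elt) : H.alg₃.der hx.isOpen μ (hx.X₁₂ F) =
    hx.lt (H.mΔ₁₂ hH).hl μ * hx.X₁₂ F - hx.X₁₂ F * hx.lt (H.mLg₁₂ hH).hl μ +
      hx.X₁₂ (H.alg₃.der hx.isOpen μ F) := FAlg.ext_evR fun l =>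
  dd_liftFam hx.isOpen (fun _ => conj_hl hH _ _ _) hx.mem_conj₁₂
    (fun v => hx.hasDirDeriv l l.2 μ v) F

lemma ad_Θ (μ ν : E) : H.alg₁.der hx.isOpen ν (hx.Θ μ) - H.alg₁.der hx.isOpen μ (hx.Θ ν) =
    hx.Θ ν * hx.Θ μ - hx.Θ μ * hx.Θ ν := FAlg.ext_evR fun l => by
  obtain ⟨D, h1, h2⟩ := hx.flat l l.2
  have h3 : ∀ μ ν, H.alg₁.evR l (H.alg₁.der hx.isOpen ν (hx.Θ μ)) = D ν μ := fun μ ν =>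
    Rep.ev_dd hx.isOpen (f := fun l => θ l μ) (fun _ _ => rfl) (h1 μ ν)
  refine Eq.trans ?_ (h2 μ ν)
  rw [map_sub, h3, h3]
  rfl

variable {ι : Type*} [Fintype ι] (e : ι → E) (y : ι → H.A₁)

/-- `x¹(l) x¹(l - ħ h⁽²⁾)⁻¹`. -/
def ρ : (H.alg₂.mero U).Elt :=
  H.alg₂.covE hx.isOpen e (fun i => hx.lt H.l1_hl (e i)) 0 (fun i => H.l2 (y i)) 1

/-- The Taylor shift `F(l - ħ h⁽³⁾)`. -/
def _root_.Deform.DeformationHopfAlgebra.shift₃ (hU : IsOpen U) (F : (H.alg₂.mero U).Elt) :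
    (H.alg₃.mero U).Elt :=
  H.alg₃.covE hU e 0 0 (fun i => H.l3 (y i)) (FAlg.liftHom H.l12 H.l12_hl U F)

lemma l12Δ_hl : IsHL (V := V) (W := (V ⊗[ℂ] V) ⊗[ℂ] V) fun y => H.l12 (H.Δh y) :=
  H.l12_hl.comp H.Δ_hl

lemma l12lg_hl : IsHL (V := V) (W := (V ⊗[ℂ] V) ⊗[ℂ] V) fun y => H.l12 (H.lg y) :=
  H.l12_hl.comp H.lg_hl

lemma l12l1_hl : IsHL (V := V) (W := (V ⊗[ℂ] V) ⊗[ℂ] V) fun y => H.l12 (H.l1 y) :=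
  H.l12_hl.comp H.l1_hl

variable {y}

lemma commute_l3 (b : H.A₁) {f : H.A₁ → H.A₂}
    (hf : IsHL (V := V) (W := (V ⊗[ℂ] V) ⊗[ℂ] V) fun y => H.l12 (f y)) (μ : E) :
    Commute (H.alg₃.const U (H.l3 b)) (hx.lt hf μ) :=
  FAlg.commute_of_evR fun _ => (H.commute_l12_l3 _ _).symm

lemma commute_l3_l12 (b : H.A₁) (F : (H.alg₂.mero U).Elt) :
    Commute (H.alg₃.const U (H.l3 b)) (FAlg.liftHom H.l12 H.l12_hl U F) :=
  FAlg.commute_of_evR fun _ => (H.commute_l12_l3 _ _).symm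

/-- The factor `x¹(l) x²(l) x²(l - ħ h⁽³⁾)⁻¹ x¹(l - ħ h⁽²⁾ - ħ h⁽³⁾)⁻¹` of both sides of the transformed
twist equation. -/
def Z (y : ι → H.A₁) : (H.alg₃.mero U).Elt :=
  H.alg₃.covE hx.isOpen e (fun i => hx.lt (l12lg_hl (H := H)) (e i)) 0 (fun i => H.l3 (y i))
    (FAlg.liftHom H.l12 H.l12_hl U (hx.ρ e y))

lemma cL_ρ (y : ι → H.A₁) : FAlg.liftHom H.cL H.cL_hl U (hx.ρ e y) =
    H.alg₃.covE hx.isOpen e (fun i => hx.lt (l12Δ_hl (H := H)) (e i)) 0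
      (fun i => H.l3 (y i)) 1 := by
  rw [ρ, FAlg.covE_liftHom, map_one]
  have h1 : (fun i => FAlg.liftHom H.cL H.cL_hl U (hx.lt H.l1_hl (e i))) =
      fun i => hx.lt (l12Δ_hl (H := H)) (e i) :=
    funext fun i => FAlg.ext_evR fun l => H.cL_l1 _
  simp only [h1, Pi.zero_apply, map_zero, cL_l2]
  rfl

lemma X₁₂_shift₃ (K : (H.alg₂.mero U).Elt) :
    hx.X₁₂ (shift₃ e y hx.isOpen K) =
      H.alg₃.covE hx.isOpen e (fun i => hx.lt (l12Δ_hl (H := H)) (e i))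
        (fun i => hx.lt (l12lg_hl (H := H)) (e i)) (fun i => H.l3 (y i))
        (FAlg.liftHom H.l12 H.l12_hl U (hx.X K)) := by
  rw [shift₃, ← X₁₂_l12]
  refine FAlg.covE_map hx.X₁₂_hl (fun F => ?_) _
  rw [FAlg.covD, FAlg.covD]
  refine (hx.X₁₂_hl.sum _ _).trans (Finset.sum_congr rfl fun i _ => ?_)
  refine (hx.X₁₂_mul_l3 _ _).trans ?_
  simp only [Pi.zero_apply, zero_mul, mul_zero, sub_zero, add_zero]
  rw [der_X₁₂]
  congr 1
  have h : ∀ a b c : (H.alg₃.mero U).Elt, c = a - b + c - a + b := by intros; abel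
  exact h _ _ _

/-- The left hand side of the twist equation. -/
lemma cL_mul_shift₃ (hy : ∀ i j, Commute (y i) (y j)) (K : (H.alg₂.mero U).Elt) :
    FAlg.liftHom H.cL H.cL_hl U (hx.X K * hx.ρ e y) *
        shift₃ e y hx.isOpen (hx.X K * hx.ρ e y) =
      FAlg.liftHom H.cL H.cL_hl U (hx.X K) * hx.X₁₂ (shift₃ e y hx.isOpen K) * hx.Z e y := by
  have hy3 : ∀ i j, Commute (H.l3 (y i)) (H.l3 (y j)) := fun i j => (hy i j).map H.l3
  have h1 := FAlg.covE_mul (hU := hx.isOpen) (e := e) (β := 0) (γ := 0)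
    (G := FAlg.liftHom H.l12 H.l12_hl U (hx.X K * hx.ρ e y)) hy3
    (fun i j => Commute.zero_right _) (fun i j => Commute.zero_right _)
    (fun j => commute_l3_l12 _ _) (fun i => hx.lt (l12Δ_hl (H := H)) (e i)) 1
  have h2 := FAlg.covE_mul (hU := hx.isOpen) (e := e) (γ := 0)
    (β := fun i => hx.lt (l12lg_hl (H := H)) (e i))
    (G := FAlg.liftHom H.l12 H.l12_hl U (hx.ρ e y)) hy3
    (fun i j => hx.commute_l3 _ _ _) (fun i j => Commute.zero_right _)
    (fun j => commute_l3_l12 _ _) (fun i => hx.lt (l12Δ_hl (H := H)) (e i))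
    (FAlg.liftHom H.l12 H.l12_hl U (hx.X K))
  rw [_root_.one_mul, map_mul, h2, ← X₁₂_shift₃, ← cL_ρ] at h1
  rw [map_mul, _root_.mul_assoc, _root_.mul_assoc]
  congr 1
  rw [shift₃, map_mul]
  exact h1.symm

/-- `x¹(l) x¹(l - ħ h⁽²⁾ - ħ h⁽³⁾)⁻¹`. -/
lemma cR_ρ (hp : ∀ i, H.Δh (y i) = H.lg (y i)) : FAlg.liftHom H.cR H.cR_hl U (hx.ρ e y) =
    H.alg₃.covE hx.isOpen e (fun i => hx.lt (l12l1_hl (H := H)) (e i)) 0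
      (fun i => H.l23 (H.lg (y i))) 1 := by
  rw [ρ, FAlg.covE_liftHom, map_one]
  have h1 : (fun i => FAlg.liftHom H.cR H.cR_hl U (hx.lt H.l1_hl (e i))) =
      fun i => hx.lt (l12l1_hl (H := H)) (e i) :=
    funext fun i => FAlg.ext_evR fun l => H.cR_l1 _
  simp only [h1, Pi.zero_apply, map_zero, cR_l2, hp]
  rfl

/-- Weight zero elements commute with `x¹(l) x¹(l - ħ h⁽²⁾ - ħ h⁽³⁾)⁻¹`. -/
lemma commute_cR_ρ (hp : ∀ i, H.Δh (y i) = H.lg (y i)) (l : U) {J : H.A₂}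
    (hJ : ∀ i, Commute (H.lg (y i)) J) :
    Commute (H.l23 J) (H.cR (H.alg₂.evR l (hx.ρ e y))) := by
  have h1 : Commute (H.alg₃.const U (H.l23 J)) (FAlg.liftHom H.cR H.cR_hl U (hx.ρ e y)) := by
    rw [cR_ρ _ _ hp]
    refine FAlg.commute_covE (fun i => FAlg.commute_of_evR fun l => ?_)
      fun i => ((hJ i).map H.l23).symm
    exact (H.commute_l1_l23 _ _).symm
  exact h1.map (H.alg₃.evR l)

/-- The logarithmic derivative of `x¹` cancels in the conjugated connection. -/
lemma l23_covD (i : ι) (F : (H.alg₂.mero U).Elt) : FAlg.liftHom H.l23 H.l23_hl U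
      ((H.alg₂.der hx.isOpen (e i) F - hx.lt H.l1_hl (e i) * F) * H.alg₂.const U (H.l2 (y i))) =
    (H.alg₃.der hx.isOpen (e i) (FAlg.liftHom H.l23 H.l23_hl U F) -
      hx.lt (l12lg_hl (H := H)) (e i) * FAlg.liftHom H.l23 H.l23_hl U F +
      FAlg.liftHom H.l23 H.l23_hl U F * hx.lt (l12l1_hl (H := H)) (e i)) *
        H.alg₃.const U (H.l3 (y i)) := by
  have h3 : hx.lt (l12lg_hl (H := H)) (e i) = hx.lt (l12l1_hl (H := H)) (e i) +
      FAlg.liftHom H.l23 H.l23_hl U (hx.lt H.l1_hl (e i)) := FAlg.ext_evR fun l => by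
    have h4 : ∀ a : H.A₁, H.l12 (H.lg a) = H.l12 (H.l1 a) + H.l23 (H.l1 a) := fun a => by
      rw [lg, map_add, l23_l1]
    exact h4 _
  have h5 : Commute (hx.lt (l12l1_hl (H := H)) (e i)) (FAlg.liftHom H.l23 H.l23_hl U F) :=
    FAlg.commute_of_evR fun l => H.commute_l1_l23 _ _
  have h6 : H.alg₃.der hx.isOpen (e i) (FAlg.liftHom H.l23 H.l23_hl U F) =
      FAlg.liftHom H.l23 H.l23_hl U (H.alg₂.der hx.isOpen (e i) F) :=
    dd_liftHL hx.isOpen H.l23_hl (e i) F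
  have h7 : FAlg.liftHom H.l23 H.l23_hl U (H.alg₂.const U (H.l2 (y i))) =
      H.alg₃.const U (H.l3 (y i)) := FAlg.ext_evR fun l => H.l23_l2 _
  rw [map_mul, map_sub, map_mul, h6, h7]
  congr 1
  rw [h3, add_mul, ← h5.eq]
  have h : ∀ a b c : (H.alg₃.mero U).Elt, a - b = a - (c + b) + c := by intros; abel
  exact h _ _ _

lemma l23_ρ (y : ι → H.A₁) : FAlg.liftHom H.l23 H.l23_hl U (hx.ρ e y) =
    H.alg₃.covE hx.isOpen e (fun i => hx.lt (l12lg_hl (H := H)) (e i))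
      (fun i => hx.lt (l12l1_hl (H := H)) (e i)) (fun i => H.l3 (y i)) 1 := by
  refine (FAlg.covE_map (hU := hx.isOpen) (e := e) (Φ := FAlg.liftHom H.l23 H.l23_hl U)
    (α' := fun i => hx.lt (l12lg_hl (H := H)) (e i)) (y' := fun i => H.l3 (y i))
    (β' := fun i => hx.lt (l12l1_hl (H := H)) (e i)) (liftHL_hl H.l23_hl) (fun F => ?_) 1).trans ?_
  · rw [FAlg.covD, FAlg.covD, map_sum]
    refine Finset.sum_congr rfl fun i _ => ?_
    rw [← l23_covD, Pi.zero_apply, mul_zero, add_zero]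
  · rw [map_one]

lemma l12_ρ (y : ι → H.A₁) : FAlg.liftHom H.l12 H.l12_hl U (hx.ρ e y) =
    H.alg₃.covE hx.isOpen e (fun i => hx.lt (l12l1_hl (H := H)) (e i)) 0
      (fun i => H.l12 (H.l2 (y i))) 1 := by
  rw [ρ, FAlg.covE_liftHom, map_one]
  have h1 : (fun i => FAlg.liftHom H.l12 H.l12_hl U (hx.lt H.l1_hl (e i))) =
      fun i => hx.lt (l12l1_hl (H := H)) (e i) := rfl
  rw [h1]
  simp only [Pi.zero_apply, map_zero]
  rfl

lemma lt_flat (μ ν : E) {W : Type*} [AddCommGroup W] [Module ℂ W] {A : FAlg W} (f : H.A₁ →+* A.Elt)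
    (hf : IsHL (V := V) (W := W) f) :
    A.der hx.isOpen μ (hx.lt hf ν) - A.der hx.isOpen ν (hx.lt hf μ) =
      hx.lt hf μ * hx.lt hf ν - hx.lt hf ν * hx.lt hf μ := by
  have h3 : ∀ μ ν, A.der hx.isOpen ν (hx.lt hf μ) =
      FAlg.liftHom f hf U (H.alg₁.der hx.isOpen ν (hx.Θ μ)) :=
    fun μ ν => dd_liftHL hx.isOpen hf ν (hx.Θ μ)
  rw [h3, h3, ← map_sub, ad_Θ, map_sub, map_mul, map_mul]
  rfl

/-- The shifts in the second and third components combine. -/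
lemma covE_l12_ρ (y : ι → H.A₁) (hp : ∀ i, H.Δh (y i) = H.lg (y i)) :
    H.alg₃.covE hx.isOpen e (fun i => hx.lt (l12l1_hl (H := H)) (e i)) 0 (fun i => H.l3 (y i))
      (FAlg.liftHom H.l12 H.l12_hl U (hx.ρ e y)) = FAlg.liftHom H.cR H.cR_hl U (hx.ρ e y) := by
  rw [l12_ρ, cR_ρ _ _ hp, FAlg.covE_covE]
  · congr 1
    funext i
    rw [lg, map_add, l23_l1, l23_l2, add_comm]
  · exact fun i j => hx.commute_l3 _ _ _
  · exact fun i j => FAlg.commute_of_evR fun l => (H.commute_l1_l2 _ _).symm.map H.l12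
  · exact fun i j => (H.commute_l12_l3 _ _).symm
  · exact fun i j => hx.lt_flat _ _ (H.l12.comp H.l1) (l12l1_hl (H := H))

lemma Z_eq (hy : ∀ i j, Commute (y i) (y j)) (hp : ∀ i, H.Δh (y i) = H.lg (y i)) :
    hx.Z e y = FAlg.liftHom H.l23 H.l23_hl U (hx.ρ e y) *
      FAlg.liftHom H.cR H.cR_hl U (hx.ρ e y) := by
  have hy3 : ∀ i j, Commute (H.l3 (y i)) (H.l3 (y j)) := fun i j => (hy i j).map H.l3
  have h1 := FAlg.covE_mul (hU := hx.isOpen) (e := e) (γ := 0)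
    (β := fun i => hx.lt (l12l1_hl (H := H)) (e i))
    (G := FAlg.liftHom H.l12 H.l12_hl U (hx.ρ e y)) hy3
    (fun i j => hx.commute_l3 _ _ _) (fun i j => Commute.zero_right _)
    (fun j => commute_l3_l12 _ _) (fun i => hx.lt (l12lg_hl (H := H)) (e i)) 1
  rw [_root_.one_mul, ← l23_ρ, covE_l12_ρ _ _ _ hp] at h1
  exact h1

lemma isUnit_ρ (y : ι → H.A₁) : IsUnit (hx.ρ e y) := by
  refine FAlg.isUnit_of_apply_zero ?_
  exact hexp_apply_zero (Z := meroSub U (V ⊗[ℂ] V)) _ _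

/-- Gauge transformations preserve the twist equation.  Let `J = Δ(x) K (x²)⁻¹ x¹(l - ħ h⁽²⁾)⁻¹`.
If `J` has weight zero and `x³` commutes with the Taylor shift of `K` in the sense of `hb`, then both sides
of the twist equation for `J` arise from those for `K` by applying the bijection
`v ↦ Δ³(x) v (x³)⁻¹ (x²)⁻¹ (x¹)⁻¹` and multiplying by the invertible factor `Z` from the right. -/
theorem twist_iff (hy : ∀ i j, Commute (y i) (y j)) (hp : ∀ i, H.Δh (y i) = H.lg (y i))
    {K : (H.alg₂.mero U).Elt} {l : U}
    (hJ : ∀ i, Commute (H.lg (y i)) (H.alg₂.evR l (hx.X K * hx.ρ e y)))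
    (hb : conj hH (H.mΔ₃ hH) (H.mLg₃ hH) (x l) (H.alg₃.evR l (shift₃ e y hx.isOpen K)) =
      conj hH (H.mΔ₁₂ hH) (H.mLg₁₂ hH) (x l) (H.alg₃.evR l (shift₃ e y hx.isOpen K))) :
    H.cL (H.alg₂.evR l (hx.X K * hx.ρ e y)) *
        H.alg₃.evR l (shift₃ e y hx.isOpen (hx.X K * hx.ρ e y)) =
      H.cR (H.alg₂.evR l (hx.X K * hx.ρ e y)) * H.l23 (H.alg₂.evR l (hx.X K * hx.ρ e y)) ↔
    H.cL (H.alg₂.evR l K) * H.alg₃.evR l (shift₃ e y hx.isOpen K) =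
      H.cR (H.alg₂.evR l K) * H.l23 (H.alg₂.evR l K) := by
  set k := H.alg₂.evR l K
  set s := H.alg₃.evR l (shift₃ e y hx.isOpen K)
  set r := H.alg₂.evR l (hx.ρ e y)
  have hL := congrArg (H.alg₃.evR l) (hx.cL_mul_shift₃ e hy K)
  have hZ := congrArg (H.alg₃.evR l) (hx.Z_eq e hy hp)
  simp only [map_mul, FAlg.evR_liftHom, evR_X, evR_X₁₂] at hL hZ
  have hcomm := hx.commute_cR_ρ e hp l hJ
  rw [map_mul, evR_X] at hcomm ⊢
  set j := conj hH (H.mΔ hH) (H.mLg hH) (x l) k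
  have h1 : H.cL j = conj hH (H.mΔΔ hH) (H.mΔ₃ hH) (x l) (H.cL k) :=
    conj_map hH H.cL_hl (fun y v => by
      change H.cL (H.Δh y * v - v * H.lg y) =
        H.cL (H.Δh y) * H.cL v - H.cL v * (H.l12 (H.Δh y) + H.l3 y)
      rw [map_sub, map_mul, map_mul, lg, map_add, cL_l1, cL_l2]) _ _
  have h2 : H.cR j = conj hH (H.mΔΔ hH) (H.m₃Δ hH) (x l) (H.cR k) :=
    conj_map hH H.cR_hl (fun y v => by
      change H.cR (H.Δh y * v - v * H.lg y) =
        H.cL (H.Δh y) * H.cR v - H.cR v * (H.l12 (H.l1 y) + H.l23 (H.Δh y))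
      rw [map_sub, map_mul, map_mul, lg, map_add, cR_l1, cR_l2, cL_Δ]) _ _
  have h3 : H.l23 j = conj hH (H.m₃Δ hH) (H.mLg₃ hH) (x l) (H.l23 k) :=
    conj_map hH H.l23_hl (fun y v => by
      change H.l23 (H.Δh y * v - v * H.lg y) =
        (H.l12 (H.l1 y) + H.l23 (H.Δh y)) * H.l23 v - H.l23 v * (H.l12 (H.lg y) + H.l3 y)
      have h4 := (H.commute_l1_l23 y v).eq
      rw [map_sub, map_mul, map_mul, lg, map_add, map_add, l23_l1, l23_l2, add_mul, h4]
      noncomm_ring) _ _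
  rw [← hb, h1, conj_mul] at hL
  have hR : H.cR (j * r) * H.l23 (j * r) =
      conj hH (H.mΔΔ hH) (H.mLg₃ hH) (x l) (H.cR k * H.l23 k) * H.alg₃.evR l (hx.Z e y) := by
    rw [hZ, ← conj_mul hH _ (H.m₃Δ hH), ← h2, ← h3, map_mul, _root_.mul_assoc, ← hcomm.eq, map_mul]
    noncomm_ring
  have hu : IsUnit (H.alg₃.evR l (hx.Z e y)) := by
    rw [Z_eq _ _ hy hp, map_mul]
    exact (((hx.isUnit_ρ e y).map _).map _).mul (((hx.isUnit_ρ e y).map _).map _)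
  rw [hR, map_mul]
  refine Iff.trans (Eq.congr ?_ rfl) (hu.mul_left_inj.trans (conj_injective hH _ _ _).eq_iff)
  rw [← hL, h1]

end Flow
end DeformationHopfAlgebra

namespace DeformationHopfAlgebra

variable {V : Type*} [AddCommGroup V] [Module ℂ V] {H : DeformationHopfAlgebra V}
variable {E : Type*} [NormedAddCommGroup E] [NormedSpace ℂ E] {U : Set E}
variable (hH : H.LocallyFinite)

/-! ### Gauge transformations given by functions with values in `H~ˣ` -/

lemma twist₂_eq (x : H.Tilde) (v : H.A₂) : H.twist₂ x v = conj hH (H.mΔ hH) (H.mLg hH) x v :=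
  twoSided_eq hH (H.mΔ hH) (H.mLg hH) x v

lemma Ad_eq (x : H.Tilde) (v : H.A₁) : H.Ad x v = conj hH (H.mId hH) (H.mId hH) x v :=
  twoSided_eq hH (H.mId hH) (H.mId hH) x v

lemma Ad₂_eq (x : H.Tilde) (v : H.A₂) : H.Ad₂ x v = conj hH (H.mLg hH) (H.mLg hH) x v :=
  twoSided_eq hH (H.mLg hH) (H.mLg hH) x v

lemma εTilde_eq (x : H.Tilde) : H.εTilde x = conj hH H.mε H.mZero x (1 : algC.Elt) :=
  twoSided_eq hH H.mε H.mZero x fone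

namespace IsMeroTilde

variable {hH} {x : E → H.Tilde} {θ : E → E → ℕ → V} (hx : H.IsMeroTilde U x θ)
include hx

section Derivatives

variable {W : Type*} [AddCommGroup W] [Module ℂ W] {A : FAlg W} {r : H.Ref A}

lemma hasDirDeriv_conj (hH : H.LocallyFinite) (f g : LieMap r) {l : E} (hl : l ∈ U) (μ : E)
    (v : A.Elt) : HasDirDeriv (fun l => conj hH f g (x l) v) μ l
      (two f g (θ l μ) (conj hH f g (x l) v)) := by
  have := (isRep_two f g).hasHDeriv_hom hH (hx.hasLogDeriv hl μ) v
  simp only [zero_smul, add_zero] at this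
  exact this

lemma hasDirDeriv_conj_inv (hH : H.LocallyFinite) (f g : LieMap r) {l : E} (hl : l ∈ U) (μ : E)
    (v : A.Elt) : HasDirDeriv (fun l => conj hH f g (x l)⁻¹ v) μ l
      (two f g (-conj hH (H.mId hH) (H.mId hH) (x l)⁻¹ (θ l μ)) (conj hH f g (x l)⁻¹ v)) := by
  have h := (isRep_two f g).hasHDeriv_hom_inv hH (hx.hasLogDeriv hl μ) v
  simp only [zero_smul, add_zero] at h
  have h2 := ((isRep_two f g).hl.left (conj hH f g (x l)⁻¹ v)).neg
    (conj hH (H.mId hH) (H.mId hH) (x l)⁻¹ (θ l μ))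
  exact (iff_of_eq (congrArg (HasDirDeriv (fun l => conj hH f g (x l)⁻¹ v) μ l) h2)).2 h

end Derivatives

/-- A function with values in the kernel of the counit is a gauge transformation. -/
lemma flow (hH : H.LocallyFinite) (hε : ∀ l ∈ U, H.εTilde (x l) = fone) : Flow hH U x θ where
  isOpen := hx.isOpen
  mero_logDeriv := hx.mero_logDeriv
  mero_conj v := by
    have h := hx.mero_twist₂ v
    refine (iff_of_eq (congrArg (IsMeroF U) (funext fun l => ?_))).1 h
    exact twist₂_eq hH _ _
  hasDirDeriv l hl μ v := hx.hasDirDeriv_conj hH _ _ hl μ v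
  flat l hl := hx.flat hH hl
  counit l hl μ := by
    have h1 := hx.hasDirDeriv_conj hH H.mε H.mZero hl μ 1
    have h2 : ∀ l ∈ U, conj hH H.mε H.mZero (x l) (1 : algC.Elt) = fone := fun l hl =>
      (εTilde_eq hH _).symm.trans (hε l hl)
    have h3 : HasDirDeriv (fun _ : E => fone) μ l
        (two H.mε H.mZero (θ l μ) (conj hH H.mε H.mZero (x l) (1 : algC.Elt))) :=
      h1.congr (Filter.eventuallyEq_of_mem (hx.isOpen.mem_nhds hl) fun l hl => (h2 l hl).symm)
    have h4 := HasHDeriv.unique h3 (HasHDeriv.const fone _)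
    have h5 : ∀ a : algC.Elt, a * 1 - 1 * 0 = 0 → a = 0 := by simp
    rw [h2 l hl] at h4
    exact h5 _ h4

/-- The function `x⁻¹` is a gauge transformation. -/
lemma flow_inv (hH : H.LocallyFinite) (hε : ∀ l ∈ U, H.εTilde (x l) = fone) :
    Flow hH U (fun l => (x l)⁻¹)
      fun l μ => -conj hH (H.mId hH) (H.mId hH) (x l)⁻¹ (θ l μ) := by
  have hf := hx.flow hH hε
  have hmA : ∀ v n, (fun l : U => conj hH (H.mId hH) (H.mId hH) (x l)⁻¹ (cst v) n) ∈
      meroSub U V := fun v n => by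
    refine (iff_of_eq (congrArg (· ∈ meroSub U V) (funext fun l => ?_))).1
      ((hx.mero_Ad_inv (cst v)).mem n)
    exact congrFun (Ad_eq hH _ _) n
  let AdF : (H.alg₁.mero U).Elt → (H.alg₁.mero U).Elt :=
    liftFam (fun l => conj hH (H.mId hH) (H.mId hH) (x l)⁻¹) (fun _ => conj_hl hH _ _ _) hmA
  have hl2 : ∀ l : U, IsHL (V := V ⊗[ℂ] V) (W := V ⊗[ℂ] V)
    (conj hH (H.mLg hH) (H.mLg hH) (x l)⁻¹) := fun l => conj_hl hH _ _ _
  have hmA₂ : ∀ w n, (fun l : U => conj hH (H.mLg hH) (H.mLg hH) (x l)⁻¹ (cst w) n) ∈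
      meroSub U (V ⊗[ℂ] V) := fun w n => by
    induction w using TensorProduct.induction_on with
    | zero =>
      refine (iff_of_eq (congrArg (· ∈ meroSub U _) (funext fun l => ?_))).1
        (Submodule.zero_mem (meroSub U (V ⊗[ℂ] V)))
      rw [cst_zero']
      exact (congrFun (hl2 l).zero n).symm
    | tmul a b =>
      have h1 := (liftBil H.t₂_hl₂ (AdF (cstF (cst a))) (AdF (cstF (cst b))) n).2
      refine (iff_of_eq (congrArg (· ∈ meroSub U _) (funext fun l => ?_))).1 h1
      rw [← ften_cst]
      exact congrFun (conj₂_t₂ hH (x l)⁻¹ (cst a) (cst b)).symm n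
    | add v w hv hw =>
      refine (iff_of_eq (congrArg (· ∈ meroSub U _) (funext fun l => ?_))).1
        (Submodule.add_mem _ hv hw)
      rw [cst_add]
      exact (congrFun ((hl2 l).add _ _) n).symm
  let Ad₂F : (H.alg₂.mero U).Elt → (H.alg₂.mero U).Elt :=
    liftFam (fun l => conj hH (H.mLg hH) (H.mLg hH) (x l)⁻¹) (fun _ => conj_hl hH _ _ _) hmA₂
  have hQ : IsUnit (hf.X 1) := by
    refine FAlg.isUnit_of_apply_zero (Subtype.ext (funext fun l => ?_))
    exact conj_apply_zero hH (H.mΔ hH) (H.mLg hH) (x l) (v := 1) rfl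
  obtain ⟨⟨Q, Q', hQ1, hQ2⟩, hQ⟩ := hQ
  change Q = hf.X 1 at hQ
  refine ⟨hx.isOpen, fun μ => ?_, fun v => ?_, fun l hl μ v => ?_, fun l hl => ?_, fun l hl μ => ?_⟩
  · have h : Rep (U := U) (fun l => -conj hH (H.mId hH) (H.mId hH) (x l)⁻¹ (θ l μ))
      (-AdF (hf.Θ μ) : (H.alg₁.mero U).Elt) := fun l hl => rfl
    exact h.isMeroF
  · -- `Δ(x)⁻¹ v x¹ x² = (x² x¹)⁻¹ (q⁻¹ v) x² x¹` for `q = Δ(x) (x²)⁻¹ (x¹)⁻¹`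
    have h : ∀ v : H.A₂, Rep (U := U) (fun l => conj hH (H.mΔ hH) (H.mLg hH) (x l)⁻¹ v)
        (Ad₂F (Q' * H.alg₂.const U v)) := fun v l hl => by
      have h1 : H.alg₂.evR ⟨l, hl⟩ Q' * conj hH (H.mΔ hH) (H.mLg hH) (x l) 1 = 1 := by
        have := congrArg (H.alg₂.evR ⟨l, hl⟩) hQ2
        rwa [map_mul, map_one, hQ] at this
      have h2 := conj_mul hH (H.mΔ hH) (H.mLg hH) (H.mLg hH) (x l) 1
        (conj hH (H.mΔ hH) (H.mLg hH) (x l)⁻¹ v)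
      have h3 : conj hH (H.mLg hH) (H.mLg hH) (x l) (conj hH (H.mΔ hH) (H.mLg hH) (x l)⁻¹ v) =
          H.alg₂.evR ⟨l, hl⟩ Q' * v := by
        rw [_root_.one_mul, conj_conj_inv] at h2
        refine Eq.trans ?_ (congrArg (H.alg₂.evR ⟨l, hl⟩ Q' * ·) h2)
        rw [← _root_.mul_assoc, h1, _root_.one_mul]
      have h4 := conj_inv_conj hH (H.mLg hH) (H.mLg hH) (x l)
        (conj hH (H.mΔ hH) (H.mLg hH) (x l)⁻¹ v)
      rw [h3] at h4
      exact h4.symm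
    exact (h v).isMeroF
  · exact hx.hasDirDeriv_conj_inv hH _ _ hl μ v
  · obtain ⟨D, h1, h2⟩ := hx.flat hH hl
    let a : (ℕ → V) → (ℕ → V) := conj hH (H.mId hH) (H.mId hH) (x l)⁻¹
    have hal : IsHL (V := V) (W := V) a := conj_hl hH _ _ _
    have h3 : ∀ μ ν, HasDirDeriv (fun l => -conj hH (H.mId hH) (H.mId hH) (x l)⁻¹ (θ l μ)) ν l
        (-(H.ad (-a (θ l ν)) (a (θ l μ)) + a (D ν μ))) := fun μ ν => by
      have h4 := HasHDeriv.app (𝕜 := ℂ) (t := 0)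
        (Φ := fun t : ℂ => conj hH (H.mId hH) (H.mId hH) (x (l + t • ν))⁻¹)
        (Φ' := fun w => H.ad (-a (θ l ν)) (a w))
        (fun t => conj_hl hH _ _ _) ((H.ad_hl₂.right _).comp hal)
        (fun v => hx.hasDirDeriv_conj_inv hH (H.mId hH) (H.mId hH) hl ν v) (h1 μ ν)
      have h5 := HasHDeriv.map (IsHL.id (V := V)).fneg h4
      simp only [zero_smul, add_zero] at h5
      exact h5
    refine ⟨_, h3, fun μ ν => ?_⟩
    have h6 : a (D ν μ) - a (D μ ν) = H.ad (a (θ l ν)) (a (θ l μ)) := by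
      let c : H.A₁ → H.A₁ := conj hH (H.mId hH) (H.mId hH) (x l)⁻¹
      have h7 : ∀ y z : H.A₁, c (y * z - z * y) = c y * c z - c z * c y := fun y z => by
        have h9 : c (y * z - z * y) = c (y * z) - c (z * y) := hal.sub _ _
        exact h9.trans (congrArg₂ (· - ·) (conj_mul hH _ _ _ _ _ _).symm
          (conj_mul hH _ _ _ _ _ _).symm)
      have h8 := hal.sub (D ν μ) (D μ ν)
      rw [h2] at h8
      exact h8.symm.trans (h7 _ _)
    have h10 : ∀ p q s t : H.A₁, s - t = p * q - q * p →
        -((-p * q - q * -p) + s) - -((-q * p - p * -q) + t) = -p * -q - -q * -p := by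
      intro p q s t h
      have : s = p * q - q * p + t := by rw [← h]; abel
      rw [this]
      noncomm_ring
    exact h10 _ _ _ _ h6
  · -- the counit is invariant under conjugation
    have h1 : ∀ a : H.A₁, H.εh (conj hH (H.mId hH) (H.mId hH) (x l)⁻¹ a) =
        conj hH H.mZero H.mZero (x l)⁻¹ (H.εh a : algC.Elt) := fun a =>
      conj_map hH (f' := H.mZero) (g' := H.mZero) (Φ := fun a => H.εh a) H.ε_hl (fun y v => by
        have h2 : ∀ a b : H.A₁, H.εh (a * b) = fsmul (H.εh a) (H.εh b) := H.counit_mul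
        have h3 : H.εh (y * v - v * y) = H.εh (y * v) - H.εh (v * y) := H.ε_hl.sub _ _
        have h4 : H.εh (y * v - v * y) = 0 := by
          rw [h3, h2, h2, fsmul_comm, sub_self]
        refine Eq.trans h4 ?_
        have h5 : ∀ c : algC.Elt, (0 : algC.Elt) = 0 * c - c * 0 := by simp
        exact h5 _) _ _
    have h2 : conj hH H.mZero H.mZero (x l)⁻¹ (H.εh (θ l μ) : algC.Elt) = H.εh (θ l μ) :=
      conj_fixed hH _ _ (fun y => by
        have h5 : ∀ c : algC.Elt, (0 : algC.Elt) * c = c * 0 := by simp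
        exact h5 _) _
    have h3 : H.εh (θ l μ) = 0 := hf.counit l hl μ
    have h4 := (h1 (θ l μ)).trans (h2.trans h3)
    have h5 : H.ε (-conj hH (H.mId hH) (H.mId hH) (x l)⁻¹ (θ l μ)) =
        -H.εh (conj hH (H.mId hH) (H.mId hH) (x l)⁻¹ (θ l μ)) := H.ε_hl.neg _
    rw [h4, neg_zero] at h5
    exact h5

end IsMeroTilde

end DeformationHopfAlgebra

/-! ### Taylor expansions as exponentials of connections -/

namespace FAlg

variable {E : Type*} [NormedAddCommGroup E] [NormedSpace ℂ E] {U : Set E} {hU : IsOpen U}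
variable {W : Type*} [AddCommGroup W] [Module ℂ W] {A : FAlg W} {ι : Type*} [Fintype ι] {e : ι → E}

/-- The element of the algebra with the given coefficients. -/
def of (A : FAlg W) (a : ℕ → W) : A.Elt := a

lemma rep_covE {α β : ι → (A.mero U).Elt} {y : ι → A.Elt} {Dr : (E → ℕ → W) → (E → ℕ → W)}
    (h : ∀ (f : E → ℕ → W) (l : U), Dr f l = ∑ i, (A.of (dirDeriv f (e i) l) -
      A.evR l (α i) * A.of (f l) + A.of (f l) * A.evR l (β i)) * y i)
    {f : E → ℕ → W} {F : (A.mero U).Elt} (hf : Rep f F) :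
    Rep (hExp Dr f) (A.covE hU e α β y F) := by
  refine rep_hExp (fun f F hf l hl => ?_) hf
  refine (h f ⟨l, hl⟩).trans ?_
  refine Eq.trans ?_ (evR_covD (hU := hU) (e := e) α β y F ⟨l, hl⟩).symm
  have h1 : ∀ i, A.of (dirDeriv f (e i) l) = A.evR ⟨l, hl⟩ (A.der hU (e i) F) := fun i =>
    hf.dirDeriv hU (e i) l hl
  have h2 : A.of (f l) = A.evR ⟨l, hl⟩ F := hf l hl
  exact Finset.sum_congr rfl fun i _ => by rw [h1, ← h2]

lemma mul_apply_zero {a b : A.Elt} (ha : a 0 = A.one 0) (hb : b 0 = A.one 0) :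
    (a * b) 0 = A.one 0 := by
  have h1 : (fun b : A.Elt => a * b) b 0 = (fun b : A.Elt => a * b) 1 0 :=
    mod_congr (A.mulL a) hb
  exact h1.trans ((congrFun (_root_.mul_one a) 0).trans ha)

lemma evR_covE_one_apply_zero (α β : ι → (A.mero U).Elt) (y : ι → A.Elt) (l : U) :
    A.evR l (A.covE hU e α β y 1) 0 = A.one 0 := covE_apply_zero _ _ _ _ _

end FAlg

namespace DeformationHopfAlgebra

variable {V : Type*} [AddCommGroup V] [Module ℂ V] {H : DeformationHopfAlgebra V}

section Counit

variable (hH : H.LocallyFinite)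

variable (H) in
lemma eL_lg (y : H.A₁) : H.eL (H.lg y) = y + H.sc (H.εh y) 1 := by
  rw [lg, map_add, eL_l1, eL_l2, add_comm]

variable (H) in
lemma eR_lg (y : H.A₁) : H.eR (H.lg y) = y + H.sc (H.εh y) 1 := by
  rw [lg, map_add, eR_l1, eR_l2]

variable (H) in
/-- `y ↦ y + ε(y)`, the image of `y¹ + y²` under `ε ⊗ id` and under `id ⊗ ε`. -/
def mIdε : LieMap (H.ref₁ hH) := ⟨fun y => H.eL (H.lg y), H.eL_hl.comp H.lg_hl,
  fun y z => by rw [lie_lg, map_sub, map_mul, map_mul],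
  fun y hy => (mod_congr H.eL_hl (H.Δh_mod hy)).symm.trans (congrFun (H.eL_Δ y) 0)⟩

/-- For `ε(x) = 1`, the right multiplications by `x ε(x)` and by `x` are the same. -/
lemma conj_mIdε {x : H.Tilde} (hx : H.εTilde x = fone) (c : H.A₁) :
    conj hH (H.mId hH) (H.mIdε hH) x c = conj hH (H.mId hH) (H.mId hH) x c := by
  have h1 : conj hH H.mZero H.mε x (1 : algC.Elt) = 1 := by
    have h2 := conj_mul hH H.mZero H.mε H.mZero x (1 : algC.Elt) 1
    have h3 : conj hH H.mε H.mZero x (1 : algC.Elt) = 1 := (εTilde_eq hH x).symm.trans hx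
    rwa [h3, _root_.mul_one, _root_.mul_one, conj_one] at h2
  have h4 := (isRep_two (H.mId hH) (H.mIdε hH)).hom_bilin hH (isRep_two H.mZero H.mε)
    (isRep_two (H.mId hH) (H.mId hH)) (B := fun c a => fsmul c a) fsmul_hl₂ (fun y a c => by
      have h5 : ∀ (y c : H.A₁) (a : ℕ → ℂ), y * H.sc a c - H.sc a c * H.eL (H.lg y) =
          H.sc ((0 : algC.Elt) * algC.of a - algC.of a * algC.of (H.εh y)) c +
            H.sc a (y * c - c * y) := by
        intro y c a
        have h6 : H.sc ((0 : algC.Elt) * algC.of a - algC.of a * algC.of (H.εh y)) c =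
            -H.sc (fsmul a (H.εh y)) c := by
          rw [zero_mul, zero_sub]
          exact (fsmul_hl₂.left c).neg _
        have h7 : H.sc a (y * c - c * y) = H.sc a (y * c) - H.sc a (c * y) :=
          (fsmul_hl₂.right a).sub _ _
        have h8 : H.sc (fsmul a (H.εh y)) c = H.sc a (H.sc (H.εh y) c) :=
          (fsmul_hl₂.left c).fsmul _ _
        have h10 : c * H.sc (H.εh y) 1 = H.sc (H.εh y) c := by rw [mul_sc, _root_.mul_one]
        rw [h6, h7, h8, eL_lg, mul_add, sc_mul, sc_mul, h10, mul_sc]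
        have h9 : ∀ p q r : H.A₁, p - (q + r) = -r + (p - q) := by intros; abel
        exact h9 _ _ _
      exact h5 y c a) x fone c
  refine (congrArg (conj hH (H.mId hH) (H.mIdε hH) x) (fsmul_fone c).symm).trans (h4.trans ?_)
  exact (congrArg (fun a : ℕ → ℂ => fsmul a (conj hH (H.mId hH) (H.mId hH) x c)) h1).trans
    (fsmul_fone _)

lemma eL_conj {x : H.Tilde} (hx : H.εTilde x = fone) (v : H.A₂) :
    H.eL (conj hH (H.mΔ hH) (H.mLg hH) x v) = conj hH (H.mId hH) (H.mId hH) x (H.eL v) := by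
  refine (conj_map hH (f' := H.mId hH) (g' := H.mIdε hH) H.eL_hl (fun y v => ?_) x v).trans
    (conj_mIdε hH hx _)
  change H.eL (H.Δh y * v - v * H.lg y) = y * H.eL v - H.eL v * H.eL (H.lg y)
  rw [map_sub, map_mul, map_mul, eL_Δ]

lemma eR_conj {x : H.Tilde} (hx : H.εTilde x = fone) (v : H.A₂) :
    H.eR (conj hH (H.mΔ hH) (H.mLg hH) x v) = conj hH (H.mId hH) (H.mId hH) x (H.eR v) := by
  refine (conj_map hH (f' := H.mId hH) (g' := H.mIdε hH) H.eR_hl (fun y v => ?_) x v).trans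
    (conj_mIdε hH hx _)
  change H.eR (H.Δh y * v - v * H.lg y) = y * H.eR v - H.eR v * H.eL (H.lg y)
  rw [map_sub, map_mul, map_mul, eR_Δ, eL_lg, eR_lg]

end Counit

section CounitShift

variable {E : Type*} [NormedAddCommGroup E] [NormedSpace ℂ E] {U : Set E} {hU : IsOpen U}
  {ι : Type*} [Fintype ι] {e : ι → E}

lemma eL_covE {α β : ι → (H.alg₂.mero U).Elt} (h : ∀ i l, H.eL (H.alg₂.evR l (α i)) =
    H.eL (H.alg₂.evR l (β i))) (y : ι → H.A₂) (l : U) :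
    H.eL (H.alg₂.evR l (H.alg₂.covE hU e α β y 1)) = 1 := by
  have h1 := FAlg.covE_liftHom (hU := hU) (e := e) H.eL_hl α β y 1
  rw [map_one, FAlg.covE_one (A := H.alg₁) fun i => FAlg.ext_evR (A := H.alg₁) fun l => h i l] at h1
  exact (congrArg (H.alg₁.evR l) h1).trans (map_one (H.alg₁.evR l))

lemma eR_covE (α β : ι → (H.alg₂.mero U).Elt) {y : ι → H.A₂} (h : ∀ i, H.eR (y i) = 0) (l : U) :
    H.eR (H.alg₂.evR l (H.alg₂.covE hU e α β y 1)) = 1 := by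
  have h1 := FAlg.covE_liftHom (hU := hU) (e := e) H.eR_hl α β y 1
  have h2 : (fun i => H.eR (y i)) = fun _ => 0 := funext h
  rw [map_one, h2, FAlg.covE_eq_self (A := H.alg₁) (by simp [FAlg.covD])] at h1
  exact (congrArg (H.alg₁.evR l) h1).trans (map_one (H.alg₁.evR l))

end CounitShift

/-- The flip of `x¹(l) x¹(l - ħ h⁽²⁾)⁻¹` is `x²(l) x²(l - ħ h⁽¹⁾)⁻¹`. -/
lemma Flow.fl_ρ {E : Type*} [NormedAddCommGroup E] [NormedSpace ℂ E] {U : Set E}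
    {hH : H.LocallyFinite} {x : E → H.Tilde} {θ : E → E → ℕ → V} (hx : Flow hH U x θ)
    {ι : Type*} [Fintype ι] (e : ι → E) (y : ι → H.A₁) :
    FAlg.liftHom H.fl H.fl_hl U (hx.ρ e y) =
      H.alg₂.covE hx.isOpen e (fun i => hx.lt H.l2_hl (e i)) 0 (fun i => H.l1 (y i)) 1 := by
  refine (FAlg.covE_liftHom H.fl_hl _ _ _ _).trans ?_
  have h1 : (fun i => FAlg.liftHom H.fl H.fl_hl U (hx.lt H.l1_hl (e i))) =
      fun i => hx.lt H.l2_hl (e i) :=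
    funext fun i => FAlg.ext_evR fun l => H.fl_l1 _
  simp only [h1, Pi.zero_apply, map_zero, fl_l2, map_one]
  rfl

section Links

variable {𝔞 : Type*} [NormedAddCommGroup 𝔞] [NormedSpace ℂ 𝔞] [FiniteDimensional ℂ 𝔞]
  (j : 𝔞 →ₗ[ℂ] (ℕ → V)) {U : Set (StrongDual ℂ 𝔞)} {hH : H.LocallyFinite}

variable {j} in
lemma IsAbelianPrimitive.commute_basisVec (hj : H.IsAbelianPrimitive j)
    (i k : Fin (Module.finrank ℂ 𝔞)) :
    Commute (H.alg₁.of (basisVec j i)) (H.alg₁.of (basisVec j k)) := hj.commute _ _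

variable {j} in
lemma IsAbelianPrimitive.Δh_eq (hj : H.IsAbelianPrimitive j) (a : 𝔞) :
    H.Δh (j a) = H.lg (j a) := hj.primitive a

variable {j} in
lemma IsAbelianPrimitive.ε_eq (hj : H.IsAbelianPrimitive j) (a : 𝔞) : H.εh (j a) = 0 :=
  H.ε_eq_zero _ (hj.primitive a)

lemma rep_shift12 (hU : IsOpen U) {J : StrongDual ℂ 𝔞 → ℕ → V ⊗[ℂ] V} {F : (H.alg₂.mero U).Elt}
    (h : Rep J F) : Rep (H.shift12 j J) (H.shift₃ (dualVec 𝔞) (basisVec j) hU F) := by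
  refine FAlg.rep_covE (A := H.alg₃) (e := dualVec 𝔞) (hU := hU)
    (fun f l => Finset.sum_congr rfl fun i _ => ?_) (F := FAlg.liftHom H.l12 H.l12_hl U F)
    fun l hl => congrArg H.leg12 (h l hl)
  have h1 : ∀ a b c : H.A₃, a * c = (a - 0 * b + b * 0) * c := by intros; simp
  exact h1 _ (H.alg₃.of (f l)) _

lemma rep_ratioLeft {x : StrongDual ℂ 𝔞 → H.Tilde} {θ : StrongDual ℂ 𝔞 → StrongDual ℂ 𝔞 → ℕ → V}
    (hx : Flow hH U x θ) : Rep (H.ratioLeft j θ) (hx.ρ (dualVec 𝔞) (basisVec j)) := by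
  refine FAlg.rep_covE (A := H.alg₂) (e := dualVec 𝔞) (hU := hx.isOpen)
    (fun f l => Finset.sum_congr rfl fun i _ => ?_) (F := 1) fun l hl => rfl
  have h1 : ∀ a b c d : H.A₂, (a - b * c) * d = (a - b * c + c * 0) * d := by intros; simp
  exact h1 _ _ (H.alg₂.of (f l)) _

/-- `x²(l - ħ h⁽¹⁾) x²(l)⁻¹`. -/
def Flow.τ {x : StrongDual ℂ 𝔞 → H.Tilde} {θ : StrongDual ℂ 𝔞 → StrongDual ℂ 𝔞 → ℕ → V}
    (hx : Flow hH U x θ) : (H.alg₂.mero U).Elt :=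
  H.alg₂.covE hx.isOpen (dualVec 𝔞) 0 (fun i => hx.lt H.l2_hl (dualVec 𝔞 i))
    (fun i => H.l1 (basisVec j i)) 1

lemma rep_ratioTwo {x : StrongDual ℂ 𝔞 → H.Tilde} {θ : StrongDual ℂ 𝔞 → StrongDual ℂ 𝔞 → ℕ → V}
    (hx : Flow hH U x θ) : Rep (H.ratioTwo j θ) (hx.τ j) := by
  refine FAlg.rep_covE (A := H.alg₂) (e := dualVec 𝔞) (hU := hx.isOpen)
    (fun f l => Finset.sum_congr rfl fun i _ => ?_) (F := 1) fun l hl => rfl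
  have h1 : ∀ a b c d : H.A₂, (a + c * b) * d = (a - 0 * c + c * b) * d := by intros; simp
  exact h1 _ _ (H.alg₂.of (f l)) _

/-- `x¹(l - ħ h⁽²⁾) x¹(l)⁻¹`; for the function `x⁻¹` in place of `x`, this is
`x¹(l - ħ h⁽²⁾)⁻¹ x¹(l)`. -/
def Flow.σ {x : StrongDual ℂ 𝔞 → H.Tilde} {θ : StrongDual ℂ 𝔞 → StrongDual ℂ 𝔞 → ℕ → V}
    (hx : Flow hH U x θ) : (H.alg₂.mero U).Elt :=
  H.alg₂.covE hx.isOpen (dualVec 𝔞) 0 (fun i => hx.lt H.l1_hl (dualVec 𝔞 i))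
    (fun i => H.l2 (basisVec j i)) 1

lemma rep_ratioRight {x : StrongDual ℂ 𝔞 → H.Tilde} {θ : StrongDual ℂ 𝔞 → StrongDual ℂ 𝔞 → ℕ → V}
    (hx : Flow hH U (fun l => (x l)⁻¹)
      fun l μ => -conj hH (H.mId hH) (H.mId hH) (x l)⁻¹ (θ l μ)) :
    Rep (H.ratioRight j x θ) (hx.σ j) := by
  refine FAlg.rep_covE (A := H.alg₂) (e := dualVec 𝔞) (hU := hx.isOpen)
    (fun f l => Finset.sum_congr rfl fun i _ => ?_) (F := 1) fun l hl => rfl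
  have h1 : ∀ (a c d : H.A₂) (b b' : H.A₁), b = b' →
      (a - c * H.l1 b) * d = (a - 0 * c + c * H.l1 (-b')) * d := by
    rintro a c d b _ rfl
    rw [map_neg, zero_mul, sub_zero, mul_neg, sub_eq_add_neg]
  exact h1 _ (H.alg₂.of (f l)) _ _ _ (Ad_eq hH _ _)

variable {j} (hj : H.IsAbelianPrimitive j) {x : StrongDual ℂ 𝔞 → H.Tilde}
  {θ : StrongDual ℂ 𝔞 → StrongDual ℂ 𝔞 → ℕ → V} (hx : Flow hH U x θ)
include hj

lemma Flow.σ_mul_ρ : hx.σ j * hx.ρ (dualVec 𝔞) (basisVec j) = 1 := by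
  have h1 := FAlg.covE_mul (hU := hx.isOpen) (e := dualVec 𝔞) (A := H.alg₂)
    (y := fun i => H.l2 (basisVec j i)) (β := fun i => hx.lt H.l1_hl (dualVec 𝔞 i))
    (γ := 0) (G := 1)
    (fun i k => (hj.commute_basisVec i k).map H.l2)
    (fun i k => FAlg.commute_of_evR fun l => (H.commute_l1_l2 _ _).symm)
    (fun i k => Commute.zero_right _) (fun k => Commute.one_right _) 0 1
  rw [_root_.mul_one, FAlg.covE_one fun _ => rfl] at h1
  exact h1.symm

/-- The flip of `x¹(l) x¹(l - ħ h⁽²⁾)⁻¹` is inverse to `x²(l - ħ h⁽¹⁾) x²(l)⁻¹`. -/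
lemma Flow.fl_ρ_inv :
    hx.τ j * FAlg.liftHom H.fl H.fl_hl U (hx.ρ (dualVec 𝔞) (basisVec j)) = 1 ∧
      FAlg.liftHom H.fl H.fl_hl U (hx.ρ (dualVec 𝔞) (basisVec j)) * hx.τ j = 1 := by
  have hc : ∀ i k, Commute (H.alg₂.const U (H.l1 (basisVec j k)))
      (hx.lt H.l2_hl (dualVec 𝔞 i)) :=
    fun i k => FAlg.commute_of_evR fun l => H.commute_l1_l2 _ _
  have h1 := fun α γ hγ => FAlg.covE_mul (hU := hx.isOpen) (e := dualVec 𝔞) (A := H.alg₂)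
    (y := fun i => H.l1 (basisVec j i)) (β := fun i => hx.lt H.l2_hl (dualVec 𝔞 i))
    (γ := γ) (G := 1)
    (fun i k => (hj.commute_basisVec i k).map H.l1) hc hγ (fun k => Commute.one_right _) α 1
  have h2 := FAlg.covE_mul (hU := hx.isOpen) (e := dualVec 𝔞) (A := H.alg₂)
    (y := fun i => H.l1 (basisVec j i)) (β := 0)
    (γ := fun i => hx.lt H.l2_hl (dualVec 𝔞 i)) (G := 1)
    (fun i k => (hj.commute_basisVec i k).map H.l1) (fun i k => Commute.zero_right _) hc
    (fun k => Commute.one_right _) (fun i => hx.lt H.l2_hl (dualVec 𝔞 i)) 1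
  have h3 := h1 0 0 fun i k => Commute.zero_right _
  rw [_root_.mul_one, FAlg.covE_one fun _ => rfl] at h2 h3
  have h4 := Flow.fl_ρ hx (dualVec 𝔞) fun i => H.alg₁.of (basisVec j i)
  exact ⟨(congrArg (hx.τ j * ·) h4).trans h3.symm, (congrArg (· * hx.τ j) h4).trans h2.symm⟩

lemma Flow.eL_ρ (l : U) : H.eL (H.alg₂.evR l (hx.ρ (dualVec 𝔞) (basisVec j))) = 1 := by
  refine eL_covE (fun i l => ?_) _ l
  have h1 : ∀ y : H.A₁, H.εh y = 0 → H.eL (H.l1 y) = H.eL 0 := fun y hy => by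
    rw [eL_l1, hy, map_zero]
    exact (fsmul_hl₂.left _).zero
  exact h1 _ (hx.counit l l.2 _)

lemma Flow.eR_ρ (l : U) : H.eR (H.alg₂.evR l (hx.ρ (dualVec 𝔞) (basisVec j))) = 1 := by
  refine eR_covE _ _ (fun i => ?_) l
  have h1 : ∀ y : H.A₁, H.εh y = 0 → H.eR (H.l2 y) = 0 := fun y hy => by
    rw [eR_l2, hy]
    exact (fsmul_hl₂.left _).zero
  exact h1 _ (hj.ε_eq _)

lemma Flow.eL_σ (l : U) : H.eL (H.alg₂.evR l (hx.σ j)) = 1 := by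
  have h1 := congrArg (fun F => H.eL (H.alg₂.evR l F)) (Flow.σ_mul_ρ hj hx)
  simp only [map_mul, map_one, Flow.eL_ρ hj, _root_.mul_one] at h1
  exact h1

lemma Flow.eR_σ (l : U) : H.eR (H.alg₂.evR l (hx.σ j)) = 1 := by
  have h1 := congrArg (fun F => H.eR (H.alg₂.evR l F)) (Flow.σ_mul_ρ hj hx)
  simp only [map_mul, map_one, Flow.eR_ρ hj, _root_.mul_one] at h1
  exact h1

end Links

section RMatrix

variable (hH : H.LocallyFinite)

lemma inv₂_eq {a b : H.A₂} (h1 : a * b = 1) (h2 : b * a = 1) : H.inv₂ a = b := by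
  classical
  have h : ∃ b, H.mul₂ a b = H.one₂ ∧ H.mul₂ b a = H.one₂ := ⟨b, h1, h2⟩
  have h3 : H.inv₂ a = h.choose := dif_pos h
  obtain ⟨h4, h5⟩ := h.choose_spec
  have h6 : ∀ c : H.A₂, c * a = 1 → c = b := fun c hc => left_inv_eq_right_inv hc h1
  exact h3.trans (h6 _ h5)

lemma fl_conj (x : H.Tilde) (v : H.A₂) :
    H.fl (conj hH (H.mΔ hH) (H.mLg hH) x v) = conj hH (H.mΔop hH) (H.mLg hH) x (H.fl v) :=
  conj_map hH H.fl_hl (fun y v => by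
    change H.fl (H.Δh y * v - v * H.lg y) = H.fl (H.Δh y) * H.fl v - H.fl v * H.lg y
    have h : H.fl (H.lg y) = H.lg y := by rw [lg, map_add, fl_l1, fl_l2, add_comm]
    rw [map_sub, map_mul, map_mul, h]) x v

variable {𝔞 : Type*} [NormedAddCommGroup 𝔞] [NormedSpace ℂ 𝔞] [FiniteDimensional ℂ 𝔞]
  {j : 𝔞 →ₗ[ℂ] (ℕ → V)} {U : Set (StrongDual ℂ 𝔞)} {hH} {x : StrongDual ℂ 𝔞 → H.Tilde}
  {θ : StrongDual ℂ 𝔞 → StrongDual ℂ 𝔞 → ℕ → V}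

/-- The transformation of dynamical `R`-matrices under a gauge transformation: `R` intertwines the
coproduct and the opposite coproduct of `x`, and the flip of `x¹(l) x¹(l - ħ h⁽²⁾)⁻¹` is inverse to
`x²(l - ħ h⁽¹⁾) x²(l)⁻¹`. -/
theorem dynR_twist₂_mul_ratioLeft (hj : H.IsAbelianPrimitive j) (hx : Flow hH U x θ)
    {R : ℕ → V ⊗[ℂ] V} (hR : H.IsUniversalR R) {l : StrongDual ℂ 𝔞} (hl : l ∈ U)
    {K : H.A₂} (hK : K 0 = H.one₂ 0) :
    H.dynR R (H.mul₂ (H.twist₂ (x l) K) (H.ratioLeft j θ l)) =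
      H.mul₂ (H.mul₂ (H.ratioTwo j θ l) (H.Ad₂ (x l) (H.dynR R K))) (H.ratioLeft j θ l) := by
  have hτ := congrArg (H.alg₂.evR ⟨l, hl⟩) (hx.fl_ρ_inv hj).1
  have hτ' := congrArg (H.alg₂.evR ⟨l, hl⟩) (hx.fl_ρ_inv hj).2
  rw [map_mul, map_one, FAlg.evR_liftHom] at hτ hτ'
  obtain ⟨⟨k, k', hk, hk'⟩, hkK⟩ := (FAlg.isUnit_of_apply_zero (A := H.alg₂) hK).map H.fl
  change k = H.fl K at hkK
  set r := H.alg₂.evR ⟨l, hl⟩ (hx.ρ (dualVec 𝔞) (basisVec j))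
  set t := H.alg₂.evR ⟨l, hl⟩ (hx.τ j)
  have hr : H.ratioLeft j θ l = r := rep_ratioLeft j hx l hl
  have ht : H.ratioTwo j θ l = t := rep_ratioTwo j hx l hl
  refine (congrArg (H.dynR R) (congrArg₂ H.mul₂ (twist₂_eq hH _ _) hr)).trans (Eq.trans ?_
    (congrArg₂ H.mul₂ (congrArg₂ H.mul₂ ht.symm (Ad₂_eq hH _ _).symm) hr.symm))
  have hfl : H.fl (conj hH (H.mΔ hH) (H.mLg hH) (x l) K) =
      conj hH (H.mΔop hH) (H.mLg hH) (x l) k := by rw [fl_conj, hkK]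
  have hinv : H.inv₂ (flip (H.mul₂ (conj hH (H.mΔ hH) (H.mLg hH) (x l) K) r)) =
      t * conj hH (H.mLg hH) (H.mΔop hH) (x l) k' := by
    have h : ∀ a : H.A₂, H.fl a = conj hH (H.mΔop hH) (H.mLg hH) (x l) k →
        H.inv₂ (H.fl (a * r)) = t * conj hH (H.mLg hH) (H.mΔop hH) (x l) k' := fun a ha => by
      rw [map_mul, ha]
      refine inv₂_eq ?_ ?_
      · rw [_root_.mul_assoc, ← _root_.mul_assoc (H.fl r), hτ', _root_.one_mul, conj_mul, hk,
          conj_one]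
      · rw [_root_.mul_assoc, ← _root_.mul_assoc _ _ (H.fl r), conj_mul, hk', conj_one,
          _root_.one_mul, hτ]
    exact h _ hfl
  have hinv' : H.inv₂ (flip K) = k' := by
    have h : ∀ a : H.A₂, k = H.fl a → H.inv₂ (H.fl a) = k' := fun a ha => by
      rw [← ha]
      exact inv₂_eq hk hk'
    exact h K hkK
  have hRfix : conj hH (H.mΔop hH) (H.mΔ hH) (x l) R = R :=
    conj_fixed hH _ _ (fun y => (hR.intertwines y).symm) _
  have h : ∀ R : H.A₂, conj hH (H.mΔop hH) (H.mΔ hH) (x l) R = R →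
      t * conj hH (H.mLg hH) (H.mΔop hH) (x l) k' * R *
        (conj hH (H.mΔ hH) (H.mLg hH) (x l) K * r) =
      t * conj hH (H.mLg hH) (H.mLg hH) (x l) (k' * R * K) * r := fun R hR => by
    rw [← conj_mul hH (H.mLg hH) (H.mΔ hH), ← conj_mul hH (H.mLg hH) (H.mΔop hH), hR]
    noncomm_ring
  exact (congrArg (fun a => H.mul₂ (H.mul₂ a R) _) hinv).trans ((h R hRfix).trans
    (congrArg (fun a => H.mul₂ (H.mul₂ t (conj hH (H.mLg hH) (H.mLg hH) (x l)
      (H.mul₂ (H.mul₂ a R) K))) r) hinv'.symm))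

end RMatrix

end DeformationHopfAlgebra

/-! ### Restriction to a subspace -/

lemma IsHL₂.sum_transpose {V₁ V₂ W : Type*} [AddCommGroup V₁] [Module ℂ V₁] [AddCommGroup V₂]
    [Module ℂ V₂] [AddCommGroup W] [Module ℂ W] {B : (ℕ → V₁) → (ℕ → V₂) → (ℕ → W)} (hB : IsHL₂ B)
    {I J : Type*} [Fintype I] [Fintype J] (c : I → J → ℂ) (a : J → ℕ → V₁) (y : I → ℕ → V₂) :
    ∑ i, B (∑ k, c i k • a k) (y i) = ∑ k, B (a k) (∑ i, c i k • y i) := by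
  have h1 : ∀ i, B (∑ k, c i k • a k) (y i) = ∑ k, c i k • B (a k) (y i) := fun i => by
    rw [(hB.left _).sum]
    exact Finset.sum_congr rfl fun k _ => (hB.left _).smul _ _
  have h2 : ∀ k, B (a k) (∑ i, c i k • y i) = ∑ i, c i k • B (a k) (y i) := fun k => by
    rw [(hB.right _).sum]
    exact Finset.sum_congr rfl fun i _ => (hB.right _).smul _ _
  simp only [h1, h2]
  exact Finset.sum_comm

section Restrict

variable {𝔞 : Type*} [NormedAddCommGroup 𝔞] [NormedSpace ℂ 𝔞] [FiniteDimensional ℂ 𝔞]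
  (𝔟 : Submodule ℂ 𝔞)

/-- The projection `𝔞* → 𝔟*` as a continuous linear map. -/
def resL : StrongDual ℂ 𝔞 →L[ℂ] StrongDual ℂ 𝔟 :=
  (ContinuousLinearMap.compL ℂ 𝔟 𝔞 ℂ).flip 𝔟.subtypeL

@[simp] lemma resL_apply (l : StrongDual ℂ 𝔞) : resL 𝔟 l = res 𝔟 l := rfl

lemma exists_resL_section : ∃ s : StrongDual ℂ 𝔟 →L[ℂ] StrongDual ℂ 𝔞, ∀ l, resL 𝔟 (s l) = l := by
  obtain ⟨q, hq⟩ := LinearMap.exists_leftInverse_of_injective 𝔟.subtype (Submodule.ker_subtype 𝔟)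
  refine ⟨(ContinuousLinearMap.compL ℂ 𝔞 𝔟 ℂ).flip (LinearMap.toContinuousLinearMap q),
    fun l => ?_⟩
  ext b
  exact congrArg l (LinearMap.congr_fun hq b)

/-- A linear section of the projection `𝔞* → 𝔟*`. -/
def resSection : StrongDual ℂ 𝔟 →L[ℂ] StrongDual ℂ 𝔞 := (exists_resL_section 𝔟).choose

lemma resL_section (l : StrongDual ℂ 𝔟) : resL 𝔟 (resSection 𝔟 l) = l :=
  (exists_resL_section 𝔟).choose_spec l

lemma isOpenMap_resL : IsOpenMap (resL 𝔟) :=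
  IsOpenMap.of_sections fun l => ⟨fun l' => l + resSection 𝔟 (l' - resL 𝔟 l),
    (continuous_const.add ((resSection 𝔟).continuous.comp
      (continuous_id.sub continuous_const))).continuousAt,
    by simp, fun l' => by rw [map_add, resL_section]; abel⟩

lemma isOpen_inter_preimage_res {U : Set (StrongDual ℂ 𝔞)} {U' : Set (StrongDual ℂ 𝔟)}
    (hU : IsOpen U) (hU' : IsOpen U') : IsOpen (U ∩ res 𝔟 ⁻¹' U') :=
  hU.inter (hU'.preimage (resL 𝔟).continuous)

lemma dense_inter_preimage_res {U : Set (StrongDual ℂ 𝔞)} {U' : Set (StrongDual ℂ 𝔟)}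
    (hU : IsOpen U) (hd : Dense U) (hd' : Dense U') : Dense (U ∩ res 𝔟 ⁻¹' U') :=
  hd.inter_of_isOpen_left (hd'.preimage (isOpenMap_resL 𝔟)) hU

lemma res_dualVec (i : Fin (Module.finrank ℂ 𝔞)) :
    resL 𝔟 (DeformationHopfAlgebra.dualVec 𝔞 i) = ∑ k,
      DeformationHopfAlgebra.dualVec 𝔞 i (Module.finBasis ℂ 𝔟 k : 𝔞) •
        DeformationHopfAlgebra.dualVec 𝔟 k := by
  refine ContinuousLinearMap.coe_injective ((Module.finBasis ℂ 𝔟).ext fun m => ?_)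
  simp [DeformationHopfAlgebra.dualVec, res, Finsupp.single_apply]

end Restrict

lemma IsMero.congr {E : Type*} [NormedAddCommGroup E] [NormedSpace ℂ E] {U : Set E} {f g : E → ℂ}
    (hU : IsOpen U) (hf : IsMero U f) (h : ∀ l ∈ U, f l = g l) : IsMero U g := by
  refine ⟨fun l hl => (hf.1 l hl).congr
    (Filter.eventuallyEq_of_mem (hU.mem_nhds hl) fun l hl => h l hl), fun l₀ => ?_⟩
  obtain ⟨a, b, ha, hb, h0, h1⟩ := hf.2 l₀
  exact ⟨a, b, ha, hb, h0, h1.mono fun l hl hlU => by rw [← h l hlU]; exact hl hlU⟩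

lemma IsMero.sum {E : Type*} [NormedAddCommGroup E] [NormedSpace ℂ E] {U : Set E} {ι : Type*}
    (s : Finset ι) {f : ι → E → ℂ} (hf : ∀ i ∈ s, IsMero U (f i)) :
    IsMero U fun l => ∑ i ∈ s, f i l := by
  classical
  induction s using Finset.induction_on with
  | empty => simpa using IsMero.const 0
  | insert a s ha ih =>
    simp only [Finset.sum_insert ha]
    exact (hf a (Finset.mem_insert_self a s)).add
      (ih fun i hi => hf i (Finset.mem_insert_of_mem hi))

section Descend

variable {E E' W : Type*} [NormedAddCommGroup E] [NormedSpace ℂ E] [NormedAddCommGroup E']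
  [NormedSpace ℂ E'] [AddCommGroup W] [Module ℂ W]

lemma IsMeroF.mono {U U' : Set E} {F : E → ℕ → W} (hF : IsMeroF U F) (h : U' ⊆ U) :
    IsMeroF U' F := by
  intro n
  obtain ⟨k, c, v, h1, h2⟩ := hF n
  exact ⟨k, c, v, fun i => (h1 i).mono h, fun l hl => h2 l (h hl)⟩

/-- A vector valued function is meromorphic if its pullback along a surjective linear map is so. -/
lemma IsMeroF.descend {O : Set E} (hO : IsOpen O) (hd : Dense O) (p : E →L[ℂ] E') (s : E' →L[ℂ] E)
    (hps : ∀ l, p (s l) = l) {F : E' → ℕ → W} (hF : IsMeroF O fun l => F (p l)) :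
    IsMeroF (p '' O) F := by
  intro n
  obtain ⟨k, c, v, h1, h2⟩ := hF n
  have hfd : FiniteDimensional ℂ (Submodule.span ℂ (Set.range v)) :=
    FiniteDimensional.span_of_finite ℂ (Set.finite_range v)
  obtain ⟨I, _, w, φ, hw, hφ⟩ := exists_coord (Submodule.span ℂ (Set.range v))
  let e := Fintype.equivFin I
  refine ⟨Fintype.card I, fun i l => φ (e.symm i) (F l n), fun i => w (e.symm i), fun i => ?_, ?_⟩
  · refine IsMero.descend hd p s hps ?_
    have h3 : IsMero O fun l => ∑ m, c m l * φ (e.symm i) (v m) :=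
      IsMero.sum _ fun m _ => (h1 m).mul (IsMero.const _)
    refine h3.congr hO fun l hl => ?_
    change _ = φ (e.symm i) (F (p l) n)
    rw [show F (p l) n = _ from h2 l hl]
    simp
  · rintro _ ⟨l, hl, rfl⟩
    have h3 : F (p l) n ∈ Submodule.span ℂ (Set.range v) := by
      rw [show F (p l) n = _ from h2 l hl]
      exact Submodule.sum_mem _ fun i _ => Submodule.smul_mem _ _
        (Submodule.subset_span (Set.mem_range_self i))
    refine (hφ _ h3).trans ?_
    exact (e.symm.sum_comp fun i => φ i (F (p l) n) • w i).symm

end Descend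

namespace DeformationHopfAlgebra

variable {V : Type*} [AddCommGroup V] [Module ℂ V] {H : DeformationHopfAlgebra V}

lemma IsMeroTilde.mono {E : Type*} [NormedAddCommGroup E] [NormedSpace ℂ E] {U U' : Set E}
    {x : E → H.Tilde} {θ : E → E → ℕ → V} (hx : H.IsMeroTilde U x θ) (h : U' ⊆ U) (ho : IsOpen U')
    (hd : Dense U') : H.IsMeroTilde U' x θ :=
  ⟨ho, hd, fun l hl => hx.holo l (h hl), fun μ => (hx.mero_logDeriv μ).mono h,
    fun v => (hx.mero_Ad v).mono h, fun v => (hx.mero_Ad_inv v).mono h,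
    fun v => (hx.mero_twist₂ v).mono h⟩

section Pull

variable {E E' : Type*} [NormedAddCommGroup E] [NormedSpace ℂ E] [NormedAddCommGroup E']
  [NormedSpace ℂ E'] {U : Set E} {U' : Set E'} (hU : IsOpen U) (hU' : IsOpen U') (p : E →L[ℂ] E')
  (s : E' →L[ℂ] E) (hps : ∀ l, p (s l) = l) (hp : ∀ l ∈ U, p l ∈ U')

/-- The pullback of functions with values in an algebra. -/
def _root_.Deform.FAlg.pull {W : Type*} [AddCommGroup W] [Module ℂ W] (A : FAlg W)
    (F : (A.mero U').Elt) : (A.mero U).Elt := Deform.pull p s hps hp F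

lemma _root_.Deform.FAlg.evR_pull {W : Type*} [AddCommGroup W] [Module ℂ W] (A : FAlg W)
    (F : (A.mero U').Elt) (l : U) :
    A.evR l (A.pull p s hps hp F) = A.evR ⟨p l, hp l l.2⟩ F := rfl

variable {ι κ : Type*} [Fintype ι] [Fintype κ] {e : ι → E} {e' : κ → E'} {y : ι → ℕ → V}
  {y' : κ → ℕ → V} (c : ι → κ → ℂ)

/-- Taylor shifts commute with pullbacks along `p : E → E'`, if the vectors `e'` and `y'` correspond
to `e` and `y` by transposed matrices. -/
lemma shift₃_pull (he : ∀ i, p (e i) = ∑ k, c i k • e' k) (hy : ∀ k, y' k = ∑ i, c i k • y i)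
    (F : (H.alg₂.mero U').Elt) :
    H.shift₃ e y hU (H.alg₂.pull p s hps hp F) = H.alg₃.pull p s hps hp (H.shift₃ e' y' hU' F) := by
  have hB : IsHL₂ (V := (V ⊗[ℂ] V) ⊗[ℂ] V) (V' := V) (W := (V ⊗[ℂ] V) ⊗[ℂ] V)
      fun (a : H.A₃) (b : H.A₁) => a * H.l3 b := H.alg₃.mul_hl₂.comp_right H.l3_hl
  have key : ∀ G : (H.alg₃.mero U').Elt,
      H.alg₃.pull p s hps hp (H.alg₃.covD hU' e' 0 0 (fun i => H.l3 (y' i)) G) =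
        H.alg₃.covD hU e 0 0 (fun i => H.l3 (y i)) (H.alg₃.pull p s hps hp G) := by
    intro G
    refine FAlg.ext_evR fun l => ?_
    have h1 : ∀ i, H.alg₃.evR l (H.alg₃.der hU (e i) (H.alg₃.pull p s hps hp G)) =
        ∑ k, c i k • ev (⟨p l, hp l l.2⟩ : U') (dd hU' (e' k) G) := fun i => by
      have h2 : H.alg₃.evR l (H.alg₃.der hU (e i) (H.alg₃.pull p s hps hp G)) =
          ev (⟨p l, hp l l.2⟩ : U') (dd hU' (p (e i)) G) :=
        congrArg (ev l) (dd_pull hU hU' p s hps hp _ G)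
      have h6 : ∀ G : ℕ → meroSub U' ((V ⊗[ℂ] V) ⊗[ℂ] V),
          ev (⟨p l, hp l l.2⟩ : U') (dd hU' (∑ k, c i k • e' k) G) =
            ∑ k, c i k • ev (⟨p l, hp l l.2⟩ : U') (dd hU' (e' k) G) := fun G => by
        rw [dd_sum, (ev_hl _).sum]
        exact Finset.sum_congr rfl fun k _ => (ev_hl _).smul _ _
      exact (h2.trans (congrArg (fun μ => ev (⟨p l, hp l l.2⟩ : U') (dd hU' μ G)) (he i))).trans
        (h6 G)
    have h3 := hB.sum_transpose c (fun k => ev (⟨p l, hp l l.2⟩ : U') (dd hU' (e' k) G)) y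
    have h4 : ∀ a b : H.A₃, a - 0 * b + b * 0 = a := by intros; simp
    have h5 : ∀ i, (∑ k, c i k • ev (⟨p l, hp l l.2⟩ : U') (dd hU' (e' k) G)) =
      H.alg₃.evR l (H.alg₃.der hU (e i) (H.alg₃.pull p s hps hp G)) := fun i => (h1 i).symm
    simp only [← hy, h5] at h3
    rw [FAlg.evR_pull, FAlg.evR_covD, FAlg.evR_covD]
    simp only [Pi.zero_apply, map_zero, h4]
    exact h3.symm
  exact (IsHL.hexp (Z := meroSub U' _) (Z₁ := meroSub U _)
    (pull_hl (W := (V ⊗[ℂ] V) ⊗[ℂ] V) p s hps hp)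
    (D := H.alg₃.covD hU' e' 0 0 fun i => H.l3 (y' i))
    (D' := H.alg₃.covD hU e 0 0 fun i => H.l3 (y i))
    (FAlg.liftHom H.l12 H.l12_hl U' F) fun _ => key _).symm

end Pull

end DeformationHopfAlgebra

namespace DeformationHopfAlgebra

variable {V : Type*} [AddCommGroup V] [Module ℂ V] {H : DeformationHopfAlgebra V}

/-! ### Vertex-IRF transformations -/

section ZeroWeight

variable (hH : H.LocallyFinite) {x : H.Tilde} {b : H.A₁}

lemma conj₃_mul_l3 (hb : conj hH (H.mId hH) (H.mId hH) x b = b) (v : H.A₃) :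
    conj hH (H.mΔ₃ hH) (H.mLg₃ hH) x (v * H.l3 b) =
      conj hH (H.mΔ₃ hH) (H.mLg₃ hH) x v * H.l3 b := by
  have h1 : H.l3 (conj hH (H.mId hH) (H.mId hH) x b) =
      conj hH (H.mLg₃ hH) (H.mLg₃ hH) x (H.l3 b) :=
    conj_map hH H.l3_hl (fun y v => by
      change H.l3 (y * v - v * y) = (H.l12 (H.lg y) + H.l3 y) * H.l3 v -
        H.l3 v * (H.l12 (H.lg y) + H.l3 y)
      rw [add_mul, mul_add, (H.commute_l12_l3 v (H.lg y)).eq, map_sub, map_mul, map_mul]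
      abel) x b
  rw [← conj_mul hH _ (H.mLg₃ hH), ← h1, hb]

variable {E : Type*} [NormedAddCommGroup E] [NormedSpace ℂ E] {U : Set E} (hU : IsOpen U)
  {ι : Type*} [Fintype ι] (e : ι → E) {y : ι → H.A₁}

/-- A linear map of `H ⊗ H ⊗ H` which commutes with multiplication by `y³` commutes with the Taylor
shift. -/
lemma apply_shift₃ {Φ : H.A₃ → H.A₃}
    (hΦ : IsHL (V := (V ⊗[ℂ] V) ⊗[ℂ] V) (W := (V ⊗[ℂ] V) ⊗[ℂ] V) Φ)
    (h : ∀ i v, Φ (v * H.l3 (y i)) = Φ v * H.l3 (y i)) (F : (H.alg₂.mero U).Elt) :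
    (liftHL hΦ (H.shift₃ e y hU F) : (H.alg₃.mero U).Elt) = H.alg₃.covE hU e 0 0
      (fun i => H.l3 (y i)) (liftHL hΦ (FAlg.liftHom H.l12 H.l12_hl U F)) := by
  refine FAlg.covE_map (liftHL_hl hΦ) (fun G => FAlg.ext_evR fun l => ?_) _
  obtain ⟨G', hG'⟩ : ∃ G' : (H.alg₃.mero U).Elt, G' = liftHL hΦ G := ⟨_, rfl⟩
  have h1 : ∀ i, H.alg₃.evR l (H.alg₃.der hU (e i) G') =
      Φ (H.alg₃.evR l (H.alg₃.der hU (e i) G)) := fun i =>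
    (congrArg (fun F => H.alg₃.evR l (H.alg₃.der hU (e i) F)) hG').trans
      (congrArg (ev l) (dd_liftHL hU hΦ (e i) G))
  have h2 : ∀ a b : H.A₃, a - 0 * b + b * 0 = a := by intros; simp
  have h3 : H.alg₃.evR l (liftHL hΦ (H.alg₃.covD hU e 0 0 (fun i => H.l3 (y i)) G)) =
      Φ (H.alg₃.evR l (H.alg₃.covD hU e 0 0 (fun i => H.l3 (y i)) G)) := rfl
  refine h3.trans (Eq.trans ?_ (congrArg (fun F => H.alg₃.evR l (H.alg₃.covD hU e 0 0
    (fun i => H.l3 (y i)) F)) hG'))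
  rw [FAlg.evR_covD, FAlg.evR_covD]
  simp only [Pi.zero_apply, map_zero, h2, h1, ← h]
  exact hΦ.sum _ _

lemma shift₃_one : H.shift₃ e y hU (1 : (H.alg₂.mero U).Elt) = 1 := by
  rw [shift₃, map_one, FAlg.covE_one fun _ => rfl]

/-- For elements of zero weight, the conjugations of Taylor shifts by `x¹ x²` and by `x¹ x² x³`
agree. -/
lemma conj₃_shift₃ (hb : ∀ i, conj hH (H.mId hH) (H.mId hH) x (y i) = y i)
    (F : (H.alg₂.mero U).Elt) (l : U) :
    conj hH (H.mΔ₃ hH) (H.mLg₃ hH) x (H.alg₃.evR l (H.shift₃ e y hU F)) =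
      conj hH (H.mΔ₁₂ hH) (H.mLg₁₂ hH) x (H.alg₃.evR l (H.shift₃ e y hU F)) := by
  have h1 := apply_shift₃ hU e (conj_hl hH (H.mΔ₃ hH) (H.mLg₃ hH) x)
    (fun i v => conj₃_mul_l3 hH (hb i) v) F
  have h2 := apply_shift₃ hU e (conj_hl hH (H.mΔ₁₂ hH) (H.mLg₁₂ hH) x)
    (fun i v => conj₁₂_mul_l3 hH x (y i) v) F
  have h3 : (liftHL (conj_hl hH (H.mΔ₃ hH) (H.mLg₃ hH) x) (FAlg.liftHom H.l12 H.l12_hl U F) :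
      (H.alg₃.mero U).Elt) =
      liftHL (conj_hl hH (H.mΔ₁₂ hH) (H.mLg₁₂ hH) x) (FAlg.liftHom H.l12 H.l12_hl U F) :=
    FAlg.ext_evR fun l => by
      refine (conj₃_t₃ hH x (H.alg₂.evR l F) 1).trans ?_
      rw [conj_one]
      exact (conj₁₂_t₃ hH x (H.alg₂.evR l F) 1).symm
  rw [h3] at h1
  exact congrArg (H.alg₃.evR l) (h1.trans h2.symm)

end ZeroWeight

section Twist

variable {𝔞 : Type*} [NormedAddCommGroup 𝔞] [NormedSpace ℂ 𝔞] [FiniteDimensional ℂ 𝔞]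
  {j : 𝔞 →ₗ[ℂ] (ℕ → V)} {U : Set (StrongDual ℂ 𝔞)} {x : StrongDual ℂ 𝔞 → H.Tilde}
  {θ : StrongDual ℂ 𝔞 → StrongDual ℂ 𝔞 → ℕ → V} {hH : H.LocallyFinite}

lemma vertexIRF_apply (hx : Flow hH U x θ) {f : StrongDual ℂ 𝔞 → ℕ → V ⊗[ℂ] V}
    {K : (H.alg₂.mero U).Elt} (hf : Rep f K) :
    Rep (H.vertexIRF j x θ f) (hx.X K * hx.ρ (dualVec 𝔞) (basisVec j) : (H.alg₂.mero U).Elt) :=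
  fun l hl => by
    have h1 : H.twist₂ (x l) (f l) = H.alg₂.evR ⟨l, hl⟩ (hx.X K) :=
      (twist₂_eq hH _ _).trans (congrArg (conj hH (H.mΔ hH) (H.mLg hH) (x l)) (hf l hl))
    exact congrArg₂ H.mul₂ h1 (rep_ratioLeft j hx l hl)

/-- Vertex-IRF transformations of solutions `f` of the twist equation, provided that the Taylor
shift of `f` commutes with `x³` in the sense of the hypothesis `hb`. -/
theorem isDynamicalTwist_vertexIRF (hj : H.IsAbelianPrimitive j) (hx : Flow hH U x θ) (hd : Dense U)
    (hε : ∀ l ∈ U, H.εTilde (x l) = fone) {f : StrongDual ℂ 𝔞 → ℕ → V ⊗[ℂ] V}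
    {K : (H.alg₂.mero U).Elt} (hf : Rep f K) (hmod : ∀ l ∈ U, f l 0 = H.one₂ 0)
    (hL : ∀ l ∈ U, H.counitLeft (f l) = H.one) (hR : ∀ l ∈ U, H.counitRight (f l) = H.one)
    (htw : ∀ l : U, H.cL (H.alg₂.evR l K) *
        H.alg₃.evR l (H.shift₃ (dualVec 𝔞) (basisVec j) hx.isOpen K) =
      H.cR (H.alg₂.evR l K) * H.l23 (H.alg₂.evR l K))
    (hb : ∀ l : U, conj hH (H.mΔ₃ hH) (H.mLg₃ hH) (x l)
        (H.alg₃.evR l (H.shift₃ (dualVec 𝔞) (basisVec j) hx.isOpen K)) =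
      conj hH (H.mΔ₁₂ hH) (H.mLg₁₂ hH) (x l)
        (H.alg₃.evR l (H.shift₃ (dualVec 𝔞) (basisVec j) hx.isOpen K)))
    (hw : ∀ l ∈ U, H.ZeroWeight₂ j (H.vertexIRF j x θ f l)) :
    H.IsDynamicalTwist j U (H.vertexIRF j x θ f) := by
  have hrep := vertexIRF_apply (j := j) hx hf
  have hε' := fun l hl => hε l hl
  refine ⟨hx.isOpen, hd, hrep.isMeroF, hw, fun l hl => ?_, fun l hl => ?_, fun l hl => ?_,
    fun l hl => ?_⟩
  · rw [hrep l hl]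
    have h1 : H.alg₂.evR ⟨l, hl⟩ (hx.X K) 0 = H.alg₂.one 0 :=
      conj_apply_zero hH _ _ (x l) ((congrFun (hf l hl) 0).symm.trans (hmod l hl))
    have h2 : H.alg₂.evR ⟨l, hl⟩ (hx.ρ (dualVec 𝔞) (basisVec j)) 0 = H.alg₂.one 0 :=
      FAlg.evR_covE_one_apply_zero _ _ _ _
    exact FAlg.mul_apply_zero h1 h2
  · have h1 := (hx.twist_iff (dualVec 𝔞) hj.commute_basisVec (fun i => hj.Δh_eq _) (l := ⟨l, hl⟩)
      (fun i => ?_) (hb ⟨l, hl⟩)).2 (htw ⟨l, hl⟩)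
    · have h2 := rep_shift12 j hx.isOpen hrep l hl
      rw [h2, hrep l hl]
      exact h1
    · have h3 := hw l hl (Module.finBasis ℂ 𝔞 i)
      rw [hrep l hl] at h3
      exact h3
  · rw [hrep l hl]
    have h1 : H.eL (H.alg₂.evR ⟨l, hl⟩ (hx.X K)) = 1 := by
      refine (eL_conj hH (hε l hl) _).trans ?_
      have h2 : H.eL (H.alg₂.evR ⟨l, hl⟩ K) = 1 :=
        (congrArg H.counitLeft (hf l hl)).symm.trans (hL l hl)
      exact (congrArg _ h2).trans (conj_one hH _ _)
    have h3 := (map_mul (H.eL) (H.alg₂.evR ⟨l, hl⟩ (hx.X K))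
      (H.alg₂.evR ⟨l, hl⟩ (hx.ρ (dualVec 𝔞) (basisVec j))))
    rw [h1, Flow.eL_ρ hj, _root_.one_mul] at h3
    exact h3
  · rw [hrep l hl]
    have h1 : H.eR (H.alg₂.evR ⟨l, hl⟩ (hx.X K)) = 1 := by
      refine (eR_conj hH (hε l hl) _).trans ?_
      have h2 : H.eR (H.alg₂.evR ⟨l, hl⟩ K) = 1 :=
        (congrArg H.counitRight (hf l hl)).symm.trans (hR l hl)
      exact (congrArg _ h2).trans (conj_one hH _ _)
    have h3 := (map_mul (H.eR) (H.alg₂.evR ⟨l, hl⟩ (hx.X K))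
      (H.alg₂.evR ⟨l, hl⟩ (hx.ρ (dualVec 𝔞) (basisVec j))))
    rw [h1, Flow.eR_ρ hj, _root_.one_mul] at h3
    exact h3

/-- Vertex-IRF transformations of the trivial twist. -/
theorem isDynamicalTwist_vertexIRF_one (hj : H.IsAbelianPrimitive j) (hx : Flow hH U x θ)
    (hd : Dense U) (hε : ∀ l ∈ U, H.εTilde (x l) = fone)
    (hw : ∀ l ∈ U, H.ZeroWeight₂ j (H.vertexIRF j x θ (fun _ => H.one₂) l)) :
    H.IsDynamicalTwist j U (H.vertexIRF j x θ (fun _ => H.one₂)) := by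
  have h1 : H.shift₃ (dualVec 𝔞) (basisVec j) hx.isOpen (1 : (H.alg₂.mero U).Elt) = 1 :=
    shift₃_one _ _
  refine isDynamicalTwist_vertexIRF hj hx hd hε (K := 1) (fun _ _ => rfl) (fun _ _ => rfl)
    (fun l hl => map_one H.eL) (fun l hl => map_one H.eR) (fun l => ?_) (fun l => ?_) hw
  · rw [h1]
    simp
  · rw [h1, map_one]
    refine (conj₃_t₃ hH (x l) 1 1).trans ?_
    rw [conj_one hH (H.mId hH)]
    exact (conj₁₂_t₃ hH (x l) 1 1).symm

variable {𝔟 : Submodule ℂ 𝔞} {U' : Set (StrongDual ℂ 𝔟)}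

lemma IsDynamicalTwist.twist_eq_evR {J : StrongDual ℂ 𝔞 → ℕ → V ⊗[ℂ] V}
    (hJ : H.IsDynamicalTwist j U J)
    {F : (H.alg₂.mero U).Elt} (hF : Rep J F) (l : U) :
    H.cL (H.alg₂.evR l F) * H.alg₃.evR l (H.shift₃ (dualVec 𝔞) (basisVec j) hJ.isOpen F) =
      H.cR (H.alg₂.evR l F) * H.l23 (H.alg₂.evR l F) := by
  have h1 := hJ.twist_eq l l.2
  rw [rep_shift12 j hJ.isOpen hF l l.2, hF l l.2] at h1
  exact h1

lemma rep_pull {E E' : Type*} [NormedAddCommGroup E] [NormedSpace ℂ E] [NormedAddCommGroup E']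
    [NormedSpace ℂ E'] {U : Set E} {U' : Set E'} (p : E →L[ℂ] E')
    (s : E' →L[ℂ] E) (hps : ∀ l, p (s l) = l) (hp : ∀ l ∈ U, p l ∈ U') {J : E' → ℕ → V ⊗[ℂ] V}
    {F : (H.alg₂.mero U').Elt} (hF : Rep J F) :
    Rep (fun l => J (p l)) (H.alg₂.pull p s hps hp F) := fun l hl => hF _ (hp l hl)

lemma basisVec_comp (k : Fin (Module.finrank ℂ 𝔟)) : basisVec (j.comp 𝔟.subtype) k =
    ∑ i, dualVec 𝔞 i (Module.finBasis ℂ 𝔟 k : 𝔞) • basisVec j i := by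
  have h2 := congrArg j ((Module.finBasis ℂ 𝔞).sum_repr (Module.finBasis ℂ 𝔟 k : 𝔞))
  rw [map_sum] at h2
  simp only [map_smul] at h2
  exact h2.symm

/-- Taylor shifts of functions of `l̄` along `𝔞` and along `𝔟` agree. -/
lemma shift₃_res (hU : IsOpen U) (hU' : IsOpen U') (hp : ∀ l ∈ U, resL 𝔟 l ∈ U')
    (F : (H.alg₂.mero U').Elt) :
    H.shift₃ (dualVec 𝔞) (basisVec j) hU
        (H.alg₂.pull (resL 𝔟) (resSection 𝔟) (resL_section 𝔟) hp F) =
      H.alg₃.pull (resL 𝔟) (resSection 𝔟) (resL_section 𝔟) hp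
        (H.shift₃ (dualVec 𝔟) (basisVec (j.comp 𝔟.subtype)) hU' F) :=
  shift₃_pull hU hU' _ _ _ hp _ (res_dualVec 𝔟) basisVec_comp F

lemma conj_shift₃_res (hU : IsOpen U) (hU' : IsOpen U') (hp : ∀ l ∈ U, resL 𝔟 l ∈ U')
    (F : (H.alg₂.mero U').Elt) (hxb : ∀ l ∈ U, H.ZeroWeight (j.comp 𝔟.subtype) (x l)) (l : U) :
    conj hH (H.mΔ₃ hH) (H.mLg₃ hH) (x l)
        (H.alg₃.evR l (H.shift₃ (dualVec 𝔞) (basisVec j) hU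
          (H.alg₂.pull (resL 𝔟) (resSection 𝔟) (resL_section 𝔟) hp F))) =
      conj hH (H.mΔ₁₂ hH) (H.mLg₁₂ hH) (x l)
        (H.alg₃.evR l (H.shift₃ (dualVec 𝔞) (basisVec j) hU
          (H.alg₂.pull (resL 𝔟) (resSection 𝔟) (resL_section 𝔟) hp F))) := by
  rw [shift₃_res hU hU' hp, FAlg.evR_pull]
  exact conj₃_shift₃ hH hU' _ (fun i => (Ad_eq hH _ _).symm.trans (hxb l l.2 _)) F _

/-- Vertex-IRF transformations of dynamical twists. -/
theorem isDynamicalTwist_vertexIRF_res (hj : H.IsAbelianPrimitive j) (hx : Flow hH U x θ)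
    (hd : Dense U) (hε : ∀ l ∈ U, H.εTilde (x l) = fone)
    (hxb : ∀ l ∈ U, H.ZeroWeight (j.comp 𝔟.subtype) (x l)) {J : StrongDual ℂ 𝔟 → ℕ → V ⊗[ℂ] V}
    (hJ : H.IsDynamicalTwist (j.comp 𝔟.subtype) U' J) (hp : ∀ l ∈ U, resL 𝔟 l ∈ U')
    (hw : ∀ l ∈ U, H.ZeroWeight₂ j (H.vertexIRF j x θ (fun l => J (res 𝔟 l)) l)) :
    H.IsDynamicalTwist j U (H.vertexIRF j x θ (fun l => J (res 𝔟 l))) := by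
  obtain ⟨F, hF⟩ : ∃ F : (H.alg₂.mero U').Elt, Rep J F := hJ.mero.exists_rep
  have hK := rep_pull (resL 𝔟) (resSection 𝔟) (resL_section 𝔟) hp hF
  have hb := conj_shift₃_res (hH := hH) hx.isOpen hJ.isOpen hp F hxb
  generalize hKF : H.alg₂.pull (resL 𝔟) (resSection 𝔟) (resL_section 𝔟) hp F = K at hK hb
  refine isDynamicalTwist_vertexIRF hj hx hd hε hK (fun l hl => hJ.mod_h _ (hp l hl))
    (fun l hl => hJ.counit_left _ (hp l hl)) (fun l hl => hJ.counit_right _ (hp l hl))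
    (fun l => ?_) hb hw
  have h1 := hJ.twist_eq_evR hF ⟨resL 𝔟 l, hp l l.2⟩
  rw [← hKF, shift₃_res hx.isOpen hJ.isOpen hp, FAlg.evR_pull, FAlg.evR_pull]
  exact h1

end Twist

end DeformationHopfAlgebra

/-! ### IRF-vertex transformations -/

lemma commute_of_mul_eq_one {M : Type*} [Monoid M] {a g r : M} (hr : IsUnit r) (h : g * r = 1)
    (hc : Commute a r) : Commute a g := by
  obtain ⟨u, rfl⟩ := hr
  rw [show g = ↑u⁻¹ from Units.eq_inv_of_mul_eq_one_right h]
  exact hc.units_inv_right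

namespace DeformationHopfAlgebra

variable {V : Type*} [AddCommGroup V] [Module ℂ V] {H : DeformationHopfAlgebra V}

section IRFVertex

variable {E : Type*} [NormedAddCommGroup E] [NormedSpace ℂ E] {U : Set E} {hH : H.LocallyFinite}
  {x : E → H.Tilde} {θ : E → E → ℕ → V}

/-- If `x⁻¹ b x = b`, then `b` commutes with the logarithmic derivatives of `x⁻¹`. -/
lemma IsMeroTilde.commute_logDeriv_inv (hx : H.IsMeroTilde U x θ) {b : H.A₁}
    (hb : ∀ l ∈ U, conj hH (H.mId hH) (H.mId hH) (x l)⁻¹ b = b) {l : E} (hl : l ∈ U) (μ : E) :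
    Commute b (H.alg₁.of (-conj hH (H.mId hH) (H.mId hH) (x l)⁻¹ (θ l μ))) := by
  have h1 := hx.hasDirDeriv_conj_inv hH (H.mId hH) (H.mId hH) hl μ b
  have h2 : HasDirDeriv (fun _ : E => b) μ l
      (two (H.mId hH) (H.mId hH) (-conj hH (H.mId hH) (H.mId hH) (x l)⁻¹ (θ l μ))
        (conj hH (H.mId hH) (H.mId hH) (x l)⁻¹ b)) :=
    h1.congr (Filter.eventuallyEq_of_mem (hx.isOpen.mem_nhds hl) fun l hl => (hb l hl).symm)
  have h3 := HasHDeriv.unique h2 (HasHDeriv.const b _)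
  rw [hb l hl] at h3
  exact (sub_eq_zero.1 h3).symm

variable {ι : Type*} [Fintype ι] {e : ι → E} {y : ι → H.A₁}

/-- If `b` commutes with the logarithmic derivatives of `x` and with the `yᵢ`, then `b¹ + b²`
commutes with `x¹(l) x¹(l - ħ h⁽²⁾)⁻¹`. -/
lemma Flow.commute_ρ (hx : Flow hH U x θ) {b : H.A₁} (hb : ∀ l : U, ∀ μ, Commute b (θ l μ))
    (hy : ∀ i, Commute b (y i)) (l : U) : Commute (H.lg b) (H.alg₂.evR l (hx.ρ e y)) := by
  have h1 : Commute (H.alg₂.const U (H.lg b)) (hx.ρ e y) := by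
    refine FAlg.commute_covE (fun i => FAlg.commute_of_evR fun l => ?_) fun i => ?_
    · exact ((hb l (e i)).map H.l1).add_left (H.commute_l1_l2 _ _).symm
    · exact (H.commute_l1_l2 _ _).add_left ((hy i).map H.l2)
  exact h1.map (H.alg₂.evR l)

lemma Flow.commute_inv_ρ (hx : Flow hH U x θ) {b : H.A₁} (hb : ∀ l : U, ∀ μ, Commute b (θ l μ))
    (hy : ∀ i, Commute b (y i)) {G : (H.alg₂.mero U).Elt} (hG : G * hx.ρ e y = 1) (l : U) :
    Commute (H.lg b) (H.alg₂.evR l G) :=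
  commute_of_mul_eq_one ((hx.isUnit_ρ e y).map (H.alg₂.evR l))
    ((map_mul (H.alg₂.evR l) G _).symm.trans ((congrArg (H.alg₂.evR l) hG).trans (map_one _)))
    (hx.commute_ρ (e := e) (y := y) hb hy l)

/-- If a gauge transformation takes the pullback of `F'` to a solution `F` of the twist equation,
then `F'` solves the twist equation. -/
lemma Flow.twist_of_pull (hx : Flow hH U x θ) (hy : ∀ i j, Commute (y i) (y j))
    (hΔ : ∀ i, H.Δh (y i) = H.lg (y i)) {E' : Type*} [NormedAddCommGroup E'] [NormedSpace ℂ E']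
    {U' : Set E'} (hU' : IsOpen U') {κ : Type*} [Fintype κ] {e' : κ → E'} {y' : κ → H.A₁}
    {p : E →L[ℂ] E'} {s : E' →L[ℂ] E} {hps : ∀ l, p (s l) = l} {hp : ∀ l ∈ U, p l ∈ U'}
    {F : (H.alg₂.mero U).Elt} {F' : (H.alg₂.mero U').Elt}
    (hF : hx.X (H.alg₂.pull p s hps hp F') * hx.ρ e y = F)
    (hs : H.shift₃ e y hx.isOpen (H.alg₂.pull p s hps hp F') =
      H.alg₃.pull p s hps hp (H.shift₃ e' y' hU' F')) {l : U}
    (hw : ∀ i, Commute (H.lg (y i)) (H.alg₂.evR l F))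
    (hb : conj hH (H.mΔ₃ hH) (H.mLg₃ hH) (x l)
        (H.alg₃.evR l (H.shift₃ e y hx.isOpen (H.alg₂.pull p s hps hp F'))) =
      conj hH (H.mΔ₁₂ hH) (H.mLg₁₂ hH) (x l)
        (H.alg₃.evR l (H.shift₃ e y hx.isOpen (H.alg₂.pull p s hps hp F'))))
    (htw : H.cL (H.alg₂.evR l F) * H.alg₃.evR l (H.shift₃ e y hx.isOpen F) =
      H.cR (H.alg₂.evR l F) * H.l23 (H.alg₂.evR l F)) :
    H.cL (H.alg₂.evR ⟨p l, hp l l.2⟩ F') *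
        H.alg₃.evR ⟨p l, hp l l.2⟩ (H.shift₃ e' y' hU' F') =
      H.cR (H.alg₂.evR ⟨p l, hp l l.2⟩ F') * H.l23 (H.alg₂.evR ⟨p l, hp l l.2⟩ F') := by
  subst hF
  have h1 := (hx.twist_iff e hy hΔ hw hb).1 htw
  rw [hs] at h1
  exact h1

/-- Conjugation by elements of zero weight preserves zero weight. -/
lemma commute_lg_conj {x : H.Tilde} {b : H.A₁} (hb : conj hH (H.mId hH) (H.mId hH) x b = b)
    (hp : H.Δh b = H.lg b) {v : H.A₂} (hv : Commute (H.lg b) v) :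
    Commute (H.lg b) (conj hH (H.mΔ hH) (H.mLg hH) x v) := by
  have h1 : conj hH (H.mΔ hH) (H.mΔ hH) x (H.Δh b) = H.Δh b := by
    have h := conj_map hH (f := H.mId hH) (g := H.mId hH) (f' := H.mΔ hH) (g' := H.mΔ hH)
      H.Δ_hl (fun y v => H.lie_hom H.Δh y v) x b
    rw [← h, hb]
  have h2 : conj hH (H.mLg hH) (H.mLg hH) x (H.lg b) = H.lg b := by
    have h := conj_map hH (f := H.mId hH) (g := H.mId hH) (f' := H.mLg hH) (g' := H.mLg hH)
      H.lg_hl (fun y v => H.lie_lg y v) x b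
    rw [← h, hb]
  have h3 := conj_mul hH (H.mΔ hH) (H.mΔ hH) (H.mLg hH) x (H.Δh b) v
  have h4 := conj_mul hH (H.mΔ hH) (H.mLg hH) (H.mLg hH) x v (H.lg b)
  rw [h1, hp] at h3
  rw [h2] at h4
  exact h3.trans ((congrArg _ hv.eq).trans h4.symm)

end IRFVertex

section Twist

variable {𝔞 : Type*} [NormedAddCommGroup 𝔞] [NormedSpace ℂ 𝔞] [FiniteDimensional ℂ 𝔞]
  {j : 𝔞 →ₗ[ℂ] (ℕ → V)} {𝔟 : Submodule ℂ 𝔞} {U : Set (StrongDual ℂ 𝔞)}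
  {x : StrongDual ℂ 𝔞 → H.Tilde} {θ : StrongDual ℂ 𝔞 → StrongDual ℂ 𝔞 → ℕ → V}
  {hH : H.LocallyFinite}

lemma rep_irfVertex (hx : Flow hH U x θ) (hx' : Flow hH U (fun l => (x l)⁻¹)
      fun l μ => -conj hH (H.mId hH) (H.mId hH) (x l)⁻¹ (θ l μ))
    {J : StrongDual ℂ 𝔞 → ℕ → V ⊗[ℂ] V} {F : (H.alg₂.mero U).Elt} (hF : Rep J F) :
    Rep (H.irfVertex j x θ J) (hx.X (F * hx'.σ j)) := fun l hl =>
  (twist₂_eq hH _ _).trans (congrArg (conj hH (H.mΔ hH) (H.mLg hH) (x l))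
    (congrArg₂ H.mul₂ (hF l hl) (rep_ratioRight j hx' l hl)))

/-- The vertex-IRF transformation by `x⁻¹` is inverse to the IRF-vertex transformation by `x`. -/
lemma X_inv_mul_ρ (hj : H.IsAbelianPrimitive j) (hx : Flow hH U x θ)
    (hx' : Flow hH U (fun l => (x l)⁻¹)
      fun l μ => -conj hH (H.mId hH) (H.mId hH) (x l)⁻¹ (θ l μ)) (F : (H.alg₂.mero U).Elt) :
    hx'.X (hx.X (F * hx'.σ j)) * hx'.ρ (dualVec 𝔞) (basisVec j) = F := by
  have h1 : hx'.X (hx.X (F * hx'.σ j)) = F * hx'.σ j :=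
    FAlg.ext_evR fun l => conj_inv_conj hH _ _ (x l) _
  have h2 : ∀ a b c : (H.alg₂.mero U).Elt, b * c = 1 → a * b * c = a := fun a b c h => by
    rw [_root_.mul_assoc, h, _root_.mul_one]
  rw [h1]
  exact h2 _ _ _ (Flow.σ_mul_ρ hj hx')

/-- Zero weight elements commute with `x¹(l - ħ h⁽²⁾)⁻¹ x¹(l)`. -/
lemma commute_σ (hj : H.IsAbelianPrimitive j) (hx : H.IsMeroTilde U x θ)
    (hx' : Flow hH U (fun l => (x l)⁻¹)
      fun l μ => -conj hH (H.mId hH) (H.mId hH) (x l)⁻¹ (θ l μ)) {a : 𝔞}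
    (hb : ∀ l ∈ U, conj hH (H.mId hH) (H.mId hH) (x l) (j a) = j a) (l : U) :
    Commute (H.lg (j a)) (H.alg₂.evR l (hx'.σ j)) := by
  have hb' : ∀ l ∈ U, conj hH (H.mId hH) (H.mId hH) (x l)⁻¹ (j a) = j a := fun l hl => by
    have h := conj_inv_conj hH (H.mId hH) (H.mId hH) (x l) (j a)
    rwa [hb l hl] at h
  have h1 : ∀ l : U, ∀ μ, Commute (H.alg₁.of (j a))
      (H.alg₁.of (-conj hH (H.mId hH) (H.mId hH) (x l)⁻¹ (θ l μ))) := fun l μ =>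
    hx.commute_logDeriv_inv hb' l.2 μ
  have h2 : ∀ i, Commute (H.alg₁.of (j a)) (H.alg₁.of (basisVec j i)) := fun i => hj.commute _ _
  exact hx'.commute_inv_ρ h1 h2 (Flow.σ_mul_ρ hj hx') l

lemma isMeroF_image_resL {W : Type*} [AddCommGroup W] [Module ℂ W] (𝔟 : Submodule ℂ 𝔞)
    {U : Set (StrongDual ℂ 𝔞)} (hU : IsOpen U) (hd : Dense U) {F : StrongDual ℂ 𝔟 → ℕ → W}
    (hF : IsMeroF U fun l => F (resL 𝔟 l)) : IsMeroF (resL 𝔟 '' U) F :=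
  have h := @IsMeroF.descend (StrongDual ℂ 𝔞) (StrongDual ℂ 𝔟) W _ _ _ _ _ _ U hU hd (resL 𝔟)
    (resSection 𝔟)
  h (resL_section 𝔟) hF

/-- The twist equation for an IRF-vertex transformation. -/
lemma twist_eq_irfVertex (hj : H.IsAbelianPrimitive j) (hf : Flow hH U x θ)
    (hf' : Flow hH U (fun l => (x l)⁻¹)
      fun l μ => -conj hH (H.mId hH) (H.mId hH) (x l)⁻¹ (θ l μ))
    (hxb : ∀ l ∈ U, H.ZeroWeight (j.comp 𝔟.subtype) (x l)⁻¹)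
    {J : StrongDual ℂ 𝔞 → ℕ → V ⊗[ℂ] V} (hJ : H.IsDynamicalTwist j U J)
    {F : (H.alg₂.mero U).Elt} (hF : Rep J F) {U' : Set (StrongDual ℂ 𝔟)} (hU' : IsOpen U')
    (hp : ∀ l ∈ U, resL 𝔟 l ∈ U') {F' : (H.alg₂.mero U').Elt}
    (hK : hf.X (F * hf'.σ j) = H.alg₂.pull (resL 𝔟) (resSection 𝔟) (resL_section 𝔟) hp F')
    (l : U) :
    H.cL (H.alg₂.evR ⟨resL 𝔟 l, hp l l.2⟩ F') * H.alg₃.evR ⟨resL 𝔟 l, hp l l.2⟩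
        (H.shift₃ (dualVec 𝔟) (basisVec (j.comp 𝔟.subtype)) hU' F') =
      H.cR (H.alg₂.evR ⟨resL 𝔟 l, hp l l.2⟩ F') * H.l23 (H.alg₂.evR ⟨resL 𝔟 l, hp l l.2⟩ F') := by
  have hX := X_inv_mul_ρ hj hf hf' F
  rw [hK] at hX
  have hw : ∀ i, Commute (H.lg (basisVec j i)) (H.alg₂.evR l F) := fun i => by
    have h3 := hJ.zeroWeight l l.2 (Module.finBasis ℂ 𝔞 i)
    rw [hF l l.2] at h3
    exact h3
  exact hf'.twist_of_pull hj.commute_basisVec (fun i => hj.Δh_eq _) hU' hX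
    (shift₃_res (j := j) hf.isOpen hU' hp F') hw
    (conj_shift₃_res (hH := hH) (x := fun l => (x l)⁻¹) hf.isOpen hU' hp F' hxb l)
    (hJ.twist_eq_evR hF l)

/-- IRF-vertex transformations of dynamical twists.  The twist equation for `J'` follows by applying
`twist_iff` to `x⁻¹`, which takes the pullback of `J'` back to `J`. -/
theorem isDynamicalTwist_irfVertex (hH : H.LocallyFinite) (hj : H.IsAbelianPrimitive j)
    (hx : H.IsMeroTilde U x θ) (hε : ∀ l ∈ U, H.εTilde (x l) = fone)
    (hxb : ∀ l ∈ U, H.ZeroWeight (j.comp 𝔟.subtype) (x l))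
    {J : StrongDual ℂ 𝔞 → ℕ → V ⊗[ℂ] V} (hJ : H.IsDynamicalTwist j U J)
    {J' : StrongDual ℂ 𝔟 → ℕ → V ⊗[ℂ] V} (hJ' : ∀ l ∈ U, H.irfVertex j x θ J l = J' (res 𝔟 l)) :
    H.IsDynamicalTwist (j.comp 𝔟.subtype) (resL 𝔟 '' U) J' := by
  have hf := hx.flow hH hε
  have hf' := hx.flow_inv hH hε
  obtain ⟨F, hF⟩ : ∃ F : (H.alg₂.mero U).Elt, Rep J F := hJ.mero.exists_rep
  have hK := rep_irfVertex (j := j) hf hf' hF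
  have hxb' : ∀ l ∈ U, ∀ b : 𝔟, conj hH (H.mId hH) (H.mId hH) (x l) (j b) = j b := fun l hl b =>
    (Ad_eq hH _ _).symm.trans (hxb l hl b)
  have hxi : ∀ l ∈ U, H.ZeroWeight (j.comp 𝔟.subtype) (x l)⁻¹ := fun l hl b =>
    (Ad_eq hH _ _).trans <|
      (congrArg (conj hH (H.mId hH) (H.mId hH) (x l)⁻¹) (hxb' l hl b).symm).trans
        (conj_inv_conj hH (H.mId hH) (H.mId hH) (x l) (j b))
  have hval : ∀ l (hl : l ∈ U), J' (resL 𝔟 l) =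
      conj hH (H.mΔ hH) (H.mLg hH) (x l) (H.alg₂.evR ⟨l, hl⟩ F * H.alg₂.evR ⟨l, hl⟩ (hf'.σ j)) :=
    fun l hl => (hJ' l hl).symm.trans (hK l hl)
  have hO : IsOpen (resL 𝔟 '' U) := isOpenMap_resL 𝔟 _ hx.isOpen
  have hmero : IsMeroF (resL 𝔟 '' U) J' := by
    refine isMeroF_image_resL 𝔟 hx.isOpen hx.dense ?_
    have h1 : Rep (U := U) (fun l => J' (resL 𝔟 l)) (hf.X (F * hf'.σ j)) := fun l hl =>
      (hJ' l hl).symm.trans (hK l hl)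
    exact h1.isMeroF
  have hF0 : ∀ l : U, H.alg₂.evR l F 0 = H.alg₂.one 0 := fun l =>
    (congrFun (hF l l.2) 0).symm.trans (hJ.mod_h l l.2)
  have hσ0 : ∀ l : U, H.alg₂.evR l (hf'.σ j) 0 = H.alg₂.one 0 := fun l =>
    FAlg.evR_covE_one_apply_zero _ _ _ _
  refine ⟨hO, ?_, hmero, ?_, ?_, ?_, ?_, ?_⟩
  · exact DenseRange.dense_image (Function.Surjective.denseRange fun l => ⟨_, resL_section 𝔟 l⟩)
      (resL 𝔟).continuous hx.dense
  · rintro _ ⟨l, hl, rfl⟩ b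
    rw [hval l hl]
    refine commute_lg_conj (hxb' l hl b) (hj.Δh_eq _) ?_
    refine Commute.mul_right ?_ (commute_σ hj hx hf' (fun l hl => hxb' l hl b) _)
    have h1 := hJ.zeroWeight l hl b
    rw [hF l hl] at h1
    exact h1
  · rintro _ ⟨l, hl, rfl⟩
    rw [hval l hl]
    exact conj_apply_zero hH _ _ (x l) (FAlg.mul_apply_zero (hF0 ⟨l, hl⟩) (hσ0 ⟨l, hl⟩))
  · rintro _ ⟨l, hl, rfl⟩
    have hp : ∀ l ∈ U, resL 𝔟 l ∈ resL 𝔟 '' U := fun l hl => ⟨l, hl, rfl⟩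
    obtain ⟨F', hF'⟩ : ∃ F' : (H.alg₂.mero (resL 𝔟 '' U)).Elt, Rep J' F' := hmero.exists_rep
    have h1 : hf.X (F * hf'.σ j) =
        H.alg₂.pull (resL 𝔟) (resSection 𝔟) (resL_section 𝔟) hp F' :=
      FAlg.ext_evR fun l => (hval l l.2).symm.trans (hF' _ (hp l l.2))
    have h2 := twist_eq_irfVertex hj hf hf' hxi hJ hF hO hp h1 ⟨l, hl⟩
    rw [rep_shift12 (j.comp 𝔟.subtype) hO hF' _ (hp l hl), hF' _ (hp l hl)]
    exact h2
  · rintro _ ⟨l, hl, rfl⟩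
    rw [hval l hl]
    refine (eL_conj hH (hε l hl) _).trans ?_
    have h2 : H.eL (H.alg₂.evR ⟨l, hl⟩ F) = 1 :=
      (congrArg H.counitLeft (hF l hl)).symm.trans (hJ.counit_left l hl)
    exact (congrArg _ ((map_mul H.eL _ _).trans ((congrArg₂ (· * ·) h2 (Flow.eL_σ hj hf' _)).trans
      (_root_.mul_one _)))).trans (conj_one hH _ _)
  · rintro _ ⟨l, hl, rfl⟩
    rw [hval l hl]
    refine (eR_conj hH (hε l hl) _).trans ?_
    have h2 : H.eR (H.alg₂.evR ⟨l, hl⟩ F) = 1 :=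
      (congrArg H.counitRight (hF l hl)).symm.trans (hJ.counit_right l hl)
    exact (congrArg _ ((map_mul H.eR _ _).trans ((congrArg₂ (· * ·) h2 (Flow.eR_σ hj hf' _)).trans
      (_root_.mul_one _)))).trans (conj_one hH _ _)

end Twist

end DeformationHopfAlgebra

namespace DeformationHopfAlgebra

variable {V : Type*} [AddCommGroup V] [Module ℂ V] {H : DeformationHopfAlgebra V}

lemma IsDynamicalTwist.mono {𝔞 : Type*} [NormedAddCommGroup 𝔞] [NormedSpace ℂ 𝔞]
    [FiniteDimensional ℂ 𝔞] {j : 𝔞 →ₗ[ℂ] (ℕ → V)} {U U' : Set (StrongDual ℂ 𝔞)}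
    {J : StrongDual ℂ 𝔞 → ℕ → V ⊗[ℂ] V} (hJ : H.IsDynamicalTwist j U J) (h : U' ⊆ U)
    (ho : IsOpen U') (hd : Dense U') : H.IsDynamicalTwist j U' J :=
  ⟨ho, hd, hJ.mero.mono h, fun l hl => hJ.zeroWeight l (h hl), fun l hl => hJ.mod_h l (h hl),
    fun l hl => hJ.twist_eq l (h hl), fun l hl => hJ.counit_left l (h hl),
    fun l hl => hJ.counit_right l (h hl)⟩

end DeformationHopfAlgebra

end Deform

end

theorem proposition2p9
    {V : Type*} [AddCommGroup V] [Module ℂ V] (H : Deform.DeformationHopfAlgebra V)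
    (hH : H.LocallyFinite)
    {𝔞 : Type*} [NormedAddCommGroup 𝔞] [NormedSpace ℂ 𝔞] [FiniteDimensional ℂ 𝔞]
    (j : 𝔞 →ₗ[ℂ] (ℕ → V)) (hj : H.IsAbelianPrimitive j) (𝔟 : Submodule ℂ 𝔞)
    (U : Set (StrongDual ℂ 𝔞)) (x : StrongDual ℂ 𝔞 → H.Tilde)
    (θ : StrongDual ℂ 𝔞 → StrongDual ℂ 𝔞 → ℕ → V) (hx : H.IsMeroTilde U x θ)
    (hε : ∀ l ∈ U, H.εTilde (x l) = Deform.fone) :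
    -- vertex-IRF transformations
    ((∀ l ∈ U, H.ZeroWeight (j.comp 𝔟.subtype) (x l)) →
      ∀ (U' : Set (StrongDual ℂ 𝔟)) (J' : StrongDual ℂ 𝔟 → ℕ → V ⊗[ℂ] V),
        H.IsDynamicalTwist (j.comp 𝔟.subtype) U' J' →
        (∀ l ∈ U ∩ Deform.res 𝔟 ⁻¹' U', H.ZeroWeight₂ j (H.vertexIRF j x θ (fun l => J' (Deform.res 𝔟 l)) l)) →
        H.IsDynamicalTwist j (U ∩ Deform.res 𝔟 ⁻¹' U') (H.vertexIRF j x θ (fun l => J' (Deform.res 𝔟 l)))) ∧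
    -- IRF-vertex transformations
    ((∀ l ∈ U, H.ZeroWeight (j.comp 𝔟.subtype) (x l)) →
      ∀ (D : Set (StrongDual ℂ 𝔞)) (J : StrongDual ℂ 𝔞 → ℕ → V ⊗[ℂ] V),
        H.IsDynamicalTwist j D J →
        ∀ J' : StrongDual ℂ 𝔟 → ℕ → V ⊗[ℂ] V,
          (∀ l ∈ U ∩ D, H.irfVertex j x θ J l = J' (Deform.res 𝔟 l)) →
          H.IsDynamicalTwist (j.comp 𝔟.subtype) (Deform.res 𝔟 '' (U ∩ D)) J') ∧
    -- vertex-IRF transformations of the trivial twist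
    ((∀ l ∈ U, H.ZeroWeight₂ j (H.vertexIRF j x θ (fun _ => H.one₂) l)) →
      H.IsDynamicalTwist j U (H.vertexIRF j x θ (fun _ => H.one₂))) ∧
    -- transformation of dynamical R-matrices
    ((∀ l ∈ U, H.ZeroWeight (j.comp 𝔟.subtype) (x l)) →
      ∀ R : ℕ → V ⊗[ℂ] V, H.IsUniversalR R →
      ∀ (U' : Set (StrongDual ℂ 𝔟)) (J' : StrongDual ℂ 𝔟 → ℕ → V ⊗[ℂ] V),
        H.IsDynamicalTwist (j.comp 𝔟.subtype) U' J' →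
      ∀ (D : Set (StrongDual ℂ 𝔞)) (J : StrongDual ℂ 𝔞 → ℕ → V ⊗[ℂ] V),
        H.IsDynamicalTwist j D J →
        (∀ l ∈ U ∩ Deform.res 𝔟 ⁻¹' U' ∩ D, J l = H.vertexIRF j x θ (fun l => J' (Deform.res 𝔟 l)) l) →
        ∀ l ∈ U ∩ Deform.res 𝔟 ⁻¹' U' ∩ D,
          H.dynR R (J l) =
            H.mul₂ (H.mul₂ (H.ratioTwo j θ l) (H.Ad₂ (x l) (H.dynR R (J' (Deform.res 𝔟 l)))))
              (H.ratioLeft j θ l)) := by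
  refine ⟨fun hxb U' J' hJ' hw => ?_, fun hxb D J hJ J' hJ'' => ?_, fun hw => ?_,
    fun hxb R hR U' J' hJ' D J hJ hJJ l hl => ?_⟩
  · have hd := Deform.dense_inter_preimage_res 𝔟 hx.isOpen hx.dense hJ'.dense
    have hx' := hx.mono Set.inter_subset_left
      (Deform.isOpen_inter_preimage_res 𝔟 hx.isOpen hJ'.isOpen) hd
    exact Deform.DeformationHopfAlgebra.isDynamicalTwist_vertexIRF_res hj
      (hx'.flow hH fun l hl => hε l hl.1) hd (fun l hl => hε l hl.1) (fun l hl => hxb l hl.1) hJ'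
      (fun l hl => hl.2) hw
  · have ho := hx.isOpen.inter hJ.isOpen
    have hd := hx.dense.inter_of_isOpen_left hJ.dense hx.isOpen
    exact Deform.DeformationHopfAlgebra.isDynamicalTwist_irfVertex hH hj
      (hx.mono Set.inter_subset_left ho hd) (fun l hl => hε l hl.1) (fun l hl => hxb l hl.1)
      (hJ.mono Set.inter_subset_right ho hd) hJ''
  · exact Deform.DeformationHopfAlgebra.isDynamicalTwist_vertexIRF_one hj (hx.flow hH hε) hx.dense
      hε hw
  · rw [hJJ l hl]
    exact Deform.DeformationHopfAlgebra.dynR_twist₂_mul_ratioLeft hj (hx.flow hH hε) hR hl.1.1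
      (hJ'.mod_h _ hl.1.2)
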